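/- Let $m\in\mathbb N$, $1<p<m$, $n\ge m-1$. Let $T^1=\mathbb R/2\pi\mathbb Z$, let $V(\theta,y)=-e^{-1/y^2}\sin(\theta+1/y)$ on $T^1\times\mathbb R$ (with $V(\theta,0)=0$), let $B_0>\sup(|V|+|\nabla V|)+1$, and let $N=T^1\times\mathbb R\times S^n$ carry the metric $d\theta^2+dy^2+(B_0-V(\theta,y))\,g_0$, where $g_0$ is the round metric. The $p$-energy of $U=(u,v)\in W^{1,p}(B_1,N)$, where $B_1\subset\mathbb R^m$ is the unit ball, $u=(\theta,y)$ takes values in $T^1\times\mathbb R$ and $v$ in $S^n\subset\mathbb R^{n+1}$, is $$E(U)=\int_{B_1}\bigl(|Du|^2+(B_0-V(u))|Dv|^2\bigr)^{p/2}\,dx .$$ The group $O(m)$ acts on $N$ by $g\cdot(\theta,y,z)=(\theta,y,gz)$, where $\mathbb R^m=\mathbb R^m\times\{0\}\subset\mathbb R^{n+1}$. A map $U$ is $p$-harmonic if it lies in $W^{1,p}(B_1,N)$ and is a critical point of $E$ under smooth compactly supported variations. A map $W:\mathbb R^m\to N$ is a tangent map of $U$ at $0$ if there are $r_k\downarrow0$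 such that $U(r_k\,\cdot)\to W$ in $W^{1,p}(B_R)$ for every $R>0$. **Proposition.** There are constants $C=C(m,p)$ and $\overline B_0=\overline B_0(m,p)$ such that for all $n$ and $B_0$ as above there is an $O(m)$-equivariant $p$-harmonic map of the form $U(x)=\bigl(u(|x|),\tfrac{x}{|x|}\bigr)$ on $B_1\setminus\{0\}$, with $u$ taking values in $T^1\times\mathbb R$, such that: 1. if $4(m-1)<(m-p)^2$, then $U$ is the unique minimizer of $E$ for its own boundary data among all maps of the form $\bigl(w(|x|),\tfrac{x}{|x|}\bigr)$ in $W^{1,p}(B_1,N)$; if moreover $B_0>\overline B_0$, then $U$ is the unique minimizer of $E$ for its own boundary data among all maps in $W^{1,p}(B_1,N)$ (two maps have the same boundary data if their difference, in $\mathbb R^2\times\mathbb R\times\mathbb R^{n+1}\supset N$ with $T^1$ the unit circle of $\mathbb R^2$, lies in $W^{1,p}_0$); 2. $E(U)\le C\,B_0^{p/2}$; 3. $U$ is smooth on $B_1\setminus\{0\}$, and no map that agrees with $U$ almost everywhere is continuous at $0$; 4. up to equality almost everywhere, the tangent maps of $U$ at $0$ are exactly the maps $x\mapsto\bigl(\theta,0,\tfrac{x}{|x|}\bigr)$,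 $\theta\in T^1$. -/

import Mathlib

open MeasureTheory Filter Topology TopologicalSpace
open scoped Distributions ContDiff ENNReal

noncomputable section

namespace PHarm

/-- Euclidean space `ℝ^m`. -/
abbrev E (m : ℕ) : Type := EuclideanSpace ℝ (Fin m)

/-- The open ball `B_R` of `ℝ^m` centred at the origin. -/
def ballO (m : ℕ) (R : ℝ) : Opens (E m) := ⟨Metric.ball 0 R, Metric.isOpen_ball⟩

/-! ### First order Sobolev spaces -/

section Sobolev

variable {m : ℕ} {F : Type*} [NormedAddCommGroup F] [NormedSpace ℝ F]

/-- `G` is the weak (distributional) derivative of `f` on the open set `Ω`. -/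
def HasWeakDeriv (Ω : Opens (E m)) (f : E m → F) (G : E m → (E m →L[ℝ] F)) : Prop :=
  LocallyIntegrableOn f (Ω : Set (E m)) ∧ LocallyIntegrableOn G (Ω : Set (E m)) ∧
    ∀ (φ : 𝓓(Ω, ℝ)) (e : E m),
      ∫ x in (Ω : Set (E m)), (fderiv ℝ (fun z => φ z) x e) • f x =
        - ∫ x in (Ω : Set (E m)), φ x • G x e

open Classical in
/-- The weak derivative of `f` on `Ω` (unique almost everywhere), and `0` if there is none. -/
def weakDeriv (Ω : Opens (E m)) (f : E m → F) : E m → (E m →L[ℝ] F) :=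
  if h : ∃ G, HasWeakDeriv Ω f G then h.choose else 0

/-- `f ∈ W^{1,p}(Ω, F)`. -/
def MemW1p (Ω : Opens (E m)) (p : ℝ) (f : E m → F) : Prop :=
  MemLp f (ENNReal.ofReal p) (volume.restrict (Ω : Set (E m))) ∧
    ∃ G, HasWeakDeriv Ω f G ∧ MemLp G (ENNReal.ofReal p) (volume.restrict (Ω : Set (E m)))

/-- `f ∈ W^{1,p}_0(Ω, F)`: the closure of the test functions in `W^{1,p}(Ω, F)`. -/
def MemW1pZero (Ω : Opens (E m)) (p : ℝ) (f : E m → F) : Prop :=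
  MemW1p Ω p f ∧ ∃ φ : ℕ → 𝓓(Ω, F),
    Tendsto (fun k => eLpNorm (fun x => f x - φ k x) (ENNReal.ofReal p)
      (volume.restrict (Ω : Set (E m)))) atTop (𝓝 0) ∧
    Tendsto (fun k => eLpNorm (fun x => weakDeriv Ω f x - fderiv ℝ (fun z => φ k z) x)
      (ENNReal.ofReal p) (volume.restrict (Ω : Set (E m)))) atTop (𝓝 0)

/-- The sequence `f k` converges to `g` in `W^{1,p}(Ω, F)`
(finitely many members of the sequence need not be Sobolev functions on `Ω`). -/
def TendstoW1p (Ω : Opens (E m)) (p : ℝ) (f : ℕ → E m → F) (g : E m → F) : Prop :=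
  (∀ᶠ k in atTop, MemW1p Ω p (f k)) ∧ MemW1p Ω p g ∧
    Tendsto (fun k => eLpNorm (fun x => f k x - g x) (ENNReal.ofReal p)
      (volume.restrict (Ω : Set (E m)))) atTop (𝓝 0) ∧
    Tendsto (fun k => eLpNorm (fun x => weakDeriv Ω (f k) x - weakDeriv Ω g x)
      (ENNReal.ofReal p) (volume.restrict (Ω : Set (E m)))) atTop (𝓝 0)

/-- The squared Hilbert–Schmidt norm `|A|² = ∑ᵢ |A eᵢ|²`. -/
def hsSq (A : E m →L[ℝ] F) : ℝ := ∑ i : Fin m, ‖A (EuclideanSpace.single i 1)‖ ^ 2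

end Sobolev

/-! ### The potential and the target `N = (T¹ × ℝ) × Sⁿ`, `T¹ = ℝ / 2πℤ` -/

/-- `V(θ, y) = - e^{-1/y²} sin (θ + 1/y)`, extended by `0` to `y = 0`. -/
def V (θ : Real.Angle) (y : ℝ) : ℝ :=
  if y = 0 then 0
  else - Real.exp (-(1 / y ^ 2)) * Real.Angle.sin (θ + ((1 / y : ℝ) : Real.Angle))

/-- The length of the gradient of `V` for the flat metric `dθ² + dy²`. -/
def gradV (θ : Real.Angle) (y : ℝ) : ℝ :=
  Real.sqrt (deriv (fun s : ℝ => V (θ + (s : Real.Angle)) y) 0 ^ 2 +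
    deriv (fun s : ℝ => V θ s) y ^ 2)

/-- The unit sphere `Sⁿ ⊂ ℝ^{n+1}`. -/
abbrev Sph (n : ℕ) : Type := Metric.sphere (0 : E (n + 1)) 1

/-- The target `N = T¹ × ℝ × Sⁿ`, with the metric `dθ² + dy² + (B₀ - V(θ, y)) g₀`. The metric
enters through the energy. -/
abbrev Target (n : ℕ) : Type := Real.Angle × ℝ × Sph n

/-- The `T¹`-component, with `T¹` isometrically embedded as the unit circle of `ℂ = ℝ²`. -/
def thetaC {m n : ℕ} (U : E m → Target n) : E m → ℂ := fun x => ((U x).1.toCircle : ℂ)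

/-- The `ℝ`-component. -/
def yC {m n : ℕ} (U : E m → Target n) : E m → ℝ := fun x => (U x).2.1

/-- The spherical component, seen in `ℝ^{n+1}`. -/
def vC {m n : ℕ} (U : E m → Target n) : E m → E (n + 1) := fun x => ((U x).2.2 : E (n + 1))

/-- `U ∈ W^{1,p}(B₁, N)`. -/
def SobolevMap {m n : ℕ} (p : ℝ) (U : E m → Target n) : Prop :=
  MemW1p (ballO m 1) p (thetaC U) ∧ MemW1p (ballO m 1) p (yC U) ∧ MemW1p (ballO m 1) p (vC U)

/-- `U` and `W` have the same boundary data on `∂B₁`: `U - W ∈ W^{1,p}_0`. -/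
def SameBoundary {m n : ℕ} (p : ℝ) (U W : E m → Target n) : Prop :=
  MemW1pZero (ballO m 1) p (fun x => thetaC U x - thetaC W x) ∧
  MemW1pZero (ballO m 1) p (fun x => yC U x - yC W x) ∧
  MemW1pZero (ballO m 1) p (fun x => vC U x - vC W x)

/-- The `p`-energy
`E(U) = ∫_{B₁} (|Dθ|² + |Dy|² + (B₀ - V(θ, y)) |Dv|²)^{p/2}` of `U = (θ, y, v)`. -/
def energy {m n : ℕ} (p B₀ : ℝ) (U : E m → Target n) : ℝ≥0∞ :=
  ∫⁻ x in (ballO m 1 : Set (E m)), ENNReal.ofReal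
    ((hsSq (weakDeriv (ballO m 1) (thetaC U) x) + hsSq (weakDeriv (ballO m 1) (yC U) x) +
      (B₀ - V (U x).1 (U x).2.1) * hsSq (weakDeriv (ballO m 1) (vC U) x)) ^ (p / 2))

/-- `U` is the unique minimizer of the energy, for its own boundary data, among the maps of
`W^{1,p}(B₁, N)` that belong to the class `S`. -/
def IsUniqueMinimizerIn {m n : ℕ} (p B₀ : ℝ) (S : Set (E m → Target n))
    (U : E m → Target n) : Prop :=
  U ∈ S ∧ SobolevMap p U ∧ ∀ W ∈ S, SobolevMap p W → SameBoundary p W U →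
    energy p B₀ U ≤ energy p B₀ W ∧
    (energy p B₀ W = energy p B₀ U →
      W =ᵐ[volume.restrict (ballO m 1 : Set (E m))] U)

/-- The radial projection `w ↦ w / |w|` onto `Sⁿ` (a fixed point of `Sⁿ` for `w = 0`). -/
def toSphere {n : ℕ} (w : E (n + 1)) : Sph n :=
  if hw : w = 0 then ⟨EuclideanSpace.single 0 1, by simp⟩
  else ⟨‖w‖⁻¹ • w, by
    rw [mem_sphere_zero_iff_norm, norm_smul, norm_inv, norm_norm,
      inv_mul_cancel₀ (norm_ne_zero_iff.mpr hw)]⟩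

/-- The variation `(θ + sη, y + sζ, (v + sψ) / |v + sψ|)` of `U = (θ, y, v)`. -/
def vary {m n : ℕ} (U : E m → Target n) (η ζ : 𝓓(ballO m 1, ℝ)) (ψ : 𝓓(ballO m 1, E (n + 1)))
    (s : ℝ) : E m → Target n :=
  fun x => ((U x).1 + ((s * η x : ℝ) : Real.Angle), (U x).2.1 + s * ζ x,
    toSphere (((U x).2.2 : E (n + 1)) + s • ψ x))

/-- `U` is `p`-harmonic: a critical point of the energy for all smooth compactly supported
variations in the target. -/
def IsPHarmonic {m n : ℕ} (p B₀ : ℝ) (U : E m → Target n) : Prop :=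
  SobolevMap p U ∧ energy p B₀ U ≠ ⊤ ∧
    ∀ (η ζ : 𝓓(ballO m 1, ℝ)) (ψ : 𝓓(ballO m 1, E (n + 1))),
      HasDerivAt (fun s : ℝ => (energy p B₀ (vary U η ζ ψ s)).toReal) 0 0

/-! ### Equivariant maps -/

/-- The inclusion `ℝ^m → ℝ^m × {0} ⊂ ℝ^{n+1}`, used for `m ≤ n + 1`. -/
def pad {m : ℕ} (n : ℕ) (x : E m) : E (n + 1) :=
  WithLp.toLp 2 fun i => if h : (i : ℕ) < m then x ⟨i, h⟩ else 0

/-- The first `m` coordinates of a point of `ℝ^{n+1}`, used for `m ≤ n + 1`. -/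
def firstCoords (m : ℕ) {n : ℕ} (z : E (n + 1)) : E m :=
  WithLp.toLp 2 fun j => if h : (j : ℕ) < n + 1 then z ⟨j, h⟩ else 0

/-- The action of `g ∈ O(m) ⊂ O(n+1)` on `ℝ^{n+1} = ℝ^m × ℝ^{n+1-m}`: `g` acts on the first `m`
coordinates and fixes the others. -/
def orthAct {m n : ℕ} (g : E m ≃ₗᵢ[ℝ] E m) (z : E (n + 1)) : E (n + 1) :=
  WithLp.toLp 2 fun i => if h : (i : ℕ) < m then g (firstCoords m z) ⟨i, h⟩ else z i

/-- `U (g x) = g · U(x)` for all `g ∈ O(m)`, where `g · (θ, y, z) = (θ, y, g z)`, at all points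
of the ball but its centre. -/
def IsEquivariant {m n : ℕ} (U : E m → Target n) : Prop :=
  ∀ (g : E m ≃ₗᵢ[ℝ] E m) (x : E m), x ∈ ballO m 1 → x ≠ 0 →
    (U (g x)).1 = (U x).1 ∧ (U (g x)).2.1 = (U x).2.1 ∧
      ((U (g x)).2.2 : E (n + 1)) = orthAct g ((U x).2.2 : E (n + 1))

/-- The map `U(x) = (u(|x|), x / |x|)`. -/
def equivMap (m n : ℕ) (u : ℝ → Real.Angle × ℝ) : E m → Target n :=
  fun x => ((u ‖x‖).1, (u ‖x‖).2, toSphere (pad n x))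

/-! ### Singularities and tangent maps -/

/-- `U` is smooth on the set `s`. -/
def SmoothMapOn {m n : ℕ} (U : E m → Target n) (s : Set (E m)) : Prop :=
  ContDiffOn ℝ ∞ (thetaC U) s ∧ ContDiffOn ℝ ∞ (yC U) s ∧ ContDiffOn ℝ ∞ (vC U) s

/-- The origin is the only singularity of `U` in `B₁`: the map is smooth on `B₁ \ {0}`, and no
map that agrees with `U` almost everywhere is continuous at the origin. -/
def OnlySingularAtZero {m n : ℕ} (U : E m → Target n) : Prop :=
  SmoothMapOn U ((ballO m 1 : Set (E m)) \ {0}) ∧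
    ∀ W : E m → Target n, W =ᵐ[volume.restrict (ballO m 1 : Set (E m))] U → ¬ ContinuousAt W 0

/-- `W : ℝ^m → N` is a tangent map of `U` at `a`: for some sequence `r_k ↓ 0` the maps
`x ↦ U(a + r_k x)` converge to `W` in `W^{1,p}(B_R)` for every `R > 0`. -/
def IsTangentMap {m n : ℕ} (p : ℝ) (U : E m → Target n) (a : E m) (W : E m → Target n) : Prop :=
  ∃ r : ℕ → ℝ, (∀ k, 0 < r k) ∧ Tendsto r atTop (𝓝 0) ∧ ∀ R : ℝ, 0 < R →
    TendstoW1p (ballO m R) p (fun k => thetaC fun x => U (a + r k • x)) (thetaC W) ∧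
    TendstoW1p (ballO m R) p (fun k => yC fun x => U (a + r k • x)) (yC W) ∧
    TendstoW1p (ballO m R) p (fun k => vC fun x => U (a + r k • x)) (vC W)

end PHarm

end

noncomputable section

namespace PHarm

open Real EuclideanSpace Metric
open Set (univ Icc Iio mem_univ mem_Iic)
open Finset (mul_sum sum_add_distrib sum_congr sum_sub_distrib)
open ENNReal (ofReal)
open ContinuousLinearMap (comp_apply fst snd inl inr le_opNorm opNorm_le_bound opNorm_comp_le
  smulRight_apply smulRightL)

/-- The logarithm of the norm. -/
notation:max "㏑" x:max => log ‖x‖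

/-- The direction of a vector. -/
notation:max "𝐧" x:max => ‖x‖⁻¹ • x

/-! ### Ordinary differential equations with bounded Lipschitz fields -/

section ODE

variable {X : Type*} [NormedAddCommGroup X] [NormedSpace ℝ X]

open scoped NNReal

/-- A bounded Lipschitz vector field has global integral curves. -/
lemma exists_global_solution [CompleteSpace X] {F : X → X} {K L : ℝ≥0} (hF : LipschitzWith K F) (hL
    : ∀ x, ‖F x‖ ≤ L) (x₀ : X) : ∃ x : ℝ → X, x 0 = x₀ ∧ ∀ t, HasDerivAt x (F (x t)) t := by
  have key : ∀ n : ℕ, ∃ x : ℝ → X, x 0 = x₀ ∧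
      ∀ t ∈ Set.Ioo (-(n + 1 : ℝ)) (n + 1), HasDerivAt x (F (x t)) t := by
    intro n
    have h0 : (0 : ℝ) ∈ Icc (-(n + 1 : ℝ)) (n + 1) := by
      constructor <;> linarith [(Nat.cast_nonneg n : (0 : ℝ) ≤ n)]
    have hPL : IsPicardLindelof (fun _ ↦ F) (tmin := -(n + 1 : ℝ)) (tmax := n + 1) ⟨0, h0⟩ x₀
        (L * (n + 1)) 0 L K := by
      refine IsPicardLindelof.of_time_independent (fun x _ => hL x) hF.lipschitzOnWith ?_
      simp
    obtain ⟨α, h1, h2⟩ := hPL.exists_eq_forall_mem_Icc_hasDerivWithinAt₀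
    exact ⟨α, h1, fun t ht => (h2 t (Set.Ioo_subset_Icc_self ht)).hasDerivAt
      (Icc_mem_nhds ht.1 ht.2)⟩
  choose x hx0 hx using key
  have huniq : ∀ n k : ℕ, n ≤ k → Set.EqOn (x n) (x k) (Set.Ioo (-(n + 1 : ℝ)) (n + 1)) := by
    intro n k hnk
    have hnk' : (n : ℝ) ≤ k := by exact_mod_cast hnk
    have hn : (0 : ℝ) ≤ n := Nat.cast_nonneg n
    refine ODE_solution_unique_of_mem_Ioo (v := fun _ => F) (s := fun _ => univ) (K := K) (t₀ := 0)
      (fun t _ => hF.lipschitzOnWith) ⟨by linarith, by linarith⟩ (fun t ht => ⟨hx n t ht, trivial⟩)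
      (fun t ht => ⟨hx k t ⟨by linarith [ht.1], by linarith [ht.2]⟩, trivial⟩) (by rw [hx0, hx0])
  refine ⟨fun t => x ⌈|t|⌉₊ t, by simp [hx0], fun t => ?_⟩
  set N : ℕ := ⌈|t|⌉₊ + 1 with hN
  have hmem : ∀ s : ℝ, s ∈ Set.Ioo (-(⌈|s|⌉₊ + 1 : ℝ)) (⌈|s|⌉₊ + 1) := by
    intro s
    have := Nat.le_ceil |s|
    constructor <;> linarith [neg_abs_le s, le_abs_self s]
  have heq : (fun s => x ⌈|s|⌉₊ s) =ᶠ[𝓝 t] x N := by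
    have : ∀ᶠ s in 𝓝 t, |s| < |t| + 1 :=
      continuous_abs.continuousAt.eventually (Iio_mem_nhds (by linarith))
    filter_upwards [this] with s hs
    refine huniq _ _ ?_ (hmem s)
    rw [hN, Nat.ceil_le]
    push_cast
    linarith [Nat.le_ceil |t|]
  have hd := hx N t ⟨by rw [hN]; push_cast; linarith [(hmem t).1], by
    rw [hN]; push_cast; linarith [(hmem t).2]⟩
  have := hd.congr_of_eventuallyEq heq
  rwa [show x N t = (fun s => x ⌈|s|⌉₊ s) t from heq.self_of_nhds.symm] at this

/-- Two integral curves diverge at most exponentially, backwards in time. -/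
lemma dist_le_of_solutions_backward {F : X → X} {K : ℝ≥0} (hF : LipschitzWith K F)
    {x y : ℝ → X} (hx : ∀ t, HasDerivAt x (F (x t)) t) (hy : ∀ t, HasDerivAt y (F (y t)) t)
    {t : ℝ} (ht : t ≤ 0) : dist (x t) (y t) ≤ dist (x 0) (y 0) * exp (K * -t) := by
  have hneg : LipschitzWith K (fun z => -F z) := hF.neg
  have hx' : ∀ s, HasDerivAt (fun s => x (-s)) (-F (x (-s))) s := fun s => by
    simpa [Function.comp_def] using (hx (-s)).scomp s (hasDerivAt_neg s)
  have hy' : ∀ s, HasDerivAt (fun s => y (-s)) (-F (y (-s))) s := fun s => by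
    simpa [Function.comp_def] using (hy (-s)).scomp s (hasDerivAt_neg s)
  have := dist_le_of_trajectories_ODE (v := fun _ z => -F z) (K := K) (a := 0) (b := -t)
    (f := fun s => x (-s)) (g := fun s => y (-s)) (δ := dist (x 0) (y 0)) (fun _ => hneg)
    (fun s _ => (hx' s).continuousAt.continuousWithinAt) (fun s _ => (hx' s).hasDerivWithinAt)
    (fun s _ => (hy' s).continuousAt.continuousWithinAt) (fun s _ => (hy' s).hasDerivWithinAt)
    (by simp) (-t) ⟨by linarith, le_rfl⟩
  simpa using this

/-- Integral curves that stay in a closed set for longer and longer times in the past have a limit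
that stays there for all negative times. -/
lemma exists_ancient_solution [CompleteSpace X] {F : X → X} {K L : ℝ≥0} (hF : LipschitzWith K F) (hL
    : ∀ x, ‖F x‖ ≤ L) {S P : Set X} (hS : IsClosed S) (hP : IsCompact P) (h : ∀ n : ℕ, ∃ x : ℝ → X,
    (∀ t, HasDerivAt x (F (x t)) t) ∧ x 0 ∈ P ∧ ∀ t ∈ Icc (-(n : ℝ)) 0, x t ∈ S) : ∃ x : ℝ → X, (∀
    t, HasDerivAt x (F (x t)) t) ∧ x 0 ∈ P ∧ ∀ t ≤ 0, x t ∈ S := by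
  choose x hx hxP hxS using h
  obtain ⟨a, haP, φ, hφ, hlim⟩ := hP.tendsto_subseq hxP
  obtain ⟨y, hy0, hy⟩ := exists_global_solution hF hL a
  refine ⟨y, hy, by rwa [hy0], fun t ht => ?_⟩
  have hconv : Tendsto (fun n => x (φ n) t) atTop (𝓝 (y t)) := by
    rw [tendsto_iff_dist_tendsto_zero]
    have h0 : Tendsto (fun n => dist (x (φ n) 0) (y 0) * exp (K * -t)) atTop (𝓝 0) := by
      have := (tendsto_iff_dist_tendsto_zero.1 hlim).mul_const (exp (K * -t))
      simpa [hy0, Function.comp_def] using this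
    exact squeeze_zero (fun _ => dist_nonneg)
      (fun n => dist_le_of_solutions_backward hF (hx (φ n)) hy ht) h0
  refine hS.mem_of_tendsto hconv ?_
  obtain ⟨N, hN⟩ := exists_nat_ge (-t)
  filter_upwards [eventually_ge_atTop N] with n hn
  refine hxS _ _ ⟨?_, ht⟩
  have h1 : (N : ℝ) ≤ φ n := by exact_mod_cast hn.trans (hφ.id_le n)
  linarith

/-- First exit: if finitely many functions are positive at time `0`, and each of them has positive
derivative whenever it vanishes while the others are nonnegative, then they stay positive. -/
lemma forall_pos_of_deriv_pos_of_eq_zero {ι : Type*} [Finite ι] {f f' : ι → ℝ → ℝ} {T : ℝ} (hd : ∀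
    i, ∀ t ∈ Icc 0 T, HasDerivAt (f i) (f' i t) t) (h0 : ∀ i, 0 < f i 0) (hb : ∀ j, ∀ t ∈ Icc 0 T,
    (∀ i, 0 ≤ f i t) → f j t = 0 → 0 < f' j t) : ∀ t ∈ Icc 0 T, ∀ i, 0 < f i t := by
  by_contra hcon
  push Not at hcon
  obtain ⟨t₁, ht₁, i₁, hi₁⟩ := hcon
  set Z : Set ℝ := {t | t ∈ Icc 0 T ∧ ∃ i, f i t ≤ 0} with hZ
  have hZne : Z.Nonempty := ⟨t₁, ht₁, i₁, hi₁⟩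
  have hZeq : Z = ⋃ i, {t | t ∈ Icc 0 T ∧ f i t ≤ 0} := by ext t; simp [hZ]
  have hZc : IsCompact Z := by
    rw [hZeq]
    refine isCompact_iUnion fun i => ?_
    have : ContinuousOn (f i) (Icc 0 T) := fun t ht => (hd i t ht).continuousAt.continuousWithinAt
    have hcl := this.preimage_isClosed_of_isClosed isClosed_Icc (isClosed_Iic (a := (0 : ℝ)))
    refine isCompact_Icc.of_isClosed_subset (s := Icc 0 T) hcl (fun t ht => ht.1)
  obtain ⟨τ, hτZ, hτ⟩ := hZc.exists_isLeast hZne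
  obtain ⟨hτI, j, hj⟩ := hτZ
  have hbefore : ∀ t ∈ Set.Ico 0 τ, ∀ i, 0 < f i t := by
    intro t ht i
    by_contra hn
    exact absurd (hτ ⟨⟨ht.1, ht.2.le.trans hτI.2⟩, i, not_lt.1 hn⟩) (not_le.2 ht.2)
  have hτpos : 0 < τ := by
    rcases hτI.1.eq_or_lt with h | h
    · exact absurd hj (not_le.2 (h ▸ h0 j))
    · exact h
  have hnn : ∀ i, 0 ≤ f i τ := by
    intro i
    have hcont : Tendsto (f i) (𝓝[<] τ) (𝓝 (f i τ)) :=
      (hd i τ hτI).continuousAt.continuousWithinAt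
    refine ge_of_tendsto hcont ?_
    filter_upwards [Ioo_mem_nhdsLT hτpos] with t ht
    exact (hbefore t ⟨ht.1.le, ht.2⟩ i).le
  have hj0 : f j τ = 0 := le_antisymm hj (hnn j)
  have hpos := hb j τ hτI hnn hj0
  have hsl := (hasDerivAt_iff_tendsto_slope.1 (hd j τ hτI)).mono_left (nhdsLT_le_nhdsNE τ)
  obtain ⟨t, ht1, ht2⟩ := ((hsl.eventually (lt_mem_nhds hpos)).and (Ioo_mem_nhdsLT hτpos)).exists
  rw [slope_def_field, hj0, sub_zero] at ht1
  have := div_neg_of_pos_of_neg (hbefore t ⟨ht2.1.le, ht2.2⟩ j) (sub_neg.2 ht2.2)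
  linarith

end ODE

/-! ### Bounded Lipschitz functions -/

section BddLip

variable {X : Type*} [PseudoMetricSpace X] {f g : X → ℝ}

/-- Bounded Lipschitz real functions. -/
def BddLip (f : X → ℝ) : Prop :=
  ∃ C : ℝ, 0 ≤ C ∧ (∀ x, |f x| ≤ C) ∧ ∀ x y, |f x - f y| ≤ C * dist x y

lemma BddLip.const (c : ℝ) : BddLip (fun _ : X => c) :=
  ⟨|c|, abs_nonneg c, fun _ => le_rfl, fun x y => by
    simpa using mul_nonneg (abs_nonneg c) dist_nonneg⟩

lemma BddLip.add (hf : BddLip f) (hg : BddLip g) : BddLip (fun x => f x + g x) := by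
  obtain ⟨C, hC, h1, h2⟩ := hf
  obtain ⟨D, hD, h3, h4⟩ := hg
  refine ⟨C + D, by positivity, fun x => (abs_add_le _ _).trans (add_le_add (h1 x) (h3 x)),
    fun x y => ?_⟩
  calc |f x + g x - (f y + g y)| = |(f x - f y) + (g x - g y)| := by ring_nf
    _ ≤ |f x - f y| + |g x - g y| := abs_add_le _ _
    _ ≤ C * dist x y + D * dist x y := add_le_add (h2 x y) (h4 x y)
    _ = (C + D) * dist x y := by ring

lemma BddLip.mul (hf : BddLip f) (hg : BddLip g) : BddLip (fun x => f x * g x) := by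
  obtain ⟨C, hC, h1, h2⟩ := hf
  obtain ⟨D, hD, h3, h4⟩ := hg
  refine ⟨C * D + 2 * (C * D), by positivity, fun x => ?_, fun x y => ?_⟩
  · rw [abs_mul]
    nlinarith [mul_le_mul (h1 x) (h3 x) (abs_nonneg _) hC, mul_nonneg hC hD]
  · have e : f x * g x - f y * g y = (f x - f y) * g x + f y * (g x - g y) := by ring
    have hd : 0 ≤ dist x y := dist_nonneg
    calc |f x * g x - f y * g y| ≤ |f x - f y| * |g x| + |f y| * |g x - g y| := by
          rw [e, ← abs_mul, ← abs_mul]; exact abs_add_le _ _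
      _ ≤ (C * dist x y) * D + C * (D * dist x y) := by
          gcongr
          exacts [h2 x y, h3 x, h1 y, h4 x y]
      _ ≤ (C * D + 2 * (C * D)) * dist x y := by nlinarith [mul_nonneg (mul_nonneg hC hD) hd]

lemma BddLip.neg (hf : BddLip f) : BddLip (fun x => -f x) := by
  simpa using (BddLip.const (-1)).mul hf

lemma BddLip.sub (hf : BddLip f) (hg : BddLip g) : BddLip (fun x => f x - g x) := by
  simpa [sub_eq_add_neg] using hf.add hg.neg

lemma BddLip.pow (hf : BddLip f) (n : ℕ) : BddLip (fun x => f x ^ n) := by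
  induction n with
  | zero => simpa using BddLip.const 1
  | succ n ih => simpa [pow_succ] using ih.mul hf

lemma BddLip.inv (hf : BddLip f) {c : ℝ} (hc : 0 < c) (h : ∀ x, c ≤ f x) :
    BddLip (fun x => (f x)⁻¹) := by
  obtain ⟨C, hC, h1, h2⟩ := hf
  refine ⟨c⁻¹ + C * (c⁻¹ * c⁻¹), by positivity, fun x => ?_, fun x y => ?_⟩
  · rw [abs_of_pos (inv_pos.2 (hc.trans_le (h x)))]
    have : (f x)⁻¹ ≤ c⁻¹ := inv_anti₀ hc (h x)
    have : 0 ≤ C * (c⁻¹ * c⁻¹) := by positivity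
    linarith
  · have hx := hc.trans_le (h x)
    have hy := hc.trans_le (h y)
    have e : (f x)⁻¹ - (f y)⁻¹ = -(f x - f y) * ((f x)⁻¹ * (f y)⁻¹) := by
      field_simp
      ring
    rw [e, abs_mul, abs_neg, abs_of_pos (a := (f x)⁻¹ * (f y)⁻¹) (by positivity)]
    calc |f x - f y| * ((f x)⁻¹ * (f y)⁻¹) ≤ (C * dist x y) * (c⁻¹ * c⁻¹) := by
          have := h2 x y
          have h3 := inv_anti₀ hc (h x)
          have h4 := inv_anti₀ hc (h y)
          gcongr
      _ ≤ (c⁻¹ + C * (c⁻¹ * c⁻¹)) * dist x y := by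
          have : 0 ≤ c⁻¹ * dist x y := by positivity
          nlinarith

lemma BddLip.comp_lipschitz {Y : Type*} [PseudoMetricSpace Y] {k : Y → X} (hf : BddLip f)
    (hk : ∀ x y, dist (k x) (k y) ≤ dist x y) : BddLip (fun y => f (k y)) := by
  obtain ⟨C, hC, h1, h2⟩ := hf
  exact ⟨C, hC, fun y => h1 _, fun x y => (h2 _ _).trans (by gcongr; exact hk x y)⟩

lemma BddLip.of_deriv {h h' : ℝ → ℝ} {C : ℝ} (hC : ∀ x, |h x| ≤ C)
    (hd : ∀ x, HasDerivAt h (h' x) x) (hC' : ∀ x, |h' x| ≤ C) : BddLip h := by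
  refine ⟨C, (abs_nonneg _).trans (hC 0), hC, fun x y => ?_⟩
  have := Convex.norm_image_sub_le_of_norm_hasDerivWithin_le (f := h) (f' := h') (s := univ) (C :=
    C) (fun x _ => (hd x).hasDerivWithinAt) (fun x _ => hC' x) convex_univ (mem_univ y) (mem_univ x)
  simpa [dist_eq] using this

lemma bddLip_sin : BddLip sin :=
  .of_deriv (C := 1) abs_sin_le_one hasDerivAt_sin abs_cos_le_one

lemma bddLip_cos : BddLip cos :=
  .of_deriv (C := 1) abs_cos_le_one hasDerivAt_cos (by simpa using abs_sin_le_one)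

lemma sq_mul_exp_neg_le (x : ℝ) : x ^ 2 * exp (-x ^ 2 / 6) ≤ 6 := by
  have h1 := add_one_le_exp (x ^ 2 / 6)
  have h2 : exp (-x ^ 2 / 6) * exp (x ^ 2 / 6) = 1 := by rw [← exp_add]; ring_nf; simp
  have h3 := exp_pos (-x ^ 2 / 6)
  nlinarith [sq_nonneg x]

lemma exp_neg_sq_div_le_one (x : ℝ) : exp (-x ^ 2 / 6) ≤ 1 := by
  rw [exp_le_one_iff]; nlinarith [sq_nonneg x]

lemma abs_mul_exp_neg_le (x : ℝ) : |x| * exp (-x ^ 2 / 6) ≤ 7 := by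
  have h1 := sq_mul_exp_neg_le x
  have h2 := exp_neg_sq_div_le_one x
  have h3 := exp_pos (-x ^ 2 / 6)
  have : |x| ≤ x ^ 2 + 1 := by rw [← sq_abs]; nlinarith [sq_nonneg (|x| - 1), abs_nonneg x]
  nlinarith

lemma hasDerivAt_exp_neg_sq_div (x : ℝ) : HasDerivAt (fun x : ℝ => exp (-x ^ 2 / 6)) (exp (-x ^ 2 /
    6) * (-(2 * x) / 6)) x := by
  have := ((hasDerivAt_pow 2 x).neg.div_const 6).exp
  simpa using this

lemma bddLip_gaussian : BddLip (fun x : ℝ => exp (-x ^ 2 / 6)) := by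
  refine .of_deriv (C := 7) (fun x => ?_) hasDerivAt_exp_neg_sq_div (fun x => ?_)
  · rw [abs_of_pos (exp_pos _)]; linarith [exp_neg_sq_div_le_one x]
  · have h := abs_mul_exp_neg_le x
    rw [abs_mul, abs_of_pos (exp_pos _), show -(2 * x) / 6 = -(x / 3) by ring, abs_neg,
      abs_div, abs_of_pos (by norm_num : (0 : ℝ) < 3)]
    have := abs_nonneg x
    have := exp_pos (-x ^ 2 / 6)
    nlinarith

lemma bddLip_mul_gaussian : BddLip (fun x : ℝ => x * exp (-x ^ 2 / 6)) := by
  refine .of_deriv (C := 7) (fun x => ?_)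
    (fun x => (hasDerivAt_id x).mul (hasDerivAt_exp_neg_sq_div x)) (fun x => ?_)
  · rw [abs_mul, abs_of_pos (exp_pos _)]; exact abs_mul_exp_neg_le x
  · have h := sq_mul_exp_neg_le x
    have h2 := exp_neg_sq_div_le_one x
    have h3 := exp_pos (-x ^ 2 / 6)
    rw [abs_le]
    simp only [id]
    constructor <;> nlinarith [sq_nonneg x]

lemma bddLip_pow_mul_gaussian {k : ℕ} (hk : k ≤ 6) :
    BddLip (fun x : ℝ => x ^ k * exp (-x ^ 2)) := by
  have h := (bddLip_mul_gaussian.pow k).mul (bddLip_gaussian.pow (6 - k))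
  have e : (fun x : ℝ => x ^ k * exp (-x ^ 2)) = fun x =>
      (x * exp (-x ^ 2 / 6)) ^ k * exp (-x ^ 2 / 6) ^ (6 - k) := by
    funext x
    rw [mul_pow, mul_assoc, ← pow_add, Nat.add_sub_of_le hk, ← exp_nat_mul]
    congr 2
    push_cast
    ring
  rw [e]
  exact h

end BddLip

/-- Truncation to `[-1, 1]`. -/
def trunc (a : ℝ) : ℝ := max (-1) (min a 1)

lemma abs_trunc_le (a : ℝ) : |trunc a| ≤ 1 := by
  rw [trunc, abs_le]
  exact ⟨le_max_left _ _, max_le (by norm_num) (min_le_right _ _)⟩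

lemma trunc_of_abs_le {a : ℝ} (h : |a| ≤ 1) : trunc a = a := by
  rw [abs_le] at h
  rw [trunc, min_eq_left h.2, max_eq_right h.1]

lemma bddLip_trunc : BddLip trunc := by
  refine ⟨1, zero_le_one, abs_trunc_le, fun x y => ?_⟩
  rw [one_mul, dist_eq]
  calc |trunc x - trunc y| ≤ |min x 1 - min y 1| := by
        have := abs_max_sub_max_le_max (-1 : ℝ) (min x 1) (-1) (min y 1)
        simpa [trunc] using this
    _ ≤ |x - y| := by
        have := abs_min_sub_min_le_max x 1 y 1
        simpa using this

lemma bddLip_inv_max_one : BddLip (fun s : ℝ => (max s 1)⁻¹) := by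
  refine ⟨1, zero_le_one, fun s => ?_, fun s r => ?_⟩
  · have : (1 : ℝ) ≤ max s 1 := le_max_right _ _
    rw [abs_of_pos (by positivity)]
    exact inv_le_one_of_one_le₀ this
  · have h1 : (1 : ℝ) ≤ max s 1 := le_max_right _ _
    have h2 : (1 : ℝ) ≤ max r 1 := le_max_right _ _
    have e : (max s 1)⁻¹ - (max r 1)⁻¹ = -(max s 1 - max r 1) * ((max s 1)⁻¹ * (max r 1)⁻¹) := by
      have : max s 1 ≠ 0 := by positivity
      have : max r 1 ≠ 0 := by positivity
      field_simp
      ring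
    have h3 : (max s 1)⁻¹ * (max r 1)⁻¹ ≤ 1 :=
      mul_le_one₀ (inv_le_one_of_one_le₀ h1) (by positivity) (inv_le_one_of_one_le₀ h2)
    have h4 : |max s 1 - max r 1| ≤ |s - r| := by
      have := abs_max_sub_max_le_max s 1 r 1
      simpa using this
    rw [e, abs_mul, abs_neg, abs_of_pos (a := (max s 1)⁻¹ * (max r 1)⁻¹) (by positivity), one_mul,
      dist_eq]
    have := abs_nonneg (max s 1 - max r 1)
    nlinarith

/-! ### The Euler–Lagrange equation of the profile

In the variables `Φ = θ + 1/y`, `s = 1/y`, `a = θ'`, `c = s² y'`. -/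

section Field

/-- `|q|²`, where `i` stands for `1/s`. -/
def speedSq (i a c : ℝ) : ℝ := a ^ 2 + c ^ 2 * i ^ 4

/-- `∇V · q`. -/
def slopeV (Φ s a c : ℝ) : ℝ :=
  -(cos Φ * a * exp (-s ^ 2) + (2 * sin Φ * (s ^ 1 * exp (-s ^ 2)) - cos Φ * exp (-s ^ 2)) * c)

/-- The friction coefficient. -/
def friction (p M lam B₀ Φ s i a c : ℝ) : ℝ :=
  (lam * (speedSq i a c + M * (B₀ + exp (-s ^ 2) * sin Φ)) - (p - 2) * M * slopeV Φ s a c) *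
  (M * (B₀ + exp (-s ^ 2) * sin Φ) + (p - 1) * speedSq i a c)⁻¹

def accA (p M lam B₀ Φ s i a c : ℝ) : ℝ :=
  M / 2 * cos Φ * exp (-s ^ 2) - friction p M lam B₀ Φ s i a c * a

def accC (p M lam B₀ Φ s i a c : ℝ) : ℝ :=
  M / 2 * (2 * sin Φ * (s ^ 5 * exp (-s ^ 2)) -
    cos Φ * (s ^ 4 * exp (-s ^ 2))) - 2 * c ^ 2 * i - friction p M lam B₀ Φ s i a c * c

/-- The vector field, truncated to be bounded and Lipschitz. -/
def profileField (p M lam B₀ : ℝ) (x : ℝ × ℝ × ℝ × ℝ) : ℝ × ℝ × ℝ × ℝ :=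
  (trunc x.2.2.1 - trunc x.2.2.2, -trunc x.2.2.2,
    accA p M lam B₀ x.1 x.2.1 (max x.2.1 1)⁻¹ (trunc x.2.2.1) (trunc x.2.2.2),
    accC p M lam B₀ x.1 x.2.1 (max x.2.1 1)⁻¹ (trunc x.2.2.1) (trunc x.2.2.2))

variable {p M lam B₀ : ℝ}

lemma speedSq_nonneg (i a c : ℝ) : 0 ≤ speedSq i a c := by unfold speedSq; positivity

lemma exp_neg_sq_mul_sin_ge (s Φ : ℝ) : -1 ≤ exp (-s ^ 2) * sin Φ := by
  have h1 : exp (-s ^ 2) ≤ 1 := exp_le_one_iff.2 (by nlinarith [sq_nonneg s])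
  have h2 := exp_pos (-s ^ 2)
  nlinarith [neg_one_le_sin Φ]

lemma friction_den_ge (hp : 1 < p) (hM : 1 ≤ M) (hB : 2 ≤ B₀) (Φ s i a c : ℝ) :
    1 ≤ M * (B₀ + exp (-s ^ 2) * sin Φ) + (p - 1) * speedSq i a c := by
  have h1 := exp_neg_sq_mul_sin_ge s Φ
  have h2 := mul_nonneg (sub_pos.2 hp).le (speedSq_nonneg i a c)
  nlinarith

lemma profileField_bddLip (hp : 1 < p) (hM : 1 ≤ M) (hB : 2 ≤ B₀) : BddLip (fun x => (profileField p
    M lam B₀ x).1) ∧ BddLip (fun x => (profileField p M lam B₀ x).2.1) ∧ BddLip (fun x =>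
    (profileField p M lam B₀ x).2.2.1) ∧ BddLip (fun x => (profileField p M lam B₀ x).2.2.2) := by
  have d1 : ∀ x y : ℝ × ℝ × ℝ × ℝ, dist x.1 y.1 ≤ dist x y := fun x y => le_max_left _ _
  have d2 : ∀ x y : ℝ × ℝ × ℝ × ℝ, dist x.2.1 y.2.1 ≤ dist x y := fun x y =>
    (le_max_left _ _).trans (le_max_right _ _)
  have d3 : ∀ x y : ℝ × ℝ × ℝ × ℝ, dist x.2.2.1 y.2.2.1 ≤ dist x y := fun x y =>
    (le_max_left _ _).trans ((le_max_right _ _).trans (le_max_right _ _))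
  have d4 : ∀ x y : ℝ × ℝ × ℝ × ℝ, dist x.2.2.2 y.2.2.2 ≤ dist x y := fun x y =>
    (le_max_right _ _).trans ((le_max_right _ _).trans (le_max_right _ _))
  have hsin := bddLip_sin.comp_lipschitz d1
  have hcos := bddLip_cos.comp_lipschitz d1
  have ha := bddLip_trunc.comp_lipschitz d3
  have hc := bddLip_trunc.comp_lipschitz d4
  have hi := bddLip_inv_max_one.comp_lipschitz d2
  have hg0 : BddLip (fun x : ℝ × ℝ × ℝ × ℝ => exp (-x.2.1 ^ 2)) := by
    simpa using (bddLip_pow_mul_gaussian (k := 0) (by norm_num)).comp_lipschitz d2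
  have hg1 := (bddLip_pow_mul_gaussian (k := 1) (by norm_num)).comp_lipschitz d2
  have hg4 := (bddLip_pow_mul_gaussian (k := 4) (by norm_num)).comp_lipschitz d2
  have hg5 := (bddLip_pow_mul_gaussian (k := 5) (by norm_num)).comp_lipschitz d2
  have hk (k : ℝ) := BddLip.const (X := ℝ × ℝ × ℝ × ℝ) k
  have hspeed := (ha.pow 2).add ((hc.pow 2).mul (hi.pow 4))
  have hslope := (((hcos.mul ha).mul hg0).add
    (((((hk 2).mul hsin).mul hg1).sub (hcos.mul hg0)).mul hc)).neg
  have hpot := (hk M).mul ((hk B₀).add (hg0.mul hsin))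
  have hden := hpot.add ((hk (p - 1)).mul hspeed)
  have hfr := (((hk lam).mul (hspeed.add hpot)).sub (((hk (p - 2)).mul (hk M)).mul hslope)).mul
    (hden.inv (c := 1) one_pos (fun x => friction_den_ge hp hM hB _ _ _ _ _))
  refine ⟨ha.sub hc, hc.neg, ?_, ?_⟩
  · exact (((hk (M / 2)).mul hcos).mul hg0).sub (hfr.mul ha)
  · exact (((hk (M / 2)).mul ((((hk 2).mul hsin).mul hg5).sub (hcos.mul hg4))).sub
      (((hk 2).mul (hc.pow 2)).mul hi)).sub (hfr.mul hc)

lemma exists_lipschitzWith_profileField (hp : 1 < p) (hM : 1 ≤ M) (hB : 2 ≤ B₀) : ∃ K L : NNReal,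
    LipschitzWith K (profileField p M lam B₀) ∧ ∀ x, ‖profileField p M lam B₀ x‖ ≤ L := by
  obtain ⟨⟨C1, h1, b1, l1⟩, ⟨C2, h2, b2, l2⟩, ⟨C3, h3, b3, l3⟩, ⟨C4, h4, b4, l4⟩⟩ :=
    profileField_bddLip (lam := lam) hp hM hB
  set C : ℝ := C1 + C2 + C3 + C4 with hC
  have hC0 : 0 ≤ C := by positivity
  have key : ∀ (w : ℝ × ℝ × ℝ × ℝ) (d : ℝ), 0 ≤ d → |w.1| ≤ C1 * d → |w.2.1| ≤ C2 * d →
      |w.2.2.1| ≤ C3 * d → |w.2.2.2| ≤ C4 * d → ‖w‖ ≤ C * d := by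
    intro w d hd e1 e2 e3 e4
    have := mul_nonneg h1 hd
    have := mul_nonneg h2 hd
    have := mul_nonneg h3 hd
    have := mul_nonneg h4 hd
    have e : C * d = C1 * d + C2 * d + C3 * d + C4 * d := by rw [hC]; ring
    simp only [Prod.norm_def, norm_eq_abs]
    refine max_le (by linarith) (max_le (by linarith) (max_le (by linarith) (by linarith)))
  refine ⟨C.toNNReal, C.toNNReal, LipschitzWith.of_dist_le_mul fun x y => ?_, fun x => ?_⟩
  · rw [coe_toNNReal _ hC0, dist_eq_norm]
    exact key _ _ dist_nonneg (l1 x y) (l2 x y) (l3 x y) (l4 x y)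
  · rw [coe_toNNReal _ hC0]
    simpa using key (profileField p M lam B₀ x) 1 zero_le_one (by simpa using b1 x)
      (by simpa using b2 x) (by simpa using b3 x) (by simpa using b4 x)

end Field

section Trap

variable {p M lam B₀ : ℝ}

/-- The slow variable `H`, close to `1` along the spiral. -/
def slowH (Φ s : ℝ) : ℝ := s ^ 4 * (2 * s * sin Φ - cos Φ)

/-- The trapping region; `a = μ e^{-s²} α`, `c = μ e^{-s²} γ`. -/
structure Trapped (Φ s α γ : ℝ) : Prop where
  phi : Φ ^ 2 ≤ 1
  slow : (slowH Φ s - 1) ^ 2 ≤ 1 / 4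
  alpha : (α - cos Φ) ^ 2 ≤ 1 / 100
  gamma : (γ - slowH Φ s) ^ 2 ≤ 1 / 100

/-- How large `s` has to be for the trapping region to be invariant. -/
structure LargeS (p M lam μ s : ℝ) : Prop where
  twelve : 12 ≤ s
  small : μ * exp (-s ^ 2) ≤ 1 / 2
  tiny : |p - 2| * (8 * M * μ + 8 * lam * μ ^ 2) * exp (-s ^ 2) ^ 2 +
    60 * s ^ 5 * (μ * exp (-s ^ 2)) ≤ lam / 40

lemma Trapped.bounds {Φ s α γ : ℝ} (h : Trapped Φ s α γ) (hs : 12 ≤ s) :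
    |sin Φ| ≤ 9 / (10 * s) ∧ 0.98 ≤ cos Φ ∧ 0.88 ≤ α ∧ α ≤ 1.1 ∧ 0.4 ≤ γ ∧ γ ≤ 1.6 ∧
      1 / 2 ≤ slowH Φ s ∧ slowH Φ s ≤ 3 / 2 := by
  have hH := abs_le_of_sq_le_sq' (a := slowH Φ s - 1) (b := 1 / 2) (by linarith [h.slow]) (by norm_num)
  have hα := abs_le_of_sq_le_sq' (a := α - cos Φ) (b := 1 / 10) (by linarith [h.alpha])
    (by norm_num)
  have hγ := abs_le_of_sq_le_sq' (a := γ - slowH Φ s) (b := 1 / 10) (by linarith [h.gamma])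
    (by norm_num)
  have hs0 : 0 < s := by linarith
  have hs4 : (12 : ℝ) ^ 4 ≤ s ^ 4 := by gcongr
  have hc1 := cos_le_one Φ
  have hΦ : |Φ| ≤ 1 := abs_le_one_iff_mul_self_le_one.2 (by nlinarith [h.phi])
  have hc0 : 0 ≤ cos Φ := (cos_pos_of_le_one hΦ).le
  have heq : 2 * s * sin Φ = cos Φ + slowH Φ s / s ^ 4 := by unfold slowH; field_simp; ring
  have hq0 : 0 ≤ slowH Φ s / s ^ 4 := div_nonneg (by linarith) (by positivity)
  have hq1 : slowH Φ s / s ^ 4 ≤ 1 / 10 := by rw [div_le_iff₀ (by positivity)]; linarith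
  have hsin0 : 0 ≤ sin Φ := by
    by_contra hneg
    have : s * sin Φ < 0 := mul_neg_of_pos_of_neg hs0 (not_le.1 hneg)
    linarith
  have hsin1 : s * sin Φ ≤ 0.55 := by linarith
  have hsinle : sin Φ ≤ 9 / (10 * s) := by rw [le_div_iff₀ (by positivity)]; nlinarith
  have hsin2 : sin Φ ≤ 0.1 := by nlinarith
  have hcos : 0.98 ≤ cos Φ := by nlinarith [sin_sq_add_cos_sq Φ]
  refine ⟨by rwa [abs_of_nonneg hsin0], hcos, ?_, ?_, ?_, ?_, ?_, ?_⟩ <;>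
    linarith [hH.1, hH.2, hα.1, hα.2, hγ.1, hγ.2]

lemma friction_sub (hp : 1 < p) (hM : 1 ≤ M) (hB : 2 ≤ B₀) (Φ s i a c : ℝ) :
    |friction p M lam B₀ Φ s i a c - lam| ≤
      |p - 2| * |M * slopeV Φ s a c + lam * speedSq i a c| := by
  have hden := friction_den_ge hp hM hB Φ s i a c
  set D := M * (B₀ + exp (-s ^ 2) * sin Φ) + (p - 1) * speedSq i a c with hD
  have e : friction p M lam B₀ Φ s i a c - lam =
      -(p - 2) * (M * slopeV Φ s a c + lam * speedSq i a c) * D⁻¹ := by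
    have hD0 : D ≠ 0 := by positivity
    unfold friction
    rw [← hD]
    field_simp
    rw [hD]
    ring
  rw [e, abs_mul, abs_mul, abs_neg, abs_of_pos (a := D⁻¹) (by positivity)]
  exact mul_le_of_le_one_right (by positivity) (inv_le_one_of_one_le₀ hden)

lemma Trapped.friction_sub_le {Φ s α γ μ : ℝ} (h : Trapped Φ s α γ) (hs : 12 ≤ s)
    (hp : 1 < p) (hM : 1 ≤ M) (hB : 2 ≤ B₀) (hlam : 0 < lam) (hμ : 0 < μ) :
    |friction p M lam B₀ Φ s s⁻¹ (μ * exp (-s ^ 2) * α) (μ * exp (-s ^ 2) * γ) - lam| ≤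
      |p - 2| * (8 * M * μ + 8 * lam * μ ^ 2) * exp (-s ^ 2) ^ 2 := by
  obtain ⟨h1, h2, h3, h4, h5, h6, h7, h8⟩ := h.bounds hs
  set e := exp (-s ^ 2) with he
  have hepos : 0 < e := exp_pos _
  have hs0 : 0 < s := by linarith
  have hs4 : (12 : ℝ) ^ 4 ≤ s ^ 4 := by gcongr
  have hi : s⁻¹ ≤ 1 := inv_le_one_of_one_le₀ (by linarith)
  have hi0 : 0 < s⁻¹ := by positivity
  have hi4 : s⁻¹ ^ 4 ≤ 1 := pow_le_one₀ hi0.le hi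
  have hcl := cos_le_one Φ
  set w := 2 * s * sin Φ - cos Φ with hw
  have hHw : slowH Φ s = s ^ 4 * w := rfl
  have hw0 : 0 ≤ w := by
    by_contra hneg
    have : s ^ 4 * w < 0 := mul_neg_of_pos_of_neg (by positivity) (not_le.1 hneg)
    linarith
  have hw1 : w ≤ 1 := by
    by_contra hneg
    have : s ^ 4 * 1 < s ^ 4 * w := by gcongr; exact not_le.1 hneg
    linarith
  have hsl : slopeV Φ s (μ * e * α) (μ * e * γ) = -(μ * e ^ 2 * (cos Φ * α + w * γ)) := by
    unfold slopeV; rw [← he, hw]; ring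
  have hsp : speedSq s⁻¹ (μ * e * α) (μ * e * γ) = μ ^ 2 * e ^ 2 * (α ^ 2 + γ ^ 2 * s⁻¹ ^ 4) := by
    unfold speedSq; ring
  have hA : cos Φ * α + w * γ ≤ 8 := by
    have e1 := mul_le_mul hcl h4 (by linarith) zero_le_one
    have e2 := mul_le_mul hw1 h6 (by linarith) zero_le_one
    linarith
  have hA0 : 0 ≤ cos Φ * α + w * γ :=
    add_nonneg (mul_nonneg (by linarith) (by linarith)) (mul_nonneg hw0 (by linarith))
  have hS : α ^ 2 + γ ^ 2 * s⁻¹ ^ 4 ≤ 8 := by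
    have e1 : γ ^ 2 * s⁻¹ ^ 4 ≤ γ ^ 2 := mul_le_of_le_one_right (by positivity) hi4
    have e2 : α ^ 2 ≤ 1.1 ^ 2 := by gcongr
    have e3 : γ ^ 2 ≤ 1.6 ^ 2 := by gcongr
    linarith
  have hS0 : 0 ≤ α ^ 2 + γ ^ 2 * s⁻¹ ^ 4 := by positivity
  refine (friction_sub hp hM hB _ _ _ _ _).trans ?_
  rw [mul_assoc |p - 2|]
  gcongr
  rw [hsl, hsp]
  have hk1 : 0 ≤ M * (μ * e ^ 2) := by positivity
  have hk2 : 0 ≤ lam * (μ ^ 2 * e ^ 2) := by positivity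
  have b1 := mul_le_mul_of_nonneg_left hA hk1
  have b2 := mul_le_mul_of_nonneg_left hS hk2
  have b3 := mul_nonneg hk1 hA0
  have b4 := mul_nonneg hk2 hS0
  rw [abs_le]
  constructor <;> linarith

lemma mul_neg_of_decay {lam z D err : ℝ} (hlam : 0 < lam) (hz : z ^ 2 = 1 / 100)
    (hD : D = -lam * z + err) (herr : |err| ≤ lam / 20) : 2 * z * D < 0 := by
  have hzabs : |z| = 1 / 10 := by
    rw [← sqrt_sq_eq_abs, hz, show (1 : ℝ) / 100 = (1 / 10) ^ 2 by norm_num, sqrt_sq (by norm_num)]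
  have h1 : |z * err| ≤ 1 / 10 * (lam / 20) := by rw [abs_mul, hzabs]; gcongr
  have h2 := (abs_le.1 h1).2
  have e : 2 * z * D = -(2 * lam * z ^ 2) + 2 * (z * err) := by rw [hD]; ring
  rw [e, hz]
  linarith

/-- The derivative of `H` along the flow. -/
def slowRate (Φ s a c : ℝ) : ℝ :=
  (2 * s ^ 5 * cos Φ + s ^ 4 * sin Φ) * (a - c) - (10 * s ^ 4 * sin Φ - 4 * s ^ 3 * cos Φ) * c

lemma Trapped.slowRate_eq {Φ s α γ e : ℝ} (h : Trapped Φ s α γ) (hs : 12 ≤ s) (he : 0 < e) :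
    ∃ k r : ℝ, slowRate Φ s (e * α) (e * γ) = e * s ^ 3 * (k * (α - γ) - r) ∧ |r| ≤ 21 ∧
      1.9 * s ^ 2 ≤ k ∧ k ≤ 2.1 * s ^ 2 := by
  obtain ⟨h1, h2, h3, h4, h5, h6, h7, h8⟩ := h.bounds hs
  have hs0 : 0 < s := by linarith
  have hcl := cos_le_one Φ
  have hsin : |s * sin Φ| ≤ 0.9 := by
    rw [abs_mul, abs_of_pos hs0]
    calc s * |sin Φ| ≤ s * (9 / (10 * s)) := by gcongr
      _ = 0.9 := by field_simp; norm_num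
  have hsin' := abs_le.1 hsin
  have hs2 : 144 ≤ s ^ 2 := by nlinarith
  have hm1 := mul_le_mul_of_nonneg_left hcl (by positivity : 0 ≤ s ^ 2)
  have hm2 := mul_le_mul_of_nonneg_left h2 (by positivity : 0 ≤ s ^ 2)
  refine ⟨2 * s ^ 2 * cos Φ + s * sin Φ, (10 * (s * sin Φ) - 4 * cos Φ) * γ, ?_, ?_, ?_, ?_⟩
  · unfold slowRate; ring
  · rw [abs_mul, abs_of_pos (a := γ) (by linarith)]
    have : |10 * (s * sin Φ) - 4 * cos Φ| ≤ 13 := by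
      rw [abs_le]; constructor <;> linarith [hsin'.1, hsin'.2]
    exact (mul_le_mul this h6 (by linarith) (by norm_num)).trans (by norm_num)
  · linarith [hsin'.1]
  · linarith [hsin'.2]

lemma Trapped.abs_slowRate_le {Φ s α γ e : ℝ} (h : Trapped Φ s α γ) (hs : 12 ≤ s) (he : 0 < e) :
    |slowRate Φ s (e * α) (e * γ)| ≤ 40 * (s ^ 5 * e) := by
  obtain ⟨k, r, hk, hr, k1, k2⟩ := h.slowRate_eq hs he
  obtain ⟨h1, h2, h3, h4, h5, h6, h7, h8⟩ := h.bounds hs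
  have hs0 : 0 < s := by linarith
  have hs2 : 144 ≤ s ^ 2 := by nlinarith
  have hes3 : 0 < e * s ^ 3 := by positivity
  have hk0 : 0 < k := by linarith
  rw [hk, abs_mul, abs_of_pos hes3]
  calc e * s ^ 3 * |k * (α - γ) - r| ≤ e * s ^ 3 * (2.1 * s ^ 2 * 1 + 21) := by
        gcongr
        refine (abs_sub _ _).trans (add_le_add ?_ hr)
        rw [abs_mul, abs_of_pos hk0]
        gcongr
        rw [abs_le]; constructor <;> linarith
    _ ≤ e * s ^ 3 * (40 * s ^ 2) := by gcongr; linarith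
    _ = 40 * (s ^ 5 * e) := by ring

lemma Trapped.slow_inward {Φ s α γ e : ℝ} (h : Trapped Φ s α γ) (hs : 12 ≤ s) (he : 0 < e) (hH :
    (slowH Φ s - 1) ^ 2 = 1 / 4) : 2 * (slowH Φ s - 1) * slowRate Φ s (e * α) (e * γ) < 0 := by
  obtain ⟨k, r, hk, hr, k1, k2⟩ := h.slowRate_eq hs he
  obtain ⟨h1, h2, h3, h4, h5, h6, h7, h8⟩ := h.bounds hs
  have hr' := abs_le.1 hr
  have hs0 : 0 < s := by linarith
  have hs2 : 144 ≤ s ^ 2 := by nlinarith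
  have hk0 : 200 ≤ k := by linarith
  have hes3 : 0 < e * s ^ 3 := by positivity
  have hcl := cos_le_one Φ
  have hγ' := abs_le_of_sq_le_sq' (a := γ - slowH Φ s) (b := 1 / 10) (by linarith [h.gamma])
    (by norm_num)
  have hα' := abs_le_of_sq_le_sq' (a := α - cos Φ) (b := 1 / 10) (by linarith [h.alpha])
    (by norm_num)
  have hcase : slowH Φ s - 1 = 1 / 2 ∨ slowH Φ s - 1 = -(1 / 2) :=
    sq_eq_sq_iff_eq_or_eq_neg.1 (by rw [hH]; norm_num)
  rcases hcase with hH | hH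
  · have hag : α - γ ≤ -0.3 := by linarith [hγ'.1, hα'.2]
    have : k * (α - γ) ≤ k * -0.3 := by gcongr
    have : e * s ^ 3 * (k * (α - γ) - r) < 0 := mul_neg_of_pos_of_neg hes3 (by linarith [hr'.1])
    rw [hH, hk]; linarith
  · have hag : 0.25 ≤ α - γ := by linarith [hγ'.2, hα'.1]
    have : k * 0.25 ≤ k * (α - γ) := by gcongr
    have : 0 < e * s ^ 3 * (k * (α - γ) - r) := mul_pos hes3 (by linarith [hr'.2])
    rw [hH, hk]; linarith

lemma Trapped.phi_ne {Φ s α γ : ℝ} (h : Trapped Φ s α γ) (hs : 12 ≤ s) : Φ ^ 2 ≠ 1 := by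
  intro hΦ
  obtain ⟨h1, -⟩ := h.bounds hs
  have hsin := sin_gt_sub_cube (x := 1) one_pos
  have hsin1 : (3 : ℝ) / 4 < |sin Φ| := by
    rcases sq_eq_sq_iff_eq_or_eq_neg.1 (hΦ.trans (one_pow 2).symm) with h | h
    · rw [h]; exact lt_of_lt_of_le (by linarith) (le_abs_self _)
    · rw [h, sin_neg, abs_neg]; exact lt_of_lt_of_le (by linarith) (le_abs_self _)
  have : |sin Φ| ≤ 3 / 40 := h1.trans (by
    rw [div_le_div_iff₀ (by positivity) (by norm_num)]; linarith)
  linarith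

lemma Trapped.inward {Φ s α γ μ ρ : ℝ} (h : Trapped Φ s α γ) (hs : LargeS p M lam μ s) (hp : 1 < p)
    (hM : 1 ≤ M) (hB : 2 ≤ B₀) (hlam : 0 < lam) (hμ : 0 < μ) {a c : ℝ} (ha : a = μ * exp (-s ^ 2) *
    α) (hc : c = μ * exp (-s ^ 2) * γ) (hρ : ρ = friction p M lam B₀ Φ s s⁻¹ a c) : ((α - cos Φ) ^ 2
    = 1 / 100 → 2 * (α - cos Φ) * (lam * cos Φ - ρ * α - 2 * s * c * α + sin Φ * (a - c)) < 0) ∧ ((γ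
    - slowH Φ s) ^ 2 = 1 / 100 → 2 * (γ - slowH Φ s) * (lam * slowH Φ s - 2 * c * γ * s⁻¹ - ρ * γ -
    2 * s * c * γ - slowRate Φ s a c) < 0) := by
  have hs12 := hs.twelve
  obtain ⟨h1, h2, h3, h4, h5, h6, h7, h8⟩ := h.bounds hs12
  have hfr := h.friction_sub_le hs12 hp hM hB hlam hμ
  have htiny := hs.tiny
  rw [← ha, ← hc, ← hρ] at hfr
  set R := |p - 2| * (8 * M * μ + 8 * lam * μ ^ 2) * exp (-s ^ 2) ^ 2 with hR
  set e := μ * exp (-s ^ 2) with he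
  have hepos : 0 < e := by positivity
  have hs0 : 0 < s := by linarith
  have hR0 : 0 ≤ R := (abs_nonneg _).trans hfr
  have hse : s * e ≤ s ^ 5 * e := by gcongr; exact le_self_pow₀ (by linarith) (by norm_num)
  have hs5 : e ≤ s ^ 5 * e := le_mul_of_one_le_left hepos.le (one_le_pow₀ (by linarith))
  have hc0 : 0 ≤ c := by rw [hc]; exact mul_nonneg hepos.le (by linarith)
  have hcle : c ≤ e * 1.6 := by rw [hc]; gcongr
  constructor
  · intro hα
    refine mul_neg_of_decay (err := (lam - ρ) * α - 2 * s * c * α + sin Φ * (a - c)) hlam hα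
      (by ring) ?_
    have e1 : |(lam - ρ) * α| ≤ R * 1.1 := by
      rw [abs_mul, abs_sub_comm]; gcongr; rw [abs_of_pos (by linarith)]; exact h4
    have e2 : |2 * s * c * α| ≤ 4 * (s ^ 5 * e) := by
      rw [abs_of_nonneg (mul_nonneg (by positivity) (by linarith))]
      calc 2 * s * c * α ≤ 2 * s * (e * 1.6) * 1.1 := by gcongr
        _ = 3.52 * (s * e) := by ring
        _ ≤ _ := by gcongr; norm_num
    have e3 : |sin Φ * (a - c)| ≤ 1 * (e * 1) := by
      rw [show a - c = e * (α - γ) by rw [ha, hc]; ring, abs_mul, abs_mul, abs_of_pos hepos]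
      gcongr
      · exact abs_sin_le_one Φ
      · rw [abs_le]; constructor <;> linarith
    have : 60 * s ^ 5 * e = 60 * (s ^ 5 * e) := by ring
    calc _ ≤ |(lam - ρ) * α| + |2 * s * c * α| + |sin Φ * (a - c)| :=
          (abs_add_le _ _).trans (by gcongr; exact abs_sub _ _)
      _ ≤ lam / 20 := by linarith
  · intro hγ
    have hi1 : s⁻¹ ≤ 1 := inv_le_one_of_one_le₀ (by linarith)
    have hdH := h.abs_slowRate_le hs12 hepos
    rw [← ha, ← hc] at hdH
    refine mul_neg_of_decay (err := (lam - ρ) * γ - 2 * c * γ * s⁻¹ - 2 * s * c * γ -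
      slowRate Φ s a c) hlam hγ (by ring) ?_
    have e1 : |(lam - ρ) * γ| ≤ R * 1.6 := by
      rw [abs_mul, abs_sub_comm]; gcongr; rw [abs_of_pos (by linarith)]; exact h6
    have e2 : |2 * s * c * γ| ≤ 6 * (s ^ 5 * e) := by
      rw [abs_of_nonneg (mul_nonneg (by positivity) (by linarith))]
      calc 2 * s * c * γ ≤ 2 * s * (e * 1.6) * 1.6 := by gcongr
        _ = 5.12 * (s * e) := by ring
        _ ≤ _ := by gcongr; norm_num
    have e3 : |2 * c * γ * s⁻¹| ≤ 6 * (s ^ 5 * e) := by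
      rw [abs_of_nonneg (mul_nonneg (mul_nonneg (by positivity) (by linarith)) (by positivity))]
      calc 2 * c * γ * s⁻¹ ≤ 2 * (e * 1.6) * 1.6 * 1 := by gcongr
        _ = 5.12 * e := by ring
        _ ≤ _ := by gcongr; norm_num
    have f1 := abs_le.1 e1
    have f2 := abs_le.1 e2
    have f3 := abs_le.1 e3
    have f4 := abs_le.1 hdH
    have : 60 * s ^ 5 * e = 60 * (s ^ 5 * e) := by ring
    rw [abs_le]
    constructor <;> linarith [f1.1, f1.2, f2.1, f2.2, f3.1, f3.2, f4.1, f4.2]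

end Trap

section Spiral

variable {p M lam B₀ μ s₀ : ℝ}

/-- Points of the phase space in the trapping region. -/
def trapSet (μ s₀ : ℝ) : Set (ℝ × ℝ × ℝ × ℝ) :=
  {w | s₀ ≤ w.2.1 ∧ Trapped w.1 w.2.1 (w.2.2.1 * exp (w.2.1 ^ 2) / μ)
    (w.2.2.2 * exp (w.2.1 ^ 2) / μ)}

lemma isClosed_trapSet (μ s₀ : ℝ) : IsClosed (trapSet μ s₀) := by
  have : trapSet μ s₀ = {w | s₀ ≤ w.2.1} ∩ ({w | w.1 ^ 2 ≤ 1} ∩ ({w | (slowH w.1 w.2.1 - 1) ^ 2 ≤ 1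
      / 4} ∩ ({w | (w.2.2.1 * exp (w.2.1 ^ 2) / μ - cos w.1) ^ 2 ≤ 1 / 100} ∩ {w | (w.2.2.2 * exp
      (w.2.1 ^ 2) / μ - slowH w.1 w.2.1) ^ 2 ≤ 1 / 100}))) := by
    ext w
    exact ⟨fun h => ⟨h.1, h.2.phi, h.2.slow, h.2.alpha, h.2.gamma⟩,
      fun h => ⟨h.1, ⟨h.2.1, h.2.2.1, h.2.2.2.1, h.2.2.2.2⟩⟩⟩
  rw [this]
  unfold slowH
  refine (isClosed_le (by fun_prop) (by fun_prop)).inter ((isClosed_le (by fun_prop) (by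
    fun_prop)).inter ((isClosed_le (by fun_prop) (by fun_prop)).inter ((isClosed_le (by fun_prop)
    (by fun_prop)).inter (isClosed_le (by fun_prop) (by fun_prop)))))

lemma exp_neg_sq_mul_self {s a : ℝ} (hμ : 0 < μ) :
    a = μ * exp (-s ^ 2) * (a * exp (s ^ 2) / μ) := by
  have : exp (-s ^ 2) * exp (s ^ 2) = 1 := by rw [← exp_add]; simp
  field_simp
  linear_combination (-a) * this

lemma Trapped.abs_le_one {Φ s a c : ℝ} (hμ : 0 < μ) (hs : LargeS p M lam μ s)
    (h : Trapped Φ s (a * exp (s ^ 2) / μ) (c * exp (s ^ 2) / μ)) :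
    |a| ≤ 1 ∧ |c| ≤ 1 ∧ 0.4 * (μ * exp (-s ^ 2)) ≤ c := by
  obtain ⟨h1, h2, h3, h4, h5, h6, h7, h8⟩ := h.bounds hs.twelve
  have ha := exp_neg_sq_mul_self (s := s) (a := a) hμ
  have hc := exp_neg_sq_mul_self (s := s) (a := c) hμ
  set α := a * exp (s ^ 2) / μ
  set γ := c * exp (s ^ 2) / μ
  have hsm := hs.small
  set e := μ * exp (-s ^ 2) with he
  have he0 : 0 < e := by positivity
  have m1 := mul_le_mul hsm h4 (by linarith) (by norm_num)
  have m2 := mul_le_mul hsm h6 (by linarith) (by norm_num)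
  have m3 : 0 ≤ e * α := mul_nonneg he0.le (by linarith)
  have m4 : e * 0.4 ≤ e * γ := mul_le_mul_of_nonneg_left h5 he0.le
  refine ⟨?_, ?_, by linarith⟩ <;> rw [abs_le] <;> constructor <;> linarith

lemma profileField_eq {Φ s a c : ℝ} (hs : 1 ≤ s) (ha : |a| ≤ 1) (hc : |c| ≤ 1) :
    profileField p M lam B₀ (Φ, s, a, c) =
      (a - c, -c, accA p M lam B₀ Φ s s⁻¹ a c, accC p M lam B₀ Φ s s⁻¹ a c) := by
  simp only [profileField, trunc_of_abs_le ha, trunc_of_abs_le hc, max_eq_left hs]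

lemma hasDerivAt_slowH {Φ s : ℝ → ℝ} {t a c : ℝ} (hΦ : HasDerivAt Φ (a - c) t) (hs : HasDerivAt s
    (-c) t) : HasDerivAt (fun t => slowH (Φ t) (s t)) (slowRate (Φ t) (s t) a c) t := by
  unfold slowH slowRate
  refine HasDerivAt.congr_deriv (f := fun t => s t ^ 4 * (2 * s t * sin (Φ t) -
    cos (Φ t))) ((hs.pow 4).mul (((hs.const_mul 2).mul hΦ.sin).sub hΦ.cos)) ?_
  simp only [Pi.pow_apply]
  push_cast
  ring

lemma hasDerivAt_normalized {a s : ℝ → ℝ} {t a' c : ℝ} (ha : HasDerivAt a a' t) (hs : HasDerivAt s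
    (-c) t) : HasDerivAt (fun t => a t * exp (s t ^ 2) / μ) (a' * exp (s t ^ 2) / μ - 2 * s t * c *
    (a t * exp (s t ^ 2) / μ)) t := by
  refine HasDerivAt.congr_deriv (f := fun t => a t * exp (s t ^ 2) / μ)
    ((ha.mul (hs.pow 2).exp).div_const μ) ?_
  simp only [Pi.pow_apply]
  push_cast
  ring

lemma hasDerivAt_components {x : ℝ → ℝ × ℝ × ℝ × ℝ} {x' : ℝ × ℝ × ℝ × ℝ} {t : ℝ} (h : HasDerivAt x
    x' t) : HasDerivAt (fun t => (x t).1) x'.1 t ∧ HasDerivAt (fun t => (x t).2.1) x'.2.1 t ∧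
    HasDerivAt (fun t => (x t).2.2.1) x'.2.2.1 t ∧ HasDerivAt (fun t => (x t).2.2.2) x'.2.2.2 t :=
  ⟨h.fst, h.snd.fst, h.snd.snd.fst, h.snd.snd.snd⟩

/-- Solutions stay trapped as long as `s ≥ s₀`. -/
lemma trapped_forward (hp : 1 < p) (hM : 1 ≤ M) (hB : 2 ≤ B₀) (hlam : 0 < lam) (hμ : μ = M / (2 *
    lam)) (hlarge : ∀ s, s₀ ≤ s → LargeS p M lam μ s) {x : ℝ → ℝ × ℝ × ℝ × ℝ} (hx : ∀ t, HasDerivAt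
    x (profileField p M lam B₀ (x t)) t) {T : ℝ} (hsT : ∀ t ∈ Icc 0 T, s₀ ≤ (x t).2.1) (h1 : (x 0).1
    ^ 2 < 1) (h2 : slowH (x 0).1 (x 0).2.1 = 1) (h3 : (x 0).2.2.1 * exp ((x 0).2.1 ^ 2) / μ = cos (x
    0).1) (h4 : (x 0).2.2.2 * exp ((x 0).2.1 ^ 2) / μ = 1) : ∀ t ∈ Icc 0 T, x t ∈ trapSet μ s₀ := by
  have hμ0 : 0 < μ := by rw [hμ]; positivity
  set Φ : ℝ → ℝ := fun t => (x t).1 with hΦ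
  set s : ℝ → ℝ := fun t => (x t).2.1 with hs
  set a : ℝ → ℝ := fun t => (x t).2.2.1 with ha
  set c : ℝ → ℝ := fun t => (x t).2.2.2 with hc
  set α : ℝ → ℝ := fun t => a t * exp (s t ^ 2) / μ with hα
  set γ : ℝ → ℝ := fun t => c t * exp (s t ^ 2) / μ with hγ
  have D := fun t => hasDerivAt_components (hx t)
  have dΦ : ∀ t, HasDerivAt Φ (trunc (a t) - trunc (c t)) t := fun t => (D t).1
  have ds : ∀ t, HasDerivAt s (-trunc (c t)) t := fun t => (D t).2.1
  have dH := fun t => hasDerivAt_slowH (dΦ t) (ds t)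
  have dα : ∀ t, HasDerivAt α ((profileField p M lam B₀ (x t)).2.2.1 * exp (s t ^ 2) / μ -
      2 * s t * trunc (c t) * α t) t := fun t => hasDerivAt_normalized (D t).2.2.1 (ds t)
  have dγ : ∀ t, HasDerivAt γ ((profileField p M lam B₀ (x t)).2.2.2 * exp (s t ^ 2) / μ -
      2 * s t * trunc (c t) * γ t) t := fun t => hasDerivAt_normalized (D t).2.2.2 (ds t)
  have key := forall_pos_of_deriv_pos_of_eq_zero (ι := Fin 4) (T := T) (f := ![fun t => 1 - Φ t ^ 2,
    fun t => 1 / 4 - (slowH (Φ t) (s t) - 1) ^ 2, fun t => 1 / 100 - (α t - cos (Φ t)) ^ 2, fun t =>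
    1 / 100 - (γ t - slowH (Φ t) (s t)) ^ 2]) (f' := ![fun t => -(2 * Φ t * (trunc (a t) - trunc (c
    t))), fun t => -(2 * (slowH (Φ t) (s t) - 1) * slowRate (Φ t) (s t) (trunc (a t)) (trunc (c
    t))), fun t => -(2 * (α t - cos (Φ t)) * ((profileField p M lam B₀ (x t)).2.2.1 * exp (s t ^ 2)
    / μ - 2 * s t * trunc (c t) * α t + sin (Φ t) * (trunc (a t) - trunc (c t)))), fun t => -(2 * (γ
    t - slowH (Φ t) (s t)) * ((profileField p M lam B₀ (x t)).2.2.2 * exp (s t ^ 2) / μ - 2 * s t *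
    trunc (c t) * γ t - slowRate (Φ t) (s t) (trunc (a t)) (trunc (c t))))]) ?_ ?_ ?_
  · intro t ht
    have := key t ht
    simp only [Fin.forall_fin_succ, Matrix.cons_val_zero, Matrix.cons_val_succ, sub_pos,
      IsEmpty.forall_iff, and_true] at this
    exact ⟨hsT t ht, ⟨this.1.le, this.2.1.le, this.2.2.1.le, this.2.2.2.le⟩⟩
  · intro i t _
    fin_cases i
    · have := ((dΦ t).pow 2).const_sub 1
      refine this.congr_deriv ?_
      simp
    · have := (((dH t).sub_const 1).pow 2).const_sub (1 / 4)
      refine this.congr_deriv ?_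
      simp
    · have := (((dα t).sub (dΦ t).cos).pow 2).const_sub (1 / 100)
      refine this.congr_deriv ?_
      simp
    · have := (((dγ t).sub (dH t)).pow 2).const_sub (1 / 100)
      refine this.congr_deriv ?_
      simp
  · intro i
    fin_cases i
    · simpa using h1
    · simp [hΦ, hs, h2]
    · simp [hα, hΦ, hs, ha, h3]
    · simp [hγ, hΦ, hs, hc, h4, h2]
  · intro j t ht hnn hj
    have hT : Trapped (Φ t) (s t) (α t) (γ t) := by
      simp only [Fin.forall_fin_succ, Matrix.cons_val_zero, Matrix.cons_val_succ, sub_nonneg,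
        IsEmpty.forall_iff, and_true] at hnn
      exact ⟨hnn.1, hnn.2.1, hnn.2.2.1, hnn.2.2.2⟩
    have hL := hlarge _ (hsT t ht)
    obtain ⟨ha1, hc1, -⟩ := Trapped.abs_le_one hμ0 hL hT
    have hs1 : 1 ≤ s t := by linarith [hL.twelve]
    have haα : a t = μ * exp (-s t ^ 2) * α t := exp_neg_sq_mul_self hμ0
    have hcγ : c t = μ * exp (-s t ^ 2) * γ t := exp_neg_sq_mul_self hμ0
    have hpf : profileField p M lam B₀ (x t) = (a t - c t, -c t, accA p M lam B₀ (Φ t) (s t) (s t)⁻¹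
        (a t) (c t), accC p M lam B₀ (Φ t) (s t) (s t)⁻¹ (a t) (c t)) := profileField_eq hs1 ha1 hc1
    have hE : exp (-s t ^ 2) * exp (s t ^ 2) = 1 := by rw [← exp_add]; simp
    have hMμ : M / 2 = μ * lam := by rw [hμ]; field_simp
    set ρ := friction p M lam B₀ (Φ t) (s t) (s t)⁻¹ (a t) (c t) with hρ
    have heA : accA p M lam B₀ (Φ t) (s t) (s t)⁻¹ (a t) (c t) * exp (s t ^ 2) / μ =
        lam * cos (Φ t) - ρ * α t := by
      unfold accA
      rw [← hρ, hMμ, hα]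
      field_simp
      linear_combination (lam * cos (Φ t) * μ) * hE
    have heC : accC p M lam B₀ (Φ t) (s t) (s t)⁻¹ (a t) (c t) * exp (s t ^ 2) / μ =
        lam * slowH (Φ t) (s t) - 2 * c t * γ t * (s t)⁻¹ - ρ * γ t := by
      unfold accC slowH
      rw [← hρ, hMμ, hγ]
      have : s t ≠ 0 := by positivity
      field_simp
      linear_combination (s t * lam * μ * (2 * sin (Φ t) * s t ^ 5 - cos (Φ t) * s t ^ 4)) * hE
    fin_cases j
    · have hj' : 1 - Φ t ^ 2 = 0 := hj
      exact absurd (by linarith) (hT.phi_ne hL.twelve)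
    · have hj' : 1 / 4 - (slowH (Φ t) (s t) - 1) ^ 2 = 0 := hj
      have := hT.slow_inward hL.twelve (e := μ * exp (-s t ^ 2)) (by positivity) (by linarith)
      rw [← haα, ← hcγ] at this
      simpa [trunc_of_abs_le ha1, trunc_of_abs_le hc1] using this
    · have hj' : 1 / 100 - (α t - cos (Φ t)) ^ 2 = 0 := hj
      have := (hT.inward hL hp hM hB hlam hμ0 haα hcγ hρ).1 (by linarith)
      simp only [Fin.reduceFinMk, Matrix.cons_val, hpf, trunc_of_abs_le ha1, trunc_of_abs_le hc1,
        heA]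
      linarith
    · have hj' : 1 / 100 - (γ t - slowH (Φ t) (s t)) ^ 2 = 0 := hj
      have := (hT.inward hL hp hM hB hlam hμ0 haα hcγ hρ).2 (by linarith)
      simp only [Fin.reduceFinMk, Matrix.cons_val, hpf, trunc_of_abs_le ha1, trunc_of_abs_le hc1,
        heC]
      linarith

/-- Backward orbits of arbitrary length ending at `s = s₀`. -/
lemma exists_long_trapped (hp : 1 < p) (hM : 1 ≤ M) (hB : 2 ≤ B₀) (hlam : 0 < lam)
    (hμ : μ = M / (2 * lam)) (hlarge : ∀ s, s₀ ≤ s → LargeS p M lam μ s) (n : ℕ) :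
    ∃ x : ℝ → ℝ × ℝ × ℝ × ℝ, (∀ t, HasDerivAt x (profileField p M lam B₀ (x t)) t) ∧
      (x 0).2.1 = s₀ ∧ ∀ t ∈ Icc (-(n : ℝ)) 0, x t ∈ trapSet μ s₀ := by
  have hμ0 : 0 < μ := by rw [hμ]; positivity
  have hs12 := (hlarge s₀ le_rfl).twelve
  set s₁ : ℝ := s₀ + n + 1 with hs₁
  have hn : (0 : ℝ) ≤ n := Nat.cast_nonneg n
  have hs₁12 : 12 ≤ s₁ := by linarith
  obtain ⟨Φ₁, hΦ₁, hH₁⟩ : ∃ Φ ∈ Icc (0 : ℝ) 1, slowH Φ s₁ = 1 := by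
    have hc : ContinuousOn (fun Φ => slowH Φ s₁) (Icc 0 1) := by unfold slowH; fun_prop
    refine intermediate_value_Icc zero_le_one hc ⟨?_, ?_⟩
    · have : 0 ≤ s₁ ^ 4 := by positivity
      simp only [slowH, sin_zero, cos_zero]; linarith
    · have h1 := sin_gt_sub_cube (x := 1) one_pos
      have h2 := cos_le_one 1
      have h3 : (1 : ℝ) ≤ s₁ ^ 4 := one_le_pow₀ (by linarith)
      have h4 : 1 ≤ 2 * s₁ * sin 1 - cos 1 := by nlinarith
      simp only [slowH]; nlinarith
  obtain ⟨K, L, hK, hL⟩ := exists_lipschitzWith_profileField (lam := lam) hp hM hB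
  obtain ⟨x, hx0, hx⟩ := exists_global_solution hK hL
    (Φ₁, s₁, μ * exp (-s₁ ^ 2) * cos Φ₁, μ * exp (-s₁ ^ 2) * 1)
  have hE : exp (-s₁ ^ 2) * exp (s₁ ^ 2) = 1 := by rw [← exp_add]; simp
  have htrap : ∀ T : ℝ, (∀ t ∈ Icc 0 T, s₀ ≤ (x t).2.1) → ∀ t ∈ Icc 0 T, x t ∈ trapSet μ s₀ := by
    intro T hT
    refine trapped_forward hp hM hB hlam hμ hlarge hx hT ?_ ?_ ?_ ?_
    · rw [hx0]
      refine lt_of_le_of_ne (by nlinarith [hΦ₁.1, hΦ₁.2]) ?_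
      refine Trapped.phi_ne (s := s₁) (α := cos Φ₁) (γ := 1) ⟨?_, ?_, ?_, ?_⟩ hs₁12
      · nlinarith [hΦ₁.1, hΦ₁.2]
      all_goals simp [hH₁]
    · rw [hx0]; exact hH₁
    · rw [hx0]; field_simp; linear_combination cos Φ₁ * hE
    · rw [hx0]; field_simp; linear_combination hE
  have ds : ∀ t, HasDerivAt (fun t => (x t).2.1) (-trunc (x t).2.2.2) t :=
    fun t => (hasDerivAt_components (hx t)).2.1
  have hcont : Continuous fun t => (x t).2.1 :=
    continuous_iff_continuousAt.2 fun t => (ds t).continuousAt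
  have hne : ∃ t : ℝ, 0 ≤ t ∧ (x t).2.1 ≤ s₀ := by
    by_contra hcon
    push Not at hcon
    have hdec : ∀ t, 0 ≤ t → 0.4 * (μ * exp (-(x t).2.1 ^ 2)) ≤ trunc (x t).2.2.2 := by
      intro t ht
      have hmem := htrap t (fun r hr => (hcon r hr.1).le) t ⟨ht, le_rfl⟩
      obtain ⟨-, h2, h3⟩ := Trapped.abs_le_one hμ0 (hlarge _ hmem.1) hmem.2
      rwa [trunc_of_abs_le h2]
    have hanti : AntitoneOn (fun t => (x t).2.1) (Set.Ici 0) := by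
      refine antitoneOn_of_deriv_nonpos (convex_Ici 0) hcont.continuousOn
        (fun t _ => (ds t).differentiableAt.differentiableWithinAt) fun t ht => ?_
      rw [interior_Ici] at ht
      rw [(ds t).deriv]
      have : 0 ≤ 0.4 * (μ * exp (-(x t).2.1 ^ 2)) := by positivity
      linarith [hdec t (le_of_lt ht)]
    set δ := 0.4 * (μ * exp (-s₁ ^ 2)) with hδ
    have hδ0 : 0 < δ := by positivity
    have hslope : ∀ t, 0 ≤ t → (x t).2.1 - (x 0).2.1 ≤ -δ * (t - 0) := by
      intro t ht
      refine Convex.image_sub_le_mul_sub_of_deriv_le (convex_Ici (0 : ℝ)) hcont.continuousOn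
        (fun t _ => (ds t).differentiableAt.differentiableWithinAt) (fun r hr => ?_) 0
        Set.self_mem_Ici t ht ht
      rw [interior_Ici] at hr
      have hr0 : (0 : ℝ) ≤ r := le_of_lt hr
      rw [(ds r).deriv]
      have h1 : (x r).2.1 ≤ s₁ := by
        have := hanti Set.self_mem_Ici (Set.mem_Ici.2 hr0) hr0
        simpa [hx0] using this
      have h2 := hcon r hr0
      have h3 : exp (-s₁ ^ 2) ≤ exp (-(x r).2.1 ^ 2) :=
        exp_le_exp.2 (by nlinarith)
      have h4 := hdec r hr0
      have h5 : δ ≤ 0.4 * (μ * exp (-(x r).2.1 ^ 2)) := by rw [hδ]; gcongr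
      linarith
    have ht0 : 0 ≤ (n + 1) / δ := by positivity
    have h1 := hslope _ ht0
    have h2 := hcon _ ht0
    rw [hx0] at h1
    have h3 : δ * ((n + 1) / δ) = n + 1 := by field_simp
    simp only at h1
    nlinarith
  set Z : Set ℝ := {t | 0 ≤ t ∧ (x t).2.1 ≤ s₀} with hZ
  have hZc : IsClosed Z := (isClosed_le continuous_const continuous_id).inter
    (isClosed_le hcont continuous_const)
  have hZb : BddBelow Z := ⟨0, fun t ht => ht.1⟩
  set T := sInf Z with hT
  have hTZ : T ∈ Z := hZc.csInf_mem hne hZb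
  have hbefore : ∀ t ∈ Set.Ico 0 T, s₀ < (x t).2.1 := by
    intro t ht
    by_contra hcon
    exact absurd (csInf_le hZb ⟨ht.1, not_lt.1 hcon⟩) (not_le.2 ht.2)
  have hTpos : 0 < T := by
    rcases hTZ.1.eq_or_lt with h | h
    · have := hTZ.2
      rw [← h, hx0] at this
      simp only at this
      linarith
    · exact h
  have hTs : (x T).2.1 = s₀ := by
    refine le_antisymm hTZ.2 ?_
    have hl : Tendsto (fun t => (x t).2.1) (𝓝[<] T) (𝓝 (x T).2.1) :=
      hcont.continuousAt.continuousWithinAt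
    refine ge_of_tendsto hl ?_
    filter_upwards [Ioo_mem_nhdsLT hTpos] with t ht
    exact (hbefore t ⟨ht.1.le, ht.2⟩).le
  have hTn : (n : ℝ) ≤ T := by
    have := Convex.mul_sub_le_image_sub_of_le_deriv (C := -1) convex_univ hcont.continuousOn
      (fun t _ => (ds t).differentiableAt.differentiableWithinAt) (fun r _ => by
        rw [(ds r).deriv]; linarith [(abs_le.1 (abs_trunc_le (x r).2.2.2)).2]) 0 (mem_univ _) T
      (mem_univ _) hTpos.le
    rw [hTs, hx0] at this
    simp only at this
    linarith
  have hall : ∀ t ∈ Icc 0 T, x t ∈ trapSet μ s₀ := by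
    refine htrap T fun t ht => ?_
    rcases ht.2.eq_or_lt with h | h
    · rw [h, hTs]
    · exact (hbefore t ⟨ht.1, h⟩).le
  refine ⟨fun t => x (t + T), fun t => ?_, by simpa using hTs, fun t ht => hall _ ⟨?_, ?_⟩⟩
  · simpa using (hx (t + T)).comp_add_const t T
  · linarith [ht.1]
  · linarith [ht.2]

/-- The spiral: a solution on `(-∞, 0]` that stays in the trapping region. -/
theorem exists_spiral (hp : 1 < p) (hM : 1 ≤ M) (hB : 2 ≤ B₀) (hlam : 0 < lam) (hμ : μ = M / (2 *
    lam)) (hlarge : ∀ s, s₀ ≤ s → LargeS p M lam μ s) : ∃ Φ s a c : ℝ → ℝ, ∀ t ≤ 0, s₀ ≤ s t ∧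
    Trapped (Φ t) (s t) (a t * exp (s t ^ 2) / μ) (c t * exp (s t ^ 2) / μ) ∧ HasDerivAt Φ (a t - c
    t) t ∧ HasDerivAt s (-c t) t ∧ HasDerivAt a (accA p M lam B₀ (Φ t) (s t) (s t)⁻¹ (a t) (c t)) t
    ∧ HasDerivAt c (accC p M lam B₀ (Φ t) (s t) (s t)⁻¹ (a t) (c t)) t := by
  have hμ0 : 0 < μ := by rw [hμ]; positivity
  obtain ⟨K, L, hK, hL⟩ := exists_lipschitzWith_profileField (lam := lam) hp hM hB
  obtain ⟨x, hx, -, hxS⟩ := exists_ancient_solution hK hL (isClosed_trapSet μ s₀) (P := Icc (-1 : ℝ)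
    1 ×ˢ ({s₀} ×ˢ (Icc (-1 : ℝ) 1 ×ˢ Icc (-1 : ℝ) 1))) (isCompact_Icc.prod (isCompact_singleton.prod
    (isCompact_Icc.prod isCompact_Icc))) (fun n => by
      obtain ⟨x, h1, h2, h3⟩ := exists_long_trapped hp hM hB hlam hμ hlarge n
      refine ⟨x, h1, ?_, h3⟩
      have h4 := h3 0 ⟨by simp, le_rfl⟩
      obtain ⟨h5, h6, -⟩ := Trapped.abs_le_one hμ0 (hlarge _ h4.1) h4.2
      refine ⟨abs_le.1 (abs_le_one_iff_mul_self_le_one.2 (by nlinarith [h4.2.phi])), h2,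
        abs_le.1 h5, abs_le.1 h6⟩)
  refine ⟨fun t => (x t).1, fun t => (x t).2.1, fun t => (x t).2.2.1, fun t => (x t).2.2.2,
    fun t ht => ?_⟩
  have hmem := hxS t ht
  have hl := hlarge _ hmem.1
  obtain ⟨h5, h6, -⟩ := Trapped.abs_le_one hμ0 hl hmem.2
  have hD := hasDerivAt_components (hx t)
  have he : profileField p M lam B₀ (x t) = _ := profileField_eq (p := p) (M := M) (lam := lam)
    (B₀ := B₀) (Φ := (x t).1) (by linarith [hl.twelve]) h5 h6
  rw [he] at hD
  exact ⟨hmem.1, hmem.2, hD⟩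

end Spiral

/-! ### The potential in the universal cover -/

section Potential

/-- `V` as a function on the plane. -/
def Vr (θ y : ℝ) : ℝ := V (θ : Real.Angle) y

/-- `∂V/∂θ`. -/
def Vθ (θ y : ℝ) : ℝ :=
  if y = 0 then 0 else -exp (-(1 / y ^ 2)) * cos (θ + 1 / y)

/-- `∂V/∂y`. -/
def Vy (θ y : ℝ) : ℝ :=
  if y = 0 then 0 else -exp (-(1 / y ^ 2)) * (2 * (1 / y) ^ 3 * sin (θ + 1 / y) - (1 / y) ^ 2 * cos
    (θ + 1 / y))

lemma Vr_of_ne {θ y : ℝ} (hy : y ≠ 0) : Vr θ y = -exp (-(1 / y ^ 2)) * sin (θ + 1 / y) := by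
  rw [Vr, V, if_neg hy, ← Real.Angle.coe_add, Real.Angle.sin_coe]

lemma Vr_zero (θ : ℝ) : Vr θ 0 = 0 := by simp [Vr, V]

lemma Vθ_of_ne {θ y : ℝ} (hy : y ≠ 0) :
    Vθ θ y = -exp (-(1 / y ^ 2)) * cos (θ + 1 / y) := by rw [Vθ, if_neg hy]

lemma Vy_of_ne {θ y : ℝ} (hy : y ≠ 0) : Vy θ y = -exp (-(1 / y ^ 2)) * (2 * (1 / y) ^ 3 * sin (θ + 1
    / y) - (1 / y) ^ 2 * cos (θ + 1 / y)) := by rw [Vy, if_neg hy]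

/-- `x^k e^{-x²}` decays faster than any power. -/
lemma exp_neg_mul_pow_le {x : ℝ} (hx : 0 < x) (k : ℕ) : exp (-x) ≤ k.factorial / x ^ k := by
  have h := pow_div_factorial_le_exp x hx.le k
  rw [exp_neg, inv_eq_one_div, div_le_div_iff₀ (exp_pos _) (by positivity), one_mul]
  rw [div_le_iff₀ (by positivity)] at h
  linarith

lemma exp_neg_inv_sq_le {y : ℝ} (hy : y ≠ 0) (k : ℕ) :
    exp (-(1 / y ^ 2)) ≤ k.factorial * (y ^ 2) ^ k := by
  have := exp_neg_mul_pow_le (x := 1 / y ^ 2) (by positivity) k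
  rwa [div_pow, one_pow, div_div_eq_mul_div, div_one] at this

lemma abs_Vr_le_exp {θ y : ℝ} (hy : y ≠ 0) : |Vr θ y| ≤ exp (-(1 / y ^ 2)) := by
  rw [Vr_of_ne hy, abs_mul, abs_neg, abs_of_pos (exp_pos _)]
  exact mul_le_of_le_one_right (exp_pos _).le (abs_sin_le_one _)

lemma abs_Vr_le_one (θ y : ℝ) : |Vr θ y| ≤ 1 := by
  by_cases hy : y = 0
  · simp [hy, Vr_zero]
  · exact (abs_Vr_le_exp hy).trans (exp_le_one_iff.2 (by simp; positivity))

lemma abs_V_le_one (θ : Real.Angle) (y : ℝ) : |V θ y| ≤ 1 := by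
  induction θ using Real.Angle.induction_on
  exact abs_Vr_le_one _ y

lemma abs_Vr_le_sq (θ y : ℝ) : |Vr θ y| ≤ y ^ 2 := by
  by_cases hy : y = 0
  · simp [hy, Vr_zero]
  · refine (abs_Vr_le_exp hy).trans ?_
    simpa using exp_neg_inv_sq_le hy 1

lemma abs_Vθ_le_exp {θ y : ℝ} (hy : y ≠ 0) : |Vθ θ y| ≤ exp (-(1 / y ^ 2)) := by
  rw [Vθ_of_ne hy, abs_mul, abs_neg, abs_of_pos (exp_pos _)]
  exact mul_le_of_le_one_right (exp_pos _).le (abs_cos_le_one _)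

lemma abs_Vθ_le (θ y : ℝ) : |Vθ θ y| ≤ y ^ 2 := by
  by_cases hy : y = 0
  · simp [hy, Vθ]
  · simpa using (abs_Vθ_le_exp hy).trans (exp_neg_inv_sq_le hy 1)

lemma abs_Vθ_le_one (θ y : ℝ) : |Vθ θ y| ≤ 1 := by
  by_cases hy : y = 0
  · simp [hy, Vθ]
  · exact (abs_Vθ_le_exp hy).trans (exp_le_one_iff.2 (by simp; positivity))

lemma abs_Vy_le_exp {θ y : ℝ} (hy : y ≠ 0) :
    |Vy θ y| ≤ exp (-(1 / y ^ 2)) * (2 * |1 / y| ^ 3 + |1 / y| ^ 2) := by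
  rw [Vy_of_ne hy, abs_mul, abs_neg, abs_of_pos (exp_pos _)]
  gcongr
  refine (abs_sub _ _).trans (add_le_add ?_ ?_)
  · rw [abs_mul, abs_mul, abs_pow, abs_of_pos (by norm_num : (0 : ℝ) < 2)]
    exact mul_le_of_le_one_right (by positivity) (abs_sin_le_one _)
  · rw [abs_mul, abs_pow]
    exact mul_le_of_le_one_right (by positivity) (abs_cos_le_one _)

lemma abs_Vy_le (θ y : ℝ) : |Vy θ y| ≤ 16 * |y| := by
  by_cases hy : y = 0
  · simp [hy, Vy]
  · have hy0 : 0 < |y| := abs_pos.2 hy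
    refine (abs_Vy_le_exp hy).trans ?_
    have h1 := exp_neg_inv_sq_le hy 1
    have h2 := exp_neg_inv_sq_le hy 2
    rw [← sq_abs y] at h1 h2 ⊢
    rw [abs_div, abs_one]
    set r := |y|
    set e := exp (-(1 / r ^ 2))
    have he : 0 < e := exp_pos _
    norm_num [Nat.factorial] at h1 h2
    have e1 : e * (2 * (1 / r) ^ 3) ≤ 4 * r := by
      rw [one_div, inv_pow, ← div_eq_mul_inv, ← mul_div_assoc, div_le_iff₀ (by positivity)]
      nlinarith
    have e2 : e * (1 / r) ^ 2 ≤ 12 * r := by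
      have h3 : e ≤ 12 * r ^ 3 := by
        rcases le_or_gt r 1 with h | h
        · have : (r ^ 2) ^ 2 ≤ r ^ 3 := by
            rw [← pow_mul]; exact pow_le_pow_of_le_one hy0.le h (by norm_num)
          nlinarith [pow_pos hy0 3]
        · have : r ^ 2 ≤ r ^ 3 := pow_le_pow_right₀ h.le (by norm_num)
          nlinarith [pow_pos hy0 3]
      rw [one_div, inv_pow, ← div_eq_mul_inv, div_le_iff₀ (by positivity)]
      nlinarith
    rw [mul_add]
    linarith

lemma abs_Vy_le_const (θ y : ℝ) : |Vy θ y| ≤ 16 := by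
  rcases le_or_gt |y| 1 with h | h
  · exact (abs_Vy_le θ y).trans (by linarith)
  · have hy : y ≠ 0 := fun h0 => by simp [h0] at h; linarith
    refine (abs_Vy_le_exp hy).trans ?_
    have h1 : exp (-(1 / y ^ 2)) ≤ 1 := exp_le_one_iff.2 (by simp; positivity)
    have h2 : |1 / y| ≤ 1 := by rw [abs_div, abs_one, div_le_one (by linarith)]; exact h.le
    have h3 : 2 * |1 / y| ^ 3 + |1 / y| ^ 2 ≤ 2 * 1 ^ 3 + 1 ^ 2 := by gcongr
    exact (mul_le_mul h1 h3 (by positivity) zero_le_one).trans (by norm_num)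

lemma hasDerivAt_exp_neg_inv_sq {y : ℝ} (hy : y ≠ 0) : HasDerivAt (fun y : ℝ => exp (-(1 / y ^ 2)))
    (exp (-(1 / y ^ 2)) * (2 * (1 / y) ^ 3)) y := by
  have h : HasDerivAt (fun y : ℝ => -(1 / y ^ 2)) (2 * (1 / y) ^ 3) y := by
    have := ((hasDerivAt_pow 2 y).fun_inv (by positivity)).neg
    refine (this.congr_of_eventuallyEq (Eventually.of_forall fun z => by simp)).congr_deriv ?_
    field_simp
    push_cast
    ring
  exact h.exp

/-- `V` is continuously differentiable on the whole plane. -/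
lemma hasFDerivAt_Vr (θ y : ℝ) : HasFDerivAt (fun z : ℝ × ℝ => Vr z.1 z.2) (Vθ θ y • fst ℝ ℝ ℝ + Vy
    θ y • snd ℝ ℝ ℝ) (θ, y) := by
  by_cases hy : y = 0
  · subst hy
    simp only [Vθ, Vy, if_true, zero_smul, add_zero]
    refine HasFDerivAt.of_isLittleO ?_
    have hO : (fun z : ℝ × ℝ => Vr z.1 z.2 - Vr θ 0 -
        (0 : ℝ × ℝ →L[ℝ] ℝ) (z - (θ, 0))) =O[𝓝 (θ, 0)] fun z => ‖z - (θ, 0)‖ ^ 2 := by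
      refine Asymptotics.IsBigO.of_bound 1 (Eventually.of_forall fun z => ?_)
      rw [Vr_zero, zero_apply, sub_zero, sub_zero, one_mul, norm_pow, norm_norm, norm_eq_abs]
      refine (abs_Vr_le_sq _ _).trans ?_
      have h := norm_snd_le (z - (θ, (0 : ℝ)))
      rw [Prod.snd_sub, sub_zero, norm_eq_abs] at h
      rw [← sq_abs]
      gcongr
    exact hO.trans_isLittleO (Asymptotics.isLittleO_pow_sub_sub (θ, (0 : ℝ)) one_lt_two)
  · have hE : HasFDerivAt (fun z : ℝ × ℝ => exp (-(1 / z.2 ^ 2)))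
        ((exp (-(1 / y ^ 2)) * (2 * (1 / y) ^ 3)) • snd ℝ ℝ ℝ) (θ, y) :=
      HasDerivAt.comp_hasFDerivAt (f := Prod.snd) (θ, y) (hasDerivAt_exp_neg_inv_sq hy)
        hasFDerivAt_snd
    have hI : HasFDerivAt (fun z : ℝ × ℝ => 1 / z.2) ((-(1 / y) ^ 2) • snd ℝ ℝ ℝ) (θ, y) := by
      have h : HasDerivAt (fun y : ℝ => 1 / y) (-(1 / y) ^ 2) y := by
        have := hasDerivAt_inv hy
        simpa [one_div] using this
      exact HasDerivAt.comp_hasFDerivAt (f := Prod.snd) (θ, y) h hasFDerivAt_snd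
    have hS := ((hasFDerivAt_fst (𝕜 := ℝ) (p := (θ, y))).add hI).sin
    have hev : (fun z : ℝ × ℝ => Vr z.1 z.2) =ᶠ[𝓝 (θ, y)]
        fun z => -(exp (-(1 / z.2 ^ 2)) * sin (z.1 + 1 / z.2)) := by
      have : ∀ᶠ z : ℝ × ℝ in 𝓝 (θ, y), z.2 ≠ 0 :=
        continuous_snd.continuousAt.eventually_ne hy
      filter_upwards [this] with z hz
      rw [Vr_of_ne hz]; ring
    refine ((hE.mul hS).neg.congr_of_eventuallyEq hev).congr_fderiv ?_
    rw [Vθ_of_ne hy, Vy_of_ne hy]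
    ext
    · simp
    · simp
      ring

lemma continuous_Vr : Continuous fun z : ℝ × ℝ => Vr z.1 z.2 :=
  continuous_iff_continuousAt.2 fun z => (hasFDerivAt_Vr z.1 z.2).continuousAt

/-- Chain rule for `V` along a curve. -/
lemma HasDerivAt.Vr {f g : ℝ → ℝ} {f' g' t : ℝ} (hf : HasDerivAt f f' t) (hg : HasDerivAt g g' t) :
    HasDerivAt (fun t => Vr (f t) (g t)) (Vθ (f t) (g t) * f' + Vy (f t) (g t) * g') t := by
  have := (hasFDerivAt_Vr (f t) (g t)).comp_hasDerivAt t (hf.prodMk hg)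
  simpa [Function.comp_def] using this

end Potential

section Comparison

lemma exp_neg_inv_sq_le_pow_six {y : ℝ} (hy : y ≠ 0) : exp (-(1 / y ^ 2)) ≤ 6 * y ^ 6 := by
  have := exp_neg_inv_sq_le hy 3
  rw [← pow_mul] at this
  simpa [Nat.factorial] using this

lemma small_V {θ y : ℝ} (hy : 0 < y) (hy1 : y ≤ 1) :
    |Vr θ y| ≤ 6 * y ^ 6 ∧ |Vθ θ y| ≤ 6 * y ^ 6 ∧ |Vy θ y| ≤ 18 * y ^ 3 := by
  have he := exp_neg_inv_sq_le_pow_six hy.ne'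
  have he0 := exp_pos (-(1 / y ^ 2))
  refine ⟨(abs_Vr_le_exp hy.ne').trans he, ?_, ?_⟩
  · rw [Vθ_of_ne hy.ne', abs_mul, abs_neg, abs_of_pos he0]
    exact (mul_le_of_le_one_right he0.le (abs_cos_le_one _)).trans he
  · refine (abs_Vy_le_exp hy.ne').trans ?_
    have h1 : 1 ≤ 1 / y := by rw [le_div_iff₀ hy]; linarith
    rw [abs_of_pos (by positivity : 0 < 1 / y)]
    have h2 : (1 / y) ^ 2 ≤ (1 / y) ^ 3 := pow_le_pow_right₀ h1 (by norm_num)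
    calc _ ≤ 6 * y ^ 6 * (2 * (1 / y) ^ 3 + (1 / y) ^ 3) := by gcongr
      _ = 18 * y ^ 3 := by field_simp; norm_num

/-- `V` in the direction of the circle, to second order. -/
lemma Vr_shift (θ ϑ y : ℝ) : Vr (θ + ϑ) y - Vr θ y - Vθ θ y * sin ϑ = -Vr θ y * (1 - cos ϑ) := by
  by_cases hy : y = 0
  · simp [hy, Vr_zero, Vθ]
  · rw [Vr_of_ne hy, Vr_of_ne hy, Vθ_of_ne hy, show θ + ϑ + 1 / y = (θ + 1 / y) + ϑ by ring,
      sin_add]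
    ring

lemma abs_Vy_shift {θ y : ℝ} (ϑ : ℝ) (hy : 0 < y) (hy1 : y ≤ 1) :
    |Vy (θ + ϑ) y - Vy θ y| ≤ 18 * y ^ 3 * (|sin ϑ| + (1 - cos ϑ)) := by
  have h1 := (small_V (θ := θ + π / 2) hy hy1).2.2
  have h2 := (small_V (θ := θ) hy hy1).2.2
  have hc : 0 ≤ 1 - cos ϑ := by linarith [cos_le_one ϑ]
  have e : Vy (θ + ϑ) y - Vy θ y = Vy (θ + π / 2) y * sin ϑ - Vy θ y * (1 - cos ϑ) := by
    have a1 : θ + ϑ + 1 / y = (θ + 1 / y) + ϑ := by ring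
    have a2 : θ + π / 2 + 1 / y = (θ + 1 / y) + π / 2 := by ring
    rw [Vy_of_ne hy.ne', Vy_of_ne hy.ne', Vy_of_ne hy.ne', a1, a2, sin_add (θ + 1 / y) ϑ,
      cos_add (θ + 1 / y) ϑ, sin_add_pi_div_two, cos_add_pi_div_two]
    ring
  rw [e, mul_add]
  refine (abs_sub _ _).trans (add_le_add ?_ ?_)
  · rw [abs_mul]; gcongr
  · rw [abs_mul, abs_of_nonneg hc]; gcongr

/-- `∂²V/∂y²`. -/
def Vyy (θ y : ℝ) : ℝ :=
  -exp (-(1 / y ^ 2)) * ((4 * (1 / y) ^ 6 - 7 * (1 / y) ^ 4) * sin (θ + 1 / y) +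
    (2 * (1 / y) ^ 3 - 4 * (1 / y) ^ 5) * cos (θ + 1 / y))

lemma hasDerivAt_Vy (θ : ℝ) {y : ℝ} (hy : 0 < y) : HasDerivAt (Vy θ) (Vyy θ y) y := by
  have hI : HasDerivAt (fun y : ℝ => 1 / y) (-(1 / y) ^ 2) y := by
    have := hasDerivAt_inv hy.ne'
    simpa [one_div] using this
  have hΨ := hI.const_add θ
  have h := (hasDerivAt_exp_neg_inv_sq hy.ne').neg.mul
    ((((hI.pow 3).const_mul 2).mul hΨ.sin).sub ((hI.pow 2).mul hΨ.cos))
  have hev : Vy θ =ᶠ[𝓝 y] fun y => -exp (-(1 / y ^ 2)) *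
      (2 * (1 / y) ^ 3 * sin (θ + 1 / y) - (1 / y) ^ 2 * cos (θ + 1 / y)) := by
    filter_upwards [eventually_ne_nhds hy.ne'] with z hz
    rw [Vy_of_ne hz]
  refine HasDerivAt.congr_deriv (h.congr_of_eventuallyEq hev) ?_
  simp only [Pi.pow_apply, Pi.mul_apply, Pi.sub_apply, Pi.neg_apply, Vyy]
  push_cast
  ring

lemma abs_Vyy_le {θ y : ℝ} (hy : 0 < y) (hy1 : y ≤ 1) : |Vyy θ y| ≤ 408 * y ^ 2 := by
  have he : exp (-(1 / y ^ 2)) ≤ 24 * y ^ 8 := by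
    have := exp_neg_inv_sq_le hy.ne' 4
    rw [← pow_mul] at this
    simpa [Nat.factorial] using this
  have h1 : 1 ≤ 1 / y := by rw [le_div_iff₀ hy]; linarith
  have p3 : (1 / y) ^ 3 ≤ (1 / y) ^ 6 := pow_le_pow_right₀ h1 (by norm_num)
  have p4 : (1 / y) ^ 4 ≤ (1 / y) ^ 6 := pow_le_pow_right₀ h1 (by norm_num)
  have p5 : (1 / y) ^ 5 ≤ (1 / y) ^ 6 := pow_le_pow_right₀ h1 (by norm_num)
  have q3 : 0 < (1 / y) ^ 3 := by positivity
  have q4 : 0 < (1 / y) ^ 4 := by positivity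
  have q5 : 0 < (1 / y) ^ 5 := by positivity
  have b1 : |(4 * (1 / y) ^ 6 - 7 * (1 / y) ^ 4) * sin (θ + 1 / y)| ≤ 11 * (1 / y) ^ 6 := by
    rw [abs_mul]
    refine (mul_le_of_le_one_right (abs_nonneg _) (abs_sin_le_one _)).trans ?_
    rw [abs_le]; constructor <;> linarith
  have b2 : |(2 * (1 / y) ^ 3 - 4 * (1 / y) ^ 5) * cos (θ + 1 / y)| ≤ 6 * (1 / y) ^ 6 := by
    rw [abs_mul]
    refine (mul_le_of_le_one_right (abs_nonneg _) (abs_cos_le_one _)).trans ?_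
    rw [abs_le]; constructor <;> linarith
  rw [Vyy, abs_mul, abs_neg, abs_of_pos (exp_pos _)]
  calc _ ≤ 24 * y ^ 8 * (11 * (1 / y) ^ 6 + 6 * (1 / y) ^ 6) := by
        gcongr
        exact (abs_add_le _ _).trans (add_le_add b1 b2)
    _ = 408 * y ^ 2 := by field_simp; norm_num

lemma hasDerivAt_Vr_right (θ y : ℝ) : HasDerivAt (Vr θ) (Vy θ y) y := by
  simpa using HasDerivAt.Vr (hasDerivAt_const y θ) (hasDerivAt_id y)

lemma Vr_taylor {θ y k : ℝ} (hy : 0 < y) (hy1 : y ≤ 1 / 2) (hk : |k| ≤ y / 2) :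
    |Vr θ (y + k) - Vr θ y - Vy θ y * k| ≤ 918 * y ^ 2 * k ^ 2 := by
  have hmem : ∀ ξ ∈ Icc (y - |k|) (y + |k|), |Vy θ ξ - Vy θ y| ≤ 918 * y ^ 2 * |k| := by
    intro ξ hξ
    have hd : ∀ x ∈ Icc (y - |k|) (y + |k|),
        HasDerivWithinAt (Vy θ) (Vyy θ x) (Icc (y - |k|) (y + |k|)) x := fun x hx =>
      (hasDerivAt_Vy θ (by linarith [hx.1])).hasDerivWithinAt
    have hb : ∀ x ∈ Icc (y - |k|) (y + |k|), ‖Vyy θ x‖ ≤ 918 * y ^ 2 := by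
      intro x hx
      have hx0 : 0 < x := by linarith [hx.1]
      have hx1 : x ≤ 3 / 2 * y := by linarith [hx.2]
      refine (abs_Vyy_le hx0 (by linarith)).trans ?_
      nlinarith
    have := Convex.norm_image_sub_le_of_norm_hasDerivWithin_le hd hb (convex_Icc _ _)
      (x := y) (y := ξ) ⟨by linarith [abs_nonneg k], by linarith [abs_nonneg k]⟩ hξ
    rw [norm_eq_abs, norm_eq_abs] at this
    refine this.trans (mul_le_mul_of_nonneg_left ?_ (by positivity))
    rw [abs_le]; constructor <;> linarith [hξ.1, hξ.2]
  have hd : ∀ x ∈ Icc (y - |k|) (y + |k|), HasDerivWithinAt (fun x => Vr θ x - Vy θ y * x) (Vy θ x -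
      Vy θ y) (Icc (y - |k|) (y + |k|)) x := fun x _ =>
    (HasDerivAt.congr_deriv (f := fun x => Vr θ x - Vy θ y * x) ((hasDerivAt_Vr_right θ x).sub
      ((hasDerivAt_id x).const_mul (Vy θ y))) (by simp)).hasDerivWithinAt
  have := Convex.norm_image_sub_le_of_norm_hasDerivWithin_le hd hmem (convex_Icc _ _)
    (x := y) (y := y + k) ⟨by linarith [abs_nonneg k], by linarith [abs_nonneg k]⟩
    ⟨by linarith [neg_abs_le k], by linarith [le_abs_self k]⟩
  rw [norm_eq_abs, norm_eq_abs, add_sub_cancel_left] at this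
  calc _ = |Vr θ (y + k) - Vy θ y * (y + k) - (Vr θ y - Vy θ y * y)| := by ring_nf
    _ ≤ 918 * y ^ 2 * |k| * |k| := this
    _ = 918 * y ^ 2 * k ^ 2 := by rw [← sq_abs k]; ring

lemma exp_neg_inv_sq_le_frac (y : ℝ) (hy : y ≠ 0) :
    exp (-(1 / y ^ 2)) ≤ 0.62 * (y ^ 2 / (1 + y ^ 2 / 2)) := by
  set x := 1 / y ^ 2 with hx
  have hx0 : 0 < x := by positivity
  have h1 : (1.625 : ℝ) ≤ exp (1 / 2) := by
    have := quadratic_le_exp_of_nonneg (x := 1 / 2) (by norm_num)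
    linarith
  have h2 := add_one_le_exp (x - 1 / 2)
  have h3 : exp x = exp (1 / 2) * exp (x - 1 / 2) := by rw [← exp_add]; ring_nf
  have h4 : 1.625 * (x + 1 / 2) ≤ exp x := by
    rw [h3]
    exact mul_le_mul h1 (by linarith) (by positivity) (by positivity)
  have h5 : y ^ 2 / (1 + y ^ 2 / 2) = 1 / (x + 1 / 2) := by rw [hx]; field_simp
  rw [h5, exp_neg, inv_eq_one_div, ← mul_div_assoc, div_le_div_iff₀ (exp_pos _) (by positivity)]
  linarith

/-- The quantities compared in `Vr_comparison` and their elementary relations. -/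
structure CompData (β θ y ϑ k X z : ℝ) : Prop where
  hβ : 2 ≤ β
  hy : 0 < y
  hyβ : y * (10000 * (1 + β)) ≤ 1
  hX : X = 2 * (1 - cos ϑ) + k ^ 2
  hz0 : 0 < z
  hz1 : z ≤ 1
  hzid : z + z * X / β = 1

namespace CompData

variable {β θ y ϑ k X z : ℝ} (h : CompData β θ y ϑ k X z)
include h

lemma y_le : y ≤ 1 / 30000 := by nlinarith [h.hβ, h.hy, h.hyβ]

lemma one_sub_cos : 0 ≤ 1 - cos ϑ := by linarith [cos_le_one ϑ]

lemma sq_le : k ^ 2 ≤ X := by rw [h.hX]; linarith [h.one_sub_cos]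

lemma X_nonneg : 0 ≤ X := (sq_nonneg k).trans h.sq_le

lemma sin_mul_le : |sin ϑ| * |k| ≤ X := by
  have h1 := sin_sq_add_cos_sq ϑ
  have h2 : sin ϑ ^ 2 ≤ 2 * (1 - cos ϑ) := by nlinarith [sq_nonneg (1 - cos ϑ)]
  rw [h.hX]
  nlinarith [sq_abs (sin ϑ), sq_abs k, sq_nonneg (|sin ϑ| - |k|)]

lemma linear_le : |Vθ θ y * sin ϑ + Vy θ y * k| ≤ 6 * y ^ 6 * |sin ϑ| + 18 * y ^ 3 * |k| := by
  obtain ⟨-, hVθ, hVy⟩ := small_V (θ := θ) h.hy (by linarith [h.y_le])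
  refine (abs_add_le _ _).trans ?_
  rw [abs_mul, abs_mul]; gcongr

lemma z_ge (hk : |k| ≤ 1) : 2 / 7 ≤ z := by
  have hX5 : X ≤ 5 := by
    have : k ^ 2 ≤ 1 := by rw [← sq_abs]; exact pow_le_one₀ (abs_nonneg k) hk
    rw [h.hX]; linarith [neg_one_le_cos ϑ]
  have h0 := h.hz0
  have h1 : z * X / β ≤ z * 5 / 2 := by
    have := h.X_nonneg
    have := h.hβ
    gcongr
  linarith [h.hzid]

lemma le_of_small (hk : |k| ≤ y / 2) : Vr (θ + ϑ) (y + k) - Vr θ y - z ^ 2 * (Vθ θ y * sin ϑ + Vy θ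
    y * k) ≤ 9 / 10 * (z * X) := by
  have hy := h.hy
  have hyt := h.y_le
  have hX0 := h.X_nonneg
  have hz0 := h.hz0
  have hz1 := h.hz1
  have hβ := h.hβ
  have hc1 := h.one_sub_cos
  have hcX : 1 - cos ϑ ≤ X := by rw [h.hX]; linarith [sq_nonneg k]
  have hk1 : |k| ≤ 1 := by linarith
  have hzl := h.z_ge hk1
  have hV := (small_V (θ := θ) hy (by linarith)).1
  have hlin' := abs_le.1 h.linear_le
  set Λ := Vθ θ y * sin ϑ + Vy θ y * k with hΛ
  have hT := (abs_le.1 (Vr_taylor (θ := θ + ϑ) hy (by linarith) hk)).2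
  have hyc : y ^ 3 ≤ (1 / 30000) ^ 3 := by gcongr
  have hy6 : y ^ 6 ≤ y ^ 3 := pow_le_pow_of_le_one hy.le (by linarith) (by norm_num)
  have hsk : (Vy (θ + ϑ) y - Vy θ y) * k ≤ 36 * y ^ 3 * X := by
    have h1 : |(Vy (θ + ϑ) y - Vy θ y) * k| ≤ 18 * y ^ 3 * (|sin ϑ| + (1 - cos ϑ)) * |k| := by
      rw [abs_mul]; gcongr; exact abs_Vy_shift ϑ hy (by linarith)
    have h2 : (|sin ϑ| + (1 - cos ϑ)) * |k| ≤ 2 * X := by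
      have h3 : (1 - cos ϑ) * |k| ≤ (1 - cos ϑ) * 1 := by gcongr
      linarith [h.sin_mul_le]
    have h3 : 18 * y ^ 3 * ((|sin ϑ| + (1 - cos ϑ)) * |k|) ≤ 18 * y ^ 3 * (2 * X) := by gcongr
    linarith [(abs_le.1 h1).2]
  have hVc : -Vr θ y * (1 - cos ϑ) ≤ 6 * y ^ 6 * X := by
    have h1 : -Vr θ y ≤ 6 * y ^ 6 := by linarith [(abs_le.1 hV).1]
    calc _ ≤ 6 * y ^ 6 * (1 - cos ϑ) := by gcongr
      _ ≤ _ := by gcongr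
  have hrest : (1 - z ^ 2) * Λ ≤ (1 / 100) * (z * X) := by
    have h1 : 1 - z ^ 2 ≤ z * X := by
      have h2 : z * X / β ≤ z * X / 2 := by gcongr
      nlinarith [h.hzid, mul_nonneg hz0.le hX0]
    have h2 : Λ ≤ 1 / 100 := by
      have e1 : 6 * y ^ 6 * |sin ϑ| ≤ 6 * y ^ 6 * 1 := by gcongr; exact abs_sin_le_one ϑ
      have e2 : 18 * y ^ 3 * |k| ≤ 18 * y ^ 3 * 1 := by gcongr
      norm_num at hyc
      linarith [hlin'.2]
    have h3 : 0 ≤ 1 - z ^ 2 := by nlinarith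
    calc _ ≤ (1 - z ^ 2) * (1 / 100) := by gcongr
      _ ≤ z * X * (1 / 100) := by gcongr
      _ = _ := by ring
  have hsplit : Vr (θ + ϑ) (y + k) - Vr θ y - z ^ 2 * Λ =
      (Vr (θ + ϑ) (y + k) - Vr (θ + ϑ) y - Vy (θ + ϑ) y * k) + (Vy (θ + ϑ) y - Vy θ y) * k +
      (Vr (θ + ϑ) y - Vr θ y - Vθ θ y * sin ϑ) + (1 - z ^ 2) * Λ := by rw [hΛ]; ring
  rw [hsplit, Vr_shift]
  have hy2 : y ^ 2 ≤ (1 / 30000) ^ 2 := by gcongr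
  have hk2 : 918 * y ^ 2 * k ^ 2 ≤ 918 * (1 / 30000) ^ 2 * X := by gcongr; exact h.sq_le
  have ha : 36 * y ^ 3 * X ≤ 36 * (1 / 30000) ^ 3 * X := by gcongr
  have hb : 6 * y ^ 6 * X ≤ 6 * (1 / 30000) ^ 3 * X := by gcongr; exact hy6.trans hyc
  have hzX : 2 / 7 * X ≤ z * X := by gcongr
  norm_num at hk2 ha hb
  linarith

lemma far_bounds (θ : ℝ) : Vr (θ + ϑ) (y + k) ≤ 0.62 * ((y + k) ^ 2 / (1 + (y + k) ^ 2 / 2)) ∧ Vr (θ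
    + ϑ) (y + k) ≤ 2 * (y + k) ^ 4 ∧ -Vr θ y ≤ 6 * y ^ 6 ∧ -(z ^ 2 * (Vθ θ y * sin ϑ + Vy θ y * k))
    ≤ z * (6 * y ^ 6 * |sin ϑ| + 18 * y ^ 3 * |k|) := by
  have h' : CompData β θ y ϑ k X z := ⟨h.hβ, h.hy, h.hyβ, h.hX, h.hz0, h.hz1, h.hzid⟩
  have hy := h.hy
  have hz0 := h.hz0
  have hV := (small_V (θ := θ) hy (by linarith [h.y_le])).1
  have hVw : Vr (θ + ϑ) (y + k) ≤ 0.62 * ((y + k) ^ 2 / (1 + (y + k) ^ 2 / 2)) ∧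
      Vr (θ + ϑ) (y + k) ≤ 2 * (y + k) ^ 4 := by
    by_cases h0 : y + k = 0
    · rw [h0, Vr_zero]; norm_num
    · have h1 := (le_abs_self _).trans (abs_Vr_le_exp (θ := θ + ϑ) h0)
      have h2 := exp_neg_inv_sq_le h0 2
      rw [← pow_mul] at h2
      refine ⟨h1.trans (exp_neg_inv_sq_le_frac _ h0), h1.trans ?_⟩
      simpa [Nat.factorial] using h2
  refine ⟨hVw.1, hVw.2, by linarith [(abs_le.1 hV).1], ?_⟩
  have hz2 : z ^ 2 ≤ z := by nlinarith [h.hz1]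
  have h1 : |z ^ 2 * (Vθ θ y * sin ϑ + Vy θ y * k)| ≤
      z * (6 * y ^ 6 * |sin ϑ| + 18 * y ^ 3 * |k|) := by
    rw [abs_mul, abs_of_pos (by positivity : 0 < z ^ 2)]
    exact mul_le_mul hz2 h'.linear_le (abs_nonneg _) hz0.le
  linarith [(abs_le.1 h1).1]

lemma le_of_medium (hk : y / 2 < |k|) (hks : |k| ≤ 1 / 100) : Vr (θ + ϑ) (y + k) - Vr θ y - z ^ 2 *
    (Vθ θ y * sin ϑ + Vy θ y * k) ≤ 9 / 10 * (z * X) := by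
  obtain ⟨-, hVw, hV', hzΛ⟩ := h.far_bounds θ
  have hy := h.hy
  have hyt := h.y_le
  have hX0 := h.X_nonneg
  have hz0 := h.hz0
  have hkX := h.sq_le
  have hzl := h.z_ge (by linarith)
  have hk0 : 0 < |k| := by linarith
  have hyk : |y + k| ≤ 3 * |k| := (abs_add_le _ _).trans (by rw [abs_of_pos hy]; linarith)
  have h4 : (y + k) ^ 4 ≤ 81 / 10000 * X := by
    have e2 : |k| ^ 2 ≤ (1 / 100) ^ 2 := by gcongr
    calc (y + k) ^ 4 = |y + k| ^ 4 := by rw [← abs_pow, abs_of_nonneg (by positivity)]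
      _ ≤ (3 * |k|) ^ 4 := by gcongr
      _ = 81 * (|k| ^ 2 * |k| ^ 2) := by ring
      _ ≤ 81 * ((1 / 100) ^ 2 * X) := by gcongr; rwa [sq_abs]
      _ = 81 / 10000 * X := by ring
  have hyk1 : y * |k| ≤ 2 * X := by
    calc y * |k| ≤ 2 * |k| * |k| := by gcongr; linarith
      _ = 2 * k ^ 2 := by rw [← sq_abs]; ring
      _ ≤ 2 * X := by gcongr
  have hyk2 : y * y ≤ 4 * X := by
    calc y * y ≤ y * (2 * |k|) := by gcongr; linarith
      _ = 2 * (y * |k|) := by ring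
      _ ≤ 4 * X := by linarith
  have hys : y * |sin ϑ| ≤ 2 * X := by
    calc y * |sin ϑ| ≤ 2 * |k| * |sin ϑ| := by gcongr; linarith
      _ = 2 * (|sin ϑ| * |k|) := by ring
      _ ≤ 2 * X := by linarith [h.sin_mul_le]
  have hp2 : y ^ 2 ≤ (1 / 30000) ^ 2 := by gcongr
  have hp4 : y ^ 4 ≤ (1 / 30000) ^ 4 := by gcongr
  have hp5 : y ^ 5 ≤ (1 / 30000) ^ 5 := by gcongr
  have g1 : 6 * y ^ 6 ≤ 6 * ((1 / 30000) ^ 4 * (4 * X)) := by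
    calc 6 * y ^ 6 = 6 * (y ^ 4 * (y * y)) := by ring
      _ ≤ _ := by gcongr
  have e1 : 6 * y ^ 6 * |sin ϑ| ≤ 6 * ((1 / 30000) ^ 5 * (2 * X)) := by
    calc 6 * y ^ 6 * |sin ϑ| = 6 * (y ^ 5 * (y * |sin ϑ|)) := by ring
      _ ≤ _ := by gcongr
  have e2 : 18 * y ^ 3 * |k| ≤ 18 * ((1 / 30000) ^ 2 * (2 * X)) := by
    calc 18 * y ^ 3 * |k| = 18 * (y ^ 2 * (y * |k|)) := by ring
      _ ≤ _ := by gcongr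
  have g2 : 6 * y ^ 6 * |sin ϑ| + 18 * y ^ 3 * |k| ≤ 1 / 100 * X := by
    norm_num at e1 e2
    linarith
  have g3 : z * (6 * y ^ 6 * |sin ϑ| + 18 * y ^ 3 * |k|) ≤ z * (1 / 100 * X) := by gcongr
  have hzX : 2 / 7 * X ≤ z * X := by gcongr
  norm_num at g1
  linarith

lemma le_of_far (hks : 1 / 100 < |k|) : Vr (θ + ϑ) (y + k) - Vr θ y - z ^ 2 * (Vθ θ y * sin ϑ + Vy θ
    y * k) ≤ 9 / 10 * (z * X) := by
  obtain ⟨hVw, -, hV', hzΛ⟩ := h.far_bounds θ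
  have hy := h.hy
  have hyt := h.y_le
  have hX0 := h.X_nonneg
  have hz0 := h.hz0
  have hz1 := h.hz1
  have hβ := h.hβ
  have hkX := h.sq_le
  have hzid := h.hzid
  have hkk : (1 / 100 : ℝ) ^ 2 ≤ k ^ 2 := by rw [← sq_abs k]; gcongr
  have hden : 0 < 1 + X / β := by positivity
  have hzX : z * X = X / (1 + X / β) := by
    rw [eq_div_iff hden.ne']
    linear_combination X * hzid
  have hzXk : k ^ 2 / (1 + k ^ 2 / 2) ≤ z * X := by
    rw [hzX, div_le_div_iff₀ (by positivity) hden]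
    have h1 : X / β ≤ X / 2 := by gcongr
    have h2 := mul_le_mul_of_nonneg_left h1 (sq_nonneg k)
    linarith
  have hlow : 1 / 20000 ≤ z * X := by
    refine le_trans ?_ hzXk
    rw [div_le_div_iff₀ (by norm_num) (by positivity)]
    norm_num at hkk
    linarith
  have hv : (y + k) ^ 2 / (1 + (y + k) ^ 2 / 2) ≤ 1.1 * (k ^ 2 / (1 + k ^ 2 / 2)) := by
    have e1 : (y + k) ^ 2 ≤ 1.1 * k ^ 2 := by
      have h1 : |y + k| ≤ 1.01 * |k| := (abs_add_le _ _).trans (by rw [abs_of_pos hy]; linarith)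
      rw [← sq_abs (y + k), ← sq_abs k]
      calc |y + k| ^ 2 ≤ (1.01 * |k|) ^ 2 := by gcongr
        _ = 1.0201 * |k| ^ 2 := by ring
        _ ≤ _ := by gcongr; norm_num
    rw [← mul_div_assoc, div_le_div_iff₀ (by positivity) (by positivity)]
    linarith [mul_nonneg (sq_nonneg (y + k)) (sq_nonneg k)]
  have hzk : z * |k| ≤ 1 + β := by
    have h1 : |k| ≤ 1 + X := by
      have := sq_abs k
      nlinarith [sq_nonneg (|k| - 1)]
    have h2 : z * X ≤ β := by
      have : z * X / β ≤ 1 := by linarith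
      rwa [div_le_one (by linarith)] at this
    calc z * |k| ≤ z * (1 + X) := by gcongr
      _ ≤ 1 + β := by linarith
  have g1 : z * (6 * y ^ 6 * |sin ϑ| + 18 * y ^ 3 * |k|) ≤ 6 * y ^ 6 + 18 * y ^ 3 * (1 + β) := by
    have e1 : z * (y ^ 6 * |sin ϑ|) ≤ 1 * (y ^ 6 * 1) := by gcongr; exact abs_sin_le_one ϑ
    have e2 : y ^ 3 * (z * |k|) ≤ y ^ 3 * (1 + β) := by gcongr
    linarith
  have g2 : y ^ 3 * (1 + β) ≤ (1 / 30000) ^ 2 * (1 / 10000) := by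
    have e1 : y * (1 + β) ≤ 1 / 10000 := by linarith [h.hyβ]
    calc y ^ 3 * (1 + β) = y ^ 2 * (y * (1 + β)) := by ring
      _ ≤ _ := by gcongr
  have g3 : y ^ 6 ≤ (1 / 30000) ^ 6 := by gcongr
  norm_num at g2 g3
  linarith

end CompData

/-- Near a point with tiny `y`-coordinate the potential is bounded by a linear function plus a
capped square, with coefficient less than one. -/
theorem Vr_comparison {β y : ℝ} (hβ : 2 ≤ β) (hy : 0 < y) (hyβ : y * (10000 * (1 + β)) ≤ 1)
    (θ ϑ k : ℝ) {X z : ℝ} (hX : X = 2 * (1 - cos ϑ) + k ^ 2) (hz : z = 1 / (1 + X / β)) :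
    Vr (θ + ϑ) (y + k) - Vr θ y - z ^ 2 * (Vθ θ y * sin ϑ + Vy θ y * k) ≤
      9 / 10 * (z * X) := by
  have hc1 : 0 ≤ 1 - cos ϑ := by linarith [cos_le_one ϑ]
  have hX0 : 0 ≤ X := by rw [hX]; positivity
  have hden : 0 < 1 + X / β := by positivity
  have h : CompData β θ y ϑ k X z := ⟨hβ, hy, hyβ, hX, by rw [hz]; positivity,
    by rw [hz, div_le_one hden]; linarith [div_nonneg hX0 (by linarith : 0 ≤ β)],
    by rw [hz]; field_simp⟩
  rcases le_or_gt |k| (y / 2) with hk | hk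
  · exact h.le_of_small hk
  rcases le_or_gt |k| (1 / 100) with hks | hks
  · exact h.le_of_medium hk hks
  · exact h.le_of_far hks

end Comparison

section Profile

/-- The integrand of the energy of the equivariant map, times `r²`, in the variable `t = log r`. -/
def enDens (M B₀ θ y a b : ℝ) : ℝ := a ^ 2 + b ^ 2 + M * (B₀ - Vr θ y)

/-- The factor `p e^{p/2 - 1}` of the first variation. -/
def enWeight (p M B₀ θ y a b : ℝ) : ℝ := p * enDens M B₀ θ y a b ^ (p / 2 - 1)

/-- A solution of the radial Euler-Lagrange system on `(-∞, 0)`, in the variable `t = log r`, that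
spirals to `y = 0` and stays `ν`-close to it. -/
structure IsProfile (p M lam B₀ ν : ℝ) (θ y a b ϖ : ℝ → ℝ) : Prop where
  hp : 1 < p
  hM : 1 ≤ M
  hlam : 0 < lam
  hB : 2 ≤ B₀
  hν : ν ≤ 1
  smooth_θ : ContDiffOn ℝ ∞ θ (Iio 0)
  smooth_y : ContDiffOn ℝ ∞ y (Iio 0)
  y_pos : ∀ t < 0, 0 < y t
  deriv_θ : ∀ t < 0, HasDerivAt θ (a t) t
  deriv_y : ∀ t < 0, HasDerivAt y (b t) t
  deriv_a : ∀ t < 0, HasDerivAt a (-(lam + ϖ t) * a t - M / 2 * Vθ (θ t) (y t)) t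
  deriv_b : ∀ t < 0, HasDerivAt b (-(lam + ϖ t) * b t - M / 2 * Vy (θ t) (y t)) t
  deriv_P : ∀ t < 0, HasDerivAt (fun t => enWeight p M B₀ (θ t) (y t) (a t) (b t))
    (ϖ t * enWeight p M B₀ (θ t) (y t) (a t) (b t)) t
  y_le : ∀ t < 0, y t ≤ ν
  a_le : ∀ t < 0, |a t| ≤ ν
  b_le : ∀ t < 0, |b t| ≤ ν
  V_le : ∀ t < 0, |Vr (θ t) (y t)| ≤ ν
  Vθ_le : ∀ t < 0, |Vθ (θ t) (y t)| ≤ ν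
  Vy_le : ∀ t < 0, |Vy (θ t) (y t)| ≤ ν
  ϖ_le : ∀ t < 0, |ϖ t| ≤ ν
  tendsto_y : Tendsto y atBot (𝓝 0)
  tendsto_a : Tendsto a atBot (𝓝 0)
  tendsto_b : Tendsto b atBot (𝓝 0)
  tendsto_θ : Tendsto θ atBot atBot

lemma tendsto_pow_mul_exp_neg_sq (k : ℕ) :
    Tendsto (fun s : ℝ => s ^ k * exp (-s ^ 2)) atTop (𝓝 0) := by
  refine squeeze_zero' (eventually_ge_atTop 0 |>.mono fun s hs => by positivity) ?_
    (tendsto_pow_mul_exp_neg_atTop_nhds_zero k)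
  filter_upwards [eventually_ge_atTop 1] with s hs
  have : exp (-s ^ 2) ≤ exp (-s) := exp_le_exp.2 (by nlinarith)
  gcongr

lemma eventually_largeS (p M μ : ℝ) {lam : ℝ} (hlam : 0 < lam) :
    ∀ᶠ s in atTop, LargeS p M lam μ s := by
  have h0 := tendsto_pow_mul_exp_neg_sq 0
  have h5 := tendsto_pow_mul_exp_neg_sq 5
  simp only [pow_zero, one_mul] at h0
  have e1 : ∀ᶠ s : ℝ in atTop, μ * exp (-s ^ 2) ≤ 1 / 2 := by
    have := h0.const_mul μ
    rw [mul_zero] at this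
    exact this.eventually_le_const (by norm_num)
  have e2 : ∀ᶠ s : ℝ in atTop, |p - 2| * (8 * M * μ + 8 * lam * μ ^ 2) * exp (-s ^ 2) ^ 2 +
      60 * μ * (s ^ 5 * exp (-s ^ 2)) ≤ lam / 40 := by
    have := ((h0.pow 2).const_mul (|p - 2| * (8 * M * μ + 8 * lam * μ ^ 2))).add
      (h5.const_mul (60 * μ))
    simp only [ne_eq, OfNat.ofNat_ne_zero, not_false_eq_true, zero_pow, mul_zero, add_zero] at this
    exact this.eventually_le_const (by positivity)
  filter_upwards [e1, e2, eventually_ge_atTop 12] with s h1 h2 h3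
  exact ⟨h3, h1, by linarith⟩

lemma tendsto_atTop_of_deriv_le {s c : ℝ → ℝ} {κ : ℝ} (hκ : 0 < κ) (h0 : ∀ t ≤ 0, 0 ≤ s t)
    (hs : ∀ t ≤ 0, HasDerivAt s (-c t) t) (hc : ∀ t ≤ 0, κ * exp (-s t ^ 2) ≤ c t) :
    Tendsto s atBot atTop := by
  have hcont : ContinuousOn s (Set.Iic 0) := fun t ht =>
    (hs t ht).continuousAt.continuousWithinAt
  have hanti : AntitoneOn s (Set.Iic 0) := by
    refine antitoneOn_of_deriv_nonpos (convex_Iic 0) hcont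
      (fun t ht => (hs t (mem_Iic.1 (interior_subset ht))).differentiableAt.differentiableWithinAt) fun t ht => ?_
    rw [(hs t (mem_Iic.1 (interior_subset ht))).deriv]
    have := hc t (mem_Iic.1 (interior_subset ht))
    have : 0 ≤ κ * exp (-s t ^ 2) := by positivity
    linarith
  refine tendsto_atTop.2 fun S => ?_
  suffices h : ∃ t₀ ≤ 0, S ≤ s t₀ by
    obtain ⟨t₀, ht₀, hS⟩ := h
    filter_upwards [eventually_le_atBot t₀] with t ht
    exact hS.trans (hanti (ht.trans ht₀) ht₀ ht)
  by_contra! hcon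
  set δ := κ * exp (-S ^ 2) with hδ
  have hδ0 : 0 < δ := by positivity
  have hS0 : 0 ≤ S := (h0 0 le_rfl).trans (hcon 0 le_rfl).le
  have hanti2 : AntitoneOn (fun t => s t + δ * t) (Set.Iic 0) := by
    have hd : ∀ t ≤ 0, HasDerivAt (fun t => s t + δ * t) (-c t + δ * 1) t := fun t ht =>
      (hs t ht).add ((hasDerivAt_id t).const_mul δ)
    refine antitoneOn_of_deriv_nonpos (convex_Iic 0) (fun t ht => (hd t
      ht).continuousAt.continuousWithinAt) (fun t ht => (hd t (mem_Iic.1 (interior_subset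
      ht))).differentiableAt.differentiableWithinAt) fun t ht => ?_
    have ht' : t ≤ 0 := mem_Iic.1 (interior_subset ht)
    rw [(hd t ht').deriv]
    have h1 := hc t ht'
    have h2 : s t ^ 2 ≤ S ^ 2 := by
      have := h0 t ht'
      have := (hcon t ht').le
      gcongr
    have h3 : δ ≤ κ * exp (-s t ^ 2) := by rw [hδ]; gcongr
    linarith
  have hle : -(S / δ) ≤ 0 := by have := div_nonneg hS0 hδ0.le; linarith
  have := hanti2 hle (mem_Iic.2 le_rfl) hle
  simp only [mul_zero, add_zero, mul_neg] at this
  rw [mul_div_cancel₀ _ hδ0.ne'] at this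
  linarith [hcon _ hle, h0 0 le_rfl]

variable {p M lam B₀ : ℝ}

lemma contDiffOn_friction (hp : 1 < p) (hM : 1 ≤ M) (hB : 2 ≤ B₀) {n : ℕ} {Φ s a c : ℝ → ℝ}
    {S : Set ℝ} (hs0 : ∀ t ∈ S, s t ≠ 0) (hΦ : ContDiffOn ℝ n Φ S) (hs : ContDiffOn ℝ n s S)
    (ha : ContDiffOn ℝ n a S) (hc : ContDiffOn ℝ n c S) :
    ContDiffOn ℝ n (fun t => friction p M lam B₀ (Φ t) (s t) (s t)⁻¹ (a t) (c t)) S := by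
  have hi := hs.inv hs0
  have he : ContDiffOn ℝ n (fun t => exp (-s t ^ 2)) S := (hs.pow 2).neg.exp
  have hsin : ContDiffOn ℝ n (fun t => sin (Φ t)) S := hΦ.sin
  have hcos : ContDiffOn ℝ n (fun t => cos (Φ t)) S := hΦ.cos
  have hspeed : ContDiffOn ℝ n (fun t => speedSq (s t)⁻¹ (a t) (c t)) S :=
    (ha.pow 2).add ((hc.pow 2).mul (hi.pow 4))
  have hslope : ContDiffOn ℝ n (fun t => slopeV (Φ t) (s t) (a t) (c t)) S :=
    (((hcos.mul ha).mul he).add ((((contDiffOn_const.mul hsin).mul ((hs.pow 1).mul he)).sub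
      (hcos.mul he)).mul hc)).neg
  have hpot : ContDiffOn ℝ n (fun t => M * (B₀ + exp (-s t ^ 2) * sin (Φ t))) S :=
    contDiffOn_const.mul (contDiffOn_const.add (he.mul hsin))
  refine ((contDiffOn_const.mul (hspeed.add hpot)).sub (contDiffOn_const.mul hslope)).mul
    ((hpot.add (contDiffOn_const.mul hspeed)).inv fun t ht => ?_)
  have := friction_den_ge hp hM hB (Φ t) (s t) (s t)⁻¹ (a t) (c t)
  positivity

lemma contDiffOn_spiral (hp : 1 < p) (hM : 1 ≤ M) (hB : 2 ≤ B₀) {Φ s a c : ℝ → ℝ} (h : ∀ t < 0, 0 <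
    s t ∧ HasDerivAt Φ (a t - c t) t ∧ HasDerivAt s (-c t) t ∧ HasDerivAt a (accA p M lam B₀ (Φ t)
    (s t) (s t)⁻¹ (a t) (c t)) t ∧ HasDerivAt c (accC p M lam B₀ (Φ t) (s t) (s t)⁻¹ (a t) (c t)) t)
    (n : ℕ) : ContDiffOn ℝ n Φ (Iio 0) ∧ ContDiffOn ℝ n s (Iio 0) ∧ ContDiffOn ℝ n a (Iio 0) ∧
    ContDiffOn ℝ n c (Iio 0) := by
  have step : ∀ {f f' : ℝ → ℝ} {n : ℕ}, (∀ t < 0, HasDerivAt f (f' t) t) →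
      ContDiffOn ℝ n f' (Iio 0) → ContDiffOn ℝ (n + 1 : ℕ) f (Iio 0) := by
    intro f f' n hf hf'
    rw [Nat.cast_add, Nat.cast_one, contDiffOn_succ_iff_deriv_of_isOpen isOpen_Iio]
    exact ⟨fun t ht => (hf t ht).differentiableAt.differentiableWithinAt, by simp,
      hf'.congr fun t ht => (hf t ht).deriv⟩
  induction n with
  | zero =>
    simp only [CharP.cast_eq_zero, contDiffOn_zero]
    exact ⟨fun t ht => (h t ht).2.1.continuousAt.continuousWithinAt,
      fun t ht => (h t ht).2.2.1.continuousAt.continuousWithinAt,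
      fun t ht => (h t ht).2.2.2.1.continuousAt.continuousWithinAt,
      fun t ht => (h t ht).2.2.2.2.continuousAt.continuousWithinAt⟩
  | succ n ih =>
    obtain ⟨i1, i2, i3, i4⟩ := ih
    have hne : ∀ t ∈ Iio (0 : ℝ), s t ≠ 0 := fun t ht => (h t ht).1.ne'
    have hf := contDiffOn_friction (lam := lam) hp hM hB hne i1 i2 i3 i4
    have he : ContDiffOn ℝ n (fun t => exp (-s t ^ 2)) (Iio 0) := (i2.pow 2).neg.exp
    have hsin : ContDiffOn ℝ n (fun t => sin (Φ t)) (Iio 0) := i1.sin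
    have hcos : ContDiffOn ℝ n (fun t => cos (Φ t)) (Iio 0) := i1.cos
    refine ⟨step (fun t ht => (h t ht).2.1) (i3.sub i4), step (fun t ht => (h t ht).2.2.1) i4.neg,
      step (fun t ht => (h t ht).2.2.2.1) (((contDiffOn_const.mul hcos).mul he).sub (hf.mul i3)),
      step (fun t ht => (h t ht).2.2.2.2) ?_⟩
    exact ((contDiffOn_const.mul (((contDiffOn_const.mul hsin).mul ((i2.pow 5).mul he)).sub
      (hcos.mul ((i2.pow 4).mul he)))).sub ((contDiffOn_const.mul (i4.pow 2)).mul
      (i2.inv hne))).sub (hf.mul i4)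

theorem exists_profile (hp : 1 < p) (hM : 1 ≤ M) (hlam : 0 < lam) (hB : 2 ≤ B₀) {ν : ℝ}
    (hν : 0 < ν) (hν1 : ν ≤ 1) : ∃ θ y a b ϖ : ℝ → ℝ, IsProfile p M lam B₀ ν θ y a b ϖ := by
  obtain ⟨μ, hμ⟩ : ∃ μ, μ = M / (2 * lam) := ⟨_, rfl⟩
  have hμ0 : 0 < μ := by rw [hμ]; positivity
  set Kc := |p - 2| * (8 * M * μ + 8 * lam * μ ^ 2) with hKc
  have h0 := tendsto_pow_mul_exp_neg_sq 0
  simp only [pow_zero, one_mul] at h0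
  have ev1 : ∀ᶠ s : ℝ in atTop, 2 * μ * exp (-s ^ 2) ≤ ν := by
    have := h0.const_mul (2 * μ)
    rw [mul_zero] at this
    exact this.eventually_le_const hν
  have ev2 : ∀ᶠ s : ℝ in atTop, Kc * exp (-s ^ 2) ^ 2 ≤ ν := by
    have := (h0.pow 2).const_mul Kc
    simp only [ne_eq, OfNat.ofNat_ne_zero, not_false_eq_true, zero_pow, mul_zero] at this
    exact this.eventually_le_const hν
  have ev3 : ∀ᶠ s : ℝ in atTop, 16 * s⁻¹ ≤ ν := by
    have := tendsto_inv_atTop_zero (𝕜 := ℝ) |>.const_mul 16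
    rw [mul_zero] at this
    exact this.eventually_le_const hν
  obtain ⟨s₀, hs₀⟩ := eventually_atTop.1
    ((eventually_largeS p M μ hlam).and (ev1.and (ev2.and ev3)))
  obtain ⟨Φ, s, a, c, h⟩ := exists_spiral (p := p) (B₀ := B₀) hp hM hB hlam hμ
    (fun s hs => (hs₀ s hs).1)
  have hs12 : ∀ t ≤ 0, 12 ≤ s t := fun t ht => (hs₀ _ (h t ht).1).1.twelve
  have hspos : ∀ t ≤ 0, 0 < s t := fun t ht => by linarith [hs12 t ht]
  have hac : ∀ t ≤ 0, |a t| ≤ 2 * μ * exp (-s t ^ 2) ∧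
      |c t| ≤ 2 * μ * exp (-s t ^ 2) ∧ 0.4 * (μ * exp (-s t ^ 2)) ≤ c t := by
    intro t ht
    have hT := (h t ht).2.1
    obtain ⟨h1, h2, h3, h4, h5, h6, h7, h8⟩ := hT.bounds (hs12 t ht)
    have ha := exp_neg_sq_mul_self (s := s t) (a := a t) hμ0
    have hc := exp_neg_sq_mul_self (s := s t) (a := c t) hμ0
    have he : 0 < μ * exp (-s t ^ 2) := by positivity
    refine ⟨?_, ?_, (Trapped.abs_le_one hμ0 (hs₀ _ (h t ht).1).1 hT).2.2⟩
    · rw [ha, abs_mul, abs_of_pos he, abs_of_pos (by linarith)]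
      nlinarith
    · rw [hc, abs_mul, abs_of_pos he, abs_of_pos (by linarith)]
      nlinarith
  have hsT : Tendsto s atBot atTop := by
    refine tendsto_atTop_of_deriv_le (c := c) (κ := 0.4 * μ) (by positivity)
      (fun t ht => (hspos t ht).le) (fun t ht => (h t ht).2.2.2.1) fun t ht => ?_
    have := (hac t ht).2.2
    linarith
  have hΦ1 : ∀ t ≤ 0, |Φ t| ≤ 1 := fun t ht =>
    abs_le_one_iff_mul_self_le_one.2 (by nlinarith [(h t ht).2.1.phi])
  have hsm := fun n => contDiffOn_spiral (p := p) (lam := lam) hp hM hB (Φ := Φ) (s := s) (a := a)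
    (c := c) (fun t ht => ⟨hspos t ht.le, (h t ht.le).2.2⟩) n
  have hyinv : ∀ t, 1 / (s t)⁻¹ = s t := fun t => by rw [one_div, inv_inv]
  have hyinv2 : ∀ t, 1 / (s t)⁻¹ ^ 2 = s t ^ 2 := fun t => by rw [inv_pow, one_div, inv_inv]
  have hne : ∀ t ≤ 0, (s t)⁻¹ ≠ 0 := fun t ht => inv_ne_zero (hspos t ht).ne'
  have hphase : ∀ t, Φ t - s t + s t = Φ t := fun t => by ring
  have hVr : ∀ t ≤ 0, Vr (Φ t - s t) (s t)⁻¹ = -exp (-s t ^ 2) * sin (Φ t) :=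
    fun t ht => by rw [Vr_of_ne (hne t ht), hyinv, hyinv2, hphase]
  have hVθ : ∀ t ≤ 0, Vθ (Φ t - s t) (s t)⁻¹ = -exp (-s t ^ 2) * cos (Φ t) :=
    fun t ht => by rw [Vθ_of_ne (hne t ht), hyinv, hyinv2, hphase]
  have hVy : ∀ t ≤ 0, Vy (Φ t - s t) (s t)⁻¹ = -exp (-s t ^ 2) *
      (2 * s t ^ 3 * sin (Φ t) - s t ^ 2 * cos (Φ t)) :=
    fun t ht => by rw [Vy_of_ne (hne t ht), hyinv, hyinv2, hphase]
  set F : ℝ → ℝ := fun t => friction p M lam B₀ (Φ t) (s t) (s t)⁻¹ (a t) (c t) with hF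
  have dθ : ∀ t < 0, HasDerivAt (fun t => Φ t - s t) (a t) t := fun t ht =>
    ((h t ht.le).2.2.1.sub (h t ht.le).2.2.2.1).congr_deriv (by ring)
  have dy : ∀ t < 0, HasDerivAt (fun t => (s t)⁻¹) (c t * (s t)⁻¹ ^ 2) t := fun t ht =>
    ((h t ht.le).2.2.2.1.fun_inv (hspos t ht.le).ne').congr_deriv (by field_simp)
  have da : ∀ t < 0, HasDerivAt a (-(lam + (F t - lam)) * a t -
      M / 2 * Vθ (Φ t - s t) (s t)⁻¹) t := fun t ht =>
    (h t ht.le).2.2.2.2.1.congr_deriv (by rw [hVθ t ht.le, accA]; simp only [hF]; ring)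
  have db : ∀ t < 0, HasDerivAt (fun t => c t * (s t)⁻¹ ^ 2)
      (-(lam + (F t - lam)) * (c t * (s t)⁻¹ ^ 2) - M / 2 * Vy (Φ t - s t) (s t)⁻¹) t :=
    fun t ht => by
      refine ((h t ht.le).2.2.2.2.2.mul ((dy t ht).pow 2)).congr_deriv ?_
      have := (hspos t ht.le).ne'
      rw [hVy t ht.le, accC]
      simp only [hF]
      simp only [Nat.cast_ofNat, Nat.add_one_sub_one, pow_one, Pi.pow_apply]
      field_simp
      ring
  have hB1 : ∀ t ≤ 0, 16 * (s t)⁻¹ ≤ ν := fun t ht => (hs₀ _ (h t ht).1).2.2.2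
  have hi0 : ∀ t ≤ 0, 0 < (s t)⁻¹ := fun t ht => inv_pos.2 (hspos t ht)
  have hi1 : ∀ t ≤ 0, (s t)⁻¹ ≤ 1 := fun t ht => inv_le_one_of_one_le₀ (by linarith [hs12 t ht])
  have hyT : Tendsto (fun t => (s t)⁻¹) atBot (𝓝 0) := tendsto_inv_atTop_zero.comp hsT
  have heT : Tendsto (fun t => 2 * μ * exp (-s t ^ 2)) atBot (𝓝 0) := by
    simpa using (h0.comp hsT).const_mul (2 * μ)
  have haT : Tendsto a atBot (𝓝 0) := squeeze_zero_norm'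
    ((eventually_le_atBot 0).mono fun t ht => (hac t ht).1) heT
  have hcT : Tendsto c atBot (𝓝 0) := squeeze_zero_norm'
    ((eventually_le_atBot 0).mono fun t ht => (hac t ht).2.1) heT
  refine ⟨fun t => Φ t - s t, fun t => (s t)⁻¹, a, fun t => c t * (s t)⁻¹ ^ 2,
    fun t => F t - lam, ?_⟩
  refine ⟨hp, hM, hlam, hB, hν1, ?_, ?_, ?_, dθ, dy, da, db, ?_, ?_, ?_, ?_,
    ?_, ?_, ?_, ?_, ?_, ?_, ?_, ?_⟩
  · exact contDiffOn_infty.2 fun n => (hsm n).1.sub (hsm n).2.1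
  · exact contDiffOn_infty.2 fun n => (hsm n).2.1.inv fun t ht => (hspos t (le_of_lt ht)).ne'
  · exact fun t ht => hi0 t ht.le
  · intro t ht
    have hA0 : 0 < enDens M B₀ (Φ t - s t) (s t)⁻¹ (a t) (c t * (s t)⁻¹ ^ 2) := by
      unfold enDens
      have := (abs_le.1 (abs_Vr_le_one (Φ t - s t) (s t)⁻¹)).2
      have : 0 < M * (B₀ - Vr (Φ t - s t) (s t)⁻¹) := by apply mul_pos <;> linarith
      positivity
    have hd : HasDerivAt (fun t => enDens M B₀ (Φ t - s t) (s t)⁻¹ (a t) (c t * (s t)⁻¹ ^ 2)) _ t :=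
      (((da t ht).pow 2).add ((db t ht).pow 2)).add
        ((HasDerivAt.Vr (dθ t ht) (dy t ht)).const_sub B₀ |>.const_mul M)
    have hd2 := (hd.rpow_const (p := p / 2 - 1) (Or.inl hA0.ne')).const_mul p
    refine hd2.congr_deriv ?_
    unfold enWeight
    rw [rpow_sub_one hA0.ne']
    have hAe : enDens M B₀ (Φ t - s t) (s t)⁻¹ (a t) (c t * (s t)⁻¹ ^ 2) =
        speedSq (s t)⁻¹ (a t) (c t) + M * (B₀ + exp (-s t ^ 2) * sin (Φ t)) := by
      unfold enDens speedSq; rw [hVr t ht.le]; ring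
    have hden := friction_den_ge hp hM hB (Φ t) (s t) (s t)⁻¹ (a t) (c t)
    have hFe : F t * (M * (B₀ + exp (-s t ^ 2) * sin (Φ t)) + (p - 1) * speedSq (s t)⁻¹ (a t) (c t))
        = lam * (speedSq (s t)⁻¹ (a t) (c t) + M * (B₀ + exp (-s t ^ 2) * sin (Φ t))) - (p - 2) * M
        * slopeV (Φ t) (s t) (a t) (c t) := by
      simp only [hF, friction]
      rw [inv_mul_cancel_right₀ (by positivity)]
    have hW : slopeV (Φ t) (s t) (a t) (c t) = Vθ (Φ t - s t) (s t)⁻¹ * a t +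
        Vy (Φ t - s t) (s t)⁻¹ * (c t * (s t)⁻¹ ^ 2) := by
      have := (hspos t ht.le).ne'
      rw [hVθ t ht.le, hVy t ht.le, slopeV]
      field_simp
      ring
    rw [hW] at hFe
    have hS : speedSq (s t)⁻¹ (a t) (c t) = a t ^ 2 + (c t * (s t)⁻¹ ^ 2) ^ 2 := by
      unfold speedSq; ring
    rw [hS] at hFe hAe
    generalize enDens M B₀ (Φ t - s t) (s t)⁻¹ (a t) (c t * (s t)⁻¹ ^ 2) = A at *
    generalize Vθ (Φ t - s t) (s t)⁻¹ = vt at *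
    generalize Vy (Φ t - s t) (s t)⁻¹ = vy at *
    generalize c t * (s t)⁻¹ ^ 2 = b at *
    generalize B₀ + exp (-s t ^ 2) * sin (Φ t) = β at *
    simp only [Nat.cast_ofNat, Nat.add_one_sub_one, pow_one]
    generalize A ^ (p / 2 - 1) = P
    have key : (F t - lam) * A = (p / 2 - 1) * (2 * a t * (-(lam + (F t - lam)) * a t - M / 2 * vt)
        + 2 * b * (-(lam + (F t - lam)) * b - M / 2 * vy) + M * -(vt * a t + vy * b)) := by
      rw [hAe]
      linear_combination hFe
    field_simp
    linear_combination (-2 * P) * key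
  · exact fun t ht => by linarith [hB1 t ht.le, hi0 t ht.le]
  · exact fun t ht => (hac t ht.le).1.trans (hs₀ _ (h t ht.le).1).2.1
  · intro t ht
    rw [abs_mul, abs_of_nonneg (by positivity : 0 ≤ (s t)⁻¹ ^ 2)]
    refine (mul_le_of_le_one_right (abs_nonneg _) (pow_le_one₀ (hi0 t ht.le).le (hi1 t ht.le))).trans
      ((hac t ht.le).2.1.trans (hs₀ _ (h t ht.le).1).2.1)
  · intro t ht
    refine (abs_Vr_le_sq _ _).trans ?_
    nlinarith [hi0 t ht.le, hi1 t ht.le, hB1 t ht.le]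
  · intro t ht
    refine (abs_Vθ_le _ _).trans ?_
    nlinarith [hi0 t ht.le, hi1 t ht.le, hB1 t ht.le]
  · intro t ht
    refine (abs_Vy_le _ _).trans ?_
    rw [abs_of_pos (hi0 t ht.le)]
    exact hB1 t ht.le
  · intro t ht
    have h1 := (h t ht.le).2.1.friction_sub_le (B₀ := B₀) (hs12 t ht.le) hp hM hB hlam hμ0
    rw [← exp_neg_sq_mul_self hμ0, ← exp_neg_sq_mul_self hμ0] at h1
    exact h1.trans (hs₀ _ (h t ht.le).1).2.2.1
  · exact hyT
  · exact haT
  · simpa using hcT.mul (hyT.pow 2)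
  · refine tendsto_atBot.2 fun S => ?_
    filter_upwards [hsT.eventually_ge_atTop (1 - S), eventually_le_atBot 0] with t h1 h2
    linarith [(abs_le.1 (hΦ1 t h2)).2]

end Profile

variable {m n : ℕ} {p M lam ε k₁ β B₀ ν η : ℝ} {F G G₁ G₂ H : Type*} [NormedAddCommGroup F]
  [NormedSpace ℝ F] [NormedAddCommGroup G] [NormedSpace ℝ G] [NormedAddCommGroup G₁]
  [NormedSpace ℝ G₁] [NormedAddCommGroup G₂] [NormedSpace ℝ G₂] [NormedAddCommGroup H]
  [InnerProductSpace ℝ H]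

/-- The unit ball. -/
notation "𝔹" => ball (0 : E _) 1

/-- Lebesgue measure on the unit ball. -/
notation "μ𝔹" => volume.restrict (ball (0 : E _) 1)

instance (m : ℕ) (R : ℝ) : IsFiniteMeasure (volume.restrict (ball (0 : E m) R)) :=
  ⟨by rw [Measure.restrict_apply_univ]; exact measure_ball_lt_top⟩

section Punctured

lemma exists_deriv_smoothTransition_bound :
    ∃ C : ℝ, 0 ≤ C ∧ ∀ x, |x| * |deriv smoothTransition (x - 1)| ≤ C := by
  have hc : Continuous fun x => |x| * |deriv smoothTransition (x - 1)| := by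
    have : Continuous (deriv smoothTransition) :=
      (smoothTransition.contDiff (n := 1)).continuous_deriv le_rfl
    fun_prop
  obtain ⟨C, hC⟩ := (isCompact_Icc (a := (1 : ℝ)) (b := 2)).exists_bound_of_continuousOn
    hc.continuousOn
  have hC0 : 0 ≤ C := (norm_nonneg _).trans (hC 1 (by norm_num))
  refine ⟨C, hC0, fun x => ?_⟩
  by_cases hx : x ∈ Icc (1 : ℝ) 2
  · exact (le_abs_self _).trans (hC x hx)
  · have : deriv smoothTransition (x - 1) = 0 := by
      rw [Set.mem_Icc, not_and_or, not_le, not_le] at hx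
      rcases hx with hx | hx
      · have : smoothTransition =ᶠ[𝓝 (x - 1)] fun _ => 0 := by
          filter_upwards [Iio_mem_nhds (by linarith : x - 1 < 0)] with y hy
          exact smoothTransition.zero_of_nonpos (le_of_lt hy)
        rw [this.deriv_eq, deriv_const]
      · have : smoothTransition =ᶠ[𝓝 (x - 1)] fun _ => 1 := by
          filter_upwards [Ioi_mem_nhds (by linarith : 1 < x - 1)] with y hy
          exact smoothTransition.one_of_one_le (le_of_lt hy)
        rw [this.deriv_eq, deriv_const]
    rw [this, abs_zero, mul_zero]; exact hC0

/-- A smooth function vanishing near the origin and equal to `1` far from it, at scale `1/k`. -/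
def cutAway (k : ℝ) (x : H) : ℝ := smoothTransition (k ^ 2 * ‖x‖ ^ 2 - 1)

lemma abs_cutAway_le (k : ℝ) (x : H) : |cutAway k x| ≤ 1 := by
  rw [cutAway, abs_of_nonneg (smoothTransition.nonneg _)]
  exact smoothTransition.le_one _

lemma hasFDerivAt_cutAway (k : ℝ) (x : H) : HasFDerivAt (cutAway k)
    ((deriv smoothTransition (k ^ 2 * ‖x‖ ^ 2 - 1) * (2 * k ^ 2)) • innerSL ℝ x) x := by
  have h1 : HasFDerivAt (fun x : H => k ^ 2 * ‖x‖ ^ 2 - 1) (k ^ 2 • (2 • innerSL ℝ x)) x :=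
    ((hasStrictFDerivAt_norm_sq x).hasFDerivAt.const_mul (k ^ 2)).sub_const 1
  have h2 : DifferentiableAt ℝ smoothTransition (k ^ 2 * ‖x‖ ^ 2 - 1) :=
    (smoothTransition.contDiff (n := 1)).differentiable one_ne_zero _
  have h3 := h2.hasDerivAt.comp_hasFDerivAt x h1
  refine h3.congr_fderiv ?_
  ext y
  simp
  ring

lemma tsupport_cutAway {k : ℝ} {x : H} (hx : x ∈ tsupport (cutAway (H := H) k)) :
    1 ≤ k ^ 2 * ‖x‖ ^ 2 := by
  have hcl : IsClosed {x : H | 1 ≤ k ^ 2 * ‖x‖ ^ 2} :=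
    isClosed_le continuous_const (by fun_prop)
  refine closure_minimal (fun y hy => ?_) hcl hx
  by_contra hlt
  simp only [Set.mem_ofPred_eq, not_le] at hlt
  exact hy (smoothTransition.zero_of_nonpos (by linarith))

lemma eventually_cutAway_eq {x : H} (hx : x ≠ 0) :
    ∀ᶠ k : ℕ in atTop, ∀ᶠ z in 𝓝 x, cutAway (k : ℝ) z = 1 := by
  have hx0 : 0 < ‖x‖ := norm_pos_iff.2 hx
  have h1 : Tendsto (fun k : ℕ => (k : ℝ) * ‖x‖) atTop atTop :=
    tendsto_natCast_atTop_atTop.atTop_mul_const hx0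
  filter_upwards [h1.eventually_gt_atTop 2] with k hk
  have hc : ContinuousAt (fun z : H => (k : ℝ) * ‖z‖) x := by fun_prop
  filter_upwards [hc.eventually_const_lt hk] with z hz
  exact smoothTransition.one_of_one_le (by nlinarith)

variable [FiniteDimensional ℝ H] [MeasurableSpace H] [BorelSpace H]

/-- An integrable function that is differentiable off the origin, with integrable derivative, has
a derivative of mean zero, provided that it is not too singular at the origin. -/
theorem integral_fderiv_eq_zero_of_punctured {f : H → G} {f' : H → H →L[ℝ] G} (e : H) (hf : ∀ x ≠ 0,
    HasFDerivAt f (f' x) x) (hi : Integrable f) (hi' : Integrable fun x => f' x e) (hr : Integrable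
    fun x => ‖x‖⁻¹ • f x) (h0 : (volume : Measure H) {0} = 0) : ∫ x, f' x e = 0 := by
  obtain ⟨C, hC0, hC⟩ := exists_deriv_smoothTransition_bound
  set d : ℕ → H → H →L[ℝ] ℝ := fun k x =>
    (deriv smoothTransition ((k : ℝ) ^ 2 * ‖x‖ ^ 2 - 1) * (2 * (k : ℝ) ^ 2)) • innerSL ℝ x
  have hd : ∀ k x, ‖d k x e‖ * ‖x‖ ≤ 2 * C * ‖e‖ := by
    intro k x
    have h1 := hC ((k : ℝ) ^ 2 * ‖x‖ ^ 2)
    rw [abs_of_nonneg (by positivity)] at h1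
    have h2 : ‖d k x e‖ ≤ |deriv smoothTransition ((k : ℝ) ^ 2 * ‖x‖ ^ 2 - 1)| *
        (2 * (k : ℝ) ^ 2) * (‖x‖ * ‖e‖) := by
      simp only [d, _root_.smul_apply, innerSL_apply_apply, smul_eq_mul, norm_mul, norm_eq_abs]
      have := abs_real_inner_le_norm x e
      rw [abs_of_pos (by norm_num : (0 : ℝ) < 2), abs_of_nonneg (by positivity : (0 : ℝ) ≤ (k : ℝ) ^ 2)]
      gcongr
    calc ‖d k x e‖ * ‖x‖ ≤ |deriv smoothTransition ((k : ℝ) ^ 2 * ‖x‖ ^ 2 - 1)| *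
        (2 * (k : ℝ) ^ 2) * (‖x‖ * ‖e‖) * ‖x‖ := by gcongr
      _ = 2 * ((k : ℝ) ^ 2 * ‖x‖ ^ 2 *
          |deriv smoothTransition ((k : ℝ) ^ 2 * ‖x‖ ^ 2 - 1)|) * ‖e‖ := by ring
      _ ≤ 2 * C * ‖e‖ := by gcongr
  have hdm : ∀ k, Continuous fun x => d k x e := by
    intro k
    have : Continuous (deriv smoothTransition) :=
      (smoothTransition.contDiff (n := 1)).continuous_deriv le_rfl
    simp only [d, _root_.smul_apply, innerSL_apply_apply]
    fun_prop
  have hcm : ∀ k : ℕ, Continuous fun x : H => cutAway (k : ℝ) x := fun k =>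
    continuous_iff_continuousAt.2 fun x => (hasFDerivAt_cutAway (k : ℝ) x).continuousAt
  have hne : ∀ᵐ x : H, x ≠ 0 := by rw [ae_iff]; simpa using h0
  have hbd : ∀ k : ℕ, ∀ᵐ x : H, ‖d k x e • f x‖ ≤ 2 * C * ‖e‖ * ‖‖x‖⁻¹ • f x‖ := by
    intro k
    filter_upwards [hne] with x hx
    have hx0 : 0 < ‖x‖ := norm_pos_iff.2 hx
    rw [norm_smul, norm_smul, norm_inv, norm_norm]
    have : ‖d k x e‖ ≤ 2 * C * ‖e‖ * ‖x‖⁻¹ := by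
      rw [← div_eq_mul_inv, le_div_iff₀ hx0]; exact hd k x
    calc _ ≤ 2 * C * ‖e‖ * ‖x‖⁻¹ * ‖f x‖ := by gcongr
      _ = _ := by ring
  have hint : ∀ k : ℕ, Integrable fun x => d k x e • f x := fun k =>
    (hr.norm.const_mul _).mono' ((hdm k).aestronglyMeasurable.smul hi.1) (hbd k)
  have hibp : ∀ k : ℕ, ∫ x, cutAway (k : ℝ) x • f' x e = -∫ x, d k x e • f x := by
    intro k
    refine integral_bilinear_hasFDerivAt_right_eq_neg_left_of_integrable
      (B := ContinuousLinearMap.lsmul ℝ ℝ) (f := cutAway (k : ℝ)) (f' := d k) (g := f) (g' := f')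
      (hint k) ?_ ?_ (fun x _ => hasFDerivAt_cutAway _ _) fun x hx => hf x ?_
    · exact hi'.bdd_smul 1 (hcm k).aestronglyMeasurable (Eventually.of_forall fun x =>
        abs_cutAway_le _ x)
    · exact hi.bdd_smul 1 (hcm k).aestronglyMeasurable (Eventually.of_forall fun x =>
        abs_cutAway_le _ x)
    · rintro rfl
      have := tsupport_cutAway hx
      simp at this
      linarith
  have hL : Tendsto (fun k : ℕ => ∫ x, cutAway (k : ℝ) x • f' x e) atTop (𝓝 (∫ x, f' x e)) := by
    refine tendsto_integral_of_dominated_convergence (fun x => ‖f' x e‖)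
      (fun k => (hcm k).aestronglyMeasurable.smul hi'.1) hi'.norm (fun k => ?_) ?_
    · refine Eventually.of_forall fun x => ?_
      rw [norm_smul]
      exact mul_le_of_le_one_left (norm_nonneg _) (abs_cutAway_le _ x)
    · filter_upwards [hne] with x hx
      refine tendsto_const_nhds.congr' ?_
      filter_upwards [eventually_cutAway_eq hx] with k hk
      rw [hk.self_of_nhds, one_smul]
  have hR : Tendsto (fun k : ℕ => -∫ x, d k x e • f x) atTop (𝓝 (-∫ _ : H, (0 : G))) := by
    refine (tendsto_integral_of_dominated_convergence _
      (fun k => (hint k).1) (hr.norm.const_mul _) hbd ?_).neg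
    filter_upwards [hne] with x hx
    refine tendsto_const_nhds.congr' ?_
    filter_upwards [eventually_cutAway_eq hx] with k hk
    have h1 : HasFDerivAt (cutAway (k : ℝ)) (d k x) x := hasFDerivAt_cutAway _ _
    have h2 : HasFDerivAt (cutAway (k : ℝ)) (0 : H →L[ℝ] ℝ) x :=
      (hasFDerivAt_const (1 : ℝ) x).congr_of_eventuallyEq hk
    rw [h1.unique h2]; simp
  have := tendsto_nhds_unique (hL.congr hibp) hR
  simpa using this

end Punctured

section WeakDerivative

variable {Ω : Opens (E m)} {f g : E m → F} {A B : E m → E m →L[ℝ] F}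

/-- The test function given by a smooth function with compact support in `Ω`. -/
def mkTest {φ : E m → F} (h1 : ContDiff ℝ ∞ φ) (h2 : HasCompactSupport φ)
    (h3 : tsupport φ ⊆ Ω) : 𝓓(Ω, F) := ⟨φ, h1, h2, h3⟩

lemma contDiff_test (φ : 𝓓(Ω, F)) : ContDiff ℝ ∞ (fun x => φ x) := φ.contDiff

lemma continuousLinearMap_eq_zero_of_single {L : E m →L[ℝ] F}
    (h : ∀ i, L (single i 1) = 0) : L = 0 := by
  ext x
  have hx : x = ∑ i, x i • single i (1 : ℝ) := by ext j; simp [Finset.sum_apply, Pi.single_apply]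
  rw [hx, map_sum]
  simp [h]

lemma integrableOn_smul_of_test {h : E m → F} (hh : LocallyIntegrableOn h Ω) {ψ : E m → ℝ}
    (hψ : Continuous ψ) {K : Set (E m)} (hK : IsCompact K) (hKΩ : K ⊆ Ω)
    (hs : ∀ x ∉ K, ψ x = 0) : IntegrableOn (fun x => ψ x • h x) Ω := by
  have h1 : IntegrableOn h K := hh.integrableOn_compact_subset hKΩ hK
  have h2 : IntegrableOn (fun x => ψ x • h x) K := by
    obtain ⟨C, hC⟩ := hK.exists_bound_of_continuousOn hψ.continuousOn
    exact h1.bdd_smul C hψ.aestronglyMeasurable ((ae_restrict_iff' hK.measurableSet).2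
      (Eventually.of_forall hC))
  refine IntegrableOn.of_ae_sdiff_eq_zero (h2 : IntegrableOn _ K)
    Ω.isOpen.measurableSet.nullMeasurableSet (Eventually.of_forall fun x hx => ?_)
  rw [hs x hx.2, zero_smul]

lemma fderiv_eq_zero_of_notMem_tsupport {φ : E m → F} {x : E m} (hx : x ∉ tsupport φ) :
    fderiv ℝ φ x = 0 := by
  have : φ =ᶠ[𝓝 x] fun _ => 0 := by
    filter_upwards [(isClosed_tsupport φ).isOpen_compl.mem_nhds hx] with y hy
    exact image_eq_zero_of_notMem_tsupport hy
  rw [this.fderiv_eq]; simp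

lemma integrableOn_test_smul {h : E m → F} (hh : LocallyIntegrableOn h Ω) (φ : 𝓓(Ω, ℝ)) :
    IntegrableOn (fun x => φ x • h x) Ω :=
  integrableOn_smul_of_test hh φ.continuous φ.hasCompactSupport φ.tsupport_subset
    fun _ hx => image_eq_zero_of_notMem_tsupport hx

lemma integrableOn_fderiv_test_smul {h : E m → F} (hh : LocallyIntegrableOn h Ω) (φ : 𝓓(Ω, ℝ))
    (e : E m) : IntegrableOn (fun x => (fderiv ℝ (fun z => φ z) x e) • h x) Ω :=
  integrableOn_smul_of_test hh (((contDiff_test φ).continuous_fderiv (by simp)).clm_apply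
    continuous_const) φ.hasCompactSupport φ.tsupport_subset fun x hx => by
      rw [fderiv_eq_zero_of_notMem_tsupport hx]; rfl

lemma locallyIntegrableOn_apply {s : Set (E m)} (hA : LocallyIntegrableOn A s) (e : E m) :
    LocallyIntegrableOn (fun x => A x e) s := fun x hx => by
  obtain ⟨t, ht, hi⟩ := hA x hx
  exact ⟨t, ht, hi.apply_continuousLinearMap e⟩

theorem HasWeakDeriv.ae_eq [CompleteSpace F] (hA : HasWeakDeriv Ω f A) (hB : HasWeakDeriv Ω f B) :
    A =ᵐ[volume.restrict (Ω : Set (E m))] B := by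
  have key : ∀ i : Fin m, ∀ᵐ x, x ∈ (Ω : Set (E m)) → A x (single i 1) - B x (single i 1) = 0 := by
    intro i
    set e : E m := single i 1
    refine Ω.isOpen.ae_eq_zero_of_integral_contDiff_smul_eq_zero
      ((locallyIntegrableOn_apply hA.2.1 e).sub (locallyIntegrableOn_apply hB.2.1 e)) fun φ h1 h2 h3 => ?_
    have e1 := hA.2.2 (mkTest h1 h2 h3) e
    rw [hB.2.2 (mkTest h1 h2 h3) e, neg_inj] at e1
    have hsub : ∫ x, φ x • (A x e - B x e) = ∫ x in (Ω : Set (E m)), φ x • (A x e - B x e) := by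
      refine (setIntegral_eq_integral_of_forall_compl_eq_zero fun x hx => ?_).symm
      rw [image_eq_zero_of_notMem_tsupport fun h => hx (h3 h), zero_smul]
    refine Eq.trans hsub ?_
    simp only [smul_sub]
    exact (integral_sub (integrableOn_test_smul (locallyIntegrableOn_apply hA.2.1 e) (mkTest h1 h2
      h3)) (integrableOn_test_smul (locallyIntegrableOn_apply hB.2.1 e) (mkTest h1 h2 h3))).trans
      (sub_eq_zero.2 e1.symm)
  rw [Filter.EventuallyEq, ae_restrict_iff' Ω.isOpen.measurableSet]
  filter_upwards [ae_all_iff.2 key] with x hx hxΩ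
  exact sub_eq_zero.1 (continuousLinearMap_eq_zero_of_single fun i => by simpa using hx i hxΩ)

lemma HasWeakDeriv.hasWeakDeriv_weakDeriv (hA : HasWeakDeriv Ω f A) :
    HasWeakDeriv Ω f (weakDeriv Ω f) := by
  have h : ∃ G, HasWeakDeriv Ω f G := ⟨A, hA⟩
  rw [weakDeriv, dif_pos h]
  exact h.choose_spec

theorem HasWeakDeriv.weakDeriv_ae_eq [CompleteSpace F] (hA : HasWeakDeriv Ω f A) :
    weakDeriv Ω f =ᵐ[volume.restrict (Ω : Set (E m))] A :=
  hA.hasWeakDeriv_weakDeriv.ae_eq hA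

lemma HasWeakDeriv.sub (hA : HasWeakDeriv Ω f A) (hB : HasWeakDeriv Ω g B) :
    HasWeakDeriv Ω (fun x => f x - g x) (fun x => A x - B x) := by
  refine ⟨hA.1.sub hB.1, hA.2.1.sub hB.2.1, fun φ e => ?_⟩
  simp only [smul_sub, _root_.sub_apply]
  rw [integral_sub (integrableOn_fderiv_test_smul hA.1 φ e) (integrableOn_fderiv_test_smul hB.1 φ
    e), integral_sub (integrableOn_test_smul (locallyIntegrableOn_apply hA.2.1 e) φ)
    (integrableOn_test_smul (locallyIntegrableOn_apply hB.2.1 e) φ), hA.2.2, hB.2.2]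
  abel

lemma locallyIntegrableOn_congr {h k : E m → G} (hh : LocallyIntegrableOn h Ω) (e : h
    =ᵐ[volume.restrict (Ω : Set (E m))] k) : LocallyIntegrableOn k Ω := by
  intro x hx
  obtain ⟨t, ht, hi⟩ := hh x hx
  refine ⟨t ∩ Ω, inter_mem ht self_mem_nhdsWithin, ?_⟩
  exact (hi.mono_set Set.inter_subset_left).congr_fun_ae
    (ae_restrict_of_ae_restrict_of_subset Set.inter_subset_right e)

lemma HasWeakDeriv.congr (hA : HasWeakDeriv Ω f A) (hf : f =ᵐ[volume.restrict (Ω : Set (E m))] g)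
    (hB : A =ᵐ[volume.restrict (Ω : Set (E m))] B) : HasWeakDeriv Ω g B := by
  refine ⟨locallyIntegrableOn_congr hA.1 hf, locallyIntegrableOn_congr hA.2.1 hB, fun φ e => ?_⟩
  rw [← integral_congr_ae (μ := volume.restrict (Ω : Set (E m))) (hf.mono fun x hx => show _ • f x =
      (fderiv ℝ (fun z => φ z) x e) • g x by rw [hx]), ← integral_congr_ae (μ := volume.restrict (Ω
      : Set (E m))) (hB.mono fun x hx => show _ • A x e = φ x • B x e by rw [hx])]
  exact hA.2.2 φ e

lemma MemW1p.hasWeakDeriv (h : MemW1p Ω p f) : HasWeakDeriv Ω f (weakDeriv Ω f) :=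
  h.2.choose_spec.1.hasWeakDeriv_weakDeriv

lemma MemW1p.memLp_weakDeriv [CompleteSpace F] (h : MemW1p Ω p f) :
    MemLp (weakDeriv Ω f) (ofReal p) (volume.restrict (Ω : Set (E m))) := by
  obtain ⟨G, h1, h2⟩ := h.2
  exact (memLp_congr_ae h1.weakDeriv_ae_eq).2 h2

end WeakDerivative

section PuncturedWeak

variable {R C : ℝ} {f : E m → F} {f' : E m → E m →L[ℝ] F}

lemma volume_singleton_zero (hm : 0 < m) : (volume : Measure (E m)) {0} = 0 := by
  have : Nonempty (Fin m) := ⟨⟨0, hm⟩⟩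
  exact measure_singleton 0

lemma ae_ne_zero (hm : 0 < m) : ∀ᵐ x : E m, x ≠ 0 := by
  rw [ae_iff]; simpa using volume_singleton_zero hm

lemma integrableOn_norm_rpow_neg (hm : 0 < m) {α : ℝ} (hα : α < m) (R : ℝ) :
    IntegrableOn (fun x : E m => ‖x‖ ^ (-α)) (ball 0 R) := by
  have h : LocallyIntegrable (fun x : E m => ‖x‖ ^ (-α)) := by
    refine locallyIntegrable_of_norm_le_rpow (C := 1) (α := α) ?_ ?_ ?_ ?_
    · rw [finrank_euclideanSpace_fin]; exact hm
    · rw [finrank_euclideanSpace_fin]; exact hα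
    · refine Eventually.of_forall fun x => ?_
      rw [one_mul, norm_of_nonneg (rpow_nonneg (norm_nonneg _) _)]
    · exact (measurable_norm.pow_const _).aestronglyMeasurable
  exact (h.integrableOn_isCompact (isCompact_closedBall 0 R)).mono_set ball_subset_closedBall

lemma isOpen_punctured (R : ℝ) : IsOpen (ball (0 : E m) R \ {0}) :=
  isOpen_ball.sdiff isClosed_singleton

lemma restrict_punctured_ball (hm : 0 < m) (R : ℝ) :
    volume.restrict (ball (0 : E m) R \ {0}) = volume.restrict (ball (0 : E m) R) :=
  Measure.restrict_congr_set (sdiff_null_ae_eq_self (volume_singleton_zero hm))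

lemma aesm_of_continuousOn_punctured [SecondCountableTopologyEither (E m) G] (hm : 0 < m)
    {g : E m → G} (hg : ContinuousOn g (ball 0 R \ {0})) :
    AEStronglyMeasurable g (volume.restrict (ball (0 : E m) R)) := by
  rw [← restrict_punctured_ball hm]
  exact hg.aestronglyMeasurable (isOpen_punctured R).measurableSet

lemma ae_restrict_punctured (hm : 0 < m) {P : E m → Prop} (h : ∀ x ∈ ball (0 : E m) R, x ≠ 0 → P x)
    : ∀ᵐ x ∂volume.restrict (ball (0 : E m) R), P x := by
  rw [ae_restrict_iff' isOpen_ball.measurableSet]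
  filter_upwards [ae_ne_zero hm] with x hx hxb using h x hxb hx

/-- A function on a ball that is `C¹` off the centre, bounded, with a derivative bounded by
`C / |x|`. -/
structure PuncturedC1 (R C : ℝ) (f : E m → F) (f' : E m → E m →L[ℝ] F) : Prop where
  hasFDerivAt : ∀ x ∈ ball (0 : E m) R, x ≠ 0 → HasFDerivAt f (f' x) x
  continuousOn : ContinuousOn f' (ball 0 R \ {0})
  bound : ∀ x ∈ ball (0 : E m) R, x ≠ 0 → ‖f x‖ ≤ C
  bound' : ∀ x ∈ ball (0 : E m) R, x ≠ 0 → ‖f' x‖ ≤ C * ‖x‖⁻¹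

namespace PuncturedC1

variable (h : PuncturedC1 R C f f')
include h

lemma continuousOn_self : ContinuousOn f (ball 0 R \ {0}) := fun x hx =>
  (h.hasFDerivAt x hx.1 hx.2).continuousAt.continuousWithinAt

lemma memLp [CompleteSpace F] (hm : 0 < m) (q : ℝ≥0∞) :
    MemLp f q (volume.restrict (ball (0 : E m) R)) := by
  exact MemLp.of_bound (aesm_of_continuousOn_punctured hm h.continuousOn_self) C
    (ae_restrict_punctured hm h.bound)

lemma memLp_deriv [CompleteSpace F] (hp : 1 < p) (hpm : p < m) :
    MemLp f' (ofReal p) (volume.restrict (ball (0 : E m) R)) := by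
  have hm : 0 < m := by rify; linarith
  have hmeas := aesm_of_continuousOn_punctured hm h.continuousOn
  refine (integrable_norm_rpow_iff hmeas (by simp; linarith) (by simp)).1 ?_
  rw [ENNReal.toReal_ofReal (by linarith)]
  refine ((integrableOn_norm_rpow_neg hm hpm R).const_mul (|C| ^ p)).mono'
    (hmeas.norm.aemeasurable.pow_const p).aestronglyMeasurable ?_
  refine ae_restrict_punctured hm fun x hx hx0 => ?_
  have h1 := h.bound' x hx hx0
  rw [norm_of_nonneg (by positivity), rpow_neg (norm_nonneg _),
    ← inv_rpow (norm_nonneg _), ← mul_rpow (abs_nonneg _) (by positivity)]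
  gcongr
  exact h1.trans (by gcongr; exact le_abs_self C)

lemma hasWeakDeriv [CompleteSpace F] (hm : 1 < m) : HasWeakDeriv (ballO m R) f f' := by
  have hm0 : 0 < m := by omega
  have i0 : IntegrableOn f (ball (0 : E m) R) :=
    memLp_one_iff_integrable.1 (h.memLp hm0 1)
  have hinv : IntegrableOn (fun x : E m => ‖x‖⁻¹) (ball 0 R) := by
    have := integrableOn_norm_rpow_neg hm0 (α := 1) (by exact_mod_cast hm) R
    simpa [rpow_neg_one] using this
  have i1 : IntegrableOn f' (ball (0 : E m) R) :=
    (hinv.const_mul C).mono' (aesm_of_continuousOn_punctured hm0 h.continuousOn)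
      (ae_restrict_punctured hm0 h.bound')
  have i2 : IntegrableOn (fun x => ‖x‖⁻¹ • f x) (ball (0 : E m) R) := by
    refine (hinv.const_mul C).mono' (hinv.1.smul i0.1) (ae_restrict_punctured hm0 fun x hx hx0 => ?_)
    rw [norm_smul, norm_inv, norm_norm, mul_comm]
    gcongr
    exact h.bound x hx hx0
  refine ⟨i0.locallyIntegrableOn, i1.locallyIntegrableOn, fun φ e => ?_⟩
  have hts := φ.tsupport_subset
  have ext : ∀ {g : E m → F}, (∀ x ∉ tsupport φ, g x = 0) →
      (Integrable g ↔ IntegrableOn g (ballO m R)) := fun hg =>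
    (integrableOn_iff_integrable_of_support_subset fun x hx =>
      hts (by by_contra hc; exact hx (hg x hc))).symm
  have exti : ∀ {g : E m → F}, (∀ x ∉ tsupport φ, g x = 0) →
      ∫ x in (ballO m R : Set (E m)), g x = ∫ x, g x := fun hg =>
    setIntegral_eq_integral_of_forall_compl_eq_zero fun x hx => hg x fun hc => hx (hts hc)
  have z0 : ∀ x ∉ tsupport φ, φ x = 0 := fun x hx => image_eq_zero_of_notMem_tsupport hx
  have z1 : ∀ x ∉ tsupport φ, fderiv ℝ (fun z => φ z) x = 0 := fun x hx =>
    fderiv_eq_zero_of_notMem_tsupport hx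
  have j1 : Integrable fun x => φ x • f x := by
    rw [ext fun x hx => by rw [z0 x hx, zero_smul]]
    exact integrableOn_test_smul i0.locallyIntegrableOn φ
  have j2 : Integrable fun x => ‖x‖⁻¹ • φ x • f x := by
    rw [ext fun x hx => by rw [z0 x hx, zero_smul, smul_zero]]
    refine (integrableOn_test_smul i2.locallyIntegrableOn φ).congr_fun (fun x _ => ?_)
      (ballO m R).isOpen.measurableSet
    exact smul_comm _ _ _
  have j3 : Integrable fun x => φ x • f' x e := by
    rw [ext fun x hx => by rw [z0 x hx, zero_smul]]
    exact integrableOn_test_smul (locallyIntegrableOn_apply i1.locallyIntegrableOn e) φ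
  have j4 : Integrable fun x => (fderiv ℝ (fun z => φ z) x e) • f x := by
    rw [ext fun x hx => by rw [z1 x hx]; simp]
    exact integrableOn_fderiv_test_smul i0.locallyIntegrableOn φ e
  have key := integral_fderiv_eq_zero_of_punctured (f := fun x => φ x • f x)
    (f' := fun x => φ x • f' x + (fderiv ℝ (fun z => φ z) x).smulRight (f x)) e ?_ j1
    (j3.add j4) j2 (volume_singleton_zero hm0)
  · simp only [_root_.add_apply, _root_.smul_apply, smulRight_apply] at key
    rw [integral_add j3 j4] at key
    rw [exti fun x hx => by rw [z1 x hx]; simp, exti fun x hx => by rw [z0 x hx, zero_smul]]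
    exact eq_neg_of_add_eq_zero_right key
  · intro x hx
    by_cases hb : x ∈ tsupport φ
    · exact (((contDiff_test φ).differentiable (by simp) x).hasFDerivAt).smul
        (h.hasFDerivAt x (hts hb) hx)
    · have hev : (fun x => φ x • f x) =ᶠ[𝓝 x] fun _ => 0 := by
        filter_upwards [(isClosed_tsupport φ).isOpen_compl.mem_nhds hb] with y hy
        rw [z0 y hy, zero_smul]
      rw [z0 x hb, z1 x hb]
      refine ((hasFDerivAt_const (0 : F) x).congr_of_eventuallyEq hev).congr_fderiv ?_
      ext; simp

lemma memW1p [CompleteSpace F] (hp : 1 < p) (hpm : p < m) : MemW1p (ballO m R) p f := by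
  have hm : 1 < m := by rify; linarith
  exact ⟨h.memLp (by omega) _, f', h.hasWeakDeriv hm, h.memLp_deriv hp hpm⟩

end PuncturedC1

end PuncturedWeak

section Admissible

variable {K : Set F}

variable (m F) in
/-- The punctured unit ball times the space of values. -/
def Reg : Set (E m × F) := (𝔹 \ {0}) ×ˢ univ

lemma isOpen_Reg : IsOpen (Reg m F) := (isOpen_punctured 1).prod isOpen_univ

lemma mem_Reg {w : E m × F} : w ∈ Reg m F ↔ w.1 ∈ 𝔹 ∧ w.1 ≠ 0 := by simp [Reg]

lemma one_le_inv_of_mem_Reg {w : E m × F} (hw : w ∈ Reg m F) : 1 ≤ ‖w.1‖⁻¹ := by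
  rw [mem_Reg, mem_ball_zero_iff] at hw
  exact (one_le_inv₀ (norm_pos_iff.2 hw.2)).2 hw.1.le

/-- Coefficients `g(x, z)` that are `C¹` off `x = 0`, bounded, with `x`-derivatives of order
`1/|x|` and bounded `z`-derivatives, as long as `z ∈ K`. -/
structure Adm (K : Set F) (g : E m × F → G) : Prop where
  contDiffOn : ContDiffOn ℝ 1 g (Reg m F)
  bound : ∃ C, 0 ≤ C ∧ ∀ w ∈ Reg m F, w.2 ∈ K → ‖g w‖ ≤ C ∧
    ∀ e ζ, ‖fderiv ℝ g w (e, ζ)‖ ≤ C * (‖e‖ * ‖w.1‖⁻¹ + ‖ζ‖)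

lemma norm_dir {x : F} (hx : x ≠ 0) : ‖𝐧x‖ = 1 := by
  rw [norm_smul, norm_inv, norm_norm, inv_mul_cancel₀ (norm_ne_zero_iff.2 hx)]

lemma log_norm_neg {x : E m} (hx : x ∈ 𝔹) (hx0 : x ≠ 0) :
    ㏑ x < 0 := log_neg (norm_pos_iff.2 hx0) (by simpa using hx)

/-- The derivative of `log |x|`. -/
def dLog (x : E m) : E m →L[ℝ] ℝ := (‖x‖ ^ 2)⁻¹ • innerSL ℝ x

/-- The derivative of `x / |x|`. -/
def dDir (x : E m) : E m →L[ℝ] E m :=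
  ‖x‖⁻¹ • ContinuousLinearMap.id ℝ (E m) - (‖x‖ ^ 3)⁻¹ • (innerSL ℝ x).smulRight x

lemma dLog_apply (x e : E m) : dLog x e = (‖x‖ ^ 2)⁻¹ * inner ℝ x e := rfl

lemma dDir_apply (x e : E m) : dDir x e = ‖x‖⁻¹ • e - ((‖x‖ ^ 3)⁻¹ * inner ℝ x e) • x := by
  simp [dDir, smul_smul]

lemma norm_dLog_le {x : E m} (hx : x ≠ 0) : ‖dLog x‖ ≤ ‖x‖⁻¹ := by
  have hx0 : 0 < ‖x‖ := norm_pos_iff.2 hx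
  rw [dLog, norm_smul, innerSL_apply_norm, norm_inv, norm_pow, norm_norm]
  apply le_of_eq
  field_simp

lemma norm_dDir_le {x : E m} (hx : x ≠ 0) : ‖dDir x‖ ≤ 2 * ‖x‖⁻¹ := by
  have hx0 : 0 < ‖x‖ := norm_pos_iff.2 hx
  refine opNorm_le_bound _ (by positivity) fun e => ?_
  rw [dDir_apply]
  refine (norm_sub_le _ _).trans ?_
  rw [norm_smul, norm_smul, norm_mul, norm_inv, norm_norm, norm_inv, norm_pow, norm_norm]
  have h1 := norm_inner_le_norm (𝕜 := ℝ) x e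
  calc _ ≤ ‖x‖⁻¹ * ‖e‖ + (‖x‖ ^ 3)⁻¹ * (‖x‖ * ‖e‖) * ‖x‖ := by gcongr
    _ = 2 * ‖x‖⁻¹ * ‖e‖ := by field_simp; norm_num

lemma hasFDerivAt_log_norm {x : E m} (hx : x ≠ 0) :
    HasFDerivAt (fun x : E m => ㏑ x) (dLog x) x := by
  have h1 := ((hasStrictFDerivAt_norm_sq x).hasFDerivAt.log (by positivity)).const_mul (1 / 2)
  have e : (fun x : E m => 1 / 2 * log (‖x‖ ^ 2)) = fun x => ㏑ x := by
    funext y; rw [log_pow]; push_cast; ring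
  rw [e] at h1
  refine h1.congr_fderiv ?_
  ext y
  simp [dLog]
  ring

lemma hasFDerivAt_dir {x : E m} (hx : x ≠ 0) : HasFDerivAt (fun x : E m => 𝐧 x) (dDir x) x := by
  have hx0 : 0 < ‖x‖ := norm_pos_iff.2 hx
  have h1 : HasFDerivAt (fun x : E m => ‖x‖⁻¹) (-((‖x‖ ^ 3)⁻¹ • innerSL ℝ x)) x := by
    have h2 := (hasFDerivAt_log_norm hx).neg.exp
    have e : (fun x : E m => ‖x‖⁻¹) =ᶠ[𝓝 x] fun x => exp (-㏑ x) := by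
      filter_upwards [isOpen_ne.mem_nhds hx] with y hy
      rw [exp_neg, exp_log (norm_pos_iff.2 hy)]
    refine (h2.congr_of_eventuallyEq e).congr_fderiv ?_
    ext y
    simp only [dLog, Pi.neg_apply, exp_neg, exp_log hx0, _root_.smul_apply, _root_.neg_apply,
      smul_eq_mul]
    field_simp
  refine (h1.smul (hasFDerivAt_id x)).congr_fderiv ?_
  ext y
  simp [dDir]
  ring

namespace Adm

variable {g : E m × F → G} {g₁ : E m × F → G₁} {g₂ : E m × F → G₂}

lemma differentiableAt (h : Adm K g) {w : E m × F} (hw : w ∈ Reg m F) : DifferentiableAt ℝ g w :=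
  (h.contDiffOn.contDiffAt (isOpen_Reg.mem_nhds hw)).differentiableAt (by simp)

lemma of_bound (h : ContDiffOn ℝ 1 g (Reg m F)) {C : ℝ} {g' : E m × F → E m × F →L[ℝ] G} (hg : ∀ w ∈
    Reg m F, HasFDerivAt g (g' w) w) (hC : ∀ w ∈ Reg m F, w.2 ∈ K → ‖g w‖ ≤ C) (hC' : ∀ w ∈ Reg m F,
    w.2 ∈ K → ∀ e ζ, ‖g' w (e, ζ)‖ ≤ C * (‖e‖ * ‖w.1‖⁻¹ + ‖ζ‖)) : Adm K g := by
  refine ⟨h, |C|, abs_nonneg _, fun w hw hK => ⟨(hC w hw hK).trans (le_abs_self _), fun e ζ => ?_⟩⟩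
  rw [(hg w hw).fderiv]
  exact (hC' w hw hK e ζ).trans (by gcongr; exact le_abs_self _)

lemma const (c : G) : Adm K (fun _ : E m × F => c) :=
  of_bound contDiffOn_const (C := ‖c‖) (fun w _ => hasFDerivAt_const c w) (fun _ _ _ => le_rfl)
    fun w _ _ e ζ => by simp; positivity

lemma bilin (B : G₁ →L[ℝ] G₂ →L[ℝ] G) (h₁ : Adm K g₁) (h₂ : Adm K g₂) :
    Adm K fun w => B (g₁ w) (g₂ w) := by
  obtain ⟨C₁, p₁, b₁⟩ := h₁.bound
  obtain ⟨C₂, p₂, b₂⟩ := h₂.bound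
  refine of_bound (B.isBoundedBilinearMap.contDiff.comp_contDiffOn
    (h₁.contDiffOn.prodMk h₂.contDiffOn)) (C := 2 * (‖B‖ * C₁ * C₂)) (fun w hw =>
    B.hasFDerivAt_of_bilinear (h₁.differentiableAt hw).hasFDerivAt
      (h₂.differentiableAt hw).hasFDerivAt) (fun w hw hK => ?_) fun w hw hK e ζ => ?_
  · have := (b₁ w hw hK).1
    have := (b₂ w hw hK).1
    have h0 : 0 ≤ ‖B‖ * C₁ * C₂ := by positivity
    calc _ ≤ ‖B‖ * ‖g₁ w‖ * ‖g₂ w‖ := B.le_opNorm₂ _ _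
      _ ≤ ‖B‖ * C₁ * C₂ := by gcongr
      _ ≤ _ := by linarith
  · obtain ⟨a₁, d₁⟩ := b₁ w hw hK
    obtain ⟨a₂, d₂⟩ := b₂ w hw hK
    have d₁ := d₁ e ζ
    have d₂ := d₂ e ζ
    set n := ‖e‖ * ‖w.1‖⁻¹ + ‖ζ‖
    simp only [_root_.add_apply, ContinuousLinearMap.precompR_apply,
      ContinuousLinearMap.precompL_apply]
    calc _ ≤ ‖B (g₁ w) (fderiv ℝ g₂ w (e, ζ))‖ + ‖B (fderiv ℝ g₁ w (e, ζ)) (g₂ w)‖ :=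
          norm_add_le _ _
      _ ≤ ‖B‖ * C₁ * (C₂ * n) + ‖B‖ * (C₁ * n) * C₂ := by
        refine add_le_add ((B.le_opNorm₂ _ _).trans (by gcongr))
          ((B.le_opNorm₂ _ _).trans (by gcongr))
      _ = _ := by ring

lemma clm (L : G₁ →L[ℝ] G) (h : Adm K g₁) : Adm K fun w => L (g₁ w) := by
  obtain ⟨C, p, b⟩ := h.bound
  refine of_bound (L.contDiff.comp_contDiffOn h.contDiffOn) (C := ‖L‖ * C)
    (fun w hw => L.hasFDerivAt.comp w (h.differentiableAt hw).hasFDerivAt)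
    (fun w hw hK => (L.le_opNorm _).trans (by gcongr; exact (b w hw hK).1)) fun w hw hK e ζ => ?_
  simp only [comp_apply]
  refine (L.le_opNorm _).trans ?_
  rw [mul_assoc]
  gcongr
  exact (b w hw hK).2 e ζ

lemma add (h₁ : Adm K g) {g₂ : E m × F → G} (h₂ : Adm K g₂) : Adm K fun w => g w + g₂ w := by
  obtain ⟨C₁, p₁, b₁⟩ := h₁.bound
  obtain ⟨C₂, p₂, b₂⟩ := h₂.bound
  refine of_bound (h₁.contDiffOn.add h₂.contDiffOn) (C := C₁ + C₂) (fun w hw =>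
    (h₁.differentiableAt hw).hasFDerivAt.add (h₂.differentiableAt hw).hasFDerivAt)
    (fun w hw hK => (norm_add_le _ _).trans (add_le_add (b₁ w hw hK).1 (b₂ w hw hK).1))
    fun w hw hK e ζ => ?_
  rw [_root_.add_apply, add_mul]
  exact (norm_add_le _ _).trans (add_le_add ((b₁ w hw hK).2 e ζ) ((b₂ w hw hK).2 e ζ))

lemma neg (h : Adm K g) : Adm K fun w => -g w := by simpa using h.clm (-ContinuousLinearMap.id ℝ G)

lemma sub (h₁ : Adm K g) {g₂ : E m × F → G} (h₂ : Adm K g₂) : Adm K fun w => g w - g₂ w := by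
  simpa [sub_eq_add_neg] using h₁.add h₂.neg

lemma mul {g₁ g₂ : E m × F → ℝ} (h₁ : Adm K g₁) (h₂ : Adm K g₂) : Adm K fun w => g₁ w * g₂ w :=
  h₁.bilin (ContinuousLinearMap.mul ℝ ℝ) h₂

lemma pow {g : E m × F → ℝ} (h : Adm K g) (k : ℕ) : Adm K fun w => g w ^ k := by
  induction k with
  | zero => simpa using const (1 : ℝ)
  | succ k ih => simpa [pow_succ] using ih.mul h

lemma smul {g₁ : E m × F → ℝ} (h₁ : Adm K g₁) (h₂ : Adm K g) : Adm K fun w => g₁ w • g w :=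
  h₁.bilin (ContinuousLinearMap.lsmul ℝ ℝ) h₂

lemma inner {g₁ g₂ : E m × F → H} (h₁ : Adm K g₁) (h₂ : Adm K g₂) : Adm K fun w => inner ℝ (g₁ w) (g₂ w) :=
  h₁.bilin (innerSL ℝ) h₂

lemma of_snd {ψ : F → G} (hψ : ContDiff ℝ 1 ψ) {C C' : ℝ} (hC : ∀ z ∈ K, ‖ψ z‖ ≤ C)
    (hC' : ∀ z ∈ K, ‖fderiv ℝ ψ z‖ ≤ C') : Adm K fun w : E m × F => ψ w.2 := by
  refine of_bound (hψ.comp_contDiffOn contDiffOn_snd) (C := max C C') (fun w hw =>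
    ((hψ.differentiable (by simp) w.2).hasFDerivAt.comp w hasFDerivAt_snd))
    (fun w _ hK => (hC _ hK).trans (le_max_left _ _)) fun w hw hK e ζ => ?_
  have h0 : 0 ≤ C' := (norm_nonneg _).trans (hC' _ hK)
  simp only [comp_apply, ContinuousLinearMap.coe_snd']
  calc _ ≤ ‖fderiv ℝ ψ w.2‖ * ‖ζ‖ := le_opNorm _ _
    _ ≤ max C C' * ‖ζ‖ := by gcongr; exact (hC' _ hK).trans (le_max_right _ _)
    _ ≤ _ := by gcongr; exact le_add_of_nonneg_left (by positivity)

lemma snd_snd {F₁ F₂ : Type*} [NormedAddCommGroup F₁] [NormedSpace ℝ F₁] [NormedAddCommGroup F₂]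
    [NormedSpace ℝ F₂] {R : ℝ} : Adm {z : F₁ × F₂ | ‖z.2‖ ≤ R} fun w : E m × (F₁ × F₂) => w.2.2 :=
  of_snd (ψ := Prod.snd) contDiff_snd (fun _ hz => hz) fun z _ => by rw [fderiv_snd]

/-- Functions of `x` alone. -/
lemma of_fst {ψ : E m → G} {ψ' : E m → E m →L[ℝ] G} {C : ℝ} (hs : ContDiffOn ℝ 1 ψ (𝔹 \ {0})) (hψ :
    ∀ x ∈ 𝔹, x ≠ 0 → HasFDerivAt ψ (ψ' x) x) (hC : ∀ x ∈ 𝔹, x ≠ 0 → ‖ψ x‖ ≤ C) (hC' : ∀ x ∈ 𝔹, x ≠ 0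
    → ‖ψ' x‖ ≤ C * ‖x‖⁻¹) : Adm K fun w : E m × F => ψ w.1 := by
  refine of_bound (hs.comp contDiffOn_fst fun w hw => hw.1) (C := C) (fun w hw =>
    ((hψ w.1 (mem_Reg.1 hw).1 (mem_Reg.1 hw).2).comp w hasFDerivAt_fst))
    (fun w hw _ => hC _ (mem_Reg.1 hw).1 (mem_Reg.1 hw).2) fun w hw hK e ζ => ?_
  have h0 : 0 ≤ C := (norm_nonneg _).trans (hC w.1 (mem_Reg.1 hw).1 (mem_Reg.1 hw).2)
  simp only [comp_apply, ContinuousLinearMap.coe_fst']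
  calc _ ≤ ‖ψ' w.1‖ * ‖e‖ := le_opNorm _ _
    _ ≤ C * ‖w.1‖⁻¹ * ‖e‖ := by gcongr; exact hC' _ (mem_Reg.1 hw).1 (mem_Reg.1 hw).2
    _ = C * (‖e‖ * ‖w.1‖⁻¹ + 0) := by ring
    _ ≤ _ := by gcongr; exact norm_nonneg _

lemma radial {γ : ℝ → G} (hs : ContDiffOn ℝ 1 γ (Iio 0)) {γ' : ℝ → G} {C : ℝ}
    (hγ : ∀ t < 0, HasDerivAt γ (γ' t) t) (hC : ∀ t < 0, ‖γ t‖ ≤ C) (hC' : ∀ t < 0, ‖γ' t‖ ≤ C) :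
    Adm K fun w : E m × F => γ ㏑w.1 := by
  refine of_fst (ψ := fun x => γ ㏑x) (C := C) (hs.comp ?_ fun x hx => log_norm_neg hx.1 hx.2)
    (fun x hx hx0 => (hγ _ (log_norm_neg hx hx0)).hasFDerivAt.comp x (hasFDerivAt_log_norm hx0))
    (fun x hx hx0 => hC _ (log_norm_neg hx hx0)) fun x hx hx0 => ?_
  · exact fun x hx => ((contDiffAt_norm ℝ hx.2).log (norm_ne_zero_iff.2 hx.2)).contDiffWithinAt
  · rw [ContinuousLinearMap.toSpanSingleton_comp, ContinuousLinearMap.norm_smulRight_apply, mul_comm]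
    gcongr
    · exact (norm_nonneg _).trans (hC' _ (log_norm_neg hx hx0))
    · exact hC' _ (log_norm_neg hx hx0)
    · exact norm_dLog_le hx0

lemma dir : Adm K fun w : E m × F => 𝐧 w.1 := by
  refine of_fst (ψ := fun x : E m => 𝐧 x) (C := 2) (fun x hx => ?_) (fun x hx hx0 =>
    hasFDerivAt_dir hx0) (fun x hx hx0 => ?_) fun x hx hx0 => ?_
  · exact (((contDiffAt_norm ℝ hx.2).inv (norm_ne_zero_iff.2 hx.2)).smul
      contDiffAt_id).contDiffWithinAt
  · rw [norm_dir hx0]; norm_num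
  · exact norm_dDir_le hx0

/-- Precomposition with a bounded truncation of the second component makes local bounds global. -/
lemma truncated {F₁ F₂ : Type*} [NormedAddCommGroup F₁] [NormedSpace ℝ F₁] [NormedAddCommGroup F₂]
    [NormedSpace ℝ F₂] {g : E m × (F₁ × F₂) → G} {τ : F₂ → F₂} {C R : ℝ} (hτ : ContDiff ℝ 1 τ) (hR :
    ∀ z, ‖τ z‖ ≤ R) (hC : ∀ z, ‖fderiv ℝ τ z‖ ≤ C) (h : Adm {z : F₁ × F₂ | ‖z.2‖ ≤ R} g) : Adm univ
    fun w : E m × (F₁ × F₂) => g (w.1, w.2.1, τ w.2.2) := by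
  obtain ⟨C₁, p₁, b₁⟩ := h.bound
  have hmem : ∀ w ∈ Reg m (F₁ × F₂), ((w.1, w.2.1, τ w.2.2) : E m × (F₁ × F₂)) ∈ Reg m (F₁ × F₂) :=
    fun w hw => mem_Reg.2 (mem_Reg.1 hw)
  have hC0 : 0 ≤ C := (norm_nonneg _).trans (hC 0)
  have hcd : ContDiff ℝ 1 fun w : E m × (F₁ × F₂) => ((w.1, w.2.1, τ w.2.2) : E m × (F₁ × F₂)) := by
    fun_prop
  have hd : ∀ w : E m × (F₁ × F₂), HasFDerivAt (fun w : E m × (F₁ × F₂) => ((w.1, w.2.1, τ w.2.2) :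
      E m × (F₁ × F₂))) ((fst ℝ _ _).prod (((fst ℝ _ _).comp (snd ℝ _ _)).prod ((fderiv ℝ τ
      w.2.2).comp ((snd ℝ _ _).comp (snd ℝ _ _))))) w := fun w =>
    hasFDerivAt_fst.prodMk ((hasFDerivAt_fst.comp w hasFDerivAt_snd).prodMk ((hτ.differentiable (by
      simp) w.2.2).hasFDerivAt.comp w (hasFDerivAt_snd.comp w hasFDerivAt_snd)))
  refine of_bound (h.contDiffOn.comp hcd.contDiffOn hmem) (C := C₁ * (1 + C))
    (fun w hw => (h.differentiableAt (hmem w hw)).hasFDerivAt.comp w (hd w))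
    (fun w hw _ => ((b₁ _ (hmem w hw) (hR _)).1).trans (by nlinarith)) fun w hw _ e ζ => ?_
  have := (b₁ _ (hmem w hw) (hR _)).2 e (ζ.1, fderiv ℝ τ w.2.2 ζ.2)
  refine this.trans ?_
  have h1 : ‖fderiv ℝ τ w.2.2 ζ.2‖ ≤ C * ‖ζ‖ := (le_opNorm _ _).trans
    (by gcongr; exacts [hC _, norm_snd_le ζ])
  have h2 : ‖(ζ.1, fderiv ℝ τ w.2.2 ζ.2)‖ ≤ (1 + C) * ‖ζ‖ := by
    rw [Prod.norm_def, max_le_iff]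
    have := norm_fst_le ζ
    constructor <;> nlinarith [norm_nonneg ζ]
  have h3 : ‖e‖ * ‖w.1‖⁻¹ ≤ (1 + C) * (‖e‖ * ‖w.1‖⁻¹) :=
    le_mul_of_one_le_left (by positivity) (by linarith)
  calc C₁ * (‖e‖ * ‖w.1‖⁻¹ + ‖(ζ.1, fderiv ℝ τ w.2.2 ζ.2)‖)
      ≤ C₁ * ((1 + C) * (‖e‖ * ‖w.1‖⁻¹) + (1 + C) * ‖ζ‖) := by gcongr
    _ = _ := by ring

end Adm

end Admissible

section NullLagrangian

/-- `D` lies in the closure of the test functions, with derivative `DD`. -/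
structure IsW1pZero (p : ℝ) (D : E m → F) (DD : E m → E m →L[ℝ] F) : Prop where
  memLp : MemLp D (ofReal p) μ𝔹
  memLp_deriv : MemLp DD (ofReal p) μ𝔹
  approx : ∃ φ : ℕ → E m → F, (∀ k, ContDiff ℝ ∞ (φ k) ∧ tsupport (φ k) ⊆ 𝔹) ∧ Tendsto (fun k =>
    eLpNorm (fun x => D x - φ k x) (ofReal p) μ𝔹) atTop (𝓝 0) ∧ Tendsto (fun k => eLpNorm (fun x =>
    DD x - fderiv ℝ (φ k) x) (ofReal p) μ𝔹) atTop (𝓝 0)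

/-- The `e`-derivative of `|x|^{1-p} g(x, D(x))` according to the chain rule, with `A` in place of
the derivative of `D`. -/
def chainTerm (p : ℝ) (g : E m × F → ℝ) (D : E m → F) (A : E m → E m →L[ℝ] F)
    (e : E m) (x : E m) : ℝ :=
  (1 - p) * ‖x‖ ^ (-1 - p) * inner ℝ x e * g (x, D x) +
    ‖x‖ ^ (1 - p) * fderiv ℝ g (x, D x) (e, A x e)

lemma hasFDerivAt_norm_rpow_of_ne {s : ℝ} {x : E m} (hx : x ≠ 0) :
    HasFDerivAt (fun x : E m => ‖x‖ ^ s) ((s * ‖x‖ ^ (s - 2)) • innerSL ℝ x) x := by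
  have hx0 : 0 < ‖x‖ := norm_pos_iff.2 hx
  have h := ((hasFDerivAt_log_norm hx).const_mul s).exp
  have e : (fun x : E m => ‖x‖ ^ s) =ᶠ[𝓝 x] fun x => exp (s * ㏑ x) := by
    filter_upwards [isOpen_ne.mem_nhds hx] with y hy
    rw [rpow_def_of_pos (norm_pos_iff.2 hy), mul_comm]
  refine (h.congr_of_eventuallyEq e).congr_fderiv ?_
  rw [dLog, mul_comm s, ← rpow_def_of_pos hx0, rpow_sub hx0, smul_smul, smul_smul]
  congr 1
  norm_num
  field_simp

lemma integrableOn_rpow_mul {q : E m → ℝ} (hp : 1 < p) (hpm : p < m) (hq : MemLp q (ofReal p) μ𝔹) :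
    IntegrableOn (fun x => ‖x‖ ^ (1 - p) * q x) 𝔹 ∧ ∃ C : ℝ≥0∞, C ≠ ⊤ ∧ ∀ q' : E m → ℝ,
    AEStronglyMeasurable q' μ𝔹 → eLpNorm (fun x => ‖x‖ ^ (1 - p) * q' x) 1 μ𝔹 ≤ C * eLpNorm q'
    (ofReal p) μ𝔹 := by
  have hm : 0 < m := by rify; linarith
  have hconj := HolderConjugate.conjExponent hp
  have h1 : MemLp (fun x : E m => ‖x‖ ^ (1 - p)) (ofReal p.conjExponent) μ𝔹 := by
    have hpos := hconj.symm.pos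
    have hmeas : AEStronglyMeasurable (fun x : E m => ‖x‖ ^ (1 - p)) μ𝔹 :=
      (measurable_norm.pow_const _).aestronglyMeasurable
    refine (integrable_norm_rpow_iff hmeas (by simpa using hpos) (by simp)).1 ?_
    refine (integrableOn_norm_rpow_neg hm hpm 1).congr (ae_of_all _ fun x => ?_)
    simp only
    rw [ENNReal.toReal_ofReal hpos.le, norm_of_nonneg (by positivity), ← rpow_mul (norm_nonneg _)]
    congr 1
    have : p - 1 ≠ 0 := by linarith
    rw [conjExponent]; field_simp; ring
  have : ENNReal.HolderTriple (ofReal p.conjExponent) (ofReal p) 1 :=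
    ENNReal.HolderConjugate.symm (hpq := hconj.ennrealOfReal)
  exact ⟨memLp_one_iff_integrable.1 (hq.mul' h1), _, h1.2.ne, fun q' hq' =>
    eLpNorm_smul_le_mul_eLpNorm (f := q') (φ := fun x : E m => ‖x‖ ^ (1 - p)) hq' h1.1⟩

variable {g : E m × F → ℝ} {D : E m → F} {DD : E m → E m →L[ℝ] F}

lemma Adm.abs_chainTerm_le (hp : 1 < p) {C : ℝ} (hC : ∀ w ∈ Reg m F, ‖g w‖ ≤ C ∧
      ∀ e ζ, ‖fderiv ℝ g w (e, ζ)‖ ≤ C * (‖e‖ * ‖w.1‖⁻¹ + ‖ζ‖)) {x : E m} (hx : x ∈ 𝔹)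
    (hx0 : x ≠ 0) (D : E m → F) (A : E m → E m →L[ℝ] F) (e : E m) :
    ‖chainTerm p g D A e x‖ ≤ p * C * ‖e‖ * ‖x‖ ^ (-p) + C * (‖x‖ ^ (1 - p) * ‖A x e‖) := by
  obtain ⟨h1, h2⟩ := hC (x, D x) (mem_Reg.2 ⟨hx, hx0⟩)
  have h2 := h2 e (A x e)
  have hx' : 0 < ‖x‖ := norm_pos_iff.2 hx0
  have e1 : ‖x‖ ^ (-1 - p) * ‖x‖ = ‖x‖ ^ (-p) := by rw [← rpow_add_one hx'.ne']; ring_nf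
  have e2 : ‖x‖ ^ (1 - p) * ‖x‖⁻¹ = ‖x‖ ^ (-p) := by
    rw [← div_eq_mul_inv, ← rpow_sub_one hx'.ne']; ring_nf
  have hC0 : 0 ≤ C := (norm_nonneg _).trans h1
  unfold chainTerm
  refine (norm_add_le _ _).trans ?_
  simp only [norm_mul]
  rw [norm_of_nonneg (rpow_nonneg (norm_nonneg x) _),
    norm_of_nonneg (rpow_nonneg (norm_nonneg x) _), norm_of_nonpos (by linarith)]
  have h3 := norm_inner_le_norm (𝕜 := ℝ) x e
  obtain ⟨c, hc⟩ : ∃ c, c = -(1 - p) := ⟨_, rfl⟩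
  have hc0 : 0 ≤ c := by linarith
  rw [← hc]
  calc _ ≤ c * ‖x‖ ^ (-1 - p) * (‖x‖ * ‖e‖) * C +
        ‖x‖ ^ (1 - p) * (C * (‖e‖ * ‖x‖⁻¹ + ‖A x e‖)) := by gcongr
    _ = (p - 1) * C * ‖e‖ * (‖x‖ ^ (-1 - p) * ‖x‖) + C * ‖e‖ * (‖x‖ ^ (1 - p) * ‖x‖⁻¹) +
        C * (‖x‖ ^ (1 - p) * ‖A x e‖) := by rw [hc]; ring
    _ = _ := by rw [e1, e2]; ring

lemma Adm.continuousOn_chain (h : Adm univ g) {φ : E m → F} (hφ : Continuous φ) : ContinuousOn (fun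
    x => g (x, φ x)) (𝔹 \ {0}) ∧ ContinuousOn (fun x => fderiv ℝ g (x, φ x)) (𝔹 \ {0}) := by
  have h1 : ContinuousOn (fun x => (x, φ x)) (𝔹 \ {0}) := by fun_prop
  have h2 : Set.MapsTo (fun x => (x, φ x)) (𝔹 \ {0}) (Reg m F) :=
    fun x hx => mem_Reg.2 hx
  exact ⟨h.contDiffOn.continuousOn.comp h1 h2,
    (h.contDiffOn.continuousOn_fderiv_of_isOpen isOpen_Reg le_rfl).comp h1 h2⟩

lemma Adm.aestronglyMeasurable_chainTerm (h : Adm univ g) (hm : 0 < m) {φ : E m → F} (hφ :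
    Continuous φ) {A : E m → E m →L[ℝ] F} (hA : AEStronglyMeasurable A μ𝔹) (e : E m) :
    AEStronglyMeasurable (chainTerm p g φ A e) μ𝔹 := by
  obtain ⟨c1, c2⟩ := h.continuousOn_chain hφ
  have : SecondCountableTopologyEither (E m) (E m × F →L[ℝ] ℝ) :=
    secondCountableTopologyEither_of_left _ _
  have m1 := aesm_of_continuousOn_punctured hm c1
  have m2 := aesm_of_continuousOn_punctured hm c2
  have m3 : AEStronglyMeasurable (fun x => fderiv ℝ g (x, φ x) (e, A x e)) μ𝔹 :=
    isBoundedBilinearMap_apply.continuous.comp_aestronglyMeasurable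
      (m2.prodMk (aestronglyMeasurable_const.prodMk (hA.apply_continuousLinearMap e)))
  have m4 : ∀ s : ℝ, AEStronglyMeasurable (fun x : E m => ‖x‖ ^ s) μ𝔹 := fun s =>
    (measurable_norm.pow_const _).aestronglyMeasurable
  have m5 : AEStronglyMeasurable (fun x : E m => Inner.inner ℝ x e) μ𝔹 :=
    (by fun_prop : Continuous fun x : E m => Inner.inner ℝ x e).aestronglyMeasurable
  exact ((((m4 _).const_mul _).mul m5).mul m1).add ((m4 _).mul m3)

lemma Adm.integrableOn_chainTerm (h : Adm univ g) (hp : 1 < p) (hpm : p < m) {φ : E m → F} {A : E m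
    → E m →L[ℝ] F} (e : E m) (hA : MemLp A (ofReal p) μ𝔹) (hmeas : AEStronglyMeasurable (chainTerm p
    g φ A e) μ𝔹) : IntegrableOn (chainTerm p g φ A e) 𝔹 := by
  have hm : 0 < m := by rify; linarith
  obtain ⟨C, hC0, hC⟩ := h.bound
  have hA' : MemLp (fun x => ‖A x e‖) (ofReal p) μ𝔹 :=
    ((ContinuousLinearMap.apply ℝ F e).comp_memLp' hA).norm
  refine Integrable.mono' (((integrableOn_norm_rpow_neg hm hpm 1).const_mul (p * C * ‖e‖)).add
    ((integrableOn_rpow_mul hp hpm hA').1.const_mul C)) hmeas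
    (ae_restrict_punctured hm fun x hx hx0 => ?_)
  exact abs_chainTerm_le hp (fun w hw => hC w hw (mem_univ _)) hx hx0 φ A e

lemma memLp_fderiv {φ : E m → F} (hφ : ContDiff ℝ ∞ φ) : MemLp (fderiv ℝ φ) (ofReal p) μ𝔹 := by
  have hdc : Continuous (fderiv ℝ φ) := hφ.continuous_fderiv (by simp)
  obtain ⟨B, hB⟩ := (isCompact_closedBall (0 : E m) 1).exists_bound_of_continuousOn hdc.continuousOn
  exact MemLp.of_bound hdc.aestronglyMeasurable B (ae_restrict_of_forall_mem measurableSet_ball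
    fun x hx => hB x (ball_subset_closedBall hx))

lemma Adm.integral_chainTerm_smooth (h : Adm univ g) (hp : 1 < p) (hpm : p < m)
    (h0 : ∀ x ∈ 𝔹, x ≠ 0 → g (x, 0) = 0) {φ : E m → F}
    (hφ : ContDiff ℝ ∞ φ) (hs : tsupport φ ⊆ 𝔹) (e : E m) :
    ∫ x in 𝔹, chainTerm p g φ (fderiv ℝ φ) e x = 0 := by
  have hm : 0 < m := by rify; linarith
  have hm1 : 1 < m := by rify; linarith
  obtain ⟨C, hC0, hC⟩ := h.bound
  have hdc : Continuous (fderiv ℝ φ) := hφ.continuous_fderiv (by simp)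
  have hi' := h.integrableOn_chainTerm hp hpm e (memLp_fderiv hφ)
    (h.aestronglyMeasurable_chainTerm hm hφ.continuous hdc.aestronglyMeasurable e)
  set f : E m → ℝ := (𝔹).indicator fun x => ‖x‖ ^ (1 - p) * g (x, φ x)
  have hg0 : ∀ x ∈ 𝔹, x ≠ 0 → ‖g (x, φ x)‖ ≤ C := fun x hx hx0 =>
    (hC (x, φ x) (mem_Reg.2 ⟨hx, hx0⟩) (mem_univ _)).1
  have hbase : AEStronglyMeasurable (fun x => ‖x‖ ^ (1 - p) * g (x, φ x))
      μ𝔹 :=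
    ((measurable_norm.pow_const _).aestronglyMeasurable).mul
      (aesm_of_continuousOn_punctured hm (h.continuousOn_chain hφ.continuous).1)
  have hf1 : Integrable f := by
    rw [integrable_indicator_iff isOpen_ball.measurableSet]
    refine ((integrableOn_norm_rpow_neg hm (α := p - 1) (by linarith) 1).const_mul C).mono' hbase
      (ae_restrict_punctured hm fun x hx hx0 => ?_)
    rw [norm_mul, norm_of_nonneg (by positivity), neg_sub, mul_comm]
    gcongr
    exact hg0 x hx hx0
  have hf2 : Integrable fun x => ‖x‖⁻¹ • f x := by
    have e1 : (fun x => ‖x‖⁻¹ • f x) = (𝔹).indicator fun x =>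
        ‖x‖⁻¹ * (‖x‖ ^ (1 - p) * g (x, φ x)) := by
      funext x
      simp only [f, Set.indicator]
      split_ifs <;> simp
    rw [e1, integrable_indicator_iff isOpen_ball.measurableSet]
    refine ((integrableOn_norm_rpow_neg hm hpm 1).const_mul C).mono'
      ((measurable_norm.inv.aestronglyMeasurable).mul hbase)
      (ae_restrict_punctured hm fun x hx hx0 => ?_)
    have hx' : 0 < ‖x‖ := norm_pos_iff.2 hx0
    have e2 : ‖x‖⁻¹ * ‖x‖ ^ (1 - p) = ‖x‖ ^ (-p) := by
      rw [mul_comm, ← div_eq_mul_inv, ← rpow_sub_one hx'.ne']; ring_nf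
    rw [← mul_assoc, e2, norm_mul, norm_of_nonneg (by positivity), mul_comm]
    gcongr
    exact hg0 x hx hx0
  set f' : E m → E m →L[ℝ] ℝ := (𝔹).indicator fun x =>
    ‖x‖ ^ (1 - p) • (fderiv ℝ g (x, φ x)).comp ((ContinuousLinearMap.id ℝ (E m)).prod (fderiv ℝ φ x))
      + g (x, φ x) • (((1 - p) * ‖x‖ ^ (1 - p - 2)) • innerSL ℝ x)
  have hf'e : (fun x => f' x e) =
      (𝔹).indicator (chainTerm p g φ (fderiv ℝ φ) e) := by
    funext x
    simp only [f', Set.indicator]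
    split_ifs
    · simp [chainTerm]
      ring_nf
    · simp
  have key := integral_fderiv_eq_zero_of_punctured (f := f) (f' := f') e ?_ hf1
    (by rw [hf'e, integrable_indicator_iff isOpen_ball.measurableSet]; exact hi') hf2
    (volume_singleton_zero hm)
  · rw [hf'e, integral_indicator isOpen_ball.measurableSet] at key
    exact key
  · intro x hx
    by_cases hb : x ∈ 𝔹
    · have hfe : f =ᶠ[𝓝 x] fun x => ‖x‖ ^ (1 - p) * g (x, φ x) := by
        filter_upwards [isOpen_ball.mem_nhds hb] with y hy
        exact Set.indicator_of_mem hy _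
      have hd := (h.differentiableAt (w := (x, φ x)) (mem_Reg.2 ⟨hb, hx⟩)).hasFDerivAt.comp x
        ((hasFDerivAt_id x).prodMk (hφ.differentiable (by simp) x).hasFDerivAt)
      refine HasFDerivAt.congr_of_eventuallyEq ?_ hfe
      simp only [f', Set.indicator_of_mem hb]
      exact (hasFDerivAt_norm_rpow_of_ne hx).mul hd
    · have hts : x ∉ tsupport φ := fun hc => hb (hs hc)
      have hfe : f =ᶠ[𝓝 x] fun _ => 0 := by
        filter_upwards [(isClosed_tsupport φ).isOpen_compl.mem_nhds hts, isOpen_ne.mem_nhds hx]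
          with y hy hy0
        by_cases hyb : y ∈ 𝔹
        · simp only [f, Set.indicator_of_mem hyb]
          rw [image_eq_zero_of_notMem_tsupport hy, h0 y hyb hy0, mul_zero]
        · exact Set.indicator_of_notMem hyb _
      simp only [f', Set.indicator_of_notMem hb]
      exact (hasFDerivAt_const (0 : ℝ) x).congr_of_eventuallyEq hfe

/-- Divergence terms do not see admissible perturbations with zero boundary values. -/
theorem Adm.integral_chainTerm (h : Adm univ g) (hp : 1 < p) (hpm : p < m) (h0 : ∀ x ∈ 𝔹, x ≠ 0 → g
    (x, 0) = 0) (hD : IsW1pZero p D DD) (e : E m) : IntegrableOn (chainTerm p g D DD e) 𝔹 ∧ ∫ x in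
    𝔹, chainTerm p g D DD e x = 0 := by
  have hm : 0 < m := by rify; linarith
  obtain ⟨φ, hφ, l1, l2⟩ := hD.approx
  have hmeasφ : ∀ k, AEStronglyMeasurable (φ k) μ𝔹 :=
    fun k => (hφ k).1.continuous.aestronglyMeasurable
  have hmeasdφ : ∀ k, AEStronglyMeasurable (fderiv ℝ (φ k)) μ𝔹 := fun k =>
    ((hφ k).1.continuous_fderiv (by simp)).aestronglyMeasurable
  have hne : ofReal p ≠ 0 := by simp; linarith
  have hmeas : TendstoInMeasure μ𝔹 φ atTop D :=
    tendstoInMeasure_of_tendsto_eLpNorm hne hmeasφ hD.memLp.1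
      (l1.congr fun k => eLpNorm_sub_comm _ _ _ _)
  obtain ⟨ns, hns, hae⟩ := hmeas.exists_seq_tendsto_ae
  obtain ⟨C, hC0, hC⟩ := h.bound
  have hC' : ∀ w ∈ Reg m F, ‖g w‖ ≤ C ∧ ∀ e ζ, ‖fderiv ℝ g w (e, ζ)‖ ≤
    C * (‖e‖ * ‖w.1‖⁻¹ + ‖ζ‖) := fun w hw => hC w hw (mem_univ _)
  have hptw : ∀ᵐ x ∂μ𝔹,
      Tendsto (fun k => chainTerm p g (φ (ns k)) DD e x) atTop (𝓝 (chainTerm p g D DD e x)) := by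
    filter_upwards [hae, ae_restrict_punctured hm (P := fun x => x ∈ 𝔹 ∧ x ≠ 0)
      fun x hx hx0 => ⟨hx, hx0⟩] with x hx hxr
    have hr : (x, D x) ∈ Reg m F := mem_Reg.2 hxr
    have hpair : Tendsto (fun k => (x, φ (ns k) x)) atTop (𝓝 (x, D x)) :=
      tendsto_const_nhds.prodMk_nhds hx
    have c1 := (h.contDiffOn.continuousOn.continuousAt (isOpen_Reg.mem_nhds hr)).tendsto.comp hpair
    have c2 := ((h.contDiffOn.continuousOn_fderiv_of_isOpen isOpen_Reg le_rfl).continuousAt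
      (isOpen_Reg.mem_nhds hr)).tendsto.comp hpair
    have c3 : Tendsto (fun k => fderiv ℝ g (x, φ (ns k) x) (e, DD x e)) atTop
        (𝓝 (fderiv ℝ g (x, D x) (e, DD x e))) :=
      ((ContinuousLinearMap.apply ℝ ℝ (e, DD x e)).continuous.tendsto _).comp c2
    exact (c1.const_mul _).add (c3.const_mul _)
  have hmS : ∀ k, AEStronglyMeasurable (chainTerm p g (φ (ns k)) DD e) μ𝔹 := fun k =>
    h.aestronglyMeasurable_chainTerm hm (hφ _).1.continuous hD.memLp_deriv.1 e
  have hint : IntegrableOn (chainTerm p g D DD e) 𝔹 :=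
    h.integrableOn_chainTerm hp hpm e hD.memLp_deriv
      (aestronglyMeasurable_of_tendsto_ae atTop hmS hptw)
  refine ⟨hint, ?_⟩
  have hDDe : MemLp (fun x => ‖DD x e‖) (ofReal p) μ𝔹 :=
    ((ContinuousLinearMap.apply ℝ F e).comp_memLp' hD.memLp_deriv).norm
  have hS : Tendsto (fun k => ∫ x in 𝔹, chainTerm p g (φ (ns k)) DD e x) atTop
      (𝓝 (∫ x in 𝔹, chainTerm p g D DD e x)) := by
    refine tendsto_integral_of_dominated_convergence (fun x => p * C * ‖e‖ * ‖x‖ ^ (-p) + C * (‖x‖ ^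
      (1 - p) * ‖DD x e‖)) hmS (((integrableOn_norm_rpow_neg hm hpm 1).const_mul (p * C * ‖e‖)).add
      ((integrableOn_rpow_mul hp hpm hDDe).1.const_mul C)) (fun k => ?_) hptw
    exact ae_restrict_punctured hm fun x hx hx0 => abs_chainTerm_le hp hC' hx hx0 _ _ e
  obtain ⟨-, B, hB, hBq⟩ := integrableOn_rpow_mul hp hpm hDDe
  have hzero : Tendsto (fun k => ∫ x in 𝔹, chainTerm p g (φ (ns k)) DD e x) atTop (𝓝 0) := by
    have hlim : Tendsto (fun k => C * ‖e‖ * (B * eLpNorm (fun x => DD x - fderiv ℝ (φ (ns k)) x)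
        (ofReal p) μ𝔹).toReal) atTop (𝓝 0) := by
      have h1 := ENNReal.Tendsto.const_mul (l2.comp hns.tendsto_atTop) (Or.inr hB)
      rw [mul_zero] at h1
      simpa using ((ENNReal.tendsto_toReal (by simp)).comp h1).const_mul (C * ‖e‖)
    refine squeeze_zero_norm' ?_ hlim
    have hfin : ∀ᶠ k in atTop, eLpNorm (fun x => DD x - fderiv ℝ (φ (ns k)) x) (ofReal p) μ𝔹 < ⊤ :=
      (l2.comp hns.tendsto_atTop).eventually_lt_const (by simp)
    filter_upwards [hfin] with k hk
    set ψ := φ (ns k) with hψ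
    have hmd : MemLp (fun x => DD x - fderiv ℝ ψ x) (ofReal p)
        μ𝔹 := ⟨hD.memLp_deriv.1.sub (hmeasdφ _), hk⟩
    have hmψ : MemLp (fderiv ℝ ψ) (ofReal p) μ𝔹 := by
      have := hD.memLp_deriv.sub hmd
      refine (memLp_congr_ae (ae_of_all _ fun x => ?_)).1 this
      simp
    have i1 := h.integrableOn_chainTerm hp hpm e hD.memLp_deriv (hmS k)
    have i2 := h.integrableOn_chainTerm hp hpm e hmψ
      (h.aestronglyMeasurable_chainTerm hm (hφ (ns k)).1.continuous (hmeasdφ _) e)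
    have hz := h.integral_chainTerm_smooth hp hpm h0 (hφ (ns k)).1 (hφ (ns k)).2 e
    have hsub : ∫ x in 𝔹, chainTerm p g ψ DD e x =
        ∫ x in 𝔹, (chainTerm p g ψ DD e x - chainTerm p g ψ (fderiv ℝ ψ) e x) := by
      rw [integral_sub i1 i2, hz, sub_zero]
    rw [hsub]
    have hn : MemLp (fun x => ‖DD x - fderiv ℝ ψ x‖) (ofReal p) μ𝔹 := hmd.norm
    have hI := (integrableOn_rpow_mul hp hpm hn).1
    refine (norm_integral_le_of_norm_le (hI.const_mul (C * ‖e‖))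
      (ae_restrict_punctured hm fun x hx hx0 => ?_)).trans ?_
    · have e1 : chainTerm p g ψ DD e x - chainTerm p g ψ (fderiv ℝ ψ) e x =
          ‖x‖ ^ (1 - p) * fderiv ℝ g (x, ψ x) (0, (DD x - fderiv ℝ ψ x) e) := by
        have : ((0 : E m), (DD x - fderiv ℝ ψ x) e) = (e, DD x e) - (e, fderiv ℝ ψ x e) := by simp
        rw [this, map_sub]
        unfold chainTerm
        ring
      rw [e1, norm_mul, norm_of_nonneg (by positivity)]
      have h2 := (hC' (x, ψ x) (mem_Reg.2 ⟨hx, hx0⟩)).2 0 ((DD x - fderiv ℝ ψ x) e)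
      rw [norm_zero, zero_mul, zero_add] at h2
      have h3 := (DD x - fderiv ℝ ψ x).le_opNorm e
      calc _ ≤ ‖x‖ ^ (1 - p) * (C * (‖DD x - fderiv ℝ ψ x‖ * ‖e‖)) := by
            gcongr; exact h2.trans (by gcongr)
        _ = _ := by ring
    · rw [integral_const_mul]
      refine mul_le_mul_of_nonneg_left ?_ (by positivity)
      have h4 := hBq _ hn.1
      have h5 : (∫ x in 𝔹, ‖x‖ ^ (1 - p) * ‖DD x - fderiv ℝ ψ x‖) = (eLpNorm (fun x => ‖x‖ ^ (1 - p)
          * ‖DD x - fderiv ℝ ψ x‖) 1 μ𝔹).toReal := by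
        rw [eLpNorm_one_eq_lintegral_enorm, ← integral_norm_eq_lintegral_enorm hI.1]
        refine integral_congr_ae (ae_of_all _ fun x => ?_)
        exact (norm_of_nonneg (by positivity)).symm
      rw [h5]
      refine ENNReal.toReal_mono ?_ (h4.trans (by rw [eLpNorm_norm]))
      exact ENNReal.mul_ne_top hB hk.ne
  exact tendsto_nhds_unique hS hzero

end NullLagrangian

section CalibrationAlgebra

/-- The gradient of the sphere part of the calibration is small enough away from the poles. -/
lemma sphere_inequality {ϑ c T : ℝ} (hM : 2 ≤ M) (hϑ : ϑ * lam ^ 2 = 4 * M) (hϑ1 : ϑ < 1)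
    (hϑ0 : 0 < ϑ) (hlam : 0 < lam) (hε : ε = (1 - ϑ) / 12) (hT : 0 ≤ T) (hc : T ≤ 1 - c ^ 2) :
    ((2 * M * c + ε) ^ 2 * (1 - c ^ 2) + 4 * T - 4 * T ^ 2 + 4 * (2 * M * c + ε) * c * T) / lam ^ 2
      + (c ^ 2 * M + T * (1 - 4 * c ^ 2)) ≤ M - (1 - ϑ) / 4 * (1 - c ^ 2) := by
  have hM0 : 0 < M := by linarith
  obtain ⟨N, hN⟩ : ∃ N, N = 1 - c ^ 2 - T := ⟨_, rfl⟩
  have hN0 : 0 ≤ N := by linarith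
  have hc1 : |c| ≤ 1 := abs_le_one_iff_mul_self_le_one.2 (by nlinarith)
  have hcl := (abs_le.1 hc1).2
  have hε0 : 0 < ε := by linarith
  have hε1 : ε ≤ 1 := by linarith
  have h1 : 1 / lam ^ 2 = ϑ / (4 * M) := by
    rw [div_eq_div_iff (by positivity) (by positivity)]; linarith
  obtain ⟨S, hS⟩ : ∃ S, S = M * c ^ 2 * (1 - c ^ 2) + T * (1 - T) / M + 2 * c ^ 2 * T := ⟨_, rfl⟩
  obtain ⟨R, hR⟩ : ∃ R, R = (c * ε + ε ^ 2 / (4 * M)) * (1 - c ^ 2) + ε * c ^ 1 * T / M := ⟨_, rfl⟩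
  have hsplit : ((2 * M * c + ε) ^ 2 * (1 - c ^ 2) + 4 * T - 4 * T ^ 2 +
      4 * (2 * M * c + ε) * c * T) / lam ^ 2 = ϑ * (S + R) := by
    rw [div_eq_mul_one_div, h1, hS, hR]
    field_simp
    ring
  have hRle : R ≤ 3 * ε * (1 - c ^ 2) := by
    have hΔ : 0 ≤ 1 - c ^ 2 := by linarith
    have a1 : c * ε + ε ^ 2 / (4 * M) ≤ 2 * ε := by
      have b1 : ε ^ 2 / (4 * M) ≤ ε := by
        rw [div_le_iff₀ (by positivity), sq]
        exact mul_le_mul_of_nonneg_left (by linarith) hε0.le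
      have b2 : c * ε ≤ 1 * ε := by gcongr
      linarith
    have a2 : ε * c ^ 1 * T / M ≤ ε * (1 - c ^ 2) := by
      rw [div_le_iff₀ hM0, pow_one]
      have b1 : ε * c * T ≤ ε * 1 * (1 - c ^ 2) := by gcongr
      have b2 : ε * (1 - c ^ 2) * 1 ≤ ε * (1 - c ^ 2) * M :=
        mul_le_mul_of_nonneg_left (by linarith) (mul_nonneg hε0.le hΔ)
      linarith
    linarith [mul_le_mul_of_nonneg_right a1 hΔ]
  have hdiff : M * (1 - c ^ 2) - T * (1 - 4 * c ^ 2) - S = T * (1 - 1 / M) +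
      T ^ 2 * ((M - 1) ^ 2 / M) + T * N * (2 * M - 2) + M * N ^ 2 := by
    rw [hS, hN]; field_simp; ring
  have hlow : 1 / 2 * (1 - c ^ 2) ^ 2 ≤ M * (1 - c ^ 2) - T * (1 - 4 * c ^ 2) - S := by
    rw [hdiff]
    have b1 : 1 / 2 ≤ (M - 1) ^ 2 / M := by rw [le_div_iff₀ hM0]; nlinarith
    have b2 : 0 ≤ T * (1 - 1 / M) := by
      have : 1 / M ≤ 1 := by rw [div_le_one hM0]; linarith
      exact mul_nonneg hT (by linarith)
    have b3 := mul_le_mul_of_nonneg_left b1 (sq_nonneg T)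
    have b4 : T * N * 2 ≤ T * N * (2 * M - 2) :=
      mul_le_mul_of_nonneg_left (by linarith) (mul_nonneg hT hN0)
    have b5 : 2 * N ^ 2 ≤ M * N ^ 2 := by gcongr
    have : 1 - c ^ 2 = T + N := by rw [hN]; ring
    have b6 : (T + N) ^ 2 = T ^ 2 + 2 * (T * N) + N ^ 2 := by ring
    rw [this, b6]
    linarith [mul_nonneg hT hN0, sq_nonneg N]
  have hSlow : 2 * c ^ 2 * (1 - c ^ 2) ≤ S := by
    have b1 : 0 ≤ T * (1 - T) / M := by
      exact div_nonneg (mul_nonneg hT (by linarith [sq_nonneg c])) hM0.le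
    have b2 : 2 * (c ^ 2 * (1 - c ^ 2)) ≤ M * (c ^ 2 * (1 - c ^ 2)) :=
      mul_le_mul_of_nonneg_right hM (mul_nonneg (sq_nonneg c) (by linarith))
    linarith [mul_nonneg (sq_nonneg c) hT]
  rw [hsplit]
  have hΔ : 0 ≤ 1 - c ^ 2 := by linarith
  have f1 : (1 - ϑ) * (2 * c ^ 2 * (1 - c ^ 2)) ≤ (1 - ϑ) * S :=
    mul_le_mul_of_nonneg_left hSlow (by linarith)
  have f2 : ϑ * R ≤ ϑ * (3 * ε * (1 - c ^ 2)) := mul_le_mul_of_nonneg_left hRle hϑ0.le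
  have f3 : ϑ * (3 * ε * (1 - c ^ 2)) ≤ 1 * (3 * ε * (1 - c ^ 2)) :=
    mul_le_mul_of_nonneg_right hϑ1.le (by positivity)
  have f4 : (1 - ϑ) / 2 * (1 - c ^ 2) ^ 2 ≤ 1 / 2 * (1 - c ^ 2) ^ 2 := by gcongr; linarith
  have f5 : (1 - ϑ) / 2 * (1 - c ^ 2) = (1 - ϑ) / 2 * (1 - c ^ 2) ^ 2 +
      (1 - ϑ) / 2 * (c ^ 2 * (1 - c ^ 2)) := by ring
  have f6 : 0 ≤ (1 - ϑ) * (c ^ 2 * (1 - c ^ 2)) :=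
    mul_nonneg (by linarith) (mul_nonneg (sq_nonneg c) hΔ)
  rw [hε] at f3 f2
  linarith

lemma cap_defect_le {s q e b : ℝ} (hs0 : 0 < s) (hs1 : s ≤ 1 / 8) (hq0 : 0 ≤ q) (hqβ : q ≤ β)
    (hβ : 2 ≤ β) (he : e ^ 2 ≤ s ^ 4 * q) (hb : 1 / 10 * β * (1 - s) ≤ b) :
    (e - 1 / 10 * q) ^ 2 / b ≤ (1 / 10 + 8 / 10 * s) * q := by
  have hb0 : 0 < b := lt_of_lt_of_le (by
    have : 0 < 1 - s := by linarith
    positivity) hb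
  rw [div_le_iff₀ hb0]
  have a1 : (e - 1 / 10 * q) ^ 2 ≤ (1 + s) * (1 / 100 * q ^ 2) + (1 + 1 / s) * e ^ 2 := by
    have a0 : 0 ≤ (s * (1 / 10 * q) + e) ^ 2 / s := by positivity
    have a00 : (s * (1 / 10 * q) + e) ^ 2 / s = s * (1 / 100 * q ^ 2) +
        2 * (1 / 10 * q) * e + 1 / s * e ^ 2 := by field_simp; ring
    linarith
  have a2 : (1 + 1 / s) * e ^ 2 ≤ (1 + 1 / s) * (s ^ 4 * q) := by gcongr
  have a3 : (1 + 1 / s) * (s ^ 4 * q) = (s ^ 4 + s ^ 3) * q := by field_simp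
  have a4 : (1 / 10 + 8 / 10 * s) * q * (1 / 10 * β * (1 - s)) ≤ (1 / 10 + 8 / 10 * s) * q * b :=
    mul_le_mul_of_nonneg_left hb (by positivity)
  have a5 : (1 + s) * (1 / 100 * q ^ 2) ≤ (1 + s) * (1 / 100 * (q * β)) := by rw [sq]; gcongr
  have s2 : s ^ 2 ≤ s * (1 / 8) := by rw [sq]; gcongr
  have s3 : s ^ 3 ≤ s * (1 / 8) ^ 2 := by rw [pow_succ' s 2]; gcongr
  have s4 : s ^ 4 ≤ s * (1 / 8) ^ 3 := by rw [pow_succ' s 3]; gcongr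
  have a6 : 2 * (1 / 100 * (6 * s - 8 * s ^ 2)) ≤ β * (1 / 100 * (6 * s - 8 * s ^ 2)) :=
    mul_le_mul_of_nonneg_right hβ (by linarith)
  have a7 : s ^ 4 + s ^ 3 ≤ β * (1 / 100 * (6 * s - 8 * s ^ 2)) := by linarith
  have a8 := mul_le_mul_of_nonneg_right a7 hq0
  linarith

/-- The calibration field is admissible: the core estimate. -/
lemma field_norm_le {g₁ s B q e₁ e₂ w S N Δ U αq γq b : ℝ} (hM : 1 ≤ M) (hs0 : 0 < s) (hs1 : s ≤ 1 /
    8) (hk : 4 * k₁ ^ 2 ≤ M * (1 - 4 * s)) (hg0 : 0 ≤ g₁) (hg1 : g₁ ≤ 1) (hα : αq ≤ U - 4 * k₁ * w +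
    (4 * k₁ ^ 2 + s ^ 2) * q) (hγ : γq ≤ s + 8 * q) (hw : M * (2 * e₁ + e₂) = 4 * k₁ * w) (hq0 : 0 ≤
    q) (hqβ : q ≤ β) (hβ : 2 ≤ β) (hβB : β - s / 20 ≤ B) (he1 : |e₁| ≤ s / 20) (he2 : |e₂| ≤ s / 20)
    (he12 : (e₁ + e₂) ^ 2 ≤ s ^ 4 * q) (hb : B - e₂ - 9 / 10 * q ≤ b) (hS : 0 ≤ S) (hSN : S + N ≤ M
    - g₁ * Δ) (hN0 : 0 ≤ N) (hNM : N ≤ M) (hN : M - N ≤ (M + 3) * Δ) (hΔ : 0 ≤ Δ) (hcase : Δ = 0 ∨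
    40 * (M + 4) * β ≤ g₁ * B) : αq + Δ * γq + (B ^ 2 * S + (B + e₁ - q) ^ 2 * N) / b ≤ M * B + U :=
    by
  obtain ⟨e1l, e1u⟩ := abs_le.1 he1
  obtain ⟨e2l, e2u⟩ := abs_le.1 he2
  obtain ⟨b₀, hb₀⟩ : ∃ b₀, b₀ = B - e₂ - 9 / 10 * q := ⟨_, rfl⟩
  have hb1 : 1 / 10 * β * (1 - s) ≤ b₀ := by
    have : 2 * s ≤ β * s := mul_le_mul_of_nonneg_right hβ hs0.le
    linarith
  have hb0 : 0 < b₀ := lt_of_lt_of_le (by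
    have : 0 < 1 - s := by linarith
    positivity) hb1
  obtain ⟨D, hD⟩ : ∃ D, D = (e₁ + e₂ - 1 / 10 * q) ^ 2 / b₀ := ⟨_, rfl⟩
  obtain ⟨κ, hκ⟩ : ∃ κ, κ = (e₂ + 9 / 10 * q) ^ 2 / b₀ := ⟨_, rfl⟩
  have hQ : B ^ 2 / b₀ = B + e₂ + 9 / 10 * q + κ := by rw [hκ]; field_simp; rw [hb₀]; ring
  have hR : (B + e₁ - q) ^ 2 / b₀ = B + 2 * e₁ + e₂ - 11 / 10 * q + D := by
    rw [hD]; field_simp; rw [hb₀]; ring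
  have hD0 : 0 ≤ D := by rw [hD]; positivity
  have hκ0 : 0 ≤ κ := by rw [hκ]; positivity
  have hDle : D ≤ (1 / 10 + 8 / 10 * s) * q := hD ▸ cap_defect_le hs0 hs1 hq0 hqβ hβ he12 hb1
  have hnum : 0 ≤ B ^ 2 * S + (B + e₁ - q) ^ 2 * N := by positivity
  have h1 : (B ^ 2 * S + (B + e₁ - q) ^ 2 * N) / b ≤ (B ^ 2 * S + (B + e₁ - q) ^ 2 * N) / b₀ :=
    div_le_div_of_nonneg_left hnum hb0 (by rw [hb₀]; exact hb)
  have h2 : (B ^ 2 * S + (B + e₁ - q) ^ 2 * N) / b₀ = B ^ 2 / b₀ * S + (B + e₁ - q) ^ 2 / b₀ * N := by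
    ring
  obtain ⟨Q, hQ'⟩ : ∃ Q, Q = B ^ 2 / b₀ := ⟨_, rfl⟩
  obtain ⟨R, hR'⟩ : ∃ R, R = (B + e₁ - q) ^ 2 / b₀ := ⟨_, rfl⟩
  rw [← hQ', ← hR'] at h2
  rw [← hQ'] at hQ
  rw [← hR'] at hR
  have hQ0 : 0 ≤ Q := by rw [hQ']; positivity
  have h3 : Q * S ≤ Q * (M - g₁ * Δ - N) := mul_le_mul_of_nonneg_left (by linarith) hQ0
  have h4 : (M - N) * (Q - R) ≤ (M - N) * (2 * q + s / 10 + κ) :=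
    mul_le_mul_of_nonneg_left (by linarith) (by linarith)
  have h5 : (M - N) * (2 * q + s / 10 + κ) ≤ (M + 3) * Δ * (2 * q + s / 10 + κ) :=
    mul_le_mul_of_nonneg_right hN (by positivity)
  have h6 : M * D ≤ M * ((1 / 10 + 8 / 10 * s) * q) := mul_le_mul_of_nonneg_left hDle (by linarith)
  have h7 : g₁ * Δ * (B - s / 20) ≤ g₁ * Δ * Q := by
    apply mul_le_mul_of_nonneg_left _ (by positivity); linarith
  have h8 : 4 * k₁ ^ 2 * q ≤ M * (1 - 4 * s) * q := mul_le_mul_of_nonneg_right hk hq0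
  have h9 : s ^ 2 * q ≤ M * s * q := by
    refine mul_le_mul_of_nonneg_right ?_ hq0
    rw [sq]
    exact mul_le_mul_of_nonneg_right (by linarith) hs0.le
  have hΔγ : Δ * γq ≤ Δ * (s + 8 * q) := mul_le_mul_of_nonneg_left hγ hΔ
  have hbr : Δ * (s + 8 * q) + (M + 3) * Δ * (2 * q + s / 10 + κ) ≤ g₁ * Δ * (B - s / 20) := by
    rcases hcase with h0 | hlt
    · simp [h0]
    · have hB0 : 0 ≤ B := by linarith
      have hB2 : 160 * β ≤ B := by
        have c1 : g₁ * B ≤ 1 * B := mul_le_mul_of_nonneg_right hg1 hB0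
        have c2 : 40 * 4 * β ≤ 40 * (M + 4) * β := by gcongr; linarith
        linarith
      have hbB : B / 2 ≤ b₀ := by rw [hb₀]; linarith
      have hκβ : κ ≤ β := by
        rw [hκ, div_le_iff₀ hb0]
        have : (e₂ + 9 / 10 * q) ^ 2 ≤ (2 * β) ^ 2 := by apply sq_le_sq'; all_goals linarith
        have c2 : β * (160 * β / 2) ≤ β * (B / 2) := by gcongr
        have c3 : β * (B / 2) ≤ β * b₀ := by gcongr
        have c4 : 0 ≤ β * β := mul_self_nonneg β
        linarith
      have : (s + 8 * q) + (M + 3) * (2 * q + s / 10 + κ) ≤ g₁ * (B - s / 20) := by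
        have : (M + 3) * (2 * q + s / 10 + κ) ≤ (M + 3) * (4 * β) :=
          mul_le_mul_of_nonneg_left (by linarith) (by linarith)
        have c1 : g₁ * (s / 20) ≤ 1 * (s / 20) := by gcongr
        have c2 : 0 ≤ M * β := by positivity
        linarith
      calc _ = Δ * ((s + 8 * q) + (M + 3) * (2 * q + s / 10 + κ)) := by ring
        _ ≤ Δ * (g₁ * (B - s / 20)) := mul_le_mul_of_nonneg_left this hΔ
        _ = _ := by ring
  have hMR : M * R = M * B + 4 * k₁ * w - 11 / 10 * (M * q) + M * D := by rw [hR]; linarith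
  have hfin : Q * (M - g₁ * Δ - N) + R * N = M * R - g₁ * Δ * Q + (M - N) * (Q - R) := by ring
  have hMsq : 0 ≤ M * s * q := by positivity
  linarith

/-- The value of the calibration on the diagonal dominates the energy density. -/
lemma value_le {ε' B q e₁ e₂ w c T U n d σ ϖ Bt : ℝ} (hM : 1 ≤ M) (hlam : 0 < lam) (hε : 0 < ε) (hε'
    : 0 < ε') (hk : lam * k₁ = M * (1 + ε')) (hw : M * (2 * e₁ + e₂) = 4 * k₁ * w) (hq : 0 ≤ q) (hT
    : 0 ≤ T) (hc : T ≤ 1 - c ^ 2) (hc1 : c ≤ 1) (hc2 : -1 ≤ c) (hσ : lam * σ = M * (1 - c ^ 2) + T +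
    ε * (1 - c)) (hn : |n| ≤ ν * q) (hd : |d - U| ≤ ν * q) (hϖ : |ϖ * k₁| ≤ ν) (hBt : |ϖ * B + Bt| ≤
    lam * ν) (he : |e₁| ≤ ν) (hν : 6 * ν ≤ ε' * M) (hν2 : 2 * ν * (4 * M + 4 + ε) ≤ ε * B) : M * B +
    U + (ε' * M / 2 * q + ε * B / 2 * (1 - c)) ≤ M / 2 * e₂ + n + d - 2 * k₁ * w + ((lam + ϖ) * B +
    Bt) * σ + (lam + ϖ) * k₁ * q + (M * c ^ 2 - T) * (B + e₁ - q) := by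
  have hσ0 : 0 ≤ σ := by
    have : 0 ≤ lam * σ := by rw [hσ]; nlinarith
    exact nonneg_of_mul_nonneg_right this hlam
  have hσ1 : lam * σ ≤ (2 * M + 2 + ε) * (1 - c) := by
    rw [hσ]
    nlinarith [mul_nonneg (by linarith : 0 ≤ M + 1) (mul_nonneg (sub_nonneg.2 hc1) (sub_nonneg.2 hc1))]
  have h1 : -(ν * ((2 * M + 2 + ε) * (1 - c))) ≤ (ϖ * B + Bt) * σ := by
    have a1 : |(ϖ * B + Bt) * σ| ≤ lam * ν * σ := by rw [abs_mul, abs_of_nonneg hσ0]; gcongr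
    have hν0 : 0 ≤ ν := (abs_nonneg _).trans he
    nlinarith [(abs_le.1 a1).1, mul_le_mul_of_nonneg_left hσ1 hν0]
  have h2 : (M * (1 - c ^ 2) + T) * e₁ ≤ (2 * M + 2) * (1 - c) * ν := by
    have a1 : M * (1 - c ^ 2) + T ≤ (2 * M + 2) * (1 - c) := by
      nlinarith [mul_nonneg (by linarith : 0 ≤ M + 1) (mul_nonneg (sub_nonneg.2 hc1) (sub_nonneg.2 hc1))]
    have a0 : 0 ≤ M * (1 - c ^ 2) + T := by nlinarith
    calc _ ≤ (M * (1 - c ^ 2) + T) * ν := mul_le_mul_of_nonneg_left ((le_abs_self _).trans he) a0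
      _ ≤ _ := mul_le_mul_of_nonneg_right a1 ((abs_nonneg _).trans he)
  have h3 : (M * c ^ 2 - T) * q ≤ M * q := by apply mul_le_mul_of_nonneg_right _ hq; nlinarith
  have h4 : -(ν * q) ≤ ϖ * k₁ * q := by
    have := mul_le_mul_of_nonneg_right (abs_le.1 hϖ).1 hq; linarith
  have h5 : lam * k₁ * q = M * q + ε' * M * q := by rw [hk]; ring
  have h6 : 6 * ν * q ≤ ε' * M * q := mul_le_mul_of_nonneg_right hν hq
  have h7 : 2 * ν * (4 * M + 4 + ε) * (1 - c) ≤ ε * B * (1 - c) :=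
    mul_le_mul_of_nonneg_right hν2 (by linarith)
  have h8 : lam * B * σ = B * (M * (1 - c ^ 2) + T + ε * (1 - c)) := by rw [← hσ]; ring
  linarith [(abs_le.1 hn).1, (abs_le.1 hd).1]

end CalibrationAlgebra

section CutVector

/-- The factor of the capped identity. -/
def capZ (β : ℝ) (h : H) : ℝ := (1 + ‖h‖ ^ 2 / β)⁻¹

/-- The capped square `|h|²/(1 + |h|²/β)`. -/
def capQ (β : ℝ) (h : H) : ℝ := capZ β h * ‖h‖ ^ 2

/-- Half of the gradient of the capped square. -/
def capX (β : ℝ) (h : H) : H := capZ β h ^ 2 • h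

/-- The derivative of `capX`. -/
def capD (β : ℝ) (h ξ : H) : H :=
  capZ β h ^ 2 • ξ - (4 * capZ β h ^ 3 / β * inner ℝ h ξ) • h

variable (hβ : 2 ≤ β) (h ξ : H)
include hβ

lemma capZ_pos : 0 < capZ β h := by
  have : 0 < β := by linarith
  unfold capZ; positivity

lemma capZ_add : capZ β h + capQ β h / β = 1 := by
  have : 0 < β := by linarith
  have h1 : 0 < 1 + ‖h‖ ^ 2 / β := by positivity
  unfold capQ capZ
  field_simp

lemma capQ_nonneg : 0 ≤ capQ β h := mul_nonneg (capZ_pos hβ h).le (sq_nonneg _)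

lemma capZ_le_one : capZ β h ≤ 1 := by
  have := capZ_add hβ h
  have := div_nonneg (capQ_nonneg hβ h) (by linarith : 0 ≤ β)
  linarith

lemma capQ_le : capQ β h ≤ β := by
  have h1 := capZ_add hβ h
  have h2 := capZ_pos hβ h
  have h3 : capQ β h / β ≤ 1 := by linarith
  rwa [div_le_one (by linarith)] at h3

lemma one_sub_capZ : 1 - capZ β h ≤ capQ β h / 2 := by
  have h1 := capZ_add hβ h
  have h2 : capQ β h / β ≤ capQ β h / 2 := div_le_div_of_nonneg_left (capQ_nonneg hβ h) two_pos hβ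
  linarith

lemma norm_capX_sq_le : ‖capX β h‖ ^ 2 ≤ capQ β h := by
  have h0 := capZ_pos hβ h
  have h1 := capZ_le_one hβ h
  rw [capX, norm_smul, norm_of_nonneg (by positivity), mul_pow, capQ]
  have : (capZ β h ^ 2) ^ 2 ≤ capZ β h := by
    calc (capZ β h ^ 2) ^ 2 = capZ β h * capZ β h ^ 3 := by ring
      _ ≤ capZ β h * 1 := by gcongr; exact pow_le_one₀ h0.le h1
      _ = _ := mul_one _
  gcongr

lemma norm_capX_le : ‖capX β h‖ ≤ β := by
  have := (norm_capX_sq_le hβ h).trans (capQ_le hβ h)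
  nlinarith [norm_nonneg (capX β h)]

lemma norm_capD_sub_le : ‖capD β h ξ - ξ‖ ≤ 3 * capQ β h * ‖ξ‖ := by
  have h0 := capZ_pos hβ h
  have h1 := capZ_le_one hβ h
  have hq := capQ_nonneg hβ h
  have h2 := one_sub_capZ hβ h
  have hβ0 : 0 < β := by linarith
  have e : capD β h ξ - ξ = -((1 - capZ β h ^ 2) • ξ) - (4 * capZ β h ^ 3 / β * inner ℝ h ξ) • h := by
    rw [capD]; module
  rw [e]
  refine (norm_sub_le _ _).trans ?_
  rw [norm_neg, norm_smul, norm_smul, norm_mul, norm_of_nonneg (by nlinarith),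
    norm_of_nonneg (by positivity)]
  have h3 := norm_inner_le_norm (𝕜 := ℝ) h ξ
  calc _ ≤ (1 - capZ β h ^ 2) * ‖ξ‖ + 4 * capZ β h ^ 3 / β * (‖h‖ * ‖ξ‖) * ‖h‖ := by gcongr
    _ = (1 - capZ β h ^ 2 + 4 * capZ β h ^ 2 * (capQ β h / β)) * ‖ξ‖ := by rw [capQ]; field_simp
    _ ≤ 3 * capQ β h * ‖ξ‖ := by
      have e1 : capQ β h / β = 1 - capZ β h := by linarith [capZ_add hβ h]
      have e2 : capZ β h ^ 2 * (1 - capZ β h) ≤ 1 * (1 - capZ β h) := by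
        gcongr; exact pow_le_one₀ h0.le h1
      rw [e1]
      gcongr
      nlinarith

lemma norm_capD_le : ‖capD β h ξ‖ ≤ 5 * ‖ξ‖ := by
  have h0 := capZ_pos hβ h
  have h1 := capZ_le_one hβ h
  have hβ0 : 0 < β := by linarith
  rw [capD]
  refine (norm_sub_le _ _).trans ?_
  rw [norm_smul, norm_smul, norm_mul, norm_of_nonneg (by positivity),
    norm_of_nonneg (by positivity)]
  have h3 := norm_inner_le_norm (𝕜 := ℝ) h ξ
  calc _ ≤ capZ β h ^ 2 * ‖ξ‖ + 4 * capZ β h ^ 3 / β * (‖h‖ * ‖ξ‖) * ‖h‖ := by gcongr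
    _ = capZ β h ^ 2 * (1 + 4 * (capQ β h / β)) * ‖ξ‖ := by rw [capQ]; field_simp
    _ ≤ 1 * 5 * ‖ξ‖ := by
      have e1 : capQ β h / β ≤ 1 := by linarith [capZ_add hβ h]
      have e0 : 0 ≤ capQ β h / β := div_nonneg (capQ_nonneg hβ h) hβ0.le
      gcongr
      · exact pow_le_one₀ h0.le h1
      · linarith
    _ = _ := by ring

omit hβ in
lemma inner_capD (η : H) : inner ℝ (capD β h ξ) η = inner ℝ ξ (capD β h η) := by
  simp only [capD, inner_sub_left, inner_sub_right, real_inner_smul_left, real_inner_smul_right]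
  rw [real_inner_comm ξ h]
  ring

/-- The radial part of the calibration field, up to small errors. -/
lemma norm_capD_sub_smul_sq_le (k₁ ν : ℝ) (hk : 0 ≤ k₁) (hξ : ‖ξ‖ ≤ ν) :
    ‖capD β h ξ - (2 * k₁) • capX β h‖ ^ 2 ≤ ‖ξ‖ ^ 2 - 4 * k₁ * inner ℝ ξ (capX β h) +
      (4 * k₁ ^ 2 + (18 * ν ^ 2 + 12 * k₁ * ν * β)) * capQ β h := by
  have hq := capQ_nonneg hβ h
  have h1 := norm_capD_sub_le hβ h ξ
  have h2 := norm_capD_le hβ h ξ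
  have h3 := norm_capD_sub_le hβ h (capX β h)
  have h4 := norm_capX_sq_le hβ h
  have h5 := norm_capX_le hβ h
  have hn := norm_nonneg ξ
  have hν : 0 ≤ ν := hn.trans hξ
  rw [norm_sub_sq_real, real_inner_smul_right, inner_capD, norm_smul, mul_pow,
    norm_of_nonneg (by positivity)]
  have e1 : inner ℝ ξ (capD β h (capX β h)) = inner ℝ ξ (capX β h) +
      inner ℝ ξ (capD β h (capX β h) - capX β h) := by rw [inner_sub_right]; ring
  have e2 : -(ν * (3 * capQ β h * β)) ≤ inner ℝ ξ (capD β h (capX β h) - capX β h) := by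
    have := abs_real_inner_le_norm ξ (capD β h (capX β h) - capX β h)
    have h6 : ‖ξ‖ * ‖capD β h (capX β h) - capX β h‖ ≤ ν * (3 * capQ β h * β) := by
      gcongr
      exact h3.trans (by gcongr)
    linarith [(abs_le.1 (this.trans h6)).1]
  have e3 : ‖capD β h ξ‖ ^ 2 ≤ ‖ξ‖ ^ 2 + 18 * ν ^ 2 * capQ β h := by
    have h6 : ‖capD β h ξ‖ ≤ ‖ξ‖ + 3 * capQ β h * ‖ξ‖ := by
      have := norm_le_norm_add_norm_sub' (capD β h ξ) ξ
      linarith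
    have h7 : (‖capD β h ξ‖ - ‖ξ‖) * (‖capD β h ξ‖ + ‖ξ‖) ≤ 3 * capQ β h * ‖ξ‖ * (6 * ‖ξ‖) := by
      apply mul_le_mul (by linarith) (by linarith) (by positivity) (by positivity)
    have h8 : capQ β h * ‖ξ‖ ^ 2 ≤ capQ β h * ν ^ 2 := by gcongr
    nlinarith
  rw [e1]
  have e4 : (2 * k₁) ^ 2 * ‖capX β h‖ ^ 2 ≤ (2 * k₁) ^ 2 * capQ β h := by gcongr
  have e5 : 2 * (2 * k₁) * -(ν * (3 * capQ β h * β)) ≤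
      2 * (2 * k₁) * inner ℝ ξ (capD β h (capX β h) - capX β h) := by gcongr
  nlinarith

end CutVector

section Padding

lemma sum_pad (hmn : m ≤ n + 1) (f : Fin (n + 1) → ℝ → ℝ) (hf : ∀ i, f i 0 = 0) (x : E m) :
    ∑ i, f i (pad n x i) = ∑ j : Fin m, f (Fin.castLE hmn j) (x j) := by
  symm
  refine Fintype.sum_of_injective (Fin.castLE hmn) (Fin.castLE_injective hmn) _ _ (fun i hi => ?_)
    fun j => ?_
  · have : ¬ (i : ℕ) < m := fun h => hi ⟨⟨i, h⟩, rfl⟩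
    simp [pad, this, hf]
  · simp [pad]

lemma inner_pad (hmn : m ≤ n + 1) (v : E (n + 1)) (x : E m) :
    inner ℝ v (pad n x) = inner ℝ (firstCoords m v) x := by
  rw [PiLp.inner_apply, PiLp.inner_apply, sum_pad hmn (fun i r => inner ℝ (v i) r) (by simp)]
  refine sum_congr rfl fun j _ => ?_
  have : (j : ℕ) ≤ n := Nat.lt_succ_iff.mp (j.2.trans_le hmn)
  simp [firstCoords, this, Fin.castLE]

lemma firstCoords_pad (hmn : m ≤ n + 1) (x : E m) : firstCoords m (pad n x) = x := by
  ext j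
  have : (j : ℕ) ≤ n := Nat.lt_succ_iff.mp (j.2.trans_le hmn)
  simp [firstCoords, pad, this]

lemma inner_pad_pad (hmn : m ≤ n + 1) (x y : E m) : inner ℝ (pad n x) (pad n y) = inner ℝ x y := by
  rw [inner_pad hmn, firstCoords_pad hmn]

lemma norm_pad (hmn : m ≤ n + 1) (x : E m) : ‖pad n x‖ = ‖x‖ := by
  rw [← sq_eq_sq₀ (norm_nonneg _) (norm_nonneg _), ← real_inner_self_eq_norm_sq,
    ← real_inner_self_eq_norm_sq, inner_pad_pad hmn]

variable (m n) in
/-- `pad` as a continuous linear map. -/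
def padL : E m →L[ℝ] E (n + 1) :=
  LinearMap.toContinuousLinearMap
    { toFun := pad n
      map_add' := fun x y => by ext i; by_cases h : (i : ℕ) < m <;> simp [pad, h]
      map_smul' := fun r x => by ext i; by_cases h : (i : ℕ) < m <;> simp [pad, h] }

@[simp] lemma padL_apply (x : E m) : padL m n x = pad n x := rfl

variable (m n) in
/-- `firstCoords` as a continuous linear map. -/
def projL : E (n + 1) →L[ℝ] E m :=
  LinearMap.toContinuousLinearMap
    { toFun := firstCoords m
      map_add' := fun x y => by ext i; by_cases h : (i : ℕ) ≤ n <;> simp [firstCoords, h]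
      map_smul' := fun r x => by ext i; by_cases h : (i : ℕ) ≤ n <;> simp [firstCoords, h] }

@[simp] lemma projL_apply (x : E (n + 1)) : projL m n x = firstCoords m x := rfl

lemma inner_pad_single (hmn : m ≤ n + 1) (v : E (n + 1)) (i : Fin m) :
    inner ℝ v (pad n (single i (1 : ℝ))) = firstCoords m v i := by
  rw [inner_pad hmn, inner_single_right]; simp

lemma sum_smul_single (x : E m) : ∑ i, x i • (single i (1 : ℝ) : E m) = x := by
  ext j; simp [Finset.sum_apply, Pi.single_apply]

lemma sum_sq_eq (x : E m) : ∑ i, x i ^ 2 = ‖x‖ ^ 2 := by rw [norm_sq_eq]; simp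

lemma sum_mul_eq (x y : E m) : ∑ i, x i * y i = inner ℝ x y := by
  rw [PiLp.inner_apply]; simp [mul_comm]

end Padding

section LinearPart

variable {ι K : Type*} [Fintype ι] [NormedAddCommGroup K] [InnerProductSpace ℝ K]

lemma weighted_cauchy_schwarz (x X : ι → H) (y Z : ι → K) {b : ℝ} (hb : 0 < b) :
    (∑ i, inner ℝ (x i) (X i) + ∑ i, inner ℝ (y i) (Z i)) ^ 2 ≤
      (∑ i, ‖x i‖ ^ 2 + (∑ i, ‖y i‖ ^ 2) / b) * (∑ i, ‖X i‖ ^ 2 + b * ∑ i, ‖Z i‖ ^ 2) := by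
  have h : ∀ s : ℝ, 0 ≤ (∑ i, ‖x i‖ ^ 2 + (∑ i, ‖y i‖ ^ 2) / b) * (s * s) + (-2 * (∑ i, inner ℝ (x
      i) (X i) + ∑ i, inner ℝ (y i) (Z i))) * s + (∑ i, ‖X i‖ ^ 2 + b * ∑ i, ‖Z i‖ ^ 2) := by
    intro s
    have h1 : 0 ≤ ∑ i, ‖s • x i - X i‖ ^ 2 + b * ∑ i, ‖(s / b) • y i - Z i‖ ^ 2 := by positivity
    have h2 : ∀ i, ‖s • x i - X i‖ ^ 2 = s ^ 2 * ‖x i‖ ^ 2 + (-2 * s) * inner ℝ (x i) (X i) +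
        ‖X i‖ ^ 2 := fun i => by
      rw [norm_sub_sq_real, norm_smul, mul_pow, norm_eq_abs, sq_abs, real_inner_smul_left]
      ring
    have h3 : ∀ i, ‖(s / b) • y i - Z i‖ ^ 2 = (s / b) ^ 2 * ‖y i‖ ^ 2 +
        (-2 * (s / b)) * inner ℝ (y i) (Z i) + ‖Z i‖ ^ 2 := fun i => by
      rw [norm_sub_sq_real, norm_smul, mul_pow, norm_eq_abs, sq_abs, real_inner_smul_left]
      ring
    simp only [h2, h3, sum_add_distrib, ← mul_sum] at h1
    refine h1.trans_eq ?_
    field_simp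
    ring
  have := discrim_le_zero h
  rw [discrim] at this
  linarith

lemma rpow_ge_of_linear {A J L : ℝ} (hp : 1 < p) (hA : 0 < A) (hJ : 0 ≤ J) (hL : L ^ 2 ≤ A * J) :
    A ^ (p / 2) + p * A ^ (p / 2 - 1) * (L - A) ≤ J ^ (p / 2) := by
  set s := sqrt (J / A) with hs
  have hs0 : 0 ≤ s := sqrt_nonneg _
  have hJs : J = A * s ^ 2 := by rw [hs, sq_sqrt (div_nonneg hJ hA.le)]; field_simp
  have hLs : L ≤ A * s := by
    have : L ^ 2 ≤ (A * s) ^ 2 := by rw [hJs] at hL; linarith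
    exact (le_abs_self L).trans (abs_le_of_sq_le_sq this (by positivity))
  have h1 := one_add_mul_self_le_rpow_one_add (s := s - 1) (p := p) (by linarith) hp.le
  rw [add_sub_cancel] at h1
  have h2 : J ^ (p / 2) = A ^ (p / 2) * s ^ p := by
    rw [hJs, mul_rpow hA.le (by positivity), ← rpow_natCast, ← rpow_mul hs0]
    congr 2
    push_cast; ring
  have h3 : A ^ (p / 2) = A ^ (p / 2 - 1) * A := by rw [rpow_sub_one hA.ne']; field_simp
  have hA' : 0 < A ^ (p / 2 - 1) := rpow_pos_of_pos hA _
  rw [h2, h3]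
  have h4 : A ^ (p / 2 - 1) * A * (1 + p * (s - 1)) ≤ A ^ (p / 2 - 1) * A * s ^ p := by gcongr
  have h5 : p * A ^ (p / 2 - 1) * L ≤ p * A ^ (p / 2 - 1) * (A * s) := by gcongr
  linarith

/-- The geometry of a point `v` of the sphere relative to the direction `o`. -/
structure SpherePoint (o : E m) (v : E (n + 1)) (c : ℝ) (ρ : E m) : Prop where
  le : m ≤ n + 1
  norm_o : ‖o‖ = 1
  norm_v : ‖v‖ = 1
  hc : c = inner ℝ v (pad n o)
  hρ : ρ = firstCoords m v - c • o

namespace SpherePoint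

variable {o : E m} {v : E (n + 1)} {c : ℝ} {ρ : E m} (h : SpherePoint o v c ρ)
include h

lemma inner_o_ρ : inner ℝ o ρ = 0 := by
  rw [h.hρ, inner_sub_right, real_inner_comm, ← inner_pad h.le, ← h.hc, inner_smul_right,
    real_inner_self_eq_norm_sq, h.norm_o]
  ring

lemma firstCoords_eq : firstCoords m v = ρ + c • o := by rw [h.hρ]; abel

lemma firstCoords_apply (i : Fin m) : firstCoords m v i = ρ i + c * o i := by
  rw [h.firstCoords_eq]; simp

lemma inner_pad_ρ : inner ℝ v (pad n ρ) = ‖ρ‖ ^ 2 := by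
  rw [inner_pad h.le, h.firstCoords_eq, inner_add_left, real_inner_smul_left, h.inner_o_ρ,
    real_inner_self_eq_norm_sq]
  ring

lemma norm_firstCoords_sq : ‖firstCoords m v‖ ^ 2 = ‖ρ‖ ^ 2 + c ^ 2 := by
  rw [h.firstCoords_eq, norm_add_sq_real, inner_smul_right, real_inner_comm, h.inner_o_ρ, norm_smul,
    h.norm_o]
  simp

lemma norm_ρ_sq_le : ‖ρ‖ ^ 2 ≤ 1 - c ^ 2 := by
  have h1 : ‖firstCoords m v‖ ^ 2 ≤ 1 := by
    have h2 : ‖firstCoords m v‖ ^ 2 ≤ ‖v‖ * ‖firstCoords m v‖ := by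
      rw [← real_inner_self_eq_norm_sq, ← inner_pad h.le]
      refine (real_inner_le_norm _ _).trans ?_
      rw [norm_pad h.le]
    rw [h.norm_v] at h2
    nlinarith [norm_nonneg (firstCoords m v)]
  linarith [h.norm_firstCoords_sq]

lemma sum_o : ∑ i, o i ^ 2 = 1 := by rw [sum_sq_eq, h.norm_o]; norm_num
lemma sum_ρ : ∑ i, ρ i ^ 2 = ‖ρ‖ ^ 2 := sum_sq_eq ρ
lemma sum_oρ : ∑ i, o i * ρ i = 0 := by rw [sum_mul_eq, h.inner_o_ρ]

lemma sum_quadratic (a b d e : ℝ) :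
    ∑ i, (a + b * o i ^ 2 + d * (o i * ρ i) + e * ρ i ^ 2) = m * a + b + e * ‖ρ‖ ^ 2 := by
  simp only [sum_add_distrib, ← mul_sum, h.sum_o, h.sum_oρ, h.sum_ρ]
  simp

/-- The gradient of `lam σ` in `v`. -/
def _root_.PHarm.sigmaGrad (n : ℕ) (M ε : ℝ) (o : E m) (c : ℝ) (ρ : E m) :
    E (n + 1) := -(2 * M * c + ε) • pad n o + (2 : ℝ) • pad n ρ

lemma sigmaGrad_normSq (M ε : ℝ) : ‖sigmaGrad n M ε o c ρ - inner ℝ v (sigmaGrad n M ε o c ρ) • v‖ ^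
    2 = (2 * M * c + ε) ^ 2 * (1 - c ^ 2) + 4 * ‖ρ‖ ^ 2 - 4 * (‖ρ‖ ^ 2) ^ 2 + 4 * (2 * M * c + ε) *
    c * ‖ρ‖ ^ 2 := by
  have h1 : inner ℝ v (sigmaGrad n M ε o c ρ) = -(2 * M * c + ε) * c + 2 * ‖ρ‖ ^ 2 := by
    rw [sigmaGrad, inner_add_right, inner_smul_right, inner_smul_right, ← h.hc, h.inner_pad_ρ]
  have h2 : ‖sigmaGrad n M ε o c ρ‖ ^ 2 = (2 * M * c + ε) ^ 2 + 4 * ‖ρ‖ ^ 2 := by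
    rw [sigmaGrad, norm_add_sq_real, real_inner_smul_left, real_inner_smul_right,
      inner_pad_pad h.le, h.inner_o_ρ, norm_smul, norm_smul, norm_pad h.le, norm_pad h.le, h.norm_o,
      mul_pow, mul_pow, norm_eq_abs, sq_abs, norm_eq_abs, sq_abs]
    ring
  rw [norm_sub_sq_real, real_inner_smul_right, real_inner_comm v (sigmaGrad n M ε o c ρ), h1, norm_smul, h.norm_v, mul_pow,
    norm_eq_abs, sq_abs, h2]
  ring

/-- The part of the calibration field that acts on derivatives of `v`. -/
def _root_.PHarm.fieldV (n : ℕ) (M lam ε B G : ℝ) (o : E m) (c : ℝ) (ρ : E m)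
    (i : Fin m) : E (n + 1) :=
  -(B * o i / lam) • sigmaGrad n M ε o c ρ +
    G • ((ρ i - c * o i) • pad n o + c • pad n (single i 1))

lemma sum_fieldV_normSq (hM : (m : ℝ) = M + 1) (hlam : 0 < lam) (ε B G : ℝ) : ∑ i, ‖fieldV n M lam ε
    B G o c ρ i - inner ℝ v (fieldV n M lam ε B G o c ρ i) • v‖ ^ 2 = B ^ 2 * (((2 * M * c + ε) ^ 2
    * (1 - c ^ 2) + 4 * ‖ρ‖ ^ 2 - 4 * (‖ρ‖ ^ 2) ^ 2 + 4 * (2 * M * c + ε) * c * ‖ρ‖ ^ 2) / lam ^ 2)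
    + G ^ 2 * (c ^ 2 * M + ‖ρ‖ ^ 2 * (1 - 4 * c ^ 2)) := by
  set g := sigmaGrad n M ε o c ρ with hg
  set Pg := g - inner ℝ v g • v with hPg
  set N : Fin m → E (n + 1) := fun i =>
    (ρ i - c * o i) • pad n o + c • pad n (single i 1) with hN
  set PN : Fin m → E (n + 1) := fun i => N i - inner ℝ v (N i) • v with hPN
  have h1 : ∀ i, fieldV n M lam ε B G o c ρ i - inner ℝ v (fieldV n M lam ε B G o c ρ i) • v =
      -(B * o i / lam) • Pg + G • PN i := by
    intro i
    have : fieldV n M lam ε B G o c ρ i = -(B * o i / lam) • g + G • N i := rfl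
    rw [this, inner_add_right, inner_smul_right, inner_smul_right, hPg, hPN]
    module
  have hvN : ∀ i, inner ℝ v (N i) = 2 * c * ρ i := by
    intro i
    simp only [hN]
    rw [inner_add_right, inner_smul_right, inner_smul_right, ← h.hc, inner_pad_single h.le,
      h.firstCoords_apply]
    ring
  have hNN : ∀ i, ‖N i‖ ^ 2 = (ρ i - c * o i) ^ 2 + c ^ 2 + 2 * c * (ρ i - c * o i) * o i := by
    intro i
    simp only [hN]
    rw [norm_add_sq_real, real_inner_smul_left, real_inner_smul_right, inner_pad_single h.le,
      firstCoords_pad h.le, norm_smul, norm_smul, norm_pad h.le, norm_pad h.le, h.norm_o,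
      PiLp.norm_single, mul_pow, mul_pow, norm_eq_abs, sq_abs, norm_eq_abs, sq_abs]
    simp
    ring
  have hPNN : ∀ i, ‖PN i‖ ^ 2 = c ^ 2 + (-c ^ 2) * o i ^ 2 + 0 * (o i * ρ i) +
      (1 - 4 * c ^ 2) * ρ i ^ 2 := by
    intro i
    simp only [hPN]
    rw [norm_sub_sq_real, real_inner_smul_right, real_inner_comm v (N i), hvN, norm_smul, h.norm_v, hNN,
      mul_pow, norm_eq_abs, sq_abs]
    ring
  have hcross : ∑ i, o i * inner ℝ Pg (PN i) = 0 := by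
    have e1 : ∑ i, o i • N i = 0 := by
      have e2 : ∀ i, o i • N i = (o i * ρ i - c * o i ^ 2) • pad n o +
          c • padL m n (o i • single i (1 : ℝ)) := fun i => by
        simp only [hN, map_smul, padL_apply]; module
      have e4 : ∑ i, padL m n (o i • single i (1 : ℝ)) = padL m n o := by
        rw [← map_sum, sum_smul_single]
      simp only [e2, sum_add_distrib, ← Finset.smul_sum, ← Finset.sum_smul, e4,
        sum_sub_distrib, ← mul_sum, h.sum_o, h.sum_oρ]
      rw [padL_apply]
      module
    have e3 : ∀ i, o i * inner ℝ Pg (PN i) = inner ℝ Pg (o i • N i) -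
        (o i * (2 * c * ρ i)) * inner ℝ Pg v := fun i => by
      simp only [hPN]
      rw [inner_sub_right, inner_smul_right, inner_smul_right, hvN]
      ring
    simp only [e3, sum_sub_distrib, ← inner_sum, e1, ← Finset.sum_mul]
    have : ∑ i, o i * (2 * c * ρ i) = 2 * c * ∑ i, o i * ρ i := by
      rw [mul_sum]; exact sum_congr rfl fun i _ => by ring
    rw [this, h.sum_oρ]
    simp
  have h2 : ∀ i, ‖-(B * o i / lam) • Pg + G • PN i‖ ^ 2 = B ^ 2 * (‖Pg‖ ^ 2 / lam ^ 2) * o i ^ 2 +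
      (-2 * B * G / lam) * (o i * inner ℝ Pg (PN i)) + G ^ 2 * ‖PN i‖ ^ 2 := by
    intro i
    rw [norm_add_sq_real, real_inner_smul_left, real_inner_smul_right, norm_smul, norm_smul,
      mul_pow, mul_pow, norm_eq_abs, sq_abs, norm_eq_abs, sq_abs]
    field_simp
  simp only [h1, h2, sum_add_distrib, ← mul_sum, hcross, h.sum_o]
  simp only [hPNN]
  rw [h.sum_quadratic, hPg, hg, h.sigmaGrad_normSq, hM]
  ring

end SpherePoint

end LinearPart

section CapCalculus

lemma hasDerivAt_capZ (hβ : 2 ≤ β) {h : ℝ → H} {h' : H} {s : ℝ} (hh : HasDerivAt h h' s) :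
    HasDerivAt (fun s => capZ β (h s)) (-(2 * inner ℝ (h s) h' / β) * capZ β (h s) ^ 2) s := by
  have hβ0 : 0 < β := by linarith
  have h1 : 0 < 1 + ‖h s‖ ^ 2 / β := by positivity
  refine (((hh.norm_sq.div_const β).const_add 1).inv h1.ne').congr_deriv ?_
  rw [capZ]
  field_simp

lemma hasDerivAt_capQ (hβ : 2 ≤ β) {h : ℝ → H} {h' : H} {s : ℝ} (hh : HasDerivAt h h' s) :
    HasDerivAt (fun s => capQ β (h s)) (2 * inner ℝ (capX β (h s)) h') s := by
  refine ((hasDerivAt_capZ hβ hh).mul hh.norm_sq).congr_deriv ?_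
  have h1 := capZ_add hβ (h s)
  rw [capX, real_inner_smul_left]
  have h2 : capQ β (h s) / β = 1 - capZ β (h s) := by linarith
  have h3 : capZ β (h s) * ‖h s‖ ^ 2 / β = 1 - capZ β (h s) := h2
  linear_combination (-(2 * inner ℝ (h s) h') * capZ β (h s)) * h3

lemma hasDerivAt_capX (hβ : 2 ≤ β) {h : ℝ → H} {h' : H} {s : ℝ} (hh : HasDerivAt h h' s) :
    HasDerivAt (fun s => capX β (h s)) (capD β (h s) h') s := by
  refine (((hasDerivAt_capZ hβ hh).pow 2).smul hh).congr_deriv ?_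
  rw [capD, sub_eq_add_neg, ← neg_smul]
  congr 2
  push_cast
  ring

end CapCalculus

section CalibrationField

/-- The part of the calibration that depends on the position `v` in the sphere. -/
def calSigma (M lam ε : ℝ) (o : E m) (v : E (n + 1)) : ℝ :=
  lam⁻¹ * (M * (1 - inner ℝ v (pad n o) ^ 2) + (‖firstCoords m v‖ ^ 2 - inner ℝ v (pad n o) ^ 2) +
    ε * (1 - inner ℝ v (pad n o)))

/-- The components of the calibration. -/
def calField (M lam ε k₁ β : ℝ) (i : Fin m) (o : E m) (v : E (n + 1)) (h u ℓ : H) (B : ℝ) : ℝ :=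
  o i * (inner ℝ u (capX β h) - B * calSigma M lam ε o v - k₁ * capQ β h) + (B + inner ℝ ℓ (capX β
    h) - capQ β h) * (inner ℝ v (pad n o) * (firstCoords m v i - inner ℝ v (pad n o) * o i))

variable {o : ℝ → E m} {v : ℝ → E (n + 1)} {c s : ℝ} {ρ : E m} {i : Fin m} {Z : E (n + 1)}

lemma SpherePoint.hasDerivAt_inner (hp : SpherePoint (o s) (v s) c ρ)
    (ho : HasDerivAt o (single i 1 - o s i • o s) s) (hv : HasDerivAt v Z s) :
    HasDerivAt (fun s => inner ℝ (v s) (pad n (o s))) (inner ℝ Z (pad n (o s)) + ρ i) s := by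
  have h1 := hv.inner ℝ ((padL m n).hasFDerivAt.comp_hasDerivAt s ho)
  refine h1.congr_deriv ?_
  simp only [Function.comp_apply, map_sub, map_smul, padL_apply, inner_sub_right, inner_smul_right,
    inner_pad_single hp.le, hp.firstCoords_apply, ← hp.hc]
  ring

lemma SpherePoint.hasDerivAt_sigma (hp : SpherePoint (o s) (v s) c ρ) (ho : HasDerivAt o (single i 1
    - o s i • o s) s) (hv : HasDerivAt v Z s) : HasDerivAt (fun s => calSigma M lam ε (o s) (v s))
    (lam⁻¹ * (inner ℝ (sigmaGrad n M ε (o s) c ρ) Z - (2 * M * c + 2 * c + ε) * ρ i)) s := by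
  have hc := hp.hasDerivAt_inner ho hv
  have hπ := ((projL m n).hasFDerivAt.comp_hasDerivAt s hv).norm_sq
  refine (((((hc.pow 2).const_sub 1).const_mul M).add (hπ.sub (hc.pow 2))).add
    ((hc.const_sub 1).const_mul ε) |>.const_mul lam⁻¹).congr_deriv ?_
  simp only [projL_apply, Function.comp_apply, ← hp.hc]
  have e1 : inner ℝ (firstCoords m (v s)) (firstCoords m Z) =
      inner ℝ Z (pad n ρ) + c * inner ℝ Z (pad n (o s)) := by
    rw [hp.firstCoords_eq, inner_add_left, real_inner_smul_left, real_inner_comm,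
      ← inner_pad hp.le, real_inner_comm _ (o s), ← inner_pad hp.le]
  rw [e1, sigmaGrad, inner_add_left, real_inner_smul_left, real_inner_smul_left,
    real_inner_comm Z (pad n (o s)), real_inner_comm Z (pad n ρ)]
  push_cast
  ring

/-- The derivative of the calibration along an admissible variation. -/
lemma SpherePoint.hasDerivAt_calField (hp : SpherePoint (o s) (v s) c ρ) (hβ : 2 ≤ β) (ho :
    HasDerivAt o (single i 1 - o s i • o s) s) (hv : HasDerivAt v Z s) {h u ℓ : ℝ → H} {X u' ℓ' : H}
    {B P : ℝ → ℝ} {B' ϖ : ℝ} (hh : HasDerivAt h (X - o s i • u s) s) (hu : HasDerivAt u (o s i • u')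
    s) (hl : HasDerivAt ℓ (o s i • ℓ') s) (hB : HasDerivAt B (o s i * B') s) (hP : HasDerivAt P (o s
    i * (ϖ * P s)) s) (p : ℝ) {f G d : ℝ} (hf : f = inner ℝ (u s) (capX β (h s)) - B s * calSigma M
    lam ε (o s) (v s) - k₁ * capQ β (h s)) (hG : G = B s + inner ℝ (ℓ s) (capX β (h s)) - capQ β (h
    s)) (hd : d = (1 - p + ϖ) * G * c + B s * (lam⁻¹ * (2 * M * c + 2 * c + ε)) - G * c + c * (inner
    ℝ ℓ' (capX β (h s)) + B' - inner ℝ (ℓ s) (capD β (h s) (u s)) + 2 * inner ℝ (capX β (h s)) (u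
    s))) : HasDerivAt (fun s => P s * calField M lam ε k₁ β i (o s) (v s) (h s) (u s) (ℓ s) (B s))
    (P s * ((inner ℝ (o s i • (capD β (h s) (u s) - (2 * k₁) • capX β (h s)) + (c * ρ i) • (capD β
    (h s) (ℓ s) - (2 : ℝ) • capX β (h s))) X + inner ℝ (fieldV n M lam ε (B s) G (o s) c ρ i) Z) +
    ((f - G * c ^ 2) + ((1 - p + ϖ) * f - f + inner ℝ u' (capX β (h s)) - inner ℝ (u s) (capD β (h
    s) (u s)) - B' * calSigma M lam ε (o s) (v s) + 2 * k₁ * inner ℝ (capX β (h s)) (u s) + G * c ^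
    2) * o s i ^ 2 + d * (o s i * ρ i) + G * ρ i ^ 2)) - (1 - p) * o s i * (P s * calField M lam ε
    k₁ β i (o s) (v s) (h s) (u s) (ℓ s) (B s))) s := by
  have hX := hasDerivAt_capX hβ hh
  have hQ := hasDerivAt_capQ hβ hh
  have hσ := hp.hasDerivAt_sigma (M := M) (lam := lam) (ε := ε) ho hv
  have hc := hp.hasDerivAt_inner ho hv
  have hoi : HasDerivAt (fun s => o s i) (1 - o s i * o s i) s := by
    have := (proj (𝕜 := ℝ) i).hasFDerivAt.comp_hasDerivAt s ho
    exact this.congr_deriv (by simp)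
  have hπ : HasDerivAt (fun s => firstCoords m (v s) i) (firstCoords m Z i) s :=
    ((proj (𝕜 := ℝ) i).comp (projL m n)).hasFDerivAt.comp_hasDerivAt s hv
  have hF := ((hu.inner ℝ hX).sub (hB.mul hσ)).sub (hQ.const_mul k₁)
  have hGd := (hB.add (hl.inner ℝ hX)).sub hQ
  have hρ := hc.mul (hπ.sub (hc.mul hoi))
  refine (hP.mul ((hoi.mul hF).add (hGd.mul hρ))).congr_deriv ?_
  have e1 : firstCoords m Z i = inner ℝ (pad n (single i 1)) Z := by
    rw [real_inner_comm, inner_pad_single hp.le]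
  simp only [Pi.mul_apply, Pi.sub_apply, Pi.add_apply]
  unfold calField fieldV
  rw [← hp.hc, hp.firstCoords_apply, e1, real_inner_comm (pad n (o s)) Z]
  simp only [inner_add_left, inner_sub_left, real_inner_smul_left, inner_sub_right,
    inner_smul_right, inner_capD]
  have e2 : ∀ a b : H, inner ℝ (capD β (h s) a) b = inner ℝ a (capD β (h s) b) := fun a b =>
    inner_capD _ _ _
  have e3 : inner ℝ (ℓ s) (capD β (h s) (X - o s i • u s)) = inner ℝ (ℓ s) (capD β (h s) X) -
      o s i * inner ℝ (ℓ s) (capD β (h s) (u s)) := by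
    rw [← e2, inner_sub_right, inner_smul_right, e2, e2]
  have e4 : inner ℝ (u s) (capD β (h s) (X - o s i • u s)) = inner ℝ (u s) (capD β (h s) X) -
      o s i * inner ℝ (u s) (capD β (h s) (u s)) := by
    rw [← e2, inner_sub_right, inner_smul_right, e2, e2]
  rw [e3, e4]
  subst hf hG hd
  ring

end CalibrationField

section PointwiseCalibration

/-- The constants of the calibration. -/
structure CalParam (M lam ε k₁ β B₀ η : ℝ) : Prop where
  hM : 4 ≤ M
  hlam : 0 < lam
  hε : 0 < ε
  hϑ : 4 * M = (1 - 12 * ε) * lam ^ 2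
  hk : lam * k₁ = M * (1 + 2 * ε)
  hβ : 2 ≤ β
  hβB : β ≤ B₀
  hη0 : 0 < η
  hη : η * (1000 * (M + 1) ^ 2 * (β + B₀ + 2)) ≤ ε ^ 2

namespace CalParam

variable (C : CalParam M lam ε k₁ β B₀ η)
include C

lemma ε_lt : ε < 1 / 12 := by
  have := C.hM
  by_contra! h
  have : (1 - 12 * ε) * lam ^ 2 ≤ 0 := mul_nonpos_of_nonpos_of_nonneg (by linarith) (sq_nonneg _)
  linarith [C.hϑ]

lemma four_le_lam : 4 ≤ lam := by
  have h1 : 16 ≤ lam ^ 2 := by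
    have : (1 - 12 * ε) * lam ^ 2 ≤ 1 * lam ^ 2 := by gcongr; linarith [C.hε]
    linarith [C.hϑ, C.hM]
  nlinarith [C.hlam]

lemma k₁_pos : 0 < k₁ := by
  have h := C.hk
  have : 0 < lam * k₁ := by rw [h]; have := C.hM; have := C.hε; positivity
  exact pos_of_mul_pos_right this C.hlam.le

lemma k₁_le : k₁ ≤ M / 2 := by
  have h1 : 4 * k₁ ≤ lam * k₁ := mul_le_mul_of_nonneg_right C.four_le_lam C.k₁_pos.le
  have h2 : M * (1 + 2 * ε) ≤ M * 2 := by
    have := C.hM; gcongr; linarith [C.ε_lt]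
  linarith [C.hk]

lemma four_k₁_sq_le : 4 * k₁ ^ 2 ≤ M * (1 - 4 * (3 / 2 * ε)) := by
  have h1 : (lam * k₁) ^ 2 = (M * (1 + 2 * ε)) ^ 2 := by rw [C.hk]
  have h2 : lam ^ 2 * (4 * k₁ ^ 2) = lam ^ 2 * (M * ((1 - 12 * ε) * (1 + 2 * ε) ^ 2)) := by
    calc lam ^ 2 * (4 * k₁ ^ 2) = 4 * (lam * k₁) ^ 2 := by ring
      _ = M * (4 * M) * (1 + 2 * ε) ^ 2 := by rw [h1]; ring
      _ = _ := by rw [C.hϑ]; ring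
  have h3 : 4 * k₁ ^ 2 = M * ((1 - 12 * ε) * (1 + 2 * ε) ^ 2) :=
    mul_left_cancel₀ (pow_ne_zero 2 C.hlam.ne') h2
  rw [h3]
  have := C.hM
  have h4 := C.hε
  have h5 := C.ε_lt
  gcongr
  nlinarith [mul_pos h4 h4, mul_pos (mul_pos h4 h4) h4]

lemma η_le {K : ℝ} (hK' : K ≤ 1000 * (M + 1) ^ 2 * (β + B₀ + 2)) :
    η * K ≤ ε ^ 2 := (mul_le_mul_of_nonneg_left hK' C.hη0.le).trans C.hη

lemma η_mul_le : η * (1000 * (M + 1) * (β + B₀ + 2)) ≤ ε ^ 2 := by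
  have := C.hM
  have := C.hβ
  have := C.hβB
  have h0 : 0 ≤ β + B₀ + 2 := by linarith
  refine C.η_le ?_
  have : (M + 1) ≤ (M + 1) ^ 2 := by nlinarith
  gcongr

lemma η_mul_le' : η * (5000 * (β + B₀ + 2)) ≤ ε ^ 2 := by
  have := C.hM
  have := C.hβ
  have := C.hβB
  refine le_trans ?_ C.η_mul_le
  have h := C.hη0
  have h1 : 5000 * (β + B₀ + 2) ≤ 1000 * (M + 1) * (β + B₀ + 2) :=
    mul_le_mul_of_nonneg_right (by linarith) (by linarith)
  exact mul_le_mul_of_nonneg_left h1 h.le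

lemma ε_sq_le : ε ^ 2 ≤ ε / 12 := by nlinarith [C.hε, C.ε_lt]

end CalParam

variable {A b B B' ϖ c nq f G d e₁ e₂ w q σ : ℝ} {o : E m} {v : E (n + 1)} {ρ : E m}
    {h u gV ℓ u' : H}

/-- The smallness of the data of the calibration at a point. -/
structure CalPoint (M k₁ β η B₀ B B' ϖ : ℝ) (h u gV ℓ : H) : Prop where
  norm_u : ‖u‖ ≤ η
  norm_gV : ‖gV‖ ≤ η
  hl : ℓ = (-(1 / 2) : ℝ) • gV + (2 * k₁ / M) • u
  ϖ_le : |ϖ| ≤ η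
  B_le : |B - B₀| ≤ η
  Bt_le : |B'| ≤ η

namespace CalPoint

variable (D : CalPoint M k₁ β η B₀ B B' ϖ h u gV ℓ) (C : CalParam M lam ε k₁ β B₀ η)
include D C

lemma norm_l_le : ‖ℓ‖ ≤ 2 * η := by
  have := C.hM
  have := C.k₁_pos
  have h2 : 2 * k₁ / M ≤ 1 := by rw [div_le_one (by linarith)]; linarith [C.k₁_le]
  rw [D.hl]
  refine (norm_add_le _ _).trans ?_
  rw [norm_smul, norm_smul, norm_of_nonneg (by positivity : 0 ≤ 2 * k₁ / M)]
  have h3 : 2 * k₁ / M * ‖u‖ ≤ 1 * η := by gcongr; exact D.norm_u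
  have h4 : ‖(-(1 / 2) : ℝ)‖ * ‖gV‖ ≤ 1 * η := by
    gcongr
    · norm_num
    · exact D.norm_gV
  linarith

lemma inner_capX_le {x : H} {K : ℝ} (hx : ‖x‖ ≤ K) : |inner ℝ x (capX β h)| ≤ K * β := by
  have hK : 0 ≤ K := (norm_nonneg _).trans hx
  exact (abs_real_inner_le_norm _ _).trans (mul_le_mul hx (norm_capX_le C.hβ h) (norm_nonneg _) hK)

lemma inner_relation : M * (2 * inner ℝ ℓ (capX β h) + inner ℝ gV (capX β h)) =
    4 * k₁ * inner ℝ u (capX β h) := by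
  have := C.hM
  rw [D.hl, inner_add_left, real_inner_smul_left, real_inner_smul_left]
  field_simp
  ring

/-- The calibration field has length at most `√A`. -/
lemma field_le (hm : (m : ℝ) = M + 1) (sp : SpherePoint o v c ρ) (hb : B - inner ℝ gV (capX β h) - 9
    / 10 * capQ β h ≤ b) (hcase : c = 1 ∨ 40 * (M + 4) * β ≤ 3 * ε * B) (hG : G = B + inner ℝ ℓ
    (capX β h) - capQ β h) : 0 < b ∧ ∑ i, ‖o i • (capD β h u - (2 * k₁) • capX β h) + (c * ρ i) •
    (capD β h ℓ - (2 : ℝ) • capX β h)‖ ^ 2 + (∑ i, ‖fieldV n M lam ε B G o c ρ i - inner ℝ v (fieldV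
    n M lam ε B G o c ρ i) • v‖ ^ 2) / b ≤ M * B + ‖u‖ ^ 2 := by
  have hM := C.hM
  have hε := C.hε
  have hε1 := C.ε_lt
  have hβ := C.hβ
  have hη := C.hη0
  have hη1 := C.η_mul_le
  have hη2 := C.η_mul_le'
  have hβB := C.hβB
  have hε2 := C.ε_sq_le
  have hq := capQ_nonneg C.hβ h
  have hqβ := capQ_le C.hβ h
  obtain ⟨B1, B2⟩ := abs_le.1 D.B_le
  have e1 := D.inner_capX_le C (D.norm_l_le C)
  have e2 := D.inner_capX_le C D.norm_gV
  have hηβ : 5000 * (η * β) ≤ ε ^ 2 := by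
    refine le_trans ?_ hη2
    have : η * β ≤ η * (β + B₀ + 2) := by gcongr; linarith
    linarith
  have hη5 : 20000 * η ≤ ε ^ 2 := by
    refine le_trans ?_ hη2
    have : η * 4 ≤ η * (β + B₀ + 2) := by gcongr; linarith
    linarith
  have hMηβ : 1000 * (M * (η * β)) ≤ ε ^ 2 := by
    refine le_trans ?_ hη1
    have : η * (1000 * M * β) ≤ η * (1000 * (M + 1) * (β + B₀ + 2)) := by gcongr <;> linarith
    linarith
  have hT := sp.norm_ρ_sq_le
  have hT0 : 0 ≤ ‖ρ‖ ^ 2 := sq_nonneg _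
  have hc2 : c ^ 2 ≤ 1 := by linarith
  have hεM : 0 < 1 - 12 * ε := by linarith
  have sph := sphere_inequality (M := M) (lam := lam) (ϑ := 1 - 12 * ε) (ε := ε) (c := c)
    (T := ‖ρ‖ ^ 2) (by linarith) C.hϑ.symm (by linarith) hεM C.hlam (by ring) hT0 hT
  have hc0 := sq_nonneg c
  have i1 : c ^ 2 * ‖ρ‖ ^ 2 ≤ c ^ 2 * 1 := mul_le_mul_of_nonneg_left (by linarith) hc0
  have i2 : c ^ 2 * 4 ≤ c ^ 2 * M := mul_le_mul_of_nonneg_left hM hc0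
  have i3 : M * ‖ρ‖ ^ 2 ≤ M * (1 - c ^ 2) := mul_le_mul_of_nonneg_left hT (by linarith)
  have i4 : 4 * ‖ρ‖ ^ 2 ≤ M * ‖ρ‖ ^ 2 := mul_le_mul_of_nonneg_right hM hT0
  have i5 : c ^ 2 * ‖ρ‖ ^ 2 ≤ 1 * ‖ρ‖ ^ 2 := mul_le_mul_of_nonneg_right hc2 hT0
  have i6 : 0 ≤ c ^ 2 * ‖ρ‖ ^ 2 := mul_nonneg hc0 hT0
  have hN0 : 0 ≤ c ^ 2 * M + ‖ρ‖ ^ 2 * (1 - 4 * c ^ 2) := by linarith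
  have hNM : c ^ 2 * M + ‖ρ‖ ^ 2 * (1 - 4 * c ^ 2) ≤ M := by linarith
  have hN : M - (c ^ 2 * M + ‖ρ‖ ^ 2 * (1 - 4 * c ^ 2)) ≤ (M + 3) * (1 - c ^ 2) := by linarith
  have hηsq : η ^ 2 ≤ η := by
    have : η * η ≤ η * 1 := mul_le_mul_of_nonneg_left (by linarith) hη.le
    linarith
  have hb0 : 0 < b := by
    have := (abs_le.1 e2).2
    linarith
  refine ⟨hb0, ?_⟩
  rw [sp.sum_fieldV_normSq hm C.hlam]
  have hS : 0 ≤ ((2 * M * c + ε) ^ 2 * (1 - c ^ 2) + 4 * ‖ρ‖ ^ 2 - 4 * (‖ρ‖ ^ 2) ^ 2 +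
      4 * (2 * M * c + ε) * c * ‖ρ‖ ^ 2) / lam ^ 2 := by rw [← sp.sigmaGrad_normSq]; positivity
  have hsum : ∑ i, ‖o i • (capD β h u - (2 * k₁) • capX β h) + (c * ρ i) • (capD β h ℓ - (2 : ℝ) •
        capX β h)‖ ^ 2 = ‖capD β h u - (2 * k₁) • capX β h‖ ^ 2 + c ^ 2 * ‖ρ‖ ^ 2 * ‖capD β h ℓ - (2
        : ℝ) • capX β h‖ ^ 2 := by
    have : ∀ i, ‖o i • (capD β h u - (2 * k₁) • capX β h) + (c * ρ i) • (capD β h ℓ - (2 : ℝ) • capX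
        β h)‖ ^ 2 = 0 + ‖capD β h u - (2 * k₁) • capX β h‖ ^ 2 * o i ^ 2 + (2 * c * inner ℝ (capD β
        h u - (2 * k₁) • capX β h) (capD β h ℓ - (2 : ℝ) • capX β h)) * (o i * ρ i) + c ^ 2 * ‖capD
        β h ℓ - (2 : ℝ) • capX β h‖ ^ 2 * ρ i ^ 2 := fun i => by
      rw [norm_add_sq_real, real_inner_smul_left, real_inner_smul_right, norm_smul, norm_smul,
        mul_pow, mul_pow, norm_eq_abs, sq_abs, norm_eq_abs, sq_abs]
      ring
    simp only [this]
    rw [sp.sum_quadratic]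
    ring
  rw [hsum]
  have hα := norm_capD_sub_smul_sq_le C.hβ h u k₁ η C.k₁_pos.le D.norm_u
  have hγ : ‖capD β h ℓ - (2 : ℝ) • capX β h‖ ^ 2 ≤ 3 / 2 * ε + 8 * capQ β h := by
    have a1 : ‖capD β h ℓ - (2 : ℝ) • capX β h‖ ≤ 10 * η + 2 * ‖capX β h‖ := by
      refine (norm_sub_le _ _).trans ?_
      rw [norm_smul, norm_of_nonneg (by norm_num : (0:ℝ) ≤ 2)]
      have := norm_capD_le C.hβ h ℓ
      linarith [D.norm_l_le C]
    have a2 := norm_capX_sq_le C.hβ h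
    have a3 : (10 * η + 2 * ‖capX β h‖) ^ 2 ≤ 200 * η ^ 2 + 8 * ‖capX β h‖ ^ 2 := by
      nlinarith [sq_nonneg (10 * η - 2 * ‖capX β h‖)]
    have a5 := pow_le_pow_left₀ (norm_nonneg _) a1 2
    linarith
  have key := field_norm_le (M := M) (g₁ := 3 * ε) (s := 3 / 2 * ε) (k₁ := k₁) (B := B) (β := β) (q
    := capQ β h) (e₁ := inner ℝ ℓ (capX β h)) (e₂ := inner ℝ gV (capX β h)) (w := inner ℝ u (capX β
    h)) (Δ := 1 - c ^ 2) (U := ‖u‖ ^ 2) (b := b) (by linarith) (by linarith) (by linarith)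
    C.four_k₁_sq_le (by linarith) (by linarith) (hα.trans ?_) hγ (D.inner_relation C) hq hqβ hβ (by
    linarith) (e1.trans (by linarith)) (e2.trans (by linarith)) ?_ hb hS (sph.trans_eq (by ring))
    hN0 hNM hN (by linarith) (hcase.imp (fun hc => by rw [hc]; ring) fun h => by linarith)
  · have a1 : c ^ 2 * ‖ρ‖ ^ 2 ≤ 1 - c ^ 2 := by linarith
    have a2 := mul_le_mul_of_nonneg_right a1 (sq_nonneg ‖capD β h ℓ - (2 : ℝ) • capX β h‖)
    rw [hG]
    linarith
  · have a1 : 12 * k₁ * η * β ≤ 6 * (M * (η * β)) := by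
      have : k₁ * (η * β) ≤ M / 2 * (η * β) := by gcongr; exact C.k₁_le
      linarith
    have a5 : 18 * η ^ 2 + 12 * k₁ * η * β ≤ (3 / 2 * ε) ^ 2 := by rw [mul_pow]; linarith
    gcongr
  · have a1 : ‖ℓ + gV‖ ≤ 3 * η := (norm_add_le _ _).trans (by linarith [D.norm_l_le C, D.norm_gV])
    have a2 : |inner ℝ (ℓ + gV) (capX β h)| ≤ 3 * η * ‖capX β h‖ :=
      (abs_real_inner_le_norm _ _).trans (by gcongr)
    rw [← inner_add_left, ← sq_abs]
    have a3 : 3 * η ≤ (3 / 2 * ε) ^ 2 := by rw [mul_pow]; linarith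
    calc |inner ℝ (ℓ + gV) (capX β h)| ^ 2 ≤ (3 * η * ‖capX β h‖) ^ 2 := by gcongr
      _ = (3 * η) ^ 2 * ‖capX β h‖ ^ 2 := by ring
      _ ≤ ((3 / 2 * ε) ^ 2) ^ 2 * capQ β h := by gcongr; exact norm_capX_sq_le C.hβ h
      _ = _ := by ring

lemma B_pos : 1 < B := by
  have h2 := C.η_mul_le'
  have h3 : η * 4 ≤ η * (β + B₀ + 2) :=
    mul_le_mul_of_nonneg_left (by linarith [C.hβ, C.hβB]) C.hη0.le
  linarith [(abs_le.1 D.B_le).1, C.hβ, C.hβB, C.ε_sq_le, C.ε_lt]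

/-- The value of the calibration dominates the energy density. -/
lemma value_add_le (hm : (m : ℝ) = M + 1) (hlam : lam = m - p) (sp : SpherePoint o v c ρ) (hu' :
    inner ℝ u' (capX β h) = -(lam + ϖ) * inner ℝ u (capX β h) - M / 2 * inner ℝ gV (capX β h) - nq)
    (hn : |nq| ≤ η * capQ β h) (hσ : σ = calSigma M lam ε o v) (hf : f = inner ℝ u (capX β h) - B *
    σ - k₁ * capQ β h) (hG : G = B + inner ℝ ℓ (capX β h) - capQ β h) : M * B + ‖u‖ ^ 2 + (ε * M *
    capQ β h + ε * B / 2 * (1 - c)) ≤ -(m * (f - G * c ^ 2) + ((1 - p + ϖ) * f - f + inner ℝ u'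
    (capX β h) - inner ℝ u (capD β h u) - B' * σ + 2 * k₁ * inner ℝ (capX β h) u + G * c ^ 2) + G *
    ‖ρ‖ ^ 2) := by
  have hM := C.hM
  have hβ := C.hβ
  have hβB := C.hβB
  have hη := C.hη0
  have hη1 := C.η_mul_le
  have hη2 := C.η_mul_le'
  have hε2 := C.ε_sq_le
  have hε := C.hε
  have hε1 := C.ε_lt
  have hlam4 := C.four_le_lam
  have hq := capQ_nonneg C.hβ h
  have hB1 := D.B_pos C
  obtain ⟨B1, B2⟩ := abs_le.1 D.B_le
  obtain ⟨δ, hδ⟩ : ∃ δ, δ = η * ((M + 1) * (β + B₀ + 2)) := ⟨_, rfl⟩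
  have hη5 : 20000 * η ≤ ε ^ 2 := by
    refine le_trans ?_ hη2
    have : η * 4 ≤ η * (β + B₀ + 2) := mul_le_mul_of_nonneg_left (by linarith) hη.le
    linarith
  have hδM : 1000 * ((M + 1) * δ) ≤ ε ^ 2 := by
    refine le_trans (le_of_eq ?_) C.hη
    rw [hδ]; ring
  have hηδ : ∀ K, K ≤ (M + 1) * (β + B₀ + 2) → η * K ≤ δ := fun K hK => by
    rw [hδ]; exact mul_le_mul_of_nonneg_left hK hη.le
  have hprod : 5 * (β + B₀ + 2) ≤ (M + 1) * (β + B₀ + 2) :=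
    mul_le_mul_of_nonneg_right (by linarith) (by linarith)
  have hprod' : (M + 1) * 6 ≤ (M + 1) * (β + B₀ + 2) :=
    mul_le_mul_of_nonneg_left (by linarith) (by linarith)
  have hδ0 : 0 ≤ δ := by rw [hδ]; have : 0 ≤ β + B₀ + 2 := by linarith
                         positivity
  have hδ1 : 5 * δ ≤ (M + 1) * δ := mul_le_mul_of_nonneg_right (by linarith) hδ0
  have hlamσ : lam * σ = M * (1 - c ^ 2) + ‖ρ‖ ^ 2 + ε * (1 - c) := by
    rw [hσ, calSigma, ← mul_assoc, mul_inv_cancel₀ C.hlam.ne', one_mul, ← sp.hc,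
      sp.norm_firstCoords_sq]
    ring
  have hT := sp.norm_ρ_sq_le
  have hT0 : 0 ≤ ‖ρ‖ ^ 2 := sq_nonneg _
  obtain ⟨c1, c2⟩ := abs_le.1 (abs_le_one_iff_mul_self_le_one.2 (by linarith) : |c| ≤ 1)
  have hηsq : η ^ 2 ≤ η := by
    have : η * η ≤ η * 1 := mul_le_mul_of_nonneg_left (by linarith) hη.le
    linarith
  have hu2 : ‖u‖ ^ 2 ≤ η := (pow_le_pow_left₀ (norm_nonneg _) D.norm_u 2).trans hηsq
  have hd : |inner ℝ u (capD β h u) - ‖u‖ ^ 2| ≤ δ * capQ β h := by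
    rw [← real_inner_self_eq_norm_sq, ← inner_sub_right]
    calc _ ≤ ‖u‖ * (3 * capQ β h * ‖u‖) := (abs_real_inner_le_norm _ _).trans
          (by gcongr; exact norm_capD_sub_le C.hβ h u)
      _ = 3 * ‖u‖ ^ 2 * capQ β h := by ring
      _ ≤ δ * capQ β h := by
        have := hηδ 3 (by linarith)
        gcongr
        linarith
  have hϖ : |ϖ * k₁| ≤ δ := by
    rw [abs_mul, abs_of_pos C.k₁_pos]
    calc |ϖ| * k₁ ≤ η * (M / 2) := by
          have := C.k₁_pos
          gcongr
          exacts [D.ϖ_le, C.k₁_le]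
      _ ≤ δ := hηδ _ (by linarith)
  have hBt : |ϖ * B + B'| ≤ lam * δ := by
    have a1 : |ϖ * B| ≤ η * (B₀ + 1) := by
      rw [abs_mul, abs_of_pos (by linarith : 0 < B)]
      exact mul_le_mul D.ϖ_le (by linarith) (by linarith) hη.le
    have a2 := hηδ (B₀ + 2) (by linarith)
    have a3 : 1 * δ ≤ lam * δ := mul_le_mul_of_nonneg_right (by linarith) hδ0
    refine (abs_add_le _ _).trans ?_
    linarith [D.Bt_le]
  have he1 : |inner ℝ ℓ (capX β h)| ≤ δ := by
    refine (D.inner_capX_le C (D.norm_l_le C)).trans ?_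
    have := hηδ (2 * β) (by linarith)
    linarith
  have hnδ : |nq| ≤ δ * capQ β h := hn.trans (by
    have := hηδ 1 (by linarith)
    gcongr
    linarith)
  have key := value_le (M := M) (ε' := 2 * ε) (n := nq) (U := ‖u‖ ^ 2) (Bt := B') (ν := δ)
    (by linarith) C.hlam hε (by linarith) C.hk (D.inner_relation C) hq hT0 hT c2 c1 hlamσ hnδ hd hϖ
    hBt he1 (by
      have : ε * 2 ≤ ε * M := mul_le_mul_of_nonneg_left (by linarith) hε.le
      linarith) (by
      have a1 : ε * 1 ≤ ε * B := mul_le_mul_of_nonneg_left hB1.le hε.le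
      have a2 : ε * δ ≤ 1 * δ := mul_le_mul_of_nonneg_right (by linarith) hδ0
      linarith)
  have hm' : (m : ℝ) = lam + p := by linarith
  have hMp : M = lam + p - 1 := by linarith
  rw [real_inner_comm u (capX β h), hu', hf, hG]
  rw [hm']
  have hcM : M * c ^ 2 = (lam + p - 1) * c ^ 2 := by rw [← hMp]
  rw [hcM] at key
  refine le_trans (le_of_eq (by ring)) (key.trans (le_of_eq (by ring)))

/-- The pointwise inequality behind minimality. -/
theorem pointwise_le (hp : 1 < p) (hm : (m : ℝ) = M + 1) (hlam : lam = m - p) (sp : SpherePoint o v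
    c ρ) (hb : B - inner ℝ gV (capX β h) - 9 / 10 * capQ β h ≤ b) (hcase : c = 1 ∨ 40 * (M + 4) * β
    ≤ 3 * ε * B) (hu' : inner ℝ u' (capX β h) = -(lam + ϖ) * inner ℝ u (capX β h) - M / 2 * inner ℝ
    gV (capX β h) - nq) (hn : |nq| ≤ η * capQ β h) (hσ : σ = calSigma M lam ε o v) (hf : f = inner ℝ
    u (capX β h) - B * σ - k₁ * capQ β h) (hG : G = B + inner ℝ ℓ (capX β h) - capQ β h) (hA : A = M
    * B + ‖u‖ ^ 2) (X : Fin m → H) (Z : Fin m → E (n + 1)) (hZ : ∀ i, inner ℝ v (Z i) = 0) : A ^ (p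
    / 2) + p * A ^ (p / 2 - 1) * (ε * M * capQ β h + ε * B / 2 * (1 - c)) + ∑ i, p * A ^ (p / 2 - 1)
    * ((inner ℝ (o i • (capD β h u - (2 * k₁) • capX β h) + (c * ρ i) • (capD β h ℓ - (2 : ℝ) • capX
    β h)) (X i) + inner ℝ (fieldV n M lam ε B G o c ρ i) (Z i)) + ((f - G * c ^ 2) + ((1 - p + ϖ) *
    f - f + inner ℝ u' (capX β h) - inner ℝ u (capD β h u) - B' * σ + 2 * k₁ * inner ℝ (capX β h) u
    + G * c ^ 2) * o i ^ 2 + d * (o i * ρ i) + G * ρ i ^ 2)) ≤ (∑ i, ‖X i‖ ^ 2 + b * ∑ i, ‖Z i‖ ^ 2)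
    ^ (p / 2) := by
  have hM := C.hM
  have hB1 := D.B_pos C
  have hA0 : 0 < A := by rw [hA]; positivity
  obtain ⟨hb0, hfield⟩ := D.field_le C hm sp hb hcase hG
  have hval := D.value_add_le C hm hlam sp hu' hn hσ hf hG
  rw [← hA] at hfield hval
  set L := ∑ i, inner ℝ (o i • (capD β h u - (2 * k₁) • capX β h) + (c * ρ i) • (capD β h ℓ - (2 :
            ℝ) • capX β h)) (X i) + ∑ i, inner ℝ (fieldV n M lam ε B G o c ρ i - inner ℝ v (fieldV n
            M lam ε B G o c ρ i) • v) (Z i) with hL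
  have hJ : 0 ≤ ∑ i, ‖X i‖ ^ 2 + b * ∑ i, ‖Z i‖ ^ 2 := by positivity
  have hCS : L ^ 2 ≤ A * (∑ i, ‖X i‖ ^ 2 + b * ∑ i, ‖Z i‖ ^ 2) :=
    (weighted_cauchy_schwarz _ X _ Z hb0).trans (mul_le_mul_of_nonneg_right hfield hJ)
  have h1 := rpow_ge_of_linear hp hA0 hJ hCS
  refine le_trans ?_ h1
  have hproj : ∀ i, inner ℝ (fieldV n M lam ε B G o c ρ i - inner ℝ v (fieldV n M lam ε B G o c ρ i)
      • v) (Z i) = inner ℝ (fieldV n M lam ε B G o c ρ i) (Z i) := fun i => by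
    rw [inner_sub_left, real_inner_smul_left, hZ]; ring
  simp only [hproj] at hL
  rw [← mul_sum, sum_add_distrib, sp.sum_quadratic, sum_add_distrib, ← hL, add_assoc, ← mul_add]
  have hP : 0 ≤ p * A ^ (p / 2 - 1) := by positivity
  gcongr
  linarith

end CalPoint

end PointwiseCalibration

variable {θ y a b ϖ : ℝ → ℝ} (h : IsProfile p M lam B₀ ν θ y a b ϖ)

/-- The energy density of the profile, and its weight in the Euler-Lagrange equations. -/
local notation:max "𝐝" t:max => enDens M B₀ (θ t) (y t) (a t) (b t)
local notation:max "𝐰" t:max => enWeight p M B₀ (θ t) (y t) (a t) (b t)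

section ProfileVectors

/-- The Euclidean space `ℂ × ℝ = ℝ³` that contains `T¹ × ℝ`. -/
abbrev Cyl : Type := WithLp 2 (ℂ × ℝ)

/-- The space that contains the target. -/
notation:max "𝕐" n:max => Cyl × E (n + 1)

/-- The point of `Cyl` with given components. -/
def mkCyl : ℂ × ℝ →L[ℝ] Cyl :=
  ((WithLp.prodContinuousLinearEquiv 2 ℝ ℂ ℝ).symm : ℂ × ℝ →L[ℝ] Cyl)

lemma inner_mkCyl (x y : ℂ × ℝ) : inner ℝ (mkCyl x) (mkCyl y) = inner ℝ x.1 y.1 + x.2 * y.2 := by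
  have : inner ℝ (mkCyl x) (mkCyl y) = inner ℝ x.1 y.1 + inner ℝ x.2 y.2 := rfl
  rw [this, inner_apply]

lemma norm_mkCyl_sq (x : ℂ × ℝ) : ‖mkCyl x‖ ^ 2 = ‖x.1‖ ^ 2 + x.2 ^ 2 := by
  rw [← real_inner_self_eq_norm_sq, inner_mkCyl, real_inner_self_eq_norm_sq]
  ring

/-- The point `e^{iθ}`. -/
def circ (θ : ℝ) : ℂ := Complex.exp (θ * Complex.I)

/-- The unit tangent `i e^{iθ}`. -/
def circT (θ : ℝ) : ℂ := Complex.I * circ θ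

lemma circ_eq (θ : ℝ) : circ θ = ⟨cos θ, sin θ⟩ := by
  apply Complex.ext <;> simp [circ, Complex.exp_ofReal_mul_I_re, Complex.exp_ofReal_mul_I_im]

lemma circT_eq (θ : ℝ) : circT θ = ⟨-sin θ, cos θ⟩ := by
  rw [circT, circ_eq]; apply Complex.ext <;> simp

lemma toCircle_coe (θ : ℝ) : (((θ : Real.Angle).toCircle : Circle) : ℂ) = circ θ := by
  rw [Real.Angle.toCircle_coe, Circle.coe_exp, circ]

lemma inner_complex (z w : ℂ) : inner ℝ z w = z.re * w.re + z.im * w.im := by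
  rw [Complex.inner]; simp [Complex.mul_re, mul_comm]

lemma norm_circ (θ : ℝ) : ‖circ θ‖ = 1 := by rw [circ, Complex.norm_exp_ofReal_mul_I]

lemma norm_circT (θ : ℝ) : ‖circT θ‖ = 1 := by rw [circT, norm_mul, norm_circ]; simp

lemma inner_circT_circ (θ φ : ℝ) : inner ℝ (circT θ) (circ φ) = sin (φ - θ) := by
  rw [inner_complex, circT_eq, circ_eq, sin_sub]; ring

lemma inner_circ_circ (θ φ : ℝ) : inner ℝ (circ θ) (circ φ) = cos (φ - θ) := by
  rw [inner_complex, circ_eq, circ_eq, cos_sub]; ring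

lemma HasDerivAt.circ {f : ℝ → ℝ} {f' t : ℝ} (hf : HasDerivAt f f' t) :
    HasDerivAt (fun t => circ (f t)) (f' • circT (f t)) t := by
  have := ((hf.ofReal_comp).mul_const Complex.I).cexp
  refine this.congr_deriv ?_
  simp [PHarm.circ, circT]
  ring

lemma HasDerivAt.circT {f : ℝ → ℝ} {f' t : ℝ} (hf : HasDerivAt f f' t) :
    HasDerivAt (fun t => circT (f t)) (-(f' • PHarm.circ (f t))) t := by
  have := (HasDerivAt.circ hf).const_mul Complex.I
  refine this.congr_deriv ?_
  simp only [PHarm.circT, Complex.real_smul]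
  linear_combination (↑f' * PHarm.circ (f t)) * Complex.I_mul_I

lemma HasDerivAt.mkCyl {f : ℝ → ℂ} {g : ℝ → ℝ} {f' : ℂ} {g' t : ℝ} (hf : HasDerivAt f f' t)
    (hg : HasDerivAt g g' t) : HasDerivAt (fun t => mkCyl (f t, g t)) (mkCyl (f', g')) t :=
  PHarm.mkCyl.hasFDerivAt.comp_hasDerivAt t (hf.prodMk hg)

lemma ContDiffOn.circ {f : ℝ → ℝ} {S : Set ℝ} {k : WithTop ℕ∞} (hf : ContDiffOn ℝ k f S) :
    ContDiffOn ℝ k (fun t => circ (f t)) S :=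
  ((Complex.ofRealCLM.contDiff.comp_contDiffOn hf).mul contDiffOn_const).cexp

/-- The velocity of the profile. -/
def velVec (θ a b : ℝ) : Cyl := mkCyl (a • circT θ, b)

/-- The gradient of the potential at a point of the profile. -/
def gradVec (θ y : ℝ) : Cyl := mkCyl (Vθ θ y • circT θ, Vy θ y)

lemma norm_velVec_sq (θ a b : ℝ) : ‖velVec θ a b‖ ^ 2 = a ^ 2 + b ^ 2 := by
  rw [velVec, norm_mkCyl_sq, norm_smul, norm_circT]; simp

lemma norm_gradVec_sq (θ y : ℝ) : ‖gradVec θ y‖ ^ 2 = Vθ θ y ^ 2 + Vy θ y ^ 2 := by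
  rw [gradVec, norm_mkCyl_sq, norm_smul, norm_circT]; simp

section Derivatives

lemma Vθ_eq_shift (θ y : ℝ) : Vθ θ y = Vr (θ + π / 2) y := by
  by_cases hy : y = 0
  · subst hy; simp [Vθ, Vr_zero]
  · rw [Vθ_of_ne hy, Vr_of_ne hy, show θ + π / 2 + 1 / y = (θ + 1 / y) + π / 2 by ring,
      sin_add_pi_div_two]

lemma Vy_eq_combination (θ y : ℝ) : Vy θ y = cos θ * Vy 0 y + sin θ * Vy (π / 2) y := by
  by_cases hy : y = 0
  · simp [Vy, hy]
  · rw [Vy_of_ne hy, Vy_of_ne hy, Vy_of_ne hy, add_comm (π / 2), sin_add_pi_div_two,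
      cos_add_pi_div_two, zero_add, sin_add, cos_add]
    ring

variable {t a b : ℝ}

lemma HasDerivAt.Vθ (hθ : HasDerivAt θ a t) (hy : HasDerivAt y b t) : HasDerivAt (fun t => Vθ (θ t)
    (y t)) (Vθ (θ t + π / 2) (y t) * a + Vy (θ t + π / 2) (y t) * b) t := by
  simp only [Vθ_eq_shift (θ _)]
  exact HasDerivAt.Vr (hθ.add_const _) hy

lemma HasDerivAt.Vy (hθ : HasDerivAt θ a t) (hy : HasDerivAt y b t) (h0 : 0 < y t) : HasDerivAt (fun
    t => Vy (θ t) (y t)) (-sin (θ t) * a * Vy 0 (y t) + cos (θ t) * (Vyy 0 (y t) * b) + (cos (θ t) *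
    a * Vy (π / 2) (y t) + sin (θ t) * (Vyy (π / 2) (y t) * b))) t := by
  have h : (fun t => PHarm.Vy (θ t) (y t)) = fun t => cos (θ t) * PHarm.Vy 0 (y t) +
      sin (θ t) * PHarm.Vy (π / 2) (y t) := funext fun t => Vy_eq_combination _ _
  rw [h]
  exact (hθ.cos.mul (HasDerivAt.comp t (hasDerivAt_Vy 0 h0) hy)).add
    (hθ.sin.mul (HasDerivAt.comp t (hasDerivAt_Vy (π / 2) h0) hy))

variable {S : Set ℝ} {k : WithTop ℕ∞}

lemma contDiffOn_exp_neg_inv_sq (hy : ContDiffOn ℝ k y S) (h0 : ∀ t ∈ S, y t ≠ 0) :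
    ContDiffOn ℝ k (fun t => -exp (-(1 / y t ^ 2))) S :=
  ((contDiffOn_const.div (hy.pow 2) fun t ht => pow_ne_zero 2 (h0 t ht)).neg.exp).neg

lemma contDiffOn_Vr (hθ : ContDiffOn ℝ k θ S) (hy : ContDiffOn ℝ k y S) (h0 : ∀ t ∈ S, y t ≠ 0) :
    ContDiffOn ℝ k (fun t => Vr (θ t) (y t)) S := by
  refine ContDiffOn.congr ?_ fun t ht => Vr_of_ne (h0 t ht)
  exact (contDiffOn_exp_neg_inv_sq hy h0).mul (hθ.add (contDiffOn_const.div hy h0)).sin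

lemma contDiffOn_Vθ (hθ : ContDiffOn ℝ k θ S) (hy : ContDiffOn ℝ k y S) (h0 : ∀ t ∈ S, y t ≠ 0) :
    ContDiffOn ℝ k (fun t => Vθ (θ t) (y t)) S := by
  simp only [Vθ_eq_shift (θ _)]
  exact contDiffOn_Vr (hθ.add contDiffOn_const) hy h0

lemma contDiffOn_Vy (hθ : ContDiffOn ℝ k θ S) (hy : ContDiffOn ℝ k y S) (h0 : ∀ t ∈ S, y t ≠ 0) :
    ContDiffOn ℝ k (fun t => Vy (θ t) (y t)) S := by
  refine ContDiffOn.congr ?_ fun t ht => Vy_of_ne (h0 t ht)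
  have hi : ContDiffOn ℝ k (fun t => 1 / y t) S := contDiffOn_const.div hy h0
  exact (contDiffOn_exp_neg_inv_sq hy h0).mul (((contDiffOn_const.mul (hi.pow 3)).mul
    (hθ.add hi).sin).sub ((hi.pow 2).mul (hθ.add hi).cos))

end Derivatives

namespace IsProfile

include h

lemma smooth_a : ContDiffOn ℝ ∞ a (Iio 0) :=
  (((contDiffOn_infty_iff_deriv_of_isOpen isOpen_Iio).1 h.smooth_θ).2).congr fun t ht =>
    (h.deriv_θ t ht).deriv.symm

lemma smooth_b : ContDiffOn ℝ ∞ b (Iio 0) :=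
  (((contDiffOn_infty_iff_deriv_of_isOpen isOpen_Iio).1 h.smooth_y).2).congr fun t ht =>
    (h.deriv_y t ht).deriv.symm

lemma y_ne : ∀ t ∈ Iio (0 : ℝ), y t ≠ 0 := fun t ht => (h.y_pos t ht).ne'

lemma smooth_V : ContDiffOn ℝ ∞ (fun t => Vr (θ t) (y t)) (Iio 0) :=
  contDiffOn_Vr h.smooth_θ h.smooth_y h.y_ne

lemma smooth_enDens : ContDiffOn ℝ ∞ (fun t => 𝐝 t) (Iio 0) :=
  ((h.smooth_a.pow 2).add (h.smooth_b.pow 2)).add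
    (contDiffOn_const.mul (contDiffOn_const.sub h.smooth_V))

lemma one_le_enDens (t : ℝ) : 1 ≤ 𝐝 t := by
  have hB := h.hB
  have h1 := (abs_le.1 (abs_Vr_le_one (θ t) (y t))).2
  have : 1 * 1 ≤ M * (B₀ - Vr (θ t) (y t)) := mul_le_mul h.hM (by linarith) zero_le_one
    (zero_le_one.trans h.hM)
  unfold enDens
  linarith [sq_nonneg (a t), sq_nonneg (b t)]

lemma enDens_le {t : ℝ} (ht : t < 0) : 𝐝 t ≤ 2 + M * (B₀ + 1) := by
  have h1 := (abs_le.1 (abs_Vr_le_one (θ t) (y t))).1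
  have : M * (B₀ - Vr (θ t) (y t)) ≤ M * (B₀ + 1) :=
    mul_le_mul_of_nonneg_left (by linarith) (zero_le_one.trans h.hM)
  have h2 : a t ^ 2 ≤ 1 := (sq_le_one_iff_abs_le_one _).2 ((h.a_le t ht).trans h.hν)
  have h3 : b t ^ 2 ≤ 1 := (sq_le_one_iff_abs_le_one _).2 ((h.b_le t ht).trans h.hν)
  unfold enDens
  linarith

lemma smooth_enWeight : ContDiffOn ℝ ∞ (fun t => 𝐰 t) (Iio 0) :=
  contDiffOn_const.mul (h.smooth_enDens.rpow_const_of_ne fun t _ =>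
    (zero_lt_one.trans_le (h.one_le_enDens t)).ne')

lemma enWeight_le {t : ℝ} (ht : t < 0) :
    |𝐰 t| ≤ p * (2 + M * (B₀ + 1)) ^ |p / 2 - 1| := by
  have h1 := h.one_le_enDens t
  have h0 : 0 ≤ 𝐝 t := by linarith
  have hp : 0 < p := zero_lt_one.trans h.hp
  rw [enWeight, abs_mul, abs_of_pos hp, abs_of_nonneg (rpow_nonneg h0 _)]
  gcongr
  exact (rpow_le_rpow_of_exponent_le h1 (le_abs_self _)).trans
    (rpow_le_rpow h0 (h.enDens_le ht) (abs_nonneg _))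

lemma hasDerivAt_velVec {t : ℝ} (ht : t < 0) : HasDerivAt (fun t => velVec (θ t) (a t) (b t)) (-(lam
    + ϖ t) • velVec (θ t) (a t) (b t) - (M / 2) • gradVec (θ t) (y t) - (a t ^ 2) • mkCyl (circ (θ
    t), 0)) t := by
  refine (HasDerivAt.mkCyl ((h.deriv_a t ht).smul (HasDerivAt.circT (h.deriv_θ t ht)))
    (h.deriv_b t ht)).congr_deriv ?_
  rw [velVec, gradVec, ← map_smul, ← map_smul, ← map_smul, ← map_sub, ← map_sub]
  congr 1
  simp only [Prod.smul_mk, Prod.mk_sub_mk, smul_eq_mul, Complex.real_smul]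
  push_cast
  congr 1
  · ring
  · ring

lemma exists_hasDerivAt_gradVec {t : ℝ} (ht : t < 0) :
    ∃ g', HasDerivAt (fun t => gradVec (θ t) (y t)) g' t :=
  ⟨_, HasDerivAt.mkCyl ((HasDerivAt.Vθ (h.deriv_θ t ht) (h.deriv_y t ht)).smul (HasDerivAt.circT
    (h.deriv_θ t ht))) (HasDerivAt.Vy (h.deriv_θ t ht) (h.deriv_y t ht) (h.y_pos t ht))⟩

variable {K : Set F}

lemma adm_circ : Adm K fun w : E m × F => circ (θ ㏑w.1) :=
  Adm.radial (γ := fun t => circ (θ t)) (C := 1) ((ContDiffOn.circ h.smooth_θ).of_le (by norm_cast))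
    (fun t ht => HasDerivAt.circ (h.deriv_θ t ht)) (fun t _ => (norm_circ _).le) fun t ht => by
      rw [norm_smul, norm_circT, mul_one]; exact (h.a_le t ht).trans h.hν

lemma adm_circT : Adm K fun w : E m × F => circT (θ ㏑w.1) :=
  h.adm_circ.clm (ContinuousLinearMap.mul ℝ ℂ Complex.I)

lemma adm_velocity {f g : ℝ → ℝ} (hs : ContDiffOn ℝ ∞ f (Iio 0))
    (hd : ∀ t < 0, HasDerivAt f (-(lam + ϖ t) * f t - M / 2 * g t) t) (hf : ∀ t < 0, |f t| ≤ ν)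
    (hg : ∀ t < 0, |g t| ≤ ν) : Adm K fun w : E m × F => f ㏑w.1 := by
  have hM := h.hM
  have hl := h.hlam
  have hν := h.hν
  refine Adm.radial (γ := f) (C := lam + 1 + M) (hs.of_le (by norm_cast)) hd
    (fun t ht => (hf t ht).trans (by linarith)) fun t ht => ?_
  have h1 : |lam + ϖ t| ≤ lam + 1 := (abs_add_le _ _).trans (by
    rw [abs_of_pos hl]; linarith [h.ϖ_le t ht])
  have h2 : |(lam + ϖ t) * f t| ≤ (lam + 1) * 1 := by rw [abs_mul]; gcongr; exact (hf t ht).trans hν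
  have h3 : |M / 2 * g t| ≤ M / 2 * 1 := by
    rw [abs_mul, abs_of_pos (by linarith : 0 < M / 2)]; gcongr; exact (hg t ht).trans hν
  rw [neg_mul, ← neg_add', norm_neg, norm_eq_abs]
  exact (abs_add_le _ _).trans (by linarith)

lemma adm_a : Adm K fun w : E m × F => a ㏑w.1 :=
  h.adm_velocity h.smooth_a h.deriv_a h.a_le h.Vθ_le

lemma adm_b : Adm K fun w : E m × F => b ㏑w.1 :=
  h.adm_velocity h.smooth_b h.deriv_b h.b_le h.Vy_le

lemma abs_combination_le {t : ℝ} (ht : t < 0) (x z : ℝ) {X Z : ℝ} (hx : |x| ≤ X)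
    (hz : |z| ≤ Z) : |x * a t + z * b t| ≤ X + Z := by
  refine (abs_add_le _ _).trans ?_
  rw [abs_mul, abs_mul]
  have h1 : |x| * |a t| ≤ X * 1 := mul_le_mul hx ((h.a_le t ht).trans h.hν) (abs_nonneg _)
    ((abs_nonneg _).trans hx)
  have h2 : |z| * |b t| ≤ Z * 1 := mul_le_mul hz ((h.b_le t ht).trans h.hν) (abs_nonneg _)
    ((abs_nonneg _).trans hz)
  linarith

lemma adm_V : Adm K fun w : E m × F =>
    Vr (θ ㏑w.1) (y ㏑w.1) :=
  Adm.radial (γ := fun t => Vr (θ t) (y t)) (C := 17) (h.smooth_V.of_le (by norm_cast)) (fun t ht =>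
    HasDerivAt.Vr (h.deriv_θ t ht) (h.deriv_y t ht)) (fun t _ => (abs_Vr_le_one _ _).trans (by
    norm_num)) fun t ht => (h.abs_combination_le ht _ _ (abs_Vθ_le_one _ _) (abs_Vy_le_const _
    _)).trans (by norm_num)

lemma adm_Vθ : Adm K fun w : E m × F =>
    Vθ (θ ㏑w.1) (y ㏑w.1) :=
  Adm.radial (γ := fun t => Vθ (θ t) (y t)) (C := 17) ((contDiffOn_Vθ h.smooth_θ h.smooth_y
    h.y_ne).of_le (by norm_cast)) (fun t ht => HasDerivAt.Vθ (h.deriv_θ t ht) (h.deriv_y t ht)) (fun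
    t _ => (abs_Vθ_le_one _ _).trans (by norm_num)) fun t ht => (h.abs_combination_le ht _ _
    (abs_Vθ_le_one _ _) (abs_Vy_le_const _ _)).trans (by norm_num)

lemma adm_Vy : Adm K fun w : E m × F =>
    Vy (θ ㏑w.1) (y ㏑w.1) :=
  Adm.radial (γ := fun t => Vy (θ t) (y t)) (C := 848) ((contDiffOn_Vy h.smooth_θ h.smooth_y
    h.y_ne).of_le (by norm_cast)) (fun t ht => HasDerivAt.Vy (h.deriv_θ t ht) (h.deriv_y t ht)
    (h.y_pos t ht)) (fun t _ => (abs_Vy_le_const _ _).trans (by norm_num)) fun t ht => by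
      have hy := h.y_pos t ht
      have hy1 : y t ≤ 1 := (h.y_le t ht).trans h.hν
      have e1 : ∀ r s : ℝ, |r| ≤ 1 → |s| ≤ 1 → ∀ x, |r * Vy x (y t) + 0| ≤ 16 ∧
          |s * Vyy x (y t)| ≤ 408 := fun r s hr hs x => by
        refine ⟨?_, ?_⟩
        · rw [add_zero, abs_mul]
          exact (mul_le_mul hr (abs_Vy_le_const _ _) (abs_nonneg _) zero_le_one).trans (by norm_num)
        · rw [abs_mul]
          refine (mul_le_mul hs (abs_Vyy_le hy hy1) (abs_nonneg _) zero_le_one).trans ?_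
          have : y t ^ 2 ≤ 1 := pow_le_one₀ hy.le hy1
          linarith
      have hs := abs_sin_le_one (θ t)
      have hc := abs_cos_le_one (θ t)
      have f1 := e1 (-sin (θ t)) (cos (θ t)) (by rwa [abs_neg]) hc 0
      have f2 := e1 (cos (θ t)) (sin (θ t)) hc hs (π / 2)
      have g1 := h.abs_combination_le ht _ _ f1.1 f1.2
      have g2 := h.abs_combination_le ht _ _ f2.1 f2.2
      rw [norm_eq_abs]
      refine le_trans (le_of_eq ?_) ((abs_add_le _ _).trans (add_le_add g1 g2)) |>.trans
        (by norm_num)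
      congr 1
      ring

lemma adm_enWeight : Adm K fun w : E m × F =>
    𝐰 ㏑w.1 :=
  Adm.radial (γ := fun t => 𝐰 t) (h.smooth_enWeight.of_le (by norm_cast)) h.deriv_P (fun t ht => h.enWeight_le ht) fun t ht => by
      rw [norm_eq_abs, abs_mul]
      exact (mul_le_mul ((h.ϖ_le t ht).trans h.hν) (h.enWeight_le ht) (abs_nonneg _)
        zero_le_one).trans_eq (one_mul _)

lemma adm_velVec : Adm K fun w : E m × F => velVec (θ (㏑ w.1)) (a ㏑w.1) (b ㏑w.1) := by
  have h1 := (h.adm_a.smul (K := K) (m := m) h.adm_circT).clm (mkCyl.comp (inl ℝ ℂ ℝ))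
  have h2 := (h.adm_b (K := K) (m := m)).clm (mkCyl.comp (inr ℝ ℂ ℝ))
  convert h1.add h2 using 2
  simp [velVec, ← map_add]

lemma adm_gradVec : Adm K fun w : E m × F => gradVec (θ ㏑w.1) (y ㏑w.1) := by
  have h1 := (h.adm_Vθ.smul (K := K) (m := m) h.adm_circT).clm (mkCyl.comp (inl ℝ ℂ ℝ))
  have h2 := (h.adm_Vy (K := K) (m := m)).clm (mkCyl.comp (inr ℝ ℂ ℝ))
  convert h1.add h2 using 2
  simp [gradVec, ← map_add]

end IsProfile

end ProfileVectors

section CalibrationCoefficients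

section Cap

lemma contDiff_capZ (hβ : 2 ≤ β) : ContDiff ℝ 1 (capZ β : H → ℝ) := by
  have hβ0 : 0 < β := by linarith
  refine ContDiff.inv (contDiff_const.add ((contDiff_norm_sq ℝ).div_const β)) fun z => ?_
  positivity

lemma contDiff_capX (hβ : 2 ≤ β) : ContDiff ℝ 1 (capX β : H → H) :=
  ((contDiff_capZ hβ).pow 2).smul contDiff_id

lemma contDiff_capQ (hβ : 2 ≤ β) : ContDiff ℝ 1 (capQ β : H → ℝ) :=
  (contDiff_capZ hβ).mul (contDiff_norm_sq ℝ)

lemma hasDerivAt_line (z ξ : H) : HasDerivAt (fun s : ℝ => z + s • ξ) ξ 0 := by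
  simpa using ((hasDerivAt_id (0 : ℝ)).smul_const ξ).const_add z

lemma norm_fderiv_capX_le (hβ : 2 ≤ β) (z : H) : ‖fderiv ℝ (capX β) z‖ ≤ 5 := by
  refine opNorm_le_bound _ (by norm_num) fun ξ => ?_
  have h1 : HasFDerivAt (capX β) (fderiv ℝ (capX β) z) (z + (0 : ℝ) • ξ) := by
    rw [zero_smul, add_zero]
    exact ((contDiff_capX hβ).differentiable one_ne_zero z).hasFDerivAt
  have h2 := h1.comp_hasDerivAt (0 : ℝ) (hasDerivAt_line z ξ)
  rw [h2.unique (hasDerivAt_capX hβ (hasDerivAt_line z ξ))]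
  exact norm_capD_le hβ _ _

lemma norm_fderiv_capQ_le (hβ : 2 ≤ β) (z : H) : ‖fderiv ℝ (capQ β) z‖ ≤ 2 * β := by
  refine opNorm_le_bound _ (by positivity) fun ξ => ?_
  have h1 : HasFDerivAt (capQ β) (fderiv ℝ (capQ β) z) (z + (0 : ℝ) • ξ) := by
    rw [zero_smul, add_zero]
    exact ((contDiff_capQ hβ).differentiable one_ne_zero z).hasFDerivAt
  have h2 := h1.comp_hasDerivAt (0 : ℝ) (hasDerivAt_line z ξ)
  rw [h2.unique (hasDerivAt_capQ hβ (hasDerivAt_line z ξ)), norm_mul, norm_eq_abs,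
    norm_eq_abs, abs_two, mul_assoc]
  gcongr
  exact (abs_real_inner_le_norm _ _).trans (by gcongr; exact norm_capX_le hβ _)

end Cap

/-- The auxiliary vector of the calibration. -/
def ellVec (M k₁ θ y a b : ℝ) : Cyl :=
  (-(1 / 2) : ℝ) • gradVec θ y + (2 * k₁ / M) • velVec θ a b

/-- The components of the calibration, as functions of `x` and of the deviation `(h, k)` from the
profile. -/
def calCoeff (p M lam ε k₁ β B₀ : ℝ) (θ y a b : ℝ → ℝ) (n : ℕ) (i : Fin m) (w : E m × 𝕐 n) : ℝ :=
  enWeight p M B₀ (θ ㏑w.1) (y ㏑w.1) (a ㏑w.1) (b ㏑w.1) * calField M lam ε k₁ β i 𝐧w.1 (w.2.2 + padL m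
    n 𝐧w.1) w.2.1 (velVec (θ ㏑w.1) (a ㏑w.1) (b ㏑w.1)) (ellVec M k₁ (θ ㏑w.1) (y ㏑w.1) (a ㏑w.1) (b
    ㏑w.1)) (B₀ - Vr (θ ㏑w.1) (y ㏑w.1))

lemma calCoeff_zero (hmn : m ≤ n + 1) (i : Fin m) {x : E m} (hx : x ≠ 0) :
    calCoeff p M lam ε k₁ β B₀ θ y a b n i (x, 0) = 0 := by
  have h1 := norm_dir hx
  simp only [calCoeff, calField, calSigma, Prod.snd_zero, Prod.fst_zero, zero_add, padL_apply,
    inner_pad_pad hmn, firstCoords_pad hmn, real_inner_self_eq_norm_sq, h1, capX, capQ, smul_zero,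
    inner_zero_right, norm_zero]
  ring

include h in
lemma IsProfile.adm_calCoeff (hβ : 2 ≤ β) (R : ℝ) (i : Fin m) :
    Adm {z : 𝕐 n | ‖z.2‖ ≤ R} (calCoeff p M lam ε k₁ β B₀ θ y a b n i) := by
  set K := {z : 𝕐 n | ‖z.2‖ ≤ R}
  have ho : Adm K fun w : E m × 𝕐 n => 𝐧 w.1 := Adm.dir
  have hoi : Adm K fun w : E m × 𝕐 n => 𝐧w.1 i :=
    ho.clm (proj (𝕜 := ℝ) i)
  have hpo : Adm K fun w : E m × 𝕐 n => padL m n 𝐧w.1 := ho.clm (padL m n)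
  have hk : Adm K fun w : E m × 𝕐 n => w.2.2 := Adm.snd_snd
  have hv : Adm K fun w : E m × 𝕐 n => w.2.2 + padL m n 𝐧w.1 := hk.add hpo
  have hcap : ∀ {G : Type} [NormedAddCommGroup G] [NormedSpace ℝ G] {ψ : Cyl → G} {C C' : ℝ},
      ContDiff ℝ 1 ψ → (∀ z, ‖ψ z‖ ≤ C) → (∀ z, ‖fderiv ℝ ψ z‖ ≤ C') →
      Adm K fun w : E m × 𝕐 n => ψ w.2.1 := by
    intro G _ _ ψ C C' h1 h2 h3
    refine Adm.of_snd (ψ := fun z : 𝕐 n => ψ z.1) (h1.comp contDiff_fst) (C' := C')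
      (fun z _ => h2 _) fun z _ => ?_
    have := ((h1.differentiable one_ne_zero z.1).hasFDerivAt.comp z hasFDerivAt_fst).fderiv
    simp only [Function.comp_def] at this
    rw [this]
    refine (opNorm_comp_le _ _).trans ?_
    exact (mul_le_mul (h3 _) (ContinuousLinearMap.norm_fst_le _ _ _) (norm_nonneg _)
      ((norm_nonneg _).trans (h3 z.1))).trans_eq (mul_one _)
  have hX : Adm K fun w : E m × 𝕐 n => capX β w.2.1 :=
    hcap (contDiff_capX hβ) (norm_capX_le hβ) (norm_fderiv_capX_le hβ)
  have hQ : Adm K fun w : E m × 𝕐 n => capQ β w.2.1 :=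
    hcap (contDiff_capQ hβ) (C := β) (fun z => by
      rw [norm_of_nonneg (capQ_nonneg hβ z)]; exact capQ_le hβ z) (norm_fderiv_capQ_le hβ)
  have hu := h.adm_velVec (m := m) (K := K)
  have hg := h.adm_gradVec (m := m) (K := K)
  have hell := ((Adm.const (m := m) (K := K) (-(1 / 2) : ℝ)).smul hg).add
    ((Adm.const (m := m) (K := K) (2 * k₁ / M)).smul hu)
  have hBB := (Adm.const (m := m) (K := K) B₀).sub h.adm_V
  have hP := h.adm_enWeight (m := m) (K := K)
  have hc := hv.inner hpo
  have hπ := hv.clm (projL m n)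
  have hπi := hπ.clm (proj (𝕜 := ℝ) i)
  have hone := Adm.const (m := m) (K := K) (1 : ℝ)
  have hσ := (Adm.const (m := m) (K := K) lam⁻¹).mul
    ((((Adm.const (m := m) (K := K) M).mul (hone.sub (hc.pow 2))).add
    ((hπ.inner hπ).sub (hc.pow 2))).add ((Adm.const (m := m) (K := K) ε).mul (hone.sub hc)))
  have hfin := hP.mul ((hoi.mul (((hu.inner hX).sub (hBB.mul hσ)).sub ((Adm.const (m := m) (K := K)
    k₁).mul hQ))).add (((hBB.add (hell.inner hX)).sub hQ).mul (hc.mul (hπi.sub (hc.mul hoi)))))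
  convert hfin using 2 with w
  simp only [calCoeff, calField, calSigma, ellVec, padL_apply, projL_apply,
    real_inner_self_eq_norm_sq]
  rfl

lemma chainTerm_truncated {g : E m × 𝕐 n → ℝ} {τ : E (n + 1) → E (n + 1)} (hτ : ∀ z, ‖z‖ < 6 / 2 → τ
    z = z) {D : E m → 𝕐 n} (A : E m → E m →L[ℝ] 𝕐 n) (e x : E m) (hx : ‖(D x).2‖ < 6 / 2) :
    chainTerm p (fun w => g (w.1, w.2.1, τ w.2.2)) D A e x = chainTerm p g D A e x := by
  have hev : (fun w : E m × 𝕐 n => g (w.1, w.2.1, τ w.2.2)) =ᶠ[𝓝 (x, D x)] g := by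
    have : ∀ᶠ w : E m × 𝕐 n in 𝓝 (x, D x), ‖w.2.2‖ < 6 / 2 :=
      (continuous_snd.snd.norm.continuousAt (x := (x, D x))).eventually_lt continuousAt_const hx
    filter_upwards [this] with w hw
    rw [hτ _ hw]
  rw [chainTerm, chainTerm, hev.fderiv_eq]
  simp only [hτ _ hx]

include h in
/-- The value of the divergence term of the calibration. -/
lemma IsProfile.chainTerm_calCoeff (hβ : 2 ≤ β) (i : Fin m) {x : E m}
    (hx : x ∈ 𝔹) (hx0 : x ≠ 0) {D : E m → 𝕐 n}
    {A : E m → E m →L[ℝ] 𝕐 n} {t c : ℝ} {o ρ : E m} {v : E (n + 1)} {u ℓ : Cyl}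
    (ht : t = ㏑ x) (ho : o = 𝐧 x) (hv : v = (D x).2 + pad n o)
    (sp : SpherePoint o v c ρ) (hu : u = velVec (θ t) (a t) (b t))
    (hl : ℓ = ellVec M k₁ (θ t) (y t) (a t) (b t)) {X : Cyl} {Z : E (n + 1)}
    (hX : X = ‖x‖ • (A x (single i 1)).1 + o i • u)
    (hZ : Z = ‖x‖ • (A x (single i 1)).2 +
      pad n (single i 1 - o i • o)) {ℓ' u' : Cyl}
    (hl' : HasDerivAt (fun t => ellVec M k₁ (θ t) (y t) (a t) (b t)) ℓ' t)
    (hu' : HasDerivAt (fun t => velVec (θ t) (a t) (b t)) u' t) {f G d B' : ℝ}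
    (hf : f = inner ℝ u (capX β (D x).1) - (B₀ - Vr (θ t) (y t)) * calSigma M lam ε o v -
      k₁ * capQ β (D x).1)
    (hG : G = (B₀ - Vr (θ t) (y t)) + inner ℝ ℓ (capX β (D x).1) - capQ β (D x).1)
    (hB' : B' = -(Vθ (θ t) (y t) * a t + Vy (θ t) (y t) * b t))
    (hd : d = (1 - p + ϖ t) * G * c + (B₀ - Vr (θ t) (y t)) * (lam⁻¹ * (2 * M * c + 2 * c + ε)) -
      G * c + c * (inner ℝ ℓ' (capX β (D x).1) + B' - inner ℝ ℓ (capD β (D x).1 u) +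
        2 * inner ℝ (capX β (D x).1) u)) :
    ‖x‖ ^ p * chainTerm p (calCoeff p M lam ε k₁ β B₀ θ y a b n i) D A
        (single i 1) x =
      𝐰 t *
        ((inner ℝ (o i • (capD β (D x).1 u - (2 * k₁) • capX β (D x).1) +
            (c * ρ i) • (capD β (D x).1 ℓ - (2 : ℝ) • capX β (D x).1)) X +
          inner ℝ (fieldV n M lam ε (B₀ - Vr (θ t) (y t)) G o c ρ i) Z) +
          ((f - G * c ^ 2) + ((1 - p + ϖ t) * f - f + inner ℝ u' (capX β (D x).1) -
            inner ℝ u (capD β (D x).1 u) - B' * calSigma M lam ε o v +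
            2 * k₁ * inner ℝ (capX β (D x).1) u + G * c ^ 2) * o i ^ 2 +
          d * (o i * ρ i) + G * ρ i ^ 2)) := by
  have hr : 0 < ‖x‖ := norm_pos_iff.2 hx0
  have ht0 : t < 0 := by rw [ht]; exact log_neg hr (by simpa using hx)
  set e : E m := single i 1 with he
  have hadm := h.adm_calCoeff (ε := ε) (k₁ := k₁) (n := n) hβ 0 i
  have hreg : ((x, D x) : E m × 𝕐 n) ∈ Reg m (𝕐 n) := mem_Reg.2 ⟨hx, hx0⟩
  set g := calCoeff (m := m) p M lam ε k₁ β B₀ θ y a b n i with hg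
  have hgd := (hadm.differentiableAt hreg).hasFDerivAt
  have hc1 : HasDerivAt (fun s : ℝ => x + s • ‖x‖ • e) (‖x‖ • e) 0 := hasDerivAt_line _ _
  have hx1 : x + (0 : ℝ) • ‖x‖ • e = x := by simp
  have hc2 : HasDerivAt (fun s : ℝ => D x + s • ‖x‖ • A x e) (‖x‖ • A x e) 0 := by
    simpa using ((hasDerivAt_id (0 : ℝ)).smul_const (‖x‖ • A x e)).const_add (D x)
  have hD1 : D x + (0 : ℝ) • ‖x‖ • A x e = D x := by simp
  have hcurve := hc1.prodMk hc2
  have hgd' : HasFDerivAt g (fderiv ℝ g (x, D x))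
      ((x + (0 : ℝ) • ‖x‖ • e, D x + (0 : ℝ) • ‖x‖ • A x e)) := by rwa [hx1, hD1]
  have h1 := hgd'.comp_hasDerivAt (0 : ℝ) hcurve
  have hoi : o i = inner ℝ x e / ‖x‖ := by
    rw [ho, he, inner_single_right]; simp; ring
  have hdt : HasDerivAt (fun s : ℝ => ㏑(x + s • ‖x‖ • e)) (o i) 0 := by
    have hl1 := hasFDerivAt_log_norm hx0
    rw [← hx1] at hl1
    refine (hl1.comp_hasDerivAt (0 : ℝ) hc1).congr_deriv ?_
    rw [hx1, dLog_apply, hoi, inner_smul_right]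
    field_simp
  have hdo : HasDerivAt (fun s : ℝ => 𝐧(x + s • ‖x‖ • e))
      (e - o i • o) 0 := by
    have hl1 := hasFDerivAt_dir hx0
    rw [← hx1] at hl1
    refine (hl1.comp_hasDerivAt (0 : ℝ) hc1).congr_deriv ?_
    rw [hx1, dDir_apply, inner_smul_right, hoi, ho, smul_smul, smul_smul, inv_mul_cancel₀ hr.ne',
      one_smul]
    congr 2
    field_simp
  have hcomp : ∀ {G : Type} [NormedAddCommGroup G] [NormedSpace ℝ G] {γ : ℝ → G} {γ' : G},
      HasDerivAt γ γ' t →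
        HasDerivAt (fun s : ℝ => γ ㏑(x + s • ‖x‖ • e)) (o i • γ') 0 := by
    intro G _ _ γ γ' hγ
    have : HasDerivAt γ γ' ㏑(x + (0 : ℝ) • ‖x‖ • e) := by rwa [hx1, ← ht]
    exact this.scomp (0 : ℝ) hdt
  have hdv : HasDerivAt (fun s : ℝ => (D x + s • ‖x‖ • A x e).2 +
      padL m n (𝐧(x + s • ‖x‖ • e))) Z 0 := by
    refine (((snd ℝ _ _).hasFDerivAt.comp_hasDerivAt (0 : ℝ) hc2).add
      ((padL m n).hasFDerivAt.comp_hasDerivAt (0 : ℝ) hdo)).congr_deriv ?_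
    rw [hZ]; simp
  have hdh : HasDerivAt (fun s : ℝ => (D x + s • ‖x‖ • A x e).1) (X - o i • u) 0 := by
    refine ((fst ℝ _ _).hasFDerivAt.comp_hasDerivAt (0 : ℝ) hc2).congr_deriv ?_
    rw [hX]; simp
  have hsp : SpherePoint (𝐧(x + (0 : ℝ) • ‖x‖ • e))
      ((D x + (0 : ℝ) • ‖x‖ • A x e).2 +
        padL m n (𝐧(x + (0 : ℝ) • ‖x‖ • e))) c ρ := by
    rw [hx1, hD1, ← ho, padL_apply, ← hv]; exact sp
  have hBd : HasDerivAt (fun t => B₀ - Vr (θ t) (y t)) B' t := by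
    rw [hB']
    exact (HasDerivAt.Vr (h.deriv_θ t ht0) (h.deriv_y t ht0)).const_sub B₀
  have hPd := hcomp (h.deriv_P t ht0)
  rw [smul_eq_mul] at hPd
  have hBd' := hcomp hBd
  rw [smul_eq_mul] at hBd'
  have hfinal := hsp.hasDerivAt_calField (M := M) (lam := lam) (ε := ε) (k₁ := k₁) (i := i) (s := 0)
    (o := fun s : ℝ => 𝐧(x + s • ‖x‖ • e))
    (v := fun s : ℝ => (D x + s • ‖x‖ • A x e).2 +
      padL m n (𝐧(x + s • ‖x‖ • e)))
    (h := fun s : ℝ => (D x + s • ‖x‖ • A x e).1) (Z := Z) (X := X) (ϖ := ϖ t)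
    (u := fun s : ℝ => velVec (θ ㏑(x + s • ‖x‖ • e)) (a ㏑(x + s • ‖x‖ • e))
      (b ㏑(x + s • ‖x‖ • e)))
    (ℓ := fun s : ℝ => ellVec M k₁ (θ ㏑(x + s • ‖x‖ • e))
      (y ㏑(x + s • ‖x‖ • e)) (a ㏑(x + s • ‖x‖ • e))
      (b ㏑(x + s • ‖x‖ • e)))
    (B := fun s : ℝ => B₀ - Vr (θ ㏑(x + s • ‖x‖ • e))
      (y ㏑(x + s • ‖x‖ • e)))
    (P := fun s : ℝ => 𝐰 ㏑(x + s • ‖x‖ • e)) (u' := u') (ℓ' := ℓ') (B' := B') (f := f) (G := G) (d := d)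
    hβ (by simpa only [hx1, ← ho] using hdo) hdv
    (by simpa only [hx1, ← ho, ← ht, ← hu] using hdh) (by simpa only [hx1, ← ho, ← ht] using hcomp hu')
    (by simpa only [hx1, ← ho, ← ht] using hcomp hl') (by simpa only [hx1, ← ho] using hBd')
    (by simpa only [hx1, ← ho, ← ht] using hPd) p
    (by simpa only [hx1, hD1, ← ho, ← ht, ← hu, padL_apply, ← hv] using hf)
    (by simpa only [hx1, hD1, ← ho, ← ht, ← hu, ← hl, padL_apply, ← hv] using hG)
    (by simpa only [hx1, hD1, ← ho, ← ht, ← hu, ← hl, padL_apply, ← hv] using hd)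
  simp only [hx1, hD1, ← ho, ← ht, ← hu, ← hl, padL_apply, ← hv] at hfinal
  have huniq := h1.unique hfinal
  have hgx : g (x, D x) = 𝐰 t *
      calField M lam ε k₁ β i o v (D x).1 u ℓ (B₀ - Vr (θ t) (y t)) := by
    rw [hg]
    simp only [calCoeff, padL_apply, ← ho, ← ht, ← hu, ← hl, ← hv]
  rw [← hgx] at huniq
  have hlin : fderiv ℝ g (x, D x) (‖x‖ • e, ‖x‖ • A x e) =
      ‖x‖ * fderiv ℝ g (x, D x) (e, A x e) := by
    rw [← Prod.smul_mk, map_smul, smul_eq_mul]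
  rw [hlin] at huniq
  have hpow1 : ‖x‖ ^ p * ‖x‖ ^ (-1 - p) = ‖x‖⁻¹ := by
    rw [← rpow_add hr]; ring_nf; rw [rpow_neg_one]
  have hpow2 : ‖x‖ ^ p * ‖x‖ ^ (1 - p) = ‖x‖ := by
    rw [← rpow_add hr]; ring_nf; rw [rpow_one]
  have hxe : inner ℝ x e = ‖x‖ * o i := by rw [hoi]; field_simp
  rw [chainTerm, hxe]
  have : ‖x‖ ^ p * ((1 - p) * ‖x‖ ^ (-1 - p) * (‖x‖ * o i) * g (x, D x) +
      ‖x‖ ^ (1 - p) * fderiv ℝ g (x, D x) (e, A x e)) =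
      (1 - p) * o i * g (x, D x) + ‖x‖ * fderiv ℝ g (x, D x) (e, A x e) := by
    have e1 : ‖x‖⁻¹ * ‖x‖ = 1 := inv_mul_cancel₀ hr.ne'
    linear_combination ((1 - p) * (‖x‖ * o i) * g (x, D x)) * hpow1 +
      (fderiv ℝ g (x, D x) (e, A x e)) * hpow2 + ((1 - p) * o i * g (x, D x)) * e1
  rw [this, huniq]
  ring

end CalibrationCoefficients

/-- The profile as a map to `T¹ × ℝ`. -/
def profMap (θ y : ℝ → ℝ) : ℝ → Real.Angle × ℝ := fun r =>
  ((θ (log r) : Real.Angle), y (log r))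

/-- The equivariant map of the profile. -/
local notation:max "𝐔" => equivMap m n (profMap θ y)

section RadialMaps

lemma continuousOn_dLog : ContinuousOn (dLog (m := m)) {0}ᶜ := by
  refine ContinuousOn.smul ((continuous_norm.pow 2).continuousOn.inv₀ fun x hx => ?_)
    (innerSL ℝ).continuous.continuousOn
  exact pow_ne_zero 2 (norm_ne_zero_iff.2 hx)

lemma continuousOn_dDir : ContinuousOn (dDir (m := m)) {0}ᶜ := by
  have h0 : ∀ x ∈ ({0}ᶜ : Set (E m)), ‖x‖ ≠ 0 := fun x hx => norm_ne_zero_iff.2 hx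
  refine ((continuous_norm.continuousOn.inv₀ h0).smul continuousOn_const).sub
    (((continuous_norm.pow 3).continuousOn.inv₀ fun x hx => pow_ne_zero 3 (h0 x hx)).smul ?_)
  have : Continuous fun x : E m => (innerSL ℝ x).smulRight x := by
    have h := (smulRightL ℝ (E m) (E m)).continuous₂
    exact h.comp ((innerSL ℝ).continuous.prodMk continuous_id)
  exact this.continuousOn

lemma PuncturedC1.radial {γ γ' : ℝ → F} {T C R : ℝ} (hc : ContinuousOn γ' (Iio T)) (hγ : ∀ t < T,
    HasDerivAt γ (γ' t) t) (hC : ∀ t < T, ‖γ t‖ ≤ C) (hC' : ∀ t < T, ‖γ' t‖ ≤ C) (hR : R ≤ exp T) :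
    PuncturedC1 R C (fun x : E m => γ ㏑x) (fun x => (dLog x).smulRight (γ' ㏑x)) := by
  have hlog : ∀ x ∈ ball (0 : E m) R, x ≠ 0 → ㏑ x < T := fun x hx hx0 =>
    (log_lt_iff_lt_exp (norm_pos_iff.2 hx0)).2 ((by simpa using hx : ‖x‖ < R).trans_le hR)
  refine ⟨fun x hx hx0 => ?_, ?_, fun x hx hx0 => hC _ (hlog x hx hx0), fun x hx hx0 => ?_⟩
  · refine ((hγ _ (hlog x hx hx0)).hasFDerivAt.comp x (hasFDerivAt_log_norm hx0)).congr_fderiv ?_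
    ext e
    simp [dLog, smul_smul]
  · have h := (smulRightL ℝ (E m) F).continuous₂
    refine h.comp_continuousOn (f := fun x : E m => (dLog x, γ' ㏑x)) ((continuousOn_dLog.mono fun x
      hx => hx.2).prodMk (hc.comp (continuous_norm.continuousOn.log fun x hx => norm_ne_zero_iff.2
      hx.2) fun x hx => hlog x hx.1 hx.2))
  · rw [ContinuousLinearMap.norm_smulRight_apply, mul_comm]
    exact mul_le_mul (hC' _ (hlog x hx hx0)) (norm_dLog_le hx0) (norm_nonneg _)
      ((norm_nonneg _).trans (hC' _ (hlog x hx hx0)))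

lemma toSphere_pad (hmn : m ≤ n + 1) {x : E m} (hx : x ≠ 0) :
    ((toSphere (pad n x) : Sph n) : E (n + 1)) = padL m n 𝐧x := by
  have h0 : pad n x ≠ 0 := by rw [← norm_ne_zero_iff, norm_pad hmn]; exact norm_ne_zero_iff.2 hx
  rw [toSphere, dif_neg h0, map_smul, padL_apply]
  change ‖pad n x‖⁻¹ • pad n x = _
  rw [norm_pad hmn]

lemma punctured_vC (hmn : m ≤ n + 1) (u : ℝ → Real.Angle × ℝ) (R : ℝ) :
    PuncturedC1 R 2 (vC (equivMap m n u)) (fun x => (padL m n).comp (dDir x)) := by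
  have hpad : ‖padL m n‖ ≤ 1 := opNorm_le_bound _ zero_le_one fun x => by
    rw [padL_apply, norm_pad hmn, one_mul]
  refine ⟨fun x hx hx0 => ?_, ?_, fun x hx hx0 => ?_, fun x hx hx0 => ?_⟩
  · have hev : vC (equivMap m n u) =ᶠ[𝓝 x] fun x => padL m n 𝐧x := by
      filter_upwards [isOpen_ne.mem_nhds hx0] with z hz using toSphere_pad hmn hz
    exact ((padL m n).hasFDerivAt.comp x (hasFDerivAt_dir hx0)).congr_of_eventuallyEq hev
  · exact continuousOn_const.clm_comp (continuousOn_dDir.mono fun x hx => hx.2)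
  · rw [vC]; simp
  · refine (opNorm_comp_le _ _).trans ?_
    calc _ ≤ 1 * (2 * ‖x‖⁻¹) := mul_le_mul hpad (norm_dDir_le hx0) (norm_nonneg _) zero_le_one
      _ = _ := one_mul _

include h in
lemma IsProfile.punctured_thetaC : PuncturedC1 1 1 (thetaC 𝐔) (fun x => (dLog x).smulRight (a ㏑x •
    circT (θ ㏑x))) := by
  have e : thetaC 𝐔 = fun x => circ (θ ㏑x) :=
    funext fun x => toCircle_coe _
  rw [e]
  refine PuncturedC1.radial (γ := fun t => circ (θ t)) (γ' := fun t => a t • circT (θ t)) (T := 0)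
    (h.smooth_a.continuousOn.smul (continuousOn_const.mul (ContDiffOn.circ
    h.smooth_θ).continuousOn)) (fun t ht => HasDerivAt.circ (h.deriv_θ t ht)) (fun t _ => (norm_circ
    _).le) (fun t ht => ?_) (by simp)
  rw [norm_smul, norm_circT, mul_one]
  exact (h.a_le t ht).trans h.hν

include h in
lemma IsProfile.punctured_yC : PuncturedC1 1 1 (yC 𝐔) (fun x => (dLog x).smulRight (b ㏑x)) :=
  PuncturedC1.radial (γ := y) (T := 0) h.smooth_b.continuousOn h.deriv_y (fun t ht => by
    rw [norm_of_nonneg (h.y_pos t ht).le]; exact (h.y_le t ht).trans h.hν)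
    (fun t ht => (h.b_le t ht).trans h.hν) (by simp)

include h in
lemma IsProfile.sobolevMap (hmn : m ≤ n + 1) (hpm : p < m) : SobolevMap p 𝐔 :=
  ⟨h.punctured_thetaC.memW1p h.hp hpm, h.punctured_yC.memW1p h.hp hpm,
    (punctured_vC hmn _ 1).memW1p h.hp hpm⟩

end RadialMaps

section ZeroBoundary

lemma MemW1pZero.isW1pZero [CompleteSpace F] {f : E m → F} (h : MemW1pZero (ballO m 1) p f) :
    IsW1pZero p f (weakDeriv (ballO m 1) f) := by
  obtain ⟨h1, φ, h2, h3⟩ := h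
  exact ⟨h1.1, h1.memLp_weakDeriv, fun k x => φ k x, fun k => ⟨contDiff_test _,
    (φ k).tsupport_subset⟩, h2, h3⟩

lemma tendsto_eLpNorm_add_zero {α A : Type*} [MeasurableSpace α] {μ : Measure α} [NormedAddCommGroup
    A] {q : ℝ≥0∞} (hq : 1 ≤ q) {u w z : ℕ → α → A} (hu : ∀ k, AEStronglyMeasurable (u k) μ) (hw : ∀
    k, AEStronglyMeasurable (w k) μ) (lu : Tendsto (fun k => eLpNorm (u k) q μ) atTop (𝓝 0)) (lw :
    Tendsto (fun k => eLpNorm (w k) q μ) atTop (𝓝 0)) (hz : ∀ k x, z k x = u k x + w k x) : Tendsto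
    (fun k => eLpNorm (z k) q μ) atTop (𝓝 0) := by
  have := lu.add lw
  rw [zero_add] at this
  refine tendsto_of_tendsto_of_tendsto_of_le_of_le tendsto_const_nhds this (fun _ => zero_le)
    fun k => ?_
  have e : z k = u k + w k := funext (hz k)
  rw [e]
  exact eLpNorm_add_le (hu k) (hw k) hq

namespace IsW1pZero

variable {f g : E m → F} {f' g' : E m → E m →L[ℝ] F}

lemma clm (L : F →L[ℝ] G) (h : IsW1pZero p f f') :
    IsW1pZero p (fun x => L (f x)) (fun x => L.comp (f' x)) := by
  obtain ⟨h1, h2, φ, h3, h4, h5⟩ := h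
  have hsq : ∀ {A B : Type _} [NormedAddCommGroup A] [NormedAddCommGroup B] {u : ℕ → E m → A} {w : ℕ
      → E m → B}, (∀ k x, ‖w k x‖ ≤ ‖L‖ * ‖u k x‖) → Tendsto (fun k => eLpNorm (u k) (ofReal p) μ𝔹)
      atTop (𝓝 0) → Tendsto (fun k => eLpNorm (w k) (ofReal p) μ𝔹) atTop (𝓝 0) := by
    intro A B _ _ u w hw hu
    have := ENNReal.Tendsto.const_mul (a := ofReal ‖L‖) hu (Or.inr ENNReal.ofReal_ne_top)
    rw [mul_zero] at this
    exact tendsto_of_tendsto_of_tendsto_of_le_of_le tendsto_const_nhds this (fun _ => zero_le)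
      fun k => eLpNorm_le_mul_eLpNorm_of_ae_le_mul (ae_of_all _ (hw k)) _
  refine ⟨L.comp_memLp' h1, ((ContinuousLinearMap.compL ℝ (E m) F G) L).comp_memLp' h2,
    fun k x => L (φ k x), fun k => ⟨L.contDiff.comp (h3 k).1, ?_⟩, hsq (fun k x => ?_) h4,
    hsq (fun k x => ?_) h5⟩
  · refine subset_trans (closure_mono fun x hx => ?_) (h3 k).2
    contrapose! hx
    simp only [Function.mem_support, ne_eq, not_not] at hx ⊢
    rw [hx, map_zero]
  · rw [← map_sub]; exact L.le_opNorm _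
  · have : fderiv ℝ (fun x => L (φ k x)) x = L.comp (fderiv ℝ (φ k) x) :=
      (L.hasFDerivAt.comp x ((h3 k).1.differentiable (by simp) x).hasFDerivAt).fderiv
    rw [this, ← ContinuousLinearMap.comp_sub]
    exact opNorm_comp_le _ _

lemma add (hp : 1 ≤ p) (hf : IsW1pZero p f f') (hg : IsW1pZero p g g') :
    IsW1pZero p (fun x => f x + g x) (fun x => f' x + g' x) := by
  obtain ⟨h1, h2, φ, h3, h4, h5⟩ := hf
  obtain ⟨k1, k2, ψ, k3, k4, k5⟩ := hg
  have hp' : 1 ≤ ofReal p := by rw [← ENNReal.ofReal_one]; exact ENNReal.ofReal_le_ofReal hp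
  have a1 : MemLp (fun x => f x + g x) (ofReal p) μ𝔹 := h1.add k1
  have a2 : MemLp (fun x => f' x + g' x) (ofReal p) μ𝔹 := by
    simpa only [sub_neg_eq_add] using! h2.sub k2.neg
  have a3 : ∀ k, ContDiff ℝ ∞ (fun x => φ k x + ψ k x) ∧
      tsupport (fun x => φ k x + ψ k x) ⊆ 𝔹 := fun k => ⟨(h3 k).1.add (k3 k).1,
    (tsupport_add _ _).trans (Set.union_subset (h3 k).2 (k3 k).2)⟩
  have a4 : Tendsto (fun k => eLpNorm (fun x => (f x + g x) - (φ k x + ψ k x)) (ofReal p)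
      μ𝔹) atTop (𝓝 0) :=
    tendsto_eLpNorm_add_zero hp' (fun k => h1.1.sub (h3 k).1.continuous.aestronglyMeasurable) (fun k
      => k1.1.sub (k3 k).1.continuous.aestronglyMeasurable) h4 k4 fun k x => add_sub_add_comm _ _ _
      _
  have a5 : Tendsto (fun k => eLpNorm (fun x => (f' x + g' x) - fderiv ℝ (fun x => φ k x + ψ k x) x)
      (ofReal p) μ𝔹) atTop (𝓝 0) := by
    refine tendsto_eLpNorm_add_zero hp' (fun k => h2.1.sub ((h3 k).1.continuous_fderiv (by
      simp)).aestronglyMeasurable) (fun k => k2.1.sub ((k3 k).1.continuous_fderiv (by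
      simp)).aestronglyMeasurable) h5 k5 fun k x => ?_
    have e : fderiv ℝ (fun x => φ k x + ψ k x) x = fderiv ℝ (φ k) x + fderiv ℝ (ψ k) x :=
      fderiv_fun_add ((h3 k).1.differentiable (by simp) x) ((k3 k).1.differentiable (by simp) x)
    rw [e]
    exact add_sub_add_comm _ _ _ _
  exact ⟨a1, a2, _, a3, a4, a5⟩

end IsW1pZero

end ZeroBoundary

section Competitor

lemma norm_circ_sub_sq (θ φ : ℝ) : ‖circ φ - circ θ‖ ^ 2 = 2 * (1 - cos (φ - θ)) := by
  rw [norm_sub_sq_real, norm_circ, norm_circ, inner_circ_circ, ← cos_neg, neg_sub]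
  ring

/-- The gain in the pointwise inequality behind minimality. -/
def calSlack (p M ε β B₀ : ℝ) (θ y a b : ℝ → ℝ) (x : E m) (h : Cyl) (c : ℝ) : ℝ :=
  enWeight p M B₀ (θ ㏑x) (y ㏑x) (a ㏑x) (b ㏑x) *
    (ε * M * capQ β h + ε * (B₀ - Vr (θ ㏑x) (y ㏑x)) / 2 * (1 - c))

include h in
set_option maxHeartbeats 1000000 in
lemma IsProfile.pointwise_le
    (C : CalParam M lam ε k₁ β B₀ η) (hνη : 2 * ν ≤ η) (hm : (m : ℝ) = M + 1)
    (hlam : lam = m - p) (hmn : m ≤ n + 1) {x : E m} (hx : x ∈ 𝔹)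
    (hx0 : x ≠ 0) {W : E m → Target n} {D : E m → 𝕐 n}
    {DD : E m → E m →L[ℝ] 𝕐 n}
    (hD : D x = (mkCyl (thetaC W x - circ (θ ㏑x), yC W x - y ㏑x),
      vC W x - padL m n 𝐧x))
    {Aθ : E m →L[ℝ] ℂ} {Ay : E m →L[ℝ] ℝ} {Av : E m →L[ℝ] E (n + 1)}
    (hDD : ∀ e, DD x e = (mkCyl
      (Aθ e - (dLog x).smulRight (a ㏑x • circT (θ ㏑x)) e,
        Ay e - (dLog x).smulRight (b ㏑x) e), Av e - padL m n (dDir x e)))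
    (horth : ∀ i, inner ℝ (vC W x) (Av (single i 1)) = 0)
    (hcase : vC W x = padL m n 𝐧x ∨ 40 * (M + 4) * β ≤ 3 * ε * (B₀ - 1)) :
    ‖x‖ ^ (-p) * 𝐝 ㏑x ^ (p / 2) +
      ‖x‖ ^ (-p) * calSlack p M ε β B₀ θ y a b x (D x).1
        (inner ℝ (vC W x) (padL m n 𝐧x)) +
      ∑ i, chainTerm p (calCoeff p M lam ε k₁ β B₀ θ y a b n i) D DD (single i 1) x ≤
      (hsSq Aθ + hsSq Ay + (B₀ - V (W x).1 (W x).2.1) * hsSq Av) ^ (p / 2) := by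
  have hM := C.hM
  have hβ := C.hβ
  have hB : 2 ≤ B₀ := hβ.trans C.hβB
  have hr : 0 < ‖x‖ := norm_pos_iff.2 hx0
  have hη2 := C.η_mul_le'
  have hε2 := C.ε_sq_le
  have hε := C.ε_lt
  have hη5 : 20000 * η ≤ ε ^ 2 := by
    refine le_trans ?_ hη2
    have : η * 4 ≤ η * (β + B₀ + 2) := mul_le_mul_of_nonneg_left (by linarith) C.hη0.le
    linarith
  set t := ㏑ x with ht
  have ht0 : t < 0 := log_neg hr (by simpa using hx)
  set o : E m := 𝐧 x with ho
  set v := vC W x with hv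
  have hy0 := h.y_pos t ht0
  have hν0 : 0 < ν := hy0.trans_le (h.y_le t ht0)
  have hν1 : ν ≤ 1 := by linarith
  obtain ⟨c, hc⟩ : ∃ c, c = inner ℝ v (padL m n o) := ⟨_, rfl⟩
  obtain ⟨ρ, hρ⟩ : ∃ ρ, ρ = firstCoords m v - c • o := ⟨_, rfl⟩
  have ho1 : ‖o‖ = 1 := ho ▸ norm_dir hx0
  have sp : SpherePoint o v c ρ := ⟨hmn, ho1, by rw [hv, vC]; simp, hc, hρ⟩
  obtain ⟨φ, hφ⟩ : ∃ φ : ℝ, (φ : Real.Angle) = (W x).1 := by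
    induction h' : (W x).1 using Real.Angle.induction_on with
    | _ φ => exact ⟨φ, rfl⟩
  have hθC : thetaC W x = circ φ := by rw [thetaC, ← hφ, toCircle_coe]
  have hyC : yC W x = (W x).2.1 := rfl
  obtain ⟨k, hk⟩ : ∃ k, k = (W x).2.1 - y t := ⟨_, rfl⟩
  obtain ⟨g, hg⟩ : ∃ g, g = (D x).1 := ⟨_, rfl⟩
  have hg' : g = mkCyl (circ φ - circ (θ t), k) := by rw [hg, hD, hθC, hyC, hk]
  have hgn : ‖g‖ ^ 2 = 2 * (1 - cos (φ - θ t)) + k ^ 2 := by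
    rw [hg', norm_mkCyl_sq, norm_circ_sub_sq]
  have hvD : v = (D x).2 + pad n o := by rw [hD, padL_apply]; simp
  obtain ⟨u, hu⟩ : ∃ u, u = velVec (θ t) (a t) (b t) := ⟨_, rfl⟩
  obtain ⟨ℓ, hl⟩ : ∃ ℓ, ℓ = ellVec M k₁ (θ t) (y t) (a t) (b t) := ⟨_, rfl⟩
  obtain ⟨g', hgd⟩ := h.exists_hasDerivAt_gradVec ht0
  have hud := h.hasDerivAt_velVec ht0
  have hld := (hgd.const_smul (-(1 / 2) : ℝ)).add (hud.const_smul (2 * k₁ / M))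
  obtain ⟨B, hBdef⟩ : ∃ B, B = B₀ - Vr (θ t) (y t) := ⟨_, rfl⟩
  obtain ⟨B', hB'⟩ : ∃ B', B' = -(Vθ (θ t) (y t) * a t + Vy (θ t) (y t) * b t) := ⟨_, rfl⟩
  have ha := h.a_le t ht0
  have hb := h.b_le t ht0
  have hsq : ∀ {r s : ℝ}, |r| ≤ ν → |s| ≤ ν → r ^ 2 + s ^ 2 ≤ η ^ 2 := fun {r s} hr hs => by
    have h1 := pow_le_pow_left₀ (abs_nonneg _) hr 2
    have h2 := pow_le_pow_left₀ (abs_nonneg _) hs 2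
    rw [sq_abs] at h1 h2
    have h3 : (2 * ν) ^ 2 ≤ η ^ 2 := pow_le_pow_left₀ (by linarith) hνη 2
    linarith [sq_nonneg ν]
  have P : CalPoint M k₁ β η B₀ B B' (ϖ t) g u (gradVec (θ t) (y t)) ℓ := by
    refine ⟨?_, ?_, by rw [hl, hu]; rfl, (h.ϖ_le t ht0).trans (by linarith), ?_, ?_⟩
    · refine le_of_sq_le_sq ?_ C.hη0.le
      rw [hu, norm_velVec_sq]; exact hsq ha hb
    · refine le_of_sq_le_sq ?_ C.hη0.le
      rw [norm_gradVec_sq]; exact hsq (h.Vθ_le t ht0) (h.Vy_le t ht0)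
    · rw [hBdef, sub_sub_cancel_left, abs_neg]; exact (h.V_le t ht0).trans (by linarith)
    · rw [hB', abs_neg]
      exact (h.abs_combination_le ht0 _ _ (h.Vθ_le t ht0) (h.Vy_le t ht0)).trans (by linarith)
  have hcz : capZ β g = 1 / (1 + ‖g‖ ^ 2 / β) := by rw [capZ, one_div]
  have hinner_grad : inner ℝ (gradVec (θ t) (y t)) (capX β g) =
      capZ β g ^ 2 * (Vθ (θ t) (y t) * sin (φ - θ t) + Vy (θ t) (y t) * k) := by
    rw [capX, real_inner_smul_right, hg', gradVec, inner_mkCyl]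
    simp only
    rw [real_inner_smul_left, inner_sub_right, inner_circT_circ, inner_circT_circ]
    simp
  have hV : V (W x).1 (W x).2.1 = Vr (θ t + (φ - θ t)) (y t + k) := by
    rw [hk, add_sub_cancel, add_sub_cancel, Vr, hφ]
  have hbb : B - inner ℝ (gradVec (θ t) (y t)) (capX β g) - 9 / 10 * capQ β g ≤
      B₀ - V (W x).1 (W x).2.1 := by
    have hyβ : y t * (10000 * (1 + β)) ≤ 1 := by
      have h1 : y t * (10000 * (1 + β)) ≤ η / 2 * (10000 * (1 + β)) := by
        gcongr
        exact (h.y_le t ht0).trans (by linarith)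
      have h2 : η * (1 + β) ≤ η * (β + B₀ + 2) :=
        mul_le_mul_of_nonneg_left (by linarith) C.hη0.le
      linarith
    have := Vr_comparison hβ hy0 hyβ (θ t) (φ - θ t) k hgn hcz
    rw [hV, hinner_grad, capQ, hBdef]
    linarith
  obtain ⟨nq, hnq⟩ : ∃ nq, nq = a t ^ 2 * inner ℝ (mkCyl (circ (θ t), 0)) (capX β g) := ⟨_, rfl⟩
  have hz0 := capZ_pos hβ g
  have hz1 := capZ_le_one hβ g
  have hnq' : |nq| ≤ η * capQ β g := by
    have e1 : inner ℝ (mkCyl (circ (θ t), 0)) (capX β g) =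
        -(capZ β g ^ 2 * (1 - cos (φ - θ t))) := by
      rw [capX, real_inner_smul_right, hg', inner_mkCyl]
      simp only
      rw [inner_sub_right, inner_circ_circ, inner_circ_circ]
      simp
      ring
    have e2 : 0 ≤ 1 - cos (φ - θ t) := by linarith [cos_le_one (φ - θ t)]
    have e3 : a t ^ 2 ≤ η := by
      have h1 := pow_le_pow_left₀ (abs_nonneg _) ha 2
      rw [sq_abs] at h1
      nlinarith
    rw [hnq, e1, abs_mul, abs_neg, abs_of_nonneg (sq_nonneg (a t)), abs_of_nonneg (by positivity)]
    have e4 : capZ β g ^ 2 * (1 - cos (φ - θ t)) ≤ capQ β g := by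
      rw [capQ]
      have : capZ β g ^ 2 ≤ capZ β g := by
        rw [sq]; exact mul_le_of_le_one_left hz0.le hz1
      apply mul_le_mul this _ e2 hz0.le
      rw [hgn]; linarith [sq_nonneg k]
    exact mul_le_mul e3 e4 (by positivity) C.hη0.le
  have hcase' : c = 1 ∨ 40 * (M + 4) * β ≤ 3 * ε * B := by
    refine hcase.imp (fun e => ?_) fun e => e.trans ?_
    · rw [hc, e, real_inner_self_eq_norm_sq, padL_apply, norm_pad hmn, ho1, one_pow]
    · have := (abs_le.1 (abs_Vr_le_one (θ t) (y t))).2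
      have hε0 := C.hε
      rw [hBdef]
      gcongr
  obtain ⟨f, hf⟩ : ∃ f, f = inner ℝ u (capX β g) - B * calSigma M lam ε o v - k₁ * capQ β g :=
    ⟨_, rfl⟩
  obtain ⟨G, hG⟩ : ∃ G, G = B + inner ℝ ℓ (capX β g) - capQ β g := ⟨_, rfl⟩
  set X : Fin m → Cyl := fun i => mkCyl (‖x‖ • Aθ (single i 1),
    ‖x‖ * Ay (single i 1)) with hX
  set Z : Fin m → E (n + 1) := fun i => ‖x‖ • Av (single i 1) with hZ
  have hdl : ∀ i, ‖x‖ * dLog x (single i 1) = o i := fun i => by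
    rw [dLog_apply, inner_single_right, ho]
    simp
    field_simp
  have hX' : ∀ i, X i = ‖x‖ • (DD x (single i 1)).1 + o i • u := fun i => by
    rw [hDD, hu, velVec, ← map_smul, ← map_smul, ← map_add, hX, ← hdl]
    refine congrArg mkCyl (Prod.ext ?_ ?_)
    · simp only [Prod.smul_mk, Prod.mk_add_mk, smulRight_apply]
      rw [smul_sub, mul_smul]
      exact (sub_add_cancel _ _).symm
    · simp only [Prod.smul_mk, Prod.mk_add_mk, smulRight_apply, smul_eq_mul]
      ring
  have hZ' : ∀ i, Z i = ‖x‖ • (DD x (single i 1)).2 +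
      pad n (single i 1 - o i • o) := fun i => by
    have e1 : ‖x‖ • dDir x (single i 1) = single i 1 - o i • o := by
      rw [dDir_apply, inner_single_right, smul_sub, smul_smul, smul_smul,
        mul_inv_cancel₀ hr.ne', one_smul, ho, smul_smul]
      congr 2
      simp
      field_simp
    rw [hDD, ← e1, ← padL_apply, map_smul, hZ]
    simp [smul_sub]
  obtain ⟨d, hd⟩ : ∃ d, d = (1 - p + ϖ t) * G * c + B * (lam⁻¹ * (2 * M * c + 2 * c + ε)) -
      G * c + c * (inner ℝ ((-(1 / 2) : ℝ) • g' + (2 * k₁ / M) •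
        (-(lam + ϖ t) • velVec (θ t) (a t) (b t) - (M / 2) • gradVec (θ t) (y t) -
        (a t ^ 2) • mkCyl (circ (θ t), 0))) (capX β g) + B' - inner ℝ ℓ (capD β g u) +
        2 * inner ℝ (capX β g) u) := ⟨_, rfl⟩
  have hA : 𝐝 t = M * B + ‖u‖ ^ 2 := by
    rw [hu, norm_velVec_sq, hBdef, enDens]; ring
  have key := P.pointwise_le C h.hp hm hlam sp hbb hcase' (d := d)
    (u' := -(lam + ϖ t) • velVec (θ t) (a t) (b t) - (M / 2) • gradVec (θ t) (y t) -
        (a t ^ 2) • mkCyl (circ (θ t), 0)) (by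
      rw [inner_sub_left, inner_sub_left, real_inner_smul_left, real_inner_smul_left,
        real_inner_smul_left, hnq, ← hu]) hnq' rfl hf hG hA X Z (fun i => by
      rw [hZ, inner_smul_right, horth, mul_zero])
  have hchain : ∀ i, ‖x‖ ^ p * chainTerm p (calCoeff p M lam ε k₁ β B₀ θ y a b n i) D DD
      (single i 1) x = _ := fun i =>
    h.chainTerm_calCoeff (M := M) (lam := lam) (ε := ε) (k₁ := k₁) hβ
      i hx hx0 ht ho hvD sp hu hl (hX' i) (hZ' i) hld hud (f := f) (G := G) (d := d)
      (by rw [← hg, ← hBdef]; exact hf) (by rw [← hg, ← hBdef]; exact hG) hB'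
      (by rw [← hg, ← hBdef]; exact hd)
  simp only [← hg, ← hBdef, enWeight] at hchain
  rw [← sum_congr rfl fun i _ => hchain i, ← mul_sum] at key
  have hWnn : 0 ≤ hsSq Aθ + hsSq Ay + (B₀ - V (W x).1 (W x).2.1) * hsSq Av := by
    have h1 := (abs_le.1 (abs_V_le_one (W x).1 (W x).2.1)).2
    have h2 : 0 ≤ B₀ - V (W x).1 (W x).2.1 := by linarith
    unfold hsSq
    positivity
  have hsum : ∑ i, ‖X i‖ ^ 2 + (B₀ - V (W x).1 (W x).2.1) * ∑ i, ‖Z i‖ ^ 2 =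
      ‖x‖ ^ 2 * (hsSq Aθ + hsSq Ay + (B₀ - V (W x).1 (W x).2.1) * hsSq Av) := by
    have e1 : ∀ i, ‖X i‖ ^ 2 = ‖x‖ ^ 2 * ‖Aθ (single i 1)‖ ^ 2 +
        ‖x‖ ^ 2 * ‖Ay (single i 1)‖ ^ 2 := fun i => by
      rw [hX, norm_mkCyl_sq, norm_smul, norm_norm, mul_pow, mul_pow, norm_eq_abs, sq_abs]
    have e2 : ∀ i, ‖Z i‖ ^ 2 = ‖x‖ ^ 2 * ‖Av (single i 1)‖ ^ 2 := fun i => by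
      rw [hZ, norm_smul, norm_norm, mul_pow]
    simp only [e1, e2, sum_add_distrib, ← mul_sum]
    unfold hsSq
    ring
  have hpow : ∀ {z : ℝ}, 0 ≤ z → (‖x‖ ^ 2 * z) ^ (p / 2) = ‖x‖ ^ p * z ^ (p / 2) := fun hz => by
    rw [mul_rpow (by positivity) hz, ← rpow_natCast, ← rpow_mul hr.le]
    congr 2
    push_cast
    ring
  rw [hsum, hpow hWnn] at key
  have hxp : 0 < ‖x‖ ^ p := rpow_pos_of_pos hr p
  refine le_of_mul_le_mul_left (le_trans (le_of_eq ?_) key) hxp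
  rw [mul_add, mul_add, rpow_neg hr.le, mul_inv_cancel_left₀ hxp.ne', mul_inv_cancel_left₀ hxp.ne',
    ← hg, ← hc, calSlack, ← ht, ← hBdef, enWeight]

end Competitor

section AdmTools

variable {K : Set F}

lemma Adm.comp_of_compact {U L : Set G₁} (hU : IsOpen U) {Ψ : G₁ → G₂} (hΨ : ContDiffOn ℝ 1 Ψ U)
    (hL : IsCompact L) (hLU : L ⊆ U) {g : E m × F → G₁} (h : Adm K g)
    (hg : ∀ w ∈ Reg m F, g w ∈ L) : Adm K fun w => Ψ (g w) := by
  obtain ⟨C₁, hC₁⟩ := hL.exists_bound_of_continuousOn (hΨ.continuousOn.mono hLU)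
  obtain ⟨C₂, hC₂⟩ := hL.exists_bound_of_continuousOn
    ((hΨ.continuousOn_fderiv_of_isOpen hU le_rfl).mono hLU)
  obtain ⟨C, hC0, hC⟩ := h.bound
  refine Adm.of_bound (hΨ.comp h.contDiffOn fun w hw => hLU (hg w hw)) (C := max C₁ (C₂ * C))
    (g' := fun w => (fderiv ℝ Ψ (g w)).comp (fderiv ℝ g w)) (fun w hw => ?_)
    (fun w hw _ => (hC₁ _ (hg w hw)).trans (le_max_left _ _)) fun w hw hK e ζ => ?_
  · exact (((hΨ.contDiffAt (hU.mem_nhds (hLU (hg w hw)))).differentiableAt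
      (by simp)).hasFDerivAt).comp w (h.differentiableAt hw).hasFDerivAt
  · have h0 : 0 ≤ C₂ := (norm_nonneg _).trans (hC₂ _ (hg w hw))
    have hn : 0 ≤ ‖e‖ * ‖w.1‖⁻¹ + ‖ζ‖ := by positivity
    calc _ ≤ ‖fderiv ℝ Ψ (g w)‖ * ‖fderiv ℝ g w (e, ζ)‖ := le_opNorm _ _
      _ ≤ C₂ * (C * (‖e‖ * ‖w.1‖⁻¹ + ‖ζ‖)) := by
        gcongr
        · exact hC₂ _ (hg w hw)
        · exact (hC w hw hK).2 e ζ
      _ = C₂ * C * (‖e‖ * ‖w.1‖⁻¹ + ‖ζ‖) := by ring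
      _ ≤ _ := by gcongr; exact le_max_right _ _

lemma Adm.congr {g₁ g₂ : E m × F → G} (h : Adm K g₁) (hg : ∀ w ∈ Reg m F, g₂ w = g₁ w) :
    Adm K g₂ := by
  obtain ⟨C, hC0, hC⟩ := h.bound
  refine ⟨h.contDiffOn.congr hg, C, hC0, fun w hw hK => ?_⟩
  have : g₂ =ᶠ[𝓝 w] g₁ := Filter.mem_of_superset (isOpen_Reg.mem_nhds hw) hg
  rw [hg w hw, this.fderiv_eq]
  exact hC w hw hK

lemma exists_punctured_bound {f : E m → G} (hf : ContDiff ℝ 1 f) :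
    ∃ C, (∀ x ∈ 𝔹, x ≠ 0 → ‖f x‖ ≤ C) ∧ ∀ x ∈ 𝔹, x ≠ 0 → ‖fderiv ℝ f x‖ ≤ C * ‖x‖⁻¹ := by
  obtain ⟨C₁, hC₁⟩ := (isCompact_closedBall (0 : E m) 1).exists_bound_of_continuousOn
    hf.continuous.continuousOn
  obtain ⟨C₂, hC₂⟩ := (isCompact_closedBall (0 : E m) 1).exists_bound_of_continuousOn
    (hf.continuous_fderiv one_ne_zero).continuousOn
  refine ⟨max C₁ C₂, fun x hx _ => (hC₁ x (ball_subset_closedBall hx)).trans (le_max_left _ _),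
    fun x hx hx0 => ?_⟩
  have h0 := (hC₂ x (ball_subset_closedBall hx)).trans (le_max_right C₁ C₂)
  exact h0.trans (le_mul_of_one_le_right ((norm_nonneg _).trans h0)
    (one_le_inv_of_mem_Reg (F := ℝ) (w := (x, 0)) (mem_Reg.2 ⟨hx, hx0⟩)))

lemma Adm.of_contDiff_fst {f : E m → G} (hf : ContDiff ℝ 1 f) : Adm K fun w : E m × F => f w.1 := by
  obtain ⟨C, h1, h2⟩ := exists_punctured_bound hf
  exact Adm.of_fst hf.contDiffOn (fun x _ _ => (hf.differentiable one_ne_zero x).hasFDerivAt) h1 h2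

lemma Adm.norm_fst : Adm K fun w : E m × F => ‖w.1‖ := by
  have h : Adm K fun w : E m × F => exp ㏑w.1 :=
    Adm.radial (γ' := exp) (C := 1) contDiff_exp.contDiffOn
      (fun t _ => hasDerivAt_exp t)
      (fun t ht => by rw [norm_of_nonneg (exp_pos t).le]; exact exp_le_one_iff.2 ht.le)
      fun t ht => by rw [norm_of_nonneg (exp_pos t).le]; exact exp_le_one_iff.2 ht.le
  exact h.congr fun w hw => (exp_log (norm_pos_iff.2 (mem_Reg.1 hw).2)).symm

lemma Adm.sum {ι : Type*} (S : Finset ι) {g : ι → E m × F → G} (h : ∀ i ∈ S, Adm K (g i)) :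
    Adm K fun w => ∑ i ∈ S, g i w := by
  classical
  induction S using Finset.induction_on with
  | empty => simpa using Adm.const (0 : G)
  | insert i S hi ih =>
    simp only [Finset.sum_insert hi]
    exact (h i (Finset.mem_insert_self i S)).add (ih fun j hj => h j (Finset.mem_insert_of_mem hj))

lemma exists_truncated_id (H : Type*) [NormedAddCommGroup H] [InnerProductSpace ℝ H]
    [FiniteDimensional ℝ H] {δ : ℝ} (hδ : 0 < δ) : ∃ (τ : H → H) (C : ℝ), ContDiff ℝ 1 τ ∧
    (∀ z, ‖τ z‖ ≤ δ) ∧ (∀ z, ‖fderiv ℝ τ z‖ ≤ C) ∧ ∀ z, ‖z‖ < δ / 2 → τ z = z := by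
  let χ : ContDiffBump (0 : H) := ⟨δ / 2, δ, by positivity, by linarith⟩
  have hs : ContDiff ℝ 1 fun z => χ z • z := χ.contDiff.smul contDiff_id
  have hc : HasCompactSupport fun z => χ z • z := χ.hasCompactSupport.smul_right
  obtain ⟨C, hC⟩ := (hc.fderiv ℝ).exists_bound_of_continuous (hs.continuous_fderiv one_ne_zero)
  refine ⟨_, C, hs, fun z => ?_, hC, fun z hz => ?_⟩
  · by_cases h : δ ≤ dist z 0
    · rw [χ.zero_of_le_dist h, zero_smul, norm_zero]; exact hδ.le
    · rw [norm_smul, norm_of_nonneg χ.nonneg]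
      have h1 : ‖z‖ < δ := by simpa using h
      calc _ ≤ 1 * ‖z‖ := by gcongr; exact χ.le_one
        _ ≤ δ := by linarith
  · rw [χ.one_of_mem_closedBall (by simpa [χ] using hz.le), one_smul]

/-- The dependence of an admissible function on a real parameter. -/
lemma Adm.slice {g : E m × ℝ → ℝ} (h : Adm univ g) : ∃ C, 0 ≤ C ∧ ∀ x ∈ 𝔹, x ≠ 0 → ∀ s, |g (x, s)| ≤
    C ∧ ∃ d, HasDerivAt (fun s => g (x, s)) d s ∧ |d| ≤ C := by
  obtain ⟨C, hC0, hC⟩ := h.bound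
  refine ⟨C, hC0, fun x hx hx0 s => ?_⟩
  have hw : ((x, s) : E m × ℝ) ∈ Reg m ℝ := mem_Reg.2 ⟨hx, hx0⟩
  obtain ⟨h1, h2⟩ := hC _ hw (mem_univ _)
  refine ⟨h1, _, (h.differentiableAt hw).hasFDerivAt.comp_hasDerivAt s
    ((hasDerivAt_const s x).prodMk (hasDerivAt_id s)), ?_⟩
  simpa using h2 0 1

lemma Adm.continuousOn_slice {g : E m × ℝ → ℝ} (h : Adm univ g) (s : ℝ) :
    ContinuousOn (fun x => g (x, s)) (𝔹 \ {0}) :=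
  h.contDiffOn.continuousOn.comp (by fun_prop) fun _ hx => mem_Reg.2 hx

end AdmTools

section Orthogonality

lemma norm_padL_dir (hmn : m ≤ n + 1) {x : E m} (hx : x ≠ 0) : ‖padL m n 𝐧x‖ = 1 := by
  rw [padL_apply, norm_pad hmn, norm_dir hx]

variable {D : E m → 𝕐 n} {DD : E m → E m →L[ℝ] 𝕐 n}

/-- A Sobolev map into the sphere is orthogonal to its weak derivative. -/
lemma IsW1pZero.inner_eq_zero (hD : IsW1pZero p D DD) (hp : 1 < p) (hpm : p < m) (hmn : m ≤ n + 1)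
    (hv : ∀ x ∈ 𝔹, x ≠ 0 → ‖(D x).2 + padL m n 𝐧x‖ = 1) (e : E m) : ∀ᵐ x ∂μ𝔹, inner ℝ ((D x).2 +
    padL m n 𝐧x) ((DD x e).2 + padL m n (dDir x e)) = 0 := by
  have hm0 : 0 < m := by rify; linarith
  obtain ⟨τ, Cτ, hτ1, hτ2, hτ3, hτ4⟩ := exists_truncated_id (E (n + 1)) (δ := 6) (by norm_num)
  set K := {z : 𝕐 n | ‖z.2‖ ≤ 6}
  have hpo : Adm K fun w : E m × 𝕐 n => padL m n 𝐧w.1 :=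
    Adm.dir.clm (padL m n)
  have hk : Adm K fun w : E m × 𝕐 n => w.2.2 := Adm.snd_snd
  have hmem : MemLp (fun x => inner ℝ ((D x).2 + padL m n 𝐧x) ((DD x e).2 + padL m n (dDir x e)))
      (ofReal p) μ𝔹 := by
    have h1 : MemLp (fun x => (DD x e).2) (ofReal p) μ𝔹 :=
      ((snd ℝ Cyl (E (n + 1))).comp
        (ContinuousLinearMap.apply ℝ (𝕐 n) e)).comp_memLp' hD.memLp_deriv
    have hP := punctured_vC (m := m) hmn (fun _ => (0, 0)) 1
    have h2 : MemLp (fun x => padL m n (dDir x e)) (ofReal p) μ𝔹 :=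
      (ContinuousLinearMap.apply ℝ (E (n + 1)) e).comp_memLp' (hP.memLp_deriv hp hpm)
    have h3 : AEStronglyMeasurable (fun x => (D x).2 + padL m n 𝐧x) μ𝔹 := by
      refine (continuous_snd.comp_aestronglyMeasurable hD.memLp.1).add ?_
      refine aesm_of_continuousOn_punctured hm0 ?_
      exact (padL m n).continuous.comp_continuousOn ((continuous_norm.continuousOn.inv₀
        fun x hx => norm_ne_zero_iff.2 hx.2).smul continuousOn_id)
    refine MemLp.mono (h1.add h2) (h3.inner (h1.add h2).1) (ae_restrict_punctured hm0 ?_)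
    intro x hx hx0
    refine (norm_inner_le_norm _ _).trans ?_
    rw [hv x hx hx0, one_mul]
    rfl
  set q := fun x => inner ℝ ((D x).2 + padL m n 𝐧x) ((DD x e).2 + padL m n (dDir x e)) with hq
  have hint := (integrableOn_rpow_mul hp hpm hmem).1
  have key : ∀ᵐ x, x ∈ 𝔹 → ‖x‖ ^ (1 - p) * q x = 0 := by
    refine isOpen_ball.ae_eq_zero_of_integral_contDiff_smul_eq_zero
      hint.locallyIntegrableOn fun φ h1 h2 h3 => ?_
    have hφ : Adm K fun w : E m × 𝕐 n => φ w.1 := Adm.of_contDiff_fst (h1.of_le (by norm_cast))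
    have hg := hφ.mul ((hk.inner hk).add ((hk.inner hpo).add (hk.inner hpo)))
    have hz := (hg.truncated hτ1 hτ2 hτ3).integral_chainTerm hp hpm (fun x hx hx0 => by
      simp [hτ4 0 (by simp)]) hD e
    have hsub : ∫ x, φ x • (‖x‖ ^ (1 - p) * q x) = ∫ x in 𝔹, φ x • (‖x‖ ^ (1 - p) * q x) := by
      refine (setIntegral_eq_integral_of_forall_compl_eq_zero fun x hx => ?_).symm
      rw [image_eq_zero_of_notMem_tsupport fun h => hx (h3 h), zero_smul]
    rw [hsub]
    refine (mul_right_injective₀ (two_ne_zero (α := ℝ))) ?_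
    beta_reduce
    rw [mul_zero, ← hz.2, ← integral_const_mul]
    refine integral_congr_ae (ae_restrict_punctured hm0 fun x hx hx0 => ?_)
    have hv1 := hv x hx hx0
    have hD3 : ‖(D x).2‖ < 6 / 2 := by
      have := norm_sub_le ((D x).2 + padL m n 𝐧x) (padL m n 𝐧x)
      rw [add_sub_cancel_right, hv1, norm_padL_dir hmn hx0] at this
      linarith
    have hsq : inner ℝ (D x).2 (D x).2 + (inner ℝ (D x).2 (padL m n 𝐧x) +
        inner ℝ (D x).2 (padL m n 𝐧x)) = (0 : ℝ) := by
      have h := norm_add_sq_real (D x).2 (padL m n 𝐧x)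
      rw [hv1, norm_padL_dir hmn hx0, ← real_inner_self_eq_norm_sq] at h
      linarith
    rw [chainTerm_truncated (g := fun w : E m × 𝕐 n => φ w.1 * (inner ℝ w.2.2 w.2.2 + (inner ℝ w.2.2
      (padL m n 𝐧w.1) + inner ℝ w.2.2 (padL m n 𝐧w.1)))) hτ4 _ _ _ hD3, chainTerm]
    have hreg : ((x, D x) : E m × 𝕐 n) ∈ Reg m (𝕐 n) :=
      mem_Reg.2 ⟨hx, hx0⟩
    have hgd := (hg.differentiableAt hreg).hasFDerivAt
    set g := fun w : E m × 𝕐 n => φ w.1 * (inner ℝ w.2.2 w.2.2 + (inner ℝ w.2.2 (padL m n 𝐧w.1) +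
      inner ℝ w.2.2 (padL m n 𝐧w.1))) with hgdef
    have hx1 : x + (0 : ℝ) • e = x := by simp
    have hD1 : D x + (0 : ℝ) • DD x e = D x := by simp
    have hc1 : HasDerivAt (fun s : ℝ => x + s • e) e 0 := hasDerivAt_line _ _
    have hc2 : HasDerivAt (fun s : ℝ => D x + s • DD x e) (DD x e) 0 := by
      simpa using ((hasDerivAt_id (0 : ℝ)).smul_const (DD x e)).const_add (D x)
    have hgd' : HasFDerivAt g (fderiv ℝ g (x, D x)) ((x + (0 : ℝ) • e, D x + (0 : ℝ) • DD x e)) := by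
      rwa [hx1, hD1]
    have e1 := hgd'.comp_hasDerivAt (0 : ℝ) (hc1.prodMk hc2)
    have e2 : HasDerivAt (fun s : ℝ => (D x + s • DD x e).2) (DD x e).2 0 :=
      (snd ℝ Cyl (E (n + 1))).hasFDerivAt.comp_hasDerivAt (0 : ℝ) hc2
    have e3 : HasDerivAt (fun s : ℝ => padL m n (𝐧(x + s • e))) (padL m n (dDir x e)) 0 := by
      have hl1 : HasFDerivAt (fun x : E m => 𝐧 x) (dDir x) (x + (0 : ℝ) • e) := by
        rw [hx1]; exact hasFDerivAt_dir hx0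
      have hl2 := hl1.comp_hasDerivAt (0 : ℝ) hc1
      exact (padL m n).hasFDerivAt.comp_hasDerivAt (0 : ℝ) hl2
    have e4 : HasDerivAt (fun s : ℝ => φ (x + s • e)) (fderiv ℝ φ x e) 0 := by
      have hl1 : HasFDerivAt φ (fderiv ℝ φ x) (x + (0 : ℝ) • e) := by
        rw [hx1]; exact (h1.differentiable (by simp) x).hasFDerivAt
      exact hl1.comp_hasDerivAt (0 : ℝ) hc1
    have e5 := e4.mul ((e2.inner ℝ e2).add ((e2.inner ℝ e3).add (e2.inner ℝ e3)))
    have e6 := e1.unique e5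
    have e7 : inner ℝ (padL m n 𝐧x) (padL m n (dDir x e)) = (0 : ℝ) := by
      rw [padL_apply, padL_apply, inner_pad_pad hmn, dDir_apply, inner_sub_right, inner_smul_right,
        inner_smul_right, real_inner_smul_left, real_inner_smul_left, real_inner_self_eq_norm_sq]
      have := norm_ne_zero_iff.2 hx0
      field_simp
      ring
    rw [e6]
    simp only [Pi.add_apply, hx1, hD1, hsq, hq, inner_add_left, inner_add_right, e7, smul_eq_mul]
    rw [real_inner_comm (D x).2 (DD x e).2, real_inner_comm (padL m n 𝐧x) (DD x e).2]
    ring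
  rw [ae_restrict_iff' measurableSet_ball]
  filter_upwards [key, ae_ne_zero hm0] with x hx hx0 hxb
  exact (mul_eq_zero.1 (hx hxb)).resolve_left (rpow_pos_of_pos (norm_pos_iff.2 hx0) _).ne'

end Orthogonality

section Comparison

/-- A calibration inequality compares integrals; equality forces the slack to vanish. -/
lemma lintegral_le_of_calibration {α : Type*} [MeasurableSpace α] {μ : Measure α} [IsFiniteMeasure
    μ] {f S T g : α → ℝ} (hf0 : ∀ᵐ x ∂μ, 0 ≤ f x) (hf : Integrable f μ) (hT : Integrable T μ) (hT0 :
    ∫ x, T x ∂μ = 0) (hS : AEStronglyMeasurable S μ) (hS0 : ∀ᵐ x ∂μ, 0 ≤ S x) (h : ∀ᵐ x ∂μ, f x + S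
    x + T x ≤ g x) : ∫⁻ x, ofReal (f x) ∂μ ≤ ∫⁻ x, ofReal (g x) ∂μ ∧ (∫⁻ x, ofReal (g x) ∂μ = ∫⁻ x,
    ofReal (f x) ∂μ → ∀ᵐ x ∂μ, S x = 0) := by
  set s := fun x => min (S x) 1
  have hs0 : ∀ᵐ x ∂μ, 0 ≤ s x := hS0.mono fun x hx => le_min hx zero_le_one
  have hs : Integrable s μ := by
    refine Integrable.of_bound (hS.inf aestronglyMeasurable_const) 1 (hs0.mono fun x hx => ?_)
    rw [norm_of_nonneg hx]; exact min_le_right _ _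
  have hsum : Integrable (fun x => f x + s x + T x) μ := (hf.add hs).add hT
  have hval : ∫ x, (f x + s x + T x) ∂μ = ∫ x, f x ∂μ + ∫ x, s x ∂μ := by
    rw [integral_add (f := fun x => f x + s x) (hf.add hs) hT, integral_add hf hs, hT0, add_zero]
  have hle : ofReal (∫ x, f x ∂μ + ∫ x, s x ∂μ) ≤ ∫⁻ x, ofReal (g x) ∂μ := by
    rw [← hval]
    have h1 : ∫ x, (f x + s x + T x) ∂μ ≤ ∫ x, max (f x + s x + T x) 0 ∂μ :=
      integral_mono hsum hsum.pos_part fun x => le_max_left _ _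
    refine (ENNReal.ofReal_le_ofReal h1).trans ?_
    rw [ofReal_integral_eq_lintegral_ofReal hsum.pos_part (ae_of_all _ fun x => le_max_right _ _)]
    simp only [ENNReal.ofReal_max, ENNReal.ofReal_zero, zero_le, max_eq_left]
    refine lintegral_mono_ae (h.mono fun x hx => ENNReal.ofReal_le_ofReal (le_trans ?_ hx))
    gcongr
    exact min_le_left _ _
  have hfe : ∫⁻ x, ofReal (f x) ∂μ = ofReal (∫ x, f x ∂μ) :=
    (ofReal_integral_eq_lintegral_ofReal hf hf0).symm
  have hsn : 0 ≤ ∫ x, s x ∂μ := integral_nonneg_of_ae hs0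
  have hfn : 0 ≤ ∫ x, f x ∂μ := integral_nonneg_of_ae hf0
  refine ⟨?_, fun heq => ?_⟩
  · rw [hfe]
    exact (ENNReal.ofReal_le_ofReal (by linarith)).trans hle
  · rw [heq, hfe, ENNReal.ofReal_le_ofReal_iff hfn] at hle
    have h0 : ∫ x, s x ∂μ = 0 := by linarith
    filter_upwards [(integral_eq_zero_iff_of_nonneg_ae hs0 hs).1 h0] with x hx
    have hx' : min (S x) 1 = 0 := hx
    rcases min_choice (S x) 1 with h1 | h1
    · rw [← h1, hx']
    · rw [h1] at hx'; norm_num at hx'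

end Comparison

section Minimality

lemma continuousOn_comp_log {γ : ℝ → F} (hγ : ContinuousOn γ (Iio 0)) :
    ContinuousOn (fun x : E m => γ ㏑x) (𝔹 \ {0}) :=
  hγ.comp (continuous_norm.continuousOn.log fun _ hx => norm_ne_zero_iff.2 hx.2)
    fun _ hx => log_norm_neg hx.1 hx.2

lemma continuousOn_norm_rpow (s : ℝ) (R : ℝ) :
    ContinuousOn (fun x : E m => ‖x‖ ^ s) (ball 0 R \ {0}) :=
  continuous_norm.continuousOn.rpow_const fun _ hx => Or.inl (norm_ne_zero_iff.2 hx.2)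

lemma thetaC_profMap (x : E m) : thetaC 𝐔 x = circ (θ ㏑x) := toCircle_coe _

lemma yC_profMap (x : E m) : yC 𝐔 x = y ㏑x := rfl

lemma vC_equivMap (hmn : m ≤ n + 1) (u : ℝ → Real.Angle × ℝ) {x : E m} (hx : x ≠ 0) :
    vC (equivMap m n u) x = padL m n 𝐧x := toSphere_pad hmn hx

include h in
lemma IsProfile.integrableOn_dens (hpm : p < m) : IntegrableOn (fun x : E m => ‖x‖ ^ (-p) * 𝐝 ㏑x ^
    (p / 2)) 𝔹 := by
  have hp := h.hp
  have hm0 : 0 < m := by rify; linarith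
  refine Integrable.mono' ((integrableOn_norm_rpow_neg hm0 hpm 1).mul_const ((2 + M * (B₀ + 1)) ^ (p
    / 2))) (aesm_of_continuousOn_punctured hm0 ((continuousOn_norm_rpow _ _).mul
    ((continuousOn_comp_log h.smooth_enDens.continuousOn).rpow_const fun _ _ => Or.inr (by
    positivity)))) (ae_restrict_punctured hm0 fun x hx hx0 => ?_)
  have h1 := h.one_le_enDens ㏑x
  have h2 := h.enDens_le (log_norm_neg hx hx0)
  rw [norm_of_nonneg (by positivity)]
  gcongr

include h in
lemma IsProfile.calSlack_nonneg_and_eq_zero (C : CalParam M lam ε k₁ β B₀ η) (x : E m) (g : Cyl) {c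
    : ℝ} (hc : c ≤ 1) : 0 ≤ calSlack p M ε β B₀ θ y a b x g c ∧ (calSlack p M ε β B₀ θ y a b x g c =
    0 → g = 0 ∧ c = 1) := by
  have hp := h.hp
  have hβ := C.hβ
  have hM := C.hM
  have hε := C.hε
  have hB : 2 ≤ B₀ := hβ.trans C.hβB
  have h1 : 0 < 𝐰 ㏑x := by
    have := h.one_le_enDens ㏑x
    rw [enWeight]
    have : 0 < 𝐝 ㏑x := by linarith
    positivity
  have h2 := capQ_nonneg hβ g
  have h3 : 0 < B₀ - Vr (θ ㏑x) (y ㏑x) := by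
    have := (abs_le.1 (abs_Vr_le_one (θ ㏑x) (y ㏑x))).2
    linarith
  have h4 : 0 ≤ 1 - c := by linarith
  rw [calSlack]
  refine ⟨by positivity, fun h0 => ?_⟩
  have h5 := (mul_eq_zero.1 h0).resolve_left h1.ne'
  have h6 : 0 ≤ ε * M * capQ β g := by positivity
  have h7 : 0 ≤ ε * (B₀ - Vr (θ ㏑x) (y ㏑x)) / 2 * (1 - c) := by positivity
  have h8 := (add_eq_zero_iff_of_nonneg h6 h7).1 h5
  constructor
  · have h9 := (mul_eq_zero.1 h8.1).resolve_left (by positivity)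
    rw [capQ] at h9
    simpa [(capZ_pos hβ g).ne'] using h9
  · have h9 := (mul_eq_zero.1 h8.2).resolve_left (by positivity)
    linarith

lemma SameBoundary.exists_isW1pZero {W U : E m → Target n} (hp : 1 < p) (h : SameBoundary p W U) : ∃
    (D : E m → 𝕐 n) (DD : E m → E m →L[ℝ] 𝕐 n), IsW1pZero p D DD ∧ (∀ x, D x = (mkCyl (thetaC W x -
    thetaC U x, yC W x - yC U x), vC W x - vC U x)) ∧ ∀ x e, DD x e = (mkCyl (weakDeriv (ballO m 1)
    (fun x => thetaC W x - thetaC U x) x e, weakDeriv (ballO m 1) (fun x => yC W x - yC U x) x e),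
    weakDeriv (ballO m 1) (fun x => vC W x - vC U x) x e) := by
  let L₁ : ℂ →L[ℝ] 𝕐 n :=
    (inl ℝ Cyl (E (n + 1))).comp (mkCyl.comp (inl ℝ ℂ ℝ))
  let L₂ : ℝ →L[ℝ] 𝕐 n :=
    (inl ℝ Cyl (E (n + 1))).comp (mkCyl.comp (inr ℝ ℂ ℝ))
  let L₃ : E (n + 1) →L[ℝ] 𝕐 n := inr ℝ Cyl (E (n + 1))
  have key : ∀ (z : ℂ) (s : ℝ) (v : E (n + 1)), L₁ z + L₂ s + L₃ v = (mkCyl (z, s), v) := by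
    intro z s v
    have : (mkCyl (z, s)) = mkCyl (z, 0) + mkCyl (0, s) := by rw [← map_add]; simp
    simp [L₁, L₂, L₃, this]
  refine ⟨_, _, ((h.1.isW1pZero.clm L₁).add hp.le (h.2.1.isW1pZero.clm L₂)).add hp.le
    (h.2.2.isW1pZero.clm L₃), fun x => key _ _ _, fun x e => key _ _ _⟩

end Minimality

section Variations

/-- The radial part of the scaled energy density of a variation. -/
def varRad (a b : ℝ → ℝ) (η ζ : E m → ℝ) (x : E m) (s : ℝ) : ℝ :=
  ∑ i, ((a ㏑x * 𝐧x i + s * (‖x‖ * fderiv ℝ η x (single i 1))) ^ 2 + (b ㏑x * 𝐧x i + s * (‖x‖ * fderiv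
      ℝ ζ x (single i 1))) ^ 2)

/-- The scaled tangential derivative of a variation of `x / |x|`. -/
def varTan (ψ : E m → E (n + 1)) (i : Fin m) (x : E m) (s : ℝ) : E (n + 1) :=
  padL m n (single i 1 - 𝐧x i • 𝐧x) + s • (‖x‖ • fderiv ℝ ψ x (single i 1))

/-- The spherical part of the scaled energy density of a variation. -/
def varSph (ψ : E m → E (n + 1)) (x : E m) (s : ℝ) : ℝ :=
  ∑ i, (‖varTan ψ i x s‖ ^ 2 * (‖padL m n 𝐧x + s • ψ x‖ ^ 2)⁻¹ - inner ℝ (padL m n 𝐧x + s • ψ x)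
    (varTan ψ i x s) ^ 2 * ((‖padL m n 𝐧x + s • ψ x‖ ^ 2)⁻¹) ^ 2)

/-- The scaled energy density of a variation. -/
def varDens (B₀ : ℝ) (θ y a b : ℝ → ℝ) (η ζ : E m → ℝ) (ψ : E m → E (n + 1))
    (x : E m) (s : ℝ) : ℝ :=
  varRad a b η ζ x s + (B₀ - Vr (θ ㏑x + s * η x) (y ㏑x + s * ζ x)) * varSph ψ x s

variable {η ζ : E m → ℝ} {ψ : E m → E (n + 1)}

lemma contDiff_fderiv_apply {f : E m → G} (hf : ContDiff ℝ ∞ f) (e : E m) : ContDiff ℝ 1 fun x => fderiv ℝ f x e :=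
  (hf.fderiv_right (m := 1) (by norm_cast)).clm_apply contDiff_const

lemma half_le_norm_dir_add (hmn : m ≤ n + 1) {x : E m} {w : E (n + 1)} (hx : x ≠ 0) (hw : ‖w‖ ≤ 1 /
    2) : 1 / 2 ≤ ‖padL m n 𝐧x + w‖ ∧ ‖padL m n 𝐧x + w‖ ≤ 3 / 2 := by
  have h1 := norm_padL_dir hmn hx
  have h2 := norm_add_le (padL m n 𝐧x) w
  have h3 := norm_sub_norm_le (padL m n 𝐧x) (-w)
  rw [norm_neg, sub_neg_eq_add] at h3
  constructor <;> linarith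

include h in
lemma adm_varRad (hη : ContDiff ℝ ∞ η) (hζ : ContDiff ℝ ∞ ζ) {τ : ℝ → ℝ} {C δ : ℝ} (hτ1 : ContDiff ℝ
    1 τ) (hτ2 : ∀ s, |τ s| ≤ δ) (hτ3 : ∀ s, ‖fderiv ℝ τ s‖ ≤ C) : Adm univ fun w : E m × ℝ => varRad
    a b η ζ w.1 (τ w.2) := by
  have hτ : Adm univ fun w : E m × ℝ => τ w.2 :=
    Adm.of_snd hτ1 (fun s _ => hτ2 s) fun s _ => hτ3 s
  have ho : Adm univ fun w : E m × ℝ => 𝐧 w.1 := Adm.dir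
  refine Adm.sum _ fun i _ => ?_
  have hoi : Adm univ fun w : E m × ℝ => 𝐧w.1 i :=
    ho.clm (proj (𝕜 := ℝ) i)
  refine Adm.add (Adm.pow (Adm.add (h.adm_a.mul hoi) (hτ.mul (Adm.norm_fst.mul ?_))) 2)
    (Adm.pow (Adm.add (h.adm_b.mul hoi) (hτ.mul (Adm.norm_fst.mul ?_))) 2)
  · exact Adm.of_contDiff_fst (contDiff_fderiv_apply hη _)
  · exact Adm.of_contDiff_fst (contDiff_fderiv_apply hζ _)

lemma adm_varSph (hmn : m ≤ n + 1) (hψ : ContDiff ℝ ∞ ψ) {τ : ℝ → ℝ} {C δ : ℝ} (hδ : ∀ x, δ * ‖ψ x‖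
    ≤ 1 / 2) (hτ1 : ContDiff ℝ 1 τ) (hτ2 : ∀ s, |τ s| ≤ δ) (hτ3 : ∀ s, ‖fderiv ℝ τ s‖ ≤ C) : Adm
    univ fun w : E m × ℝ => varSph ψ w.1 (τ w.2) := by
  have hτ : Adm univ fun w : E m × ℝ => τ w.2 :=
    Adm.of_snd hτ1 (fun s _ => hτ2 s) fun s _ => hτ3 s
  have ho : Adm univ fun w : E m × ℝ => 𝐧 w.1 := Adm.dir
  have hw : Adm univ fun w : E m × ℝ => padL m n 𝐧w.1 + τ w.2 • ψ w.1 :=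
    (ho.clm (padL m n)).add (hτ.smul (Adm.of_contDiff_fst (hψ.of_le (by norm_cast))))
  have hq : Adm univ fun w : E m × ℝ => ‖padL m n 𝐧w.1 + τ w.2 • ψ w.1‖ ^ 2 := by
    have := hw.inner hw
    simpa only [real_inner_self_eq_norm_sq] using this
  have hqi : Adm univ fun w : E m × ℝ =>
      (‖padL m n 𝐧w.1 + τ w.2 • ψ w.1‖ ^ 2)⁻¹ := by
    refine hq.comp_of_compact (U := {0}ᶜ) (L := Icc (1 / 4) (9 / 4)) isOpen_compl_singleton
      (Ψ := fun z => z⁻¹) (fun z hz => (contDiffAt_inv ℝ hz).contDiffWithinAt) isCompact_Icc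
      (fun z hz hz0 => ?_) fun w hw => ?_
    · rw [Set.mem_singleton_iff] at hz0
      have := hz.1
      rw [hz0] at this
      norm_num at this
    · have hb : ‖τ w.2 • ψ w.1‖ ≤ 1 / 2 := by
        rw [norm_smul]
        exact (mul_le_mul_of_nonneg_right (hτ2 w.2) (norm_nonneg _)).trans (hδ w.1)
      obtain ⟨h1, h2⟩ := half_le_norm_dir_add hmn (mem_Reg.1 hw).2 hb
      have h3 := pow_le_pow_left₀ (by norm_num) h1 2
      have h4 := pow_le_pow_left₀ (by positivity) h2 2
      norm_num at h3 h4
      exact ⟨by norm_num; exact h3, by norm_num; exact h4⟩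
  refine Adm.sum _ fun i _ => ?_
  have hoi : Adm univ fun w : E m × ℝ => 𝐧w.1 i :=
    ho.clm (proj (𝕜 := ℝ) i)
  have ht : Adm univ fun w : E m × ℝ => varTan ψ i w.1 (τ w.2) :=
    (((Adm.const _).sub (hoi.smul ho)).clm (padL m n)).add (hτ.smul (Adm.norm_fst.smul
      (Adm.of_contDiff_fst (contDiff_fderiv_apply hψ _))))
  have ht2 : Adm univ fun w : E m × ℝ => ‖varTan ψ i w.1 (τ w.2)‖ ^ 2 := by
    have := ht.inner ht
    simpa only [real_inner_self_eq_norm_sq] using this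
  exact (ht2.mul hqi).sub (((hw.inner ht).pow 2).mul (hqi.pow 2))

lemma norm_single_sub_sq {o : E m} (ho : ‖o‖ = 1) (i : Fin m) :
    ‖single i (1 : ℝ) - o i • o‖ ^ 2 = 1 - o i ^ 2 := by
  rw [norm_sub_sq_real, inner_smul_right, inner_single_left, norm_smul, ho]
  simp
  ring

lemma sum_norm_single_sub_sq {o : E m} (ho : ‖o‖ = 1) :
    ∑ i, ‖single i (1 : ℝ) - o i • o‖ ^ 2 = m - 1 := by
  have h := real_norm_sq_eq o
  rw [ho] at h
  simp only [norm_single_sub_sq ho, sum_sub_distrib, ← h]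
  simp

lemma inner_single_sub {o : E m} (ho : ‖o‖ = 1) (i : Fin m) :
    inner ℝ o (single i (1 : ℝ) - o i • o) = 0 := by
  rw [inner_sub_right, inner_smul_right, inner_single_right, real_inner_self_eq_norm_sq, ho]
  simp

lemma varDens_zero (hm : (m : ℝ) = M + 1) (hmn : m ≤ n + 1) {x : E m} (hx : x ≠ 0) :
    varDens B₀ θ y a b η ζ ψ x 0 = 𝐝 ㏑x := by
  have ho := norm_dir hx
  have h1 : varSph ψ x 0 = M := by
    have hM : M = m - 1 := by linarith
    simp only [varSph, varTan, zero_smul, add_zero, padL_apply, norm_pad hmn, inner_pad_pad hmn,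
      inner_single_sub ho, ho]
    rw [hM, ← sum_norm_single_sub_sq ho]
    simp
  have h2 : varRad a b η ζ x 0 = a ㏑x ^ 2 + b ㏑x ^ 2 := by
    have h := real_norm_sq_eq 𝐧x
    rw [ho, one_pow] at h
    simp only [varRad, zero_mul, add_zero, mul_pow, ← add_mul, ← mul_sum, ← h, mul_one]
  rw [varDens, h1, h2, enDens]
  simp
  ring

include h in
/-- Uniform control of the scaled energy density of a variation. -/
lemma exists_varDens_bound (hm : (m : ℝ) = M + 1) (hmn : m ≤ n + 1) (hη : ContDiff ℝ ∞ η) (hζ :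
    ContDiff ℝ ∞ ζ) (hψ : ContDiff ℝ ∞ ψ) {Cη Cζ Cψ : ℝ} (hCη : ∀ x, |η x| ≤ Cη) (hCζ : ∀ x, |ζ x| ≤
    Cζ) (hCψ : ∀ x, ‖ψ x‖ ≤ Cψ) : ∃ s₀ C : ℝ, 0 < s₀ ∧ 0 ≤ C ∧ (∀ x, s₀ * ‖ψ x‖ ≤ 1 / 2) ∧ (∀ x ∈ 𝔹,
    x ≠ 0 → ∀ s, |s| < s₀ → 1 / 2 ≤ varDens B₀ θ y a b η ζ ψ x s ∧ varDens B₀ θ y a b η ζ ψ x s ≤ C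
    ∧ ∃ d, HasDerivAt (varDens B₀ θ y a b η ζ ψ x) d s ∧ |d| ≤ C) ∧ ∀ s, |s| < s₀ → ContinuousOn
    (fun x => varDens B₀ θ y a b η ζ ψ x s) (𝔹 \ {0}) := by
  have hM := h.hM
  have hB := h.hB
  have hCψ0 : 0 ≤ Cψ := (norm_nonneg _).trans (hCψ 0)
  have hCη0 : 0 ≤ Cη := (abs_nonneg _).trans (hCη 0)
  have hCζ0 : 0 ≤ Cζ := (abs_nonneg _).trans (hCζ 0)
  obtain ⟨δ, hδ⟩ : ∃ δ, δ = 1 / (2 * (Cψ + 1)) := ⟨_, rfl⟩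
  have hδ0 : 0 < δ := by rw [hδ]; positivity
  have hδψ : ∀ x, δ * ‖ψ x‖ ≤ 1 / 2 := fun x => by
    have h1 : δ * ‖ψ x‖ ≤ δ * (Cψ + 1) := by gcongr; linarith [hCψ x]
    have h2 : δ * (Cψ + 1) = 1 / 2 := by rw [hδ]; field_simp
    linarith
  obtain ⟨τ, Cτ, hτ1, hτ2, hτ3, hτ4⟩ := exists_truncated_id ℝ hδ0
  have hR := adm_varRad h hη hζ hτ1 hτ2 hτ3
  have hS := adm_varSph hmn hψ hδψ hτ1 hτ2 hτ3
  obtain ⟨C₁, hC₁0, hC₁⟩ := hR.slice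
  obtain ⟨C₂, hC₂0, hC₂⟩ := hS.slice
  obtain ⟨C, hC⟩ : ∃ C, C = C₁ + (Cη + 16 * Cζ) * C₂ + (B₀ + 1) * C₂ := ⟨_, rfl⟩
  have hC0 : 0 ≤ C := by rw [hC]; positivity
  have hev : ∀ s : ℝ, |s| < δ / 2 → ∀ᶠ s' in 𝓝 s, τ s' = s' := fun s hs =>
    (continuous_abs.continuousAt.eventually_lt continuousAt_const hs).mono fun s' hs' => hτ4 s' hs'
  have hder : ∀ x ∈ 𝔹, x ≠ 0 → ∀ s, |s| < δ / 2 →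
      ∃ d, HasDerivAt (varDens B₀ θ y a b η ζ ψ x) d s ∧ |d| ≤ C := by
    intro x hx hx0 s hs
    obtain ⟨b1, d₁, hd₁, hb₁⟩ := hC₁ x hx hx0 s
    obtain ⟨b2, d₂, hd₂, hb₂⟩ := hC₂ x hx hx0 s
    rw [hτ4 s hs] at b1 b2
    have hd₁' : HasDerivAt (varRad a b η ζ x) d₁ s :=
      hd₁.congr_of_eventuallyEq ((hev s hs).mono fun s' hs' => by simp only [hs'])
    have hd₂' : HasDerivAt (varSph ψ x) d₂ s :=
      hd₂.congr_of_eventuallyEq ((hev s hs).mono fun s' hs' => by simp only [hs'])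
    have hVd := HasDerivAt.Vr (((hasDerivAt_id s).mul_const (η x)).const_add (θ ㏑x))
      (((hasDerivAt_id s).mul_const (ζ x)).const_add (y ㏑x))
    refine ⟨_, hd₁'.add ((hVd.const_sub B₀).mul hd₂'), ?_⟩
    simp only [id, one_mul]
    have e1 := abs_Vr_le_one (θ ㏑x + s * η x) (y ㏑x + s * ζ x)
    have e2 := abs_Vθ_le_one (θ ㏑x + s * η x) (y ㏑x + s * ζ x)
    have e3 := abs_Vy_le_const (θ ㏑x + s * η x) (y ㏑x + s * ζ x)
    refine (abs_add_le _ _).trans ?_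
    rw [hC, add_assoc]
    refine add_le_add hb₁ ((abs_add_le _ _).trans (add_le_add ?_ ?_))
    · rw [abs_mul, abs_neg]
      refine mul_le_mul ((abs_add_le _ _).trans (add_le_add ?_ ?_)) b2 (abs_nonneg _) (by positivity)
      · rw [abs_mul]
        calc _ ≤ 1 * Cη := mul_le_mul e2 (hCη x) (abs_nonneg _) one_pos.le
          _ = Cη := one_mul _
      · rw [abs_mul]
        exact mul_le_mul e3 (hCζ x) (abs_nonneg _) (by norm_num)
    · rw [abs_mul]
      refine mul_le_mul ((abs_sub _ _).trans ?_) hb₂ (abs_nonneg _) (by linarith)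
      rw [abs_of_nonneg (by linarith : (0 : ℝ) ≤ B₀)]
      linarith
  obtain ⟨s₀, hs₀⟩ : ∃ s₀, s₀ = min (δ / 2) (1 / (2 * (C + 1))) := ⟨_, rfl⟩
  have hs₀1 : s₀ ≤ δ / 2 := hs₀ ▸ min_le_left _ _
  have hs₀2 : s₀ * C ≤ 1 / 2 := by
    have h1 : s₀ ≤ 1 / (2 * (C + 1)) := hs₀ ▸ min_le_right _ _
    have h2 : s₀ * (2 * (C + 1)) ≤ 1 := by rwa [le_div_iff₀ (by positivity)] at h1
    have h3 : 0 < s₀ := by rw [hs₀]; positivity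
    linarith
  refine ⟨s₀, max C (2 + M * (B₀ + 1) + 1), by rw [hs₀]; positivity, le_max_of_le_left hC0,
    fun x => ?_, fun x hx hx0 s hs => ?_, fun s hs => ?_⟩
  · exact (mul_le_mul_of_nonneg_right (by linarith) (norm_nonneg _)).trans (hδψ x)
  · have hmv : |varDens B₀ θ y a b η ζ ψ x s - varDens B₀ θ y a b η ζ ψ x 0| ≤ C * |s| := by
      have hcx : Convex ℝ {s : ℝ | |s| < s₀} := by
        have : {s : ℝ | |s| < s₀} = ball 0 s₀ := by ext; simp
        rw [this]; exact convex_ball _ _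
      choose! d hd hdC using fun s (hs : s ∈ {s : ℝ | |s| < s₀}) =>
        hder x hx hx0 s (lt_of_lt_of_le hs hs₀1)
      have h0 : (0 : ℝ) ∈ {s : ℝ | |s| < s₀} := by simpa using (abs_nonneg s).trans_lt hs
      have := hcx.norm_image_sub_le_of_norm_hasDerivWithin_le
        (fun s hs => (hd s hs).hasDerivWithinAt) hdC h0 (show s ∈ {s : ℝ | |s| < s₀} from hs)
      simpa using this
    have hz := varDens_zero (B₀ := B₀) (θ := θ) (y := y) (a := a) (b := b) (η := η) (ζ := ζ)
      (ψ := ψ) hm hmn hx0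
    have h1 := h.one_le_enDens ㏑x
    have h2 := h.enDens_le (log_norm_neg hx hx0)
    have h3 : C * |s| ≤ 1 / 2 := by
      refine le_trans ?_ hs₀2
      rw [mul_comm]; gcongr
    rw [hz] at hmv
    have h4 := abs_le.1 (hmv.trans h3)
    refine ⟨by linarith, (by linarith : _ ≤ 2 + M * (B₀ + 1) + 1).trans (le_max_right _ _), ?_⟩
    obtain ⟨d, hd, hdC⟩ := hder x hx hx0 s (hs.trans_le hs₀1)
    exact ⟨d, hd, hdC.trans (le_max_left _ _)⟩
  · have c1 := hR.continuousOn_slice s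
    have c2 := hS.continuousOn_slice s
    simp only [hτ4 s (hs.trans_le hs₀1)] at c1 c2
    refine c1.add (ContinuousOn.mul (continuousOn_const.sub ?_) c2)
    exact continuous_Vr.comp_continuousOn (((continuousOn_comp_log h.smooth_θ.continuousOn).add
      (hη.continuous.const_mul s).continuousOn).prodMk ((continuousOn_comp_log
      h.smooth_y.continuousOn).add (hζ.continuous.const_mul s).continuousOn))

end Variations

section VariedMaps

lemma PuncturedC1.congr {R C : ℝ} {f g : E m → F} {f' : E m → E m →L[ℝ] F} (h : PuncturedC1 R C f f')
    (hfg : ∀ x, x ≠ 0 → g x = f x) : PuncturedC1 R C g f' :=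
  ⟨fun x hx hx0 => (h.hasFDerivAt x hx hx0).congr_of_eventuallyEq
      (Filter.mem_of_superset (isOpen_ne.mem_nhds hx0) hfg), h.continuousOn,
    fun x hx hx0 => by rw [hfg x hx0]; exact h.bound x hx hx0, h.bound'⟩

lemma PuncturedC1.mono {R C C' : ℝ} {f : E m → F} {f' : E m → E m →L[ℝ] F}
    (h : PuncturedC1 R C f f') (hC : C ≤ C') : PuncturedC1 R C' f f' :=
  ⟨h.hasFDerivAt, h.continuousOn, fun x hx hx0 => (h.bound x hx hx0).trans hC,
    fun x hx hx0 => (h.bound' x hx hx0).trans (by gcongr)⟩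

lemma PuncturedC1.add {R C₁ C₂ : ℝ} {f g : E m → F} {f' g' : E m → E m →L[ℝ] F}
    (hf : PuncturedC1 R C₁ f f') (hg : PuncturedC1 R C₂ g g') :
    PuncturedC1 R (C₁ + C₂) (fun x => f x + g x) fun x => f' x + g' x :=
  ⟨fun x hx hx0 => (hf.hasFDerivAt x hx hx0).add (hg.hasFDerivAt x hx hx0), hf.continuousOn.add
    hg.continuousOn, fun x hx hx0 => (norm_add_le _ _).trans (add_le_add (hf.bound x hx hx0)
    (hg.bound x hx hx0)), fun x hx hx0 => by
      rw [add_mul]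
      exact (norm_add_le _ _).trans (add_le_add (hf.bound' x hx hx0) (hg.bound' x hx hx0))⟩

lemma PuncturedC1.of_contDiff {f : E m → F} (hf : ContDiff ℝ ∞ f) (s : ℝ) :
    ∃ C, PuncturedC1 1 C (fun x => s • f x) fun x => s • fderiv ℝ f x := by
  obtain ⟨C, h1, h2⟩ := exists_punctured_bound ((hf.const_smul s).of_le (by norm_cast))
  have hd := fun x => (hf.differentiable (by simp) x).hasFDerivAt.const_smul s
  exact ⟨C, fun x _ _ => hd x, ((hf.continuous_fderiv (by simp)).const_smul s).continuousOn, h1,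
    fun x hx hx0 => (hd x).fderiv ▸ h2 x hx hx0⟩

lemma PuncturedC1.circ {R C : ℝ} {f : E m → ℝ} {f' : E m → E m →L[ℝ] ℝ} (hC : 1 ≤ C) (hf : ∀ x ∈
    ball (0 : E m) R, x ≠ 0 → HasFDerivAt f (f' x) x) (hc : ContinuousOn f' (ball 0 R \ {0})) (hb :
    ∀ x ∈ ball (0 : E m) R, x ≠ 0 → ‖f' x‖ ≤ C * ‖x‖⁻¹) : PuncturedC1 R C (fun x => PHarm.circ (f
    x)) fun x => (f' x).smulRight (circT (f x)) := by
  refine ⟨fun x hx hx0 => ?_, ?_, fun x _ _ => by rw [norm_circ]; exact hC, fun x hx hx0 => ?_⟩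
  · have h1 : HasDerivAt PHarm.circ (circT (f x)) (f x) := by
      simpa using PHarm.HasDerivAt.circ (hasDerivAt_id (f x))
    exact (h1.hasFDerivAt.comp x (hf x hx hx0)).congr_fderiv (by ext; simp)
  · have h1 : ContinuousOn f (ball 0 R \ {0}) := fun x hx =>
      (hf x hx.1 hx.2).continuousAt.continuousWithinAt
    have h2 : Continuous circT := by unfold circT PHarm.circ; fun_prop
    have h := (smulRightL ℝ (E m) ℂ).continuous₂
    exact h.comp_continuousOn (f := fun x : E m => (f' x, circT (f x)))
      (hc.prodMk (h2.comp_continuousOn h1))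
  · rw [ContinuousLinearMap.norm_smulRight_apply, norm_circT, mul_one]
    exact hb x hx hx0

lemma PuncturedC1.normalize {R C : ℝ} {w : E m → E n} {w' : E m → E m →L[ℝ] E n}
    (h : PuncturedC1 R C w w') (hC : 1 ≤ C) (hw : ∀ x ∈ ball (0 : E m) R, x ≠ 0 → 1 / 2 ≤ ‖w x‖) :
    PuncturedC1 R (4 * C) (fun x => ‖w x‖⁻¹ • w x) fun x => (dDir (w x)).comp (w' x) := by
  have hw0 : ∀ x ∈ ball (0 : E m) R, x ≠ 0 → w x ≠ 0 := fun x hx hx0 h0 => by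
    have := hw x hx hx0
    rw [h0, norm_zero] at this
    norm_num at this
  refine ⟨fun x hx hx0 => (hasFDerivAt_dir (hw0 x hx hx0)).comp x (h.hasFDerivAt x hx hx0), ?_,
    fun x hx hx0 => ?_, fun x hx hx0 => ?_⟩
  · exact (continuousOn_dDir.comp h.continuousOn_self fun x hx => hw0 x hx.1 hx.2).clm_comp
      h.continuousOn
  · rw [norm_dir (hw0 x hx hx0)]
    linarith
  · have h1 : ‖w x‖⁻¹ ≤ 2 := by
      rw [inv_le_comm₀ (norm_pos_iff.2 (hw0 x hx hx0)) (by norm_num)]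
      linarith [hw x hx hx0]
    calc _ ≤ ‖dDir (w x)‖ * ‖w' x‖ := opNorm_comp_le _ _
      _ ≤ 2 * ‖w x‖⁻¹ * (C * ‖x‖⁻¹) := by
        gcongr
        · exact norm_dDir_le (hw0 x hx hx0)
        · exact h.bound' x hx hx0
      _ ≤ 2 * 2 * (C * ‖x‖⁻¹) := by gcongr
      _ = _ := by ring

lemma norm_dDir_apply_sq {w : E n} (hw : w ≠ 0) (z : E n) :
    ‖dDir w z‖ ^ 2 = ‖z‖ ^ 2 * (‖w‖ ^ 2)⁻¹ - inner ℝ w z ^ 2 * ((‖w‖ ^ 2)⁻¹) ^ 2 := by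
  have h0 := norm_ne_zero_iff.2 hw
  rw [dDir_apply, norm_sub_sq_real, inner_smul_right, real_inner_smul_left, norm_smul, norm_smul,
    norm_inv, norm_norm, norm_mul, norm_inv, norm_pow, norm_norm, mul_pow, mul_pow, mul_pow,
    norm_eq_abs, sq_abs, real_inner_comm]
  field_simp
  ring

lemma norm_mul_dLog (x e : E m) (hx : x ≠ 0) : dLog x e = ‖x‖⁻¹ * inner ℝ 𝐧x e := by
  have h0 := norm_ne_zero_iff.2 hx
  rw [dLog_apply, real_inner_smul_left]
  field_simp

lemma dLog_single {x : E m} (hx : x ≠ 0) (i : Fin m) : dLog x (single i 1) = ‖x‖⁻¹ * 𝐧x i := by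
  rw [norm_mul_dLog x _ hx, inner_single_right]
  simp

lemma dDir_single {x : E m} (hx : x ≠ 0) (i : Fin m) : dDir x (single i 1) =
    ‖x‖⁻¹ • (single i 1 - 𝐧x i • 𝐧x) := by
  have h0 := norm_ne_zero_iff.2 hx
  rw [dDir_apply, inner_single_right, smul_sub, smul_smul, smul_smul]
  congr 2
  simp
  field_simp

variable {η ζ : 𝓓(ballO m 1, ℝ)} {ψ : 𝓓(ballO m 1, E (n + 1))}

include h in
/-- The energy density of a variation. -/
lemma IsProfile.energy_vary (hpm : p < m) (hmn : m ≤ n + 1) {s : ℝ} (hs : ∀ x, ‖s • ψ x‖ ≤ 1 / 2)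
    (h0 : ∀ x ∈ 𝔹, x ≠ 0 → 0 ≤ varDens B₀ θ y a b η ζ ψ x s) : energy p B₀ (vary 𝐔 η ζ ψ s) = ∫⁻ x
    in 𝔹, ofReal (‖x‖ ^ (-p) * varDens B₀ θ y a b η ζ ψ x s ^ (p / 2)) := by
  have hm1 : 1 < m := by exact_mod_cast h.hp.trans hpm
  have hm0 : 0 < m := by omega
  set U := vary 𝐔 η ζ ψ s with hU
  obtain ⟨Cη, hCη⟩ := PuncturedC1.of_contDiff (contDiff_test η) s
  obtain ⟨Cζ, hCζ⟩ := PuncturedC1.of_contDiff (contDiff_test ζ) s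
  obtain ⟨Cψ, hCψ⟩ := PuncturedC1.of_contDiff (contDiff_test ψ) s
  have hty := (h.punctured_yC (m := m) (n := n)).add hCζ
  have hda : ContinuousOn (fun x : E m => a ㏑x • dLog x) (𝔹 \ {0}) :=
    (continuousOn_comp_log h.smooth_a.continuousOn).smul (continuousOn_dLog.mono fun x hx => hx.2)
  have htθ : PuncturedC1 1 (max 1 (1 + Cη)) (thetaC U) fun x =>
      (a ㏑x • dLog x + s • fderiv ℝ (fun z => η z) x).smulRight (circT (θ ㏑x + s * η x)) := by
    refine (PuncturedC1.circ (f := fun x => θ ㏑x + s • η x) (f' := fun x => a ㏑x • dLog x + s •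
      fderiv ℝ (fun z => η z) x) (le_max_left _ _) (fun x hx hx0 => ?_) (hda.add hCη.continuousOn)
      fun x hx hx0 => ?_).congr fun x hx0 => ?_
    · refine HasFDerivAt.add ?_ (hCη.hasFDerivAt x hx hx0)
      exact ((h.deriv_θ _ (log_norm_neg hx hx0)).comp_hasFDerivAt x (hasFDerivAt_log_norm hx0))
    · have h1 : ‖a ㏑x • dLog x‖ ≤ 1 * ‖x‖⁻¹ := by
        rw [norm_smul]
        exact mul_le_mul ((h.a_le _ (log_norm_neg hx hx0)).trans h.hν) (norm_dLog_le hx0)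
          (norm_nonneg _) one_pos.le
      refine (norm_add_le _ _).trans ((add_le_add h1 (hCη.bound' x hx hx0)).trans ?_)
      rw [← add_mul]
      gcongr
      exact le_max_right _ _
    · rw [hU, thetaC, vary, ← toCircle_coe, Real.Angle.coe_add]; rfl
  have hv := (punctured_vC (m := m) hmn (profMap θ y) 1).add hCψ
  have hne : ∀ x : E m, x ≠ 0 → 1 / 2 ≤ ‖vC 𝐔 x + s • ψ x‖ :=
    fun x hx0 => by
      rw [vC_equivMap hmn _ hx0]
      exact (half_le_norm_dir_add hmn hx0 (hs x)).1
  have hne0 : ∀ x : E m, x ≠ 0 → vC 𝐔 x + s • ψ x ≠ 0 :=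
    fun x hx0 hz => by
      have := hne x hx0
      rw [hz, norm_zero] at this
      norm_num at this
  have htv : PuncturedC1 1 (4 * max 1 (2 + Cψ)) (vC U) fun x =>
      (dDir (vC 𝐔 x + s • ψ x)).comp
        ((padL m n).comp (dDir x) + s • fderiv ℝ (fun z => ψ z) x) := by
    refine ((hv.mono (le_max_right 1 _)).normalize (le_max_left _ _)
      fun x _ hx0 => hne x hx0).congr fun x hx0 => ?_
    have := hne0 x hx0
    rw [hU]
    simp only [vC, vary, toSphere] at this ⊢
    rw [dif_neg this]
  refine lintegral_congr_ae ?_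
  filter_upwards [(htθ.hasWeakDeriv hm1).weakDeriv_ae_eq, (hty.hasWeakDeriv hm1).weakDeriv_ae_eq,
    (htv.hasWeakDeriv hm1).weakDeriv_ae_eq,
    ae_restrict_punctured (R := 1) hm0 fun x hx hx0 => And.intro hx hx0] with x e1 e2 e3 hx
  have hr : 0 < ‖x‖ := norm_pos_iff.2 hx.2
  have e2' : weakDeriv (ballO m 1) (yC U) x =
      (dLog x).smulRight (b ㏑x) + s • fderiv ℝ (fun z => ζ z) x := e2
  rw [e1, e2', e3]
  have hw := vC_equivMap hmn (profMap θ y) hx.2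
  have hwne := hne0 x hx.2
  rw [hw] at hwne ⊢
  have hV : V (U x).1 (U x).2.1 = Vr (θ ㏑x + s * η x) (y ㏑x + s * ζ x) := by
    rw [hU, Vr, vary, Real.Angle.coe_add]; rfl
  have k1 : hsSq ((a ㏑x • dLog x + s • fderiv ℝ (fun z => η z) x).smulRight
        (circT (θ ㏑x + s * η x))) + hsSq ((dLog x).smulRight (b ㏑x) +
        s • fderiv ℝ (fun z => ζ z) x) = (‖x‖ ^ 2)⁻¹ * varRad a b η ζ x s := by
    rw [hsSq, hsSq, varRad, ← sum_add_distrib, mul_sum]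
    refine sum_congr rfl fun i _ => ?_
    simp only [smulRight_apply, _root_.add_apply, _root_.smul_apply, norm_smul,
      norm_circT, mul_one, norm_eq_abs, sq_abs, smul_eq_mul, dLog_single hx.2]
    field_simp
  have k2 : hsSq ((dDir (padL m n 𝐧x + s • ψ x)).comp ((padL m n).comp (dDir x) + s • fderiv ℝ (fun
        z => ψ z) x)) = (‖x‖ ^ 2)⁻¹ * varSph ψ x s := by
    rw [hsSq, varSph, mul_sum]
    refine sum_congr rfl fun i _ => ?_
    have e4 : ((padL m n).comp (dDir x) + s • fderiv ℝ (fun z => ψ z) x)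
        (single i 1) = ‖x‖⁻¹ • varTan ψ i x s := by
      have e5 : ‖x‖⁻¹ * s * ‖x‖ = s := by field_simp
      rw [varTan, smul_add, ← map_smul, ← dDir_single hx.2, smul_smul, smul_smul, e5]
      rfl
    rw [comp_apply, e4, norm_dDir_apply_sq hwne, norm_smul, inner_smul_right, norm_inv, norm_norm]
    ring
  rw [hV, k1, k2, ← mul_left_comm, ← mul_add]
  have k3 : varRad a b η ζ x s + (B₀ - Vr (θ ㏑x + s * η x) (y ㏑x + s * ζ x)) * varSph ψ x s =
      varDens B₀ θ y a b η ζ ψ x s := rfl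
  rw [k3, mul_rpow (by positivity) (h0 x hx.1 hx.2), ← rpow_natCast,
    ← rpow_neg hr.le, ← rpow_mul hr.le]
  congr 3
  push_cast
  ring

end VariedMaps

section Minimality

lemma target_ext {U W : E m → Target n} {x : E m} (h₁ : thetaC W x = thetaC U x)
    (h₂ : yC W x = yC U x) (h₃ : vC W x = vC U x) : W x = U x := by
  refine Prod.ext ?_ (Prod.ext h₂ (Subtype.ext h₃))
  rw [← Real.Angle.arg_toCircle (W x).1, ← Real.Angle.arg_toCircle (U x).1]
  exact congrArg (fun z : ℂ => (Complex.arg z : Real.Angle)) h₁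

lemma vary_zero (U : E m → Target n) (η ζ : 𝓓(ballO m 1, ℝ)) (ψ : 𝓓(ballO m 1, E (n + 1))) :
    vary U η ζ ψ 0 = U :=
  funext fun x => by
    have h : ((U x).2.2 : E (n + 1)) ≠ 0 := fun h0 => by simpa [h0] using (U x).2.2.2
    refine Prod.ext (by simp [vary]) (Prod.ext (by simp [vary]) (Subtype.ext ?_))
    simp [vary, toSphere, h]

include h in
lemma IsProfile.energy_eq (hm : (m : ℝ) = M + 1) (hpm : p < m) (hmn : m ≤ n + 1) : energy p B₀ 𝐔 =
    ∫⁻ x : E m in 𝔹, ofReal (‖x‖ ^ (-p) * 𝐝 ㏑x ^ (p / 2)) := by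
  have h0 : ∀ x : E m, x ≠ 0 → varDens B₀ θ y a b (0 : 𝓓(ballO m 1, ℝ)) (0 : 𝓓(ballO m 1, ℝ))
      (0 : 𝓓(ballO m 1, E (n + 1))) x 0 = 𝐝 ㏑x := fun x => varDens_zero hm hmn
  rw [← vary_zero 𝐔 0 0 0, h.energy_vary hpm hmn (by simp)
    fun x _ hx0 => by rw [h0 x hx0]; linarith [h.one_le_enDens ㏑x]]
  exact lintegral_congr_ae (ae_restrict_punctured (by rify; linarith [h.hp]) fun x _ hx0 =>
    congrArg (fun z => ofReal (‖x‖ ^ (-p) * z ^ (p / 2))) (h0 x hx0))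

include h in
theorem IsProfile.isUniqueMinimizerIn (C : CalParam M lam ε k₁ β B₀ η) (hνη : 2 * ν ≤ η) (hpm : p <
    m) (hm : (m : ℝ) = M + 1) (hlam : lam = m - p) (hmn : m ≤ n + 1) {S : Set (E m → Target n)} (hS
    : 𝐔 ∈ S) (hcase : ∀ W ∈ S, ∀ x : E m, x ≠ 0 → vC W x = padL m n 𝐧x ∨ 40 * (M + 4) * β ≤ 3 * ε *
    (B₀ - 1)) : IsUniqueMinimizerIn p B₀ S 𝐔 := by
  have hU := h.sobolevMap hmn hpm
  refine ⟨hS, hU, fun W hWS hW hWU => ?_⟩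
  have hM : 1 ≤ M := by linarith [C.hM]
  have hβ := C.hβ
  have hB : 2 ≤ B₀ := hβ.trans C.hβB
  have hm1 : 1 < m := by exact_mod_cast h.hp.trans hpm
  have hm0 : 0 < m := by omega
  obtain ⟨D, DD, hD, hDx, hDDx⟩ := hWU.exists_isW1pZero h.hp
  set μ := μ𝔹 with hμ
  have hvD : ∀ x : E m, x ≠ 0 → (D x).2 + padL m n 𝐧x = vC W x := fun x hx0 => by
    rw [hDx, vC_equivMap hmn _ hx0, sub_add_cancel]
  have hvn : ∀ x : E m, ‖vC W x‖ = 1 := fun x => by rw [vC]; simp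
  have hD3 : ∀ x : E m, x ≠ 0 → ‖(D x).2‖ < 6 / 2 := fun x hx => by
    rw [hDx, vC_equivMap hmn _ hx]
    refine (norm_sub_le _ _).trans_lt ?_
    rw [hvn, norm_padL_dir hmn hx]; norm_num
  have horth := fun i => hD.inner_eq_zero h.hp hpm hmn (fun x _ hx0 => by rw [hvD x hx0, hvn])
    (single i 1)
  obtain ⟨τ, Cτ, hτ1, hτ2, hτ3, hτ4⟩ := exists_truncated_id (E (n + 1)) (δ := 6) (by norm_num)
  have hchain : ∀ i, IntegrableOn (chainTerm p (calCoeff p M lam ε k₁ β B₀ θ y a b n i) D DD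
      (single i 1)) 𝔹 ∧ ∫ x in 𝔹,
      chainTerm p (calCoeff p M lam ε k₁ β B₀ θ y a b n i) D DD (single i 1) x = 0 := by
    intro i
    have h1 := ((h.adm_calCoeff hβ 6 i).truncated hτ1 hτ2 hτ3).integral_chainTerm
      h.hp hpm (fun x hx hx0 => by
        have := calCoeff_zero (p := p) (M := M) (lam := lam) (ε := ε) (k₁ := k₁) (β := β)
          (B₀ := B₀) (θ := θ) (y := y) (a := a) (b := b) hmn i hx0
        simpa only [Prod.fst_zero, Prod.snd_zero, hτ4 0 (by simp)] using! this) hD (single i 1)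
    have h2 : chainTerm p (fun w => calCoeff p M lam ε k₁ β B₀ θ y a b n i (w.1, w.2.1, τ w.2.2)) D DD
        (single i 1) =ᵐ[μ] chainTerm p (calCoeff p M lam ε k₁ β B₀ θ y a b n i) D DD
        (single i 1) :=
      ae_restrict_punctured hm0 fun x _ hx0 => chainTerm_truncated hτ4 _ _ _ (hD3 x hx0)
    exact ⟨h1.1.congr h2, by rw [← integral_congr_ae h2]; exact h1.2⟩
  have hfin := lintegral_le_of_calibration (μ := μ) (f := fun x => ‖x‖ ^ (-p) * 𝐝 ㏑x ^ (p / 2)) (S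
    := fun x => ‖x‖ ^ (-p) * calSlack p M ε β B₀ θ y a b x (D x).1 (inner ℝ (vC W x) (padL m n 𝐧x)))
    (T := fun x => ∑ i, chainTerm p (calCoeff p M lam ε k₁ β B₀ θ y a b n i) D DD (single i 1) x) (g
    := fun x => (hsSq (weakDeriv (ballO m 1) (thetaC W) x) + hsSq (weakDeriv (ballO m 1) (yC W) x) +
    (B₀ - V (W x).1 (W x).2.1) * hsSq (weakDeriv (ballO m 1) (vC W) x)) ^ (p / 2)) (ae_of_all _ fun
    x => by
      have := h.one_le_enDens ㏑x
      positivity)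
    (h.integrableOn_dens hpm)
    (integrable_finsetSum _ fun i _ => (hchain i).1)
    (by rw [integral_finsetSum _ fun i _ => (hchain i).1]
        exact Finset.sum_eq_zero fun i _ => (hchain i).2)
    ?_ ?_ ?_
  · rw [h.energy_eq hm hpm hmn]
    refine ⟨hfin.1, fun heq => ?_⟩
    filter_upwards [hfin.2 heq, ae_restrict_punctured (R := 1) hm0 fun x _ hx0 => hx0] with x hx hx0
    have hc : inner ℝ (vC W x) (padL m n 𝐧x) ≤ 1 := by
      refine (real_inner_le_norm _ _).trans ?_
      rw [hvn, norm_padL_dir hmn hx0, one_mul]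
    have hs := (h.calSlack_nonneg_and_eq_zero C x (D x).1 hc).2
      ((mul_eq_zero.1 hx).resolve_left (rpow_pos_of_pos (norm_pos_iff.2 hx0) _).ne')
    have hv : vC W x = vC 𝐔 x := by
      rw [vC_equivMap hmn _ hx0]
      exact (inner_eq_one_iff_of_norm_eq_one (hvn x) (norm_padL_dir hmn hx0)).1 hs.2
    have hcyl := hs.1
    rw [hDx] at hcyl
    have hn := norm_mkCyl_sq (thetaC W x - thetaC 𝐔 x, yC W x - yC 𝐔 x)
    simp only at hcyl
    rw [hcyl, norm_zero, zero_pow two_ne_zero] at hn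
    have hn' := (add_eq_zero_iff_of_nonneg (sq_nonneg _) (sq_nonneg _)).1 hn.symm
    have h1 : thetaC W x = thetaC 𝐔 x := by simpa [sub_eq_zero] using hn'.1
    have h2 : yC W x = yC 𝐔 x := by simpa [sub_eq_zero] using hn'.2
    exact target_ext h1 h2 hv
  · refine AEStronglyMeasurable.mul
      (aesm_of_continuousOn_punctured hm0 (continuousOn_norm_rpow _ _)) ?_
    refine AEStronglyMeasurable.mul (aesm_of_continuousOn_punctured hm0 (continuousOn_comp_log (γ :=
      fun t => 𝐰 t) h.smooth_enWeight.continuousOn)) ?_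
    refine AEStronglyMeasurable.add ?_ (AEStronglyMeasurable.mul ?_ ?_)
    · exact ((contDiff_capQ hβ).continuous.comp_aestronglyMeasurable
        (continuous_fst.comp_aestronglyMeasurable hD.memLp.1)).const_mul _
    · refine aesm_of_continuousOn_punctured hm0 ?_
      exact (continuousOn_const.mul (continuousOn_const.sub (continuousOn_comp_log
        (γ := fun t => Vr (θ t) (y t)) h.smooth_V.continuousOn))).div_const 2
    · refine AEStronglyMeasurable.sub aestronglyMeasurable_const
        (hW.2.2.1.1.inner (aesm_of_continuousOn_punctured hm0 ?_))
      exact (padL m n).continuous.comp_continuousOn ((continuous_norm.continuousOn.inv₀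
        fun x hx => norm_ne_zero_iff.2 hx.2).smul continuousOn_id)
  · refine ae_restrict_punctured hm0 fun x _ hx0 => mul_nonneg (by positivity)
      (h.calSlack_nonneg_and_eq_zero C x (D x).1 ?_).1
    refine (real_inner_le_norm _ _).trans ?_
    rw [hvn, norm_padL_dir hmn hx0, one_mul]
  · filter_upwards [(hW.1.hasWeakDeriv.sub ((h.punctured_thetaC (m := m) (n := n)).hasWeakDeriv
      hm1)).weakDeriv_ae_eq, (hW.2.1.hasWeakDeriv.sub ((h.punctured_yC (m := m) (n :=
      n)).hasWeakDeriv hm1)).weakDeriv_ae_eq, (hW.2.2.hasWeakDeriv.sub ((punctured_vC (m := m) hmn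
      (profMap θ y) 1).hasWeakDeriv hm1)).weakDeriv_ae_eq, ae_restrict_punctured (R := 1) hm0 fun x
      hx hx0 => And.intro hx hx0, ae_all_iff.2 horth] with x e1 e2 e3 hx ho
    have hDD : ∀ e, DD x e = (mkCyl (weakDeriv (ballO m 1) (thetaC W) x e - (dLog x).smulRight (a ㏑x
      • circT (θ ㏑x)) e, weakDeriv (ballO m 1) (yC W) x e - (dLog x).smulRight (b ㏑x) e), weakDeriv
      (ballO m 1) (vC W) x e - padL m n (dDir x e)) := fun e => by rw [hDDx, e1, e2, e3]; rfl
    refine h.pointwise_le C hνη hm hlam hmn hx.1 hx.2 (by rw [hDx, thetaC_profMap, yC_profMap,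
      vC_equivMap hmn _ hx.2]) hDD (fun i => ?_) (hcase W hWS x hx.2)
    have := ho i
    rwa [hvD x hx.2, hDD, sub_add_cancel] at this

end Minimality

section Constants

lemma two_le_of_bound {K : ℝ} (hK : ∀ (θ : Real.Angle) (y : ℝ), |V θ y| + gradV θ y ≤ K)
    (hB : K + 1 < B₀) : 2 ≤ B₀ := by
  have h1 : ∀ s : ℝ, 0 < s → exp (-s ^ 2) ≤ K := fun s hs => by
    have h2 := hK (((-(π / 2) - s : ℝ)) : Real.Angle) (1 / s)
    have h3 : |V (((-(π / 2) - s : ℝ)) : Real.Angle) (1 / s)| = exp (-s ^ 2) := by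
      rw [V, if_neg (by positivity), one_div_one_div, ← Real.Angle.coe_add, Real.Angle.sin_coe,
        sub_add_cancel, sin_neg, sin_pi_div_two, mul_neg_one, neg_neg, abs_of_pos (exp_pos _)]
      congr 2
      field_simp
    have h4 : 0 ≤ gradV (((-(π / 2) - s : ℝ)) : Real.Angle) (1 / s) := sqrt_nonneg _
    linarith
  have h5 : Tendsto (fun s : ℝ => exp (-s ^ 2)) (𝓝[>] 0) (𝓝 (exp (-0 ^ 2))) :=
    (by fun_prop : Continuous fun s : ℝ => exp (-s ^ 2)).continuousWithinAt.tendsto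
  have h6 := le_of_tendsto h5 (eventually_mem_nhdsWithin.mono fun s hs => h1 s hs)
  norm_num at h6
  linarith

/-- The choice of the parameters of the calibration. -/
lemma exists_calibrated (hp : 1 < p) (hpm : p < m) : ∃ Bbar : ℝ, ∀ B₀ : ℝ, 2 ≤ B₀ →
    ∃ ν : ℝ, 0 < ν ∧ ν ≤ 1 ∧ ∀ (n : ℕ) (θ y a b ϖ : ℝ → ℝ), m ≤ n + 1 →
      IsProfile p (m - 1) (m - p) B₀ ν θ y a b ϖ → 4 * ((m : ℝ) - 1) < ((m : ℝ) - p) ^ 2 →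
      IsUniqueMinimizerIn p B₀ (Set.range (equivMap m n)) (equivMap m n (profMap θ y)) ∧
      (Bbar < B₀ → IsUniqueMinimizerIn p B₀ univ (equivMap m n (profMap θ y))) := by
  by_cases hc : 4 * ((m : ℝ) - 1) < ((m : ℝ) - p) ^ 2
  swap
  · exact ⟨0, fun B₀ _ => ⟨1, one_pos, le_rfl, fun _ _ _ _ _ _ _ _ h => absurd h hc⟩⟩
  obtain ⟨M, hM⟩ : ∃ M : ℝ, M = m - 1 := ⟨_, rfl⟩
  obtain ⟨lam, hl⟩ : ∃ lam : ℝ, lam = m - p := ⟨_, rfl⟩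
  rw [← hM, ← hl] at hc
  have hl0 : 0 < lam := by linarith
  have hlM : lam < M := by linarith
  have hM4 : 4 ≤ M := by
    have : lam ^ 2 < M ^ 2 := by gcongr
    have h2 : 4 * M < M * M := by linarith [sq M]
    exact (lt_of_mul_lt_mul_right h2 (by linarith)).le
  obtain ⟨ε, hε⟩ : ∃ ε : ℝ, ε = (1 - 4 * M / lam ^ 2) / 12 := ⟨_, rfl⟩
  have hε0 : 0 < ε := by
    have : 4 * M / lam ^ 2 < 1 := by rwa [div_lt_one (by positivity)]
    linarith
  have hϑ : 4 * M = (1 - 12 * ε) * lam ^ 2 := by rw [hε]; field_simp; ring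
  obtain ⟨s, hs⟩ : ∃ s : ℝ, s = 3 * ε / (80 * (M + 4)) := ⟨_, rfl⟩
  have hs' : s * (80 * (M + 4)) = 3 * ε := by rw [hs]; field_simp
  have hs0 : 0 < s := by rw [hs]; positivity
  have hε1 : ε ≤ 1 / 12 := by
    have : 0 ≤ 4 * M / lam ^ 2 := by positivity
    linarith
  have hs1 : s ≤ 1 := by
    have : s * 1 ≤ s * (80 * (M + 4)) := by gcongr; linarith
    linarith
  refine ⟨2 / s, fun B₀ hB => ?_⟩
  obtain ⟨η, hη⟩ : ∃ η : ℝ, η = ε ^ 2 / (1000 * (M + 1) ^ 2 * (B₀ + B₀ + 2)) := ⟨_, rfl⟩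
  have hη0 : 0 < η := by rw [hη]; positivity
  have hη' : η * (1000 * (M + 1) ^ 2 * (B₀ + B₀ + 2)) = ε ^ 2 := by rw [hη]; field_simp
  have hCal : ∀ β, 2 ≤ β → β ≤ B₀ →
      CalParam M lam ε (M * (1 + 2 * ε) / lam) β B₀ η := fun β h1 h2 =>
    ⟨hM4, hl0, hε0, hϑ, by field_simp, h1, h2, hη0, by rw [← hη']; gcongr⟩
  have hη1 : η ≤ 1 := by
    have h1 := (hCal B₀ hB le_rfl).η_mul_le'
    have h2 := (hCal B₀ hB le_rfl).ε_sq_le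
    have h3 : η * 1 ≤ η * (5000 * (B₀ + B₀ + 2)) := by gcongr; linarith
    linarith
  refine ⟨η / 2, by linarith, by linarith, fun n θ y a b ϖ hmn h _ => ⟨?_, fun hBb => ?_⟩⟩
  · rw [← hM, ← hl] at h
    refine h.isUniqueMinimizerIn (hCal B₀ hB le_rfl) (by linarith) hpm
      (by linarith) hl hmn ⟨_, rfl⟩ ?_
    rintro W ⟨u, rfl⟩ x hx
    exact Or.inl (vC_equivMap hmn u hx)
  · rw [← hM, ← hl] at h
    have h2 : 2 < B₀ * s := by rwa [div_lt_iff₀ hs0] at hBb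
    refine h.isUniqueMinimizerIn (hCal (s * B₀) (by linarith) (by nlinarith)) (by linarith) hpm (by linarith) hl hmn (mem_univ _) fun W _ x _ => Or.inr ?_
    have h3 : 3 * ε * B₀ = s * (80 * (M + 4)) * B₀ := by rw [hs']
    have h4 : 0 ≤ ε * (B₀ - 2) := by apply mul_nonneg hε0.le; linarith
    linarith

end Constants

section Elementary

include h in
lemma IsProfile.energy_le (hpm : p < m) (hm : (m : ℝ) = M + 1) (hmn : m ≤ n + 1) : energy p B₀ 𝐔 ≤
    ofReal (((1 + 2 * M) ^ (p / 2) * ∫ x : E m in 𝔹, ‖x‖ ^ (-p)) * B₀ ^ (p / 2)) := by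
  have hp := h.hp
  have hM := h.hM
  have hB := h.hB
  have hm0 : 0 < m := by rify; linarith
  have hi := integrableOn_norm_rpow_neg hm0 hpm 1
  have hd := h.integrableOn_dens hpm
  rw [h.energy_eq hm hpm hmn, ← ofReal_integral_eq_lintegral_ofReal hd]
  · refine ENNReal.ofReal_le_ofReal ?_
    have e : (1 + 2 * M) ^ (p / 2) * (∫ x : E m in 𝔹, ‖x‖ ^ (-p)) * B₀ ^ (p / 2) =
        ∫ x : E m in 𝔹, ((1 + 2 * M) * B₀) ^ (p / 2) * ‖x‖ ^ (-p) := by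
      rw [integral_const_mul, mul_rpow (by linarith) (by linarith)]; ring
    rw [e]
    refine integral_mono_ae hd (hi.const_mul _) (ae_restrict_punctured hm0 fun x hx hx0 => ?_)
    have h1 := h.one_le_enDens ㏑x
    have h2 := h.enDens_le (log_norm_neg hx hx0)
    have h3 : 2 + M * (B₀ + 1) ≤ (1 + 2 * M) * B₀ := by nlinarith
    beta_reduce
    rw [mul_comm]
    gcongr
    linarith
  · exact ae_of_all _ fun x => by
      have := h.one_le_enDens ㏑x
      positivity

lemma orthAct_pad (hmn : m ≤ n + 1) (g : E m ≃ₗᵢ[ℝ] E m) (x : E m) :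
    orthAct g (pad n x) = pad n (g x) := by
  rw [orthAct, firstCoords_pad hmn]
  ext i
  by_cases hi : (i : ℕ) < m <;> simp [pad, hi]

lemma isEquivariant_equivMap (hmn : m ≤ n + 1) (u : ℝ → Real.Angle × ℝ) :
    IsEquivariant (equivMap m n u) := by
  intro g x _ hx0
  have hg0 : g x ≠ 0 := by simpa using hx0
  refine ⟨by simp [equivMap], by simp [equivMap], ?_⟩
  have h1 := vC_equivMap hmn u hg0
  have h2 := vC_equivMap hmn u hx0
  rw [vC] at h1 h2
  rw [h1, h2, padL_apply, padL_apply, orthAct_pad hmn, map_smul, g.norm_map]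

include h in
lemma IsProfile.smoothMapOn (hmn : m ≤ n + 1) : SmoothMapOn 𝐔 ((ballO m 1 : Set (E m)) \ {0}) := by
  have hn : ContDiffOn ℝ ∞ (fun x : E m => ‖x‖) ((ballO m 1 : Set (E m)) \ {0}) :=
    fun x hx => (contDiffAt_norm ℝ hx.2).contDiffWithinAt
  have hl : ContDiffOn ℝ ∞ (fun x : E m => ㏑ x) ((ballO m 1 : Set (E m)) \ {0}) :=
    hn.log fun x hx => norm_ne_zero_iff.2 hx.2
  have hmap : Set.MapsTo (fun x : E m => ㏑ x) ((ballO m 1 : Set (E m)) \ {0})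
      (Iio 0) := fun x hx => log_norm_neg hx.1 hx.2
  refine ⟨?_, h.smooth_y.comp hl hmap, ?_⟩
  · exact ((PHarm.ContDiffOn.circ h.smooth_θ).comp hl hmap).congr fun x _ => thetaC_profMap x
  · exact ((padL m n).contDiff.comp_contDiffOn ((hn.inv fun x hx => norm_ne_zero_iff.2 hx.2).smul
      contDiffOn_id)).congr fun x hx => vC_equivMap hmn _ hx.2

lemma not_continuousAt_of_ae_eq (hm : 0 < m) (hmn : m ≤ n + 1) (u : ℝ → Real.Angle × ℝ)
    {W : E m → Target n} (hW : W =ᵐ[volume.restrict (ballO m 1 : Set (E m))] equivMap m n u) :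
    ¬ ContinuousAt W 0 := by
  intro hc
  have hv : ContinuousAt (vC W) 0 := continuous_subtype_val.continuousAt.comp hc.snd.snd
  obtain ⟨δ, hδ, hδ'⟩ := continuousAt_iff.1 hv (1 / 2) (by norm_num)
  have h1 : ∀ᵐ x : E m, x ∈ 𝔹 → W x = equivMap m n u x :=
    (ae_restrict_iff' measurableSet_ball).1 hW
  have h2 : ∀ᵐ x : E m, -x ∈ 𝔹 → W (-x) = equivMap m n u (-x) :=
    (Measure.measurePreserving_neg (volume : Measure (E m))).quasiMeasurePreserving.ae h1
  have h3 : ∃ x : E m, x ∈ ball (0 : E m) (min δ 1) ∧ x ≠ 0 ∧ (x ∈ 𝔹 → W x = equivMap m n u x) ∧ (-x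
      ∈ 𝔹 → W (-x) = equivMap m n u (-x)) := by
    have hne : NeBot (ae (volume.restrict (ball (0 : E m) (min δ 1)))) := by
      rw [ae_neBot, Ne, Measure.restrict_eq_zero]
      exact (measure_ball_pos _ _ (by positivity)).ne'
    have h4 : ∀ᵐ x ∂volume.restrict (ball (0 : E m) (min δ 1)), x ∈ ball (0 : E m) (min δ 1) ∧ x ≠ 0
        ∧ (x ∈ 𝔹 → W x = equivMap m n u x) ∧ (-x ∈ 𝔹 → W (-x) = equivMap m n u (-x)) := by
      filter_upwards [ae_restrict_mem measurableSet_ball, ae_restrict_of_ae (ae_ne_zero hm),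
        ae_restrict_of_ae h1, ae_restrict_of_ae h2] with x a1 a2 a3 a4
      exact ⟨a1, a2, a3, a4⟩
    exact h4.exists
  obtain ⟨x, hx, hx0, e1, e2⟩ := h3
  have hx' : ‖x‖ < min δ 1 := by simpa using hx
  have hxδ := hx'.trans_le (min_le_left _ _)
  have hx1 := hx'.trans_le (min_le_right _ _)
  have k1 : vC W x = padL m n 𝐧x := by rw [vC, e1 (by simpa using hx1)]; exact vC_equivMap hmn u hx0
  have k2 : vC W (-x) = -padL m n 𝐧x := by
    have := vC_equivMap hmn u (neg_ne_zero.2 hx0)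
    rw [norm_neg, smul_neg, map_neg] at this
    rw [vC, e2 (by simpa using hx1)]; exact this
  have d1 := hδ' (x := x) (by simpa using hxδ)
  have d2 := hδ' (x := -x) (by simpa using hxδ)
  have d3 := (dist_triangle_right (vC W x) (vC W (-x)) (vC W 0)).trans_lt (add_lt_add d1 d2)
  rw [k1, k2, dist_eq_norm, sub_neg_eq_add, ← two_smul ℝ, norm_smul, norm_padL_dir hmn hx0] at d3
  norm_num at d3

end Elementary

section StrongConvergence

variable {R C : ℝ}

lemma tendsto_eLpNorm_zero_of_dominated {α A : Type*} [MeasurableSpace α] {μ : Measure α}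
    [NormedAddCommGroup A] (hp : 0 < p) {f : ℕ → α → A} {g : α → ℝ} (hf : ∀ᶠ k in atTop,
    AEStronglyMeasurable (f k) μ) (hg : MemLp g (ofReal p) μ) (hfg : ∀ᶠ k in atTop, ∀ᵐ x ∂μ, ‖f k x‖
    ≤ g x) (hlim : ∀ᵐ x ∂μ, Tendsto (fun k => f k x) atTop (𝓝 0)) : Tendsto (fun k => eLpNorm (f k)
    (ofReal p) μ) atTop (𝓝 0) := by
  have hp0 : ofReal p ≠ 0 := by simpa using hp
  have hpt : (ofReal p).toReal = p := ENNReal.toReal_ofReal hp.le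
  simp only [eLpNorm_eq_lintegral_rpow_enorm_toReal hp0 ENNReal.ofReal_ne_top, hpt]
  have h0 : Tendsto (fun k => ∫⁻ x, ‖f k x‖ₑ ^ p ∂μ) atTop (𝓝 (∫⁻ _, 0 ∂μ)) := by
    refine tendsto_lintegral_filter_of_dominated_convergence' (fun x => ‖g x‖ₑ ^ p)
      (hf.mono fun k hk => hk.enorm.pow_const p) (hfg.mono fun k hk => hk.mono fun x hx => ?_) ?_
      (hlim.mono fun x hx => ?_)
    · gcongr
      rw [enorm_le_iff_norm_le]
      exact hx.trans (le_abs_self _)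
    · have := lintegral_rpow_enorm_lt_top_of_eLpNorm_lt_top hp0 ENNReal.ofReal_ne_top hg.2
      rw [hpt] at this
      exact this.ne
    · have h1 : Tendsto (fun k => ‖f k x‖ₑ) atTop (𝓝 0) := by simpa using hx.enorm
      simpa [hp] using h1.ennrpow_const p
  rw [lintegral_zero] at h0
  simpa [hp] using h0.ennrpow_const (1 / p)

lemma TendstoW1p.comp {Ω : Opens (E m)} {f : ℕ → E m → F} {g : E m → F} (h : TendstoW1p Ω p f g) {φ
    : ℕ → ℕ} (hφ : Tendsto φ atTop atTop) : TendstoW1p Ω p (fun k => f (φ k)) g :=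
  ⟨hφ.eventually h.1, h.2.1, h.2.2.1.comp hφ, h.2.2.2.comp hφ⟩

variable [CompleteSpace F]

lemma tendstoW1p_of_punctured (hp : 1 < p) (hpm : p < m) {f : ℕ → E m → F} {g : E m → F} {f' : ℕ → E
    m → E m →L[ℝ] F} {g' : E m → E m →L[ℝ] F} (hf : ∀ᶠ k in atTop, PuncturedC1 R C (f k) (f' k)) (hg
    : PuncturedC1 R C g g') (h : ∀ x : E m, x ≠ 0 → Tendsto (fun k => f k x) atTop (𝓝 (g x))) (h' :
    ∀ x : E m, x ≠ 0 → Tendsto (fun k => f' k x) atTop (𝓝 (g' x))) : TendstoW1p (ballO m R) p f g :=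
    by
  have hm1 : 1 < m := by exact_mod_cast hp.trans hpm
  have hm0 : 0 < m := by omega
  refine ⟨hf.mono fun k hk => hk.memW1p hp hpm, hg.memW1p hp hpm, ?_, ?_⟩
  · refine tendsto_eLpNorm_zero_of_dominated (by linarith) (g := fun _ => C + C) (hf.mono fun k hk
      => ?_) (memLp_const (μ := volume.restrict (ball (0 : E m) R)) _) (hf.mono fun k hk => ?_) ?_
    · exact (hk.memLp hm0 1).1.sub (hg.memLp hm0 1).1
    · exact ae_restrict_punctured hm0 fun x hx hx0 =>
        (norm_sub_le _ _).trans (add_le_add (hk.bound x hx hx0) (hg.bound x hx hx0))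
    · exact ae_restrict_punctured hm0 fun x hx hx0 => by simpa using (h x hx0).sub_const (g x)
  · have hr : MemLp (fun x : E m => ‖x‖ ^ (-1 : ℝ)) (ofReal p)
        (volume.restrict (ball (0 : E m) R)) := by
      refine (integrable_norm_rpow_iff ?_ (by simp; linarith) ENNReal.ofReal_ne_top).1 ?_
      · exact (measurable_norm.pow_const _).aestronglyMeasurable
      · rw [ENNReal.toReal_ofReal (by linarith)]
        refine (integrableOn_norm_rpow_neg hm0 hpm R).congr (ae_of_all _ fun x => ?_)
        beta_reduce
        rw [norm_of_nonneg (by positivity), ← rpow_mul (norm_nonneg _), neg_one_mul]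
    have key : Tendsto (fun k => eLpNorm (fun x => f' k x - g' x) (ofReal p)
        (volume.restrict (ball (0 : E m) R))) atTop (𝓝 0) := by
      refine tendsto_eLpNorm_zero_of_dominated (by linarith) (g := fun x => (C + C) * ‖x‖ ^ (-1 :
        ℝ)) (hf.mono fun k hk => ?_) (hr.const_mul _) (hf.mono fun k hk => ?_) ?_
      · exact (hk.memLp_deriv hp hpm).1.sub (hg.memLp_deriv hp hpm).1
      · exact ae_restrict_punctured hm0 fun x hx hx0 => by
          rw [rpow_neg_one, add_mul]
          exact (norm_sub_le _ _).trans (add_le_add (hk.bound' x hx hx0) (hg.bound' x hx hx0))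
      · exact ae_restrict_punctured hm0 fun x hx hx0 => by simpa using (h' x hx0).sub_const (g' x)
    refine key.congr' (hf.mono fun k hk => eLpNorm_congr_ae ?_)
    filter_upwards [(hk.hasWeakDeriv hm1).weakDeriv_ae_eq, (hg.hasWeakDeriv hm1).weakDeriv_ae_eq]
      with x e1 e2
    rw [e1, e2]

variable {Ω : Opens (E m)} {f : ℕ → E m → F} {g g₂ : E m → F}

lemma TendstoW1p.congr (h : TendstoW1p Ω p f g)
    (hg : g =ᵐ[volume.restrict (Ω : Set (E m))] g₂) : TendstoW1p Ω p f g₂ := by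
  have hw := h.2.1.hasWeakDeriv
  have hw₂ := hw.congr hg (EventuallyEq.refl _ _)
  refine ⟨h.1, ⟨h.2.1.1.ae_eq hg, _, hw₂, h.2.1.memLp_weakDeriv⟩, ?_, ?_⟩
  · refine h.2.2.1.congr fun k => eLpNorm_congr_ae ?_
    filter_upwards [hg] with x hx
    rw [hx]
  · refine h.2.2.2.congr fun k => eLpNorm_congr_ae ?_
    filter_upwards [hw₂.weakDeriv_ae_eq] with x hx
    rw [hx]

lemma TendstoW1p.unique (hp : 1 ≤ p) (h : TendstoW1p Ω p f g) (h₂ : TendstoW1p Ω p f g₂) :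
    g =ᵐ[volume.restrict (Ω : Set (E m))] g₂ := by
  have hp' : (1 : ℝ≥0∞) ≤ ofReal p := by simpa using hp
  have hle : eLpNorm (fun x => g x - g₂ x) (ofReal p)
      (volume.restrict (Ω : Set (E m))) ≤ 0 + 0 := by
    refine ge_of_tendsto (h₂.2.2.1.add h.2.2.1) (h.1.mono fun k hk => ?_)
    have e : (fun x => g x - g₂ x) = (fun x => f k x - g₂ x) - (fun x => f k x - g x) := by
      funext x; simp
    rw [e]
    exact eLpNorm_sub_le (hk.1.1.sub h₂.2.1.1.1) (hk.1.1.sub h.2.1.1.1) hp'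
  rw [add_zero, nonpos_iff_eq_zero, eLpNorm_eq_zero_iff (f := fun x => g x - g₂ x) (h.2.1.1.1.sub h₂.2.1.1.1)
    (by simp; linarith)] at hle
  filter_upwards [hle] with x hx
  exact sub_eq_zero.1 hx

end StrongConvergence

section TangentMaps

include h

lemma IsProfile.tendsto_shift (s : ℝ) : Tendsto (fun t => θ (t + s) - θ t) atBot (𝓝 0) := by
  refine Metric.tendsto_nhds.2 fun ε hε => ?_
  obtain ⟨δ, hδ, hδs⟩ : ∃ δ, 0 < δ ∧ δ * |s| < ε := by
    refine ⟨ε / (|s| + 1), by positivity, ?_⟩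
    rw [div_mul_eq_mul_div, div_lt_iff₀ (by positivity)]
    linarith [mul_comm ε |s|]
  obtain ⟨T, hT⟩ := eventually_atBot.1 ((tendsto_nhds.1 h.tendsto_a δ hδ).and
    (eventually_lt_atBot (0 : ℝ)))
  filter_upwards [eventually_le_atBot T, eventually_le_atBot (T - s)] with t h1 h2
  have := (convex_Iic T).norm_image_sub_le_of_norm_hasDerivWithin_le (f := θ) (f' := a) (C := δ)
    (fun x hx => (h.deriv_θ x (hT x hx).2).hasDerivWithinAt) (fun x hx => by simpa using (hT x
    hx).1.le) (x := t) (y := t + s) h1 (mem_Iic.2 (by linarith))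
  rw [add_sub_cancel_left, norm_eq_abs s] at this
  rw [dist_zero_right]
  exact this.trans_lt hδs

/-- Strong convergence of the rescaled maps along radii with convergent angle. -/
lemma IsProfile.tendstoW1p_rescaled (hmn : m ≤ n + 1) (hpm : p < m) {r : ℕ → ℝ} (hr : ∀ k, 0 < r k)
    (hr0 : Tendsto r atTop (𝓝 0)) {Θ : Real.Angle} (hΘ : Tendsto (fun k => circ (θ (log (r k))))
    atTop (𝓝 (Θ.toCircle : ℂ))) {R : ℝ} (hR : 0 < R) : TendstoW1p (ballO m R) p (fun k => thetaC fun
    x => 𝐔 ((0 : E m) + r k • x)) (thetaC (equivMap m n fun _ => (Θ, 0))) ∧ TendstoW1p (ballO m R) p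
    (fun k => yC fun x => 𝐔 ((0 : E m) + r k • x)) (yC (equivMap m n fun _ => (Θ, 0))) ∧ TendstoW1p
    (ballO m R) p (fun k => vC fun x => 𝐔 ((0 : E m) + r k • x)) (vC (equivMap m n fun _ => (Θ, 0)))
    := by
  have hlog : Tendsto (fun k => log (r k)) atTop atBot :=
    tendsto_log_nhdsGT_zero.comp (tendsto_nhdsWithin_iff.2 ⟨hr0, .of_forall hr⟩)
  have hnorm : ∀ k (x : E m), x ≠ 0 →
      log ‖(0 : E m) + r k • x‖ = log (r k) + ㏑ x := fun k x hx => by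
    rw [zero_add, norm_smul, norm_of_nonneg (hr k).le, log_mul (hr k).ne' (norm_ne_zero_iff.2 hx)]
  have hlt : ∀ k, ∀ t < -log (r k), log (r k) + t < 0 := fun k t ht => by linarith
  have hRk : ∀ᶠ k in atTop, R ≤ exp (-log (r k)) := by
    filter_upwards [hlog.eventually_le_atBot (-log R)] with k hk
    exact (log_le_iff_le_exp hR).1 (by linarith)
  have hshift : ∀ s, Tendsto (fun k => log (r k) + s) atTop atBot := fun s =>
    tendsto_atBot_add_const_right _ s hlog
  have hmapsto : ∀ k, Set.MapsTo (fun t => log (r k) + t) (Iio (-log (r k)))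
      (Iio 0) := fun k t ht => hlt k t ht
  have hcont : ∀ {γ : ℝ → ℝ} (k : ℕ), ContinuousOn γ (Iio 0) →
      ContinuousOn (fun t => γ (log (r k) + t)) (Iio (-log (r k))) := fun k hγ =>
    hγ.comp (by fun_prop) (hmapsto k)
  have hsm : ∀ {γ γ' : ℝ → ℝ} (k : ℕ) {t : ℝ}, t < -log (r k) → (∀ t < 0, HasDerivAt γ (γ' t) t) →
      HasDerivAt (fun t => γ (log (r k) + t)) (γ' (log (r k) + t)) t :=
    fun k t ht hγ => (hγ _ (hlt k t ht)).comp_const_add _ _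
  have hsR : ∀ {G : Type} [NormedAddCommGroup G] [NormedSpace ℝ G] (x : E m) {z : ℕ → G},
      Tendsto z atTop (𝓝 0) → Tendsto (fun k => (dLog x).smulRight (z k)) atTop
        (𝓝 (0 : E m →L[ℝ] G)) := fun x z hz => by
    have := ((smulRightL ℝ (E m) _ (dLog x)).continuous.tendsto 0).comp hz
    simpa [Function.comp_def] using! this
  refine ⟨?_, ?_, ?_⟩
  · refine tendstoW1p_of_punctured h.hp hpm (C := 1) (f' := fun k x => (dLog x).smulRight
      (a (log (r k) + ㏑ x) • circT (θ (log (r k) + ㏑ x))))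
      (g' := fun _ => 0) (hRk.mono fun k hk => ?_) ?_ (fun x hx => ?_) fun x hx => ?_
    · refine (PuncturedC1.radial (γ := fun t => circ (θ (log (r k) + t))) (γ' := fun t => a (log (r
        k) + t) • circT (θ (log (r k) + t))) ?_ (fun t ht => HasDerivAt.circ (hsm k ht h.deriv_θ))
        (fun t _ => (norm_circ _).le) (fun t ht => ?_) hk).congr fun x hx => ?_
      · refine (hcont k h.smooth_a.continuousOn).smul ?_
        have h2 : Continuous circT := by unfold circT circ; fun_prop
        exact h2.comp_continuousOn (hcont k h.smooth_θ.continuousOn)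
      · rw [norm_smul, norm_circT, mul_one]
        exact (h.a_le _ (hlt k t ht)).trans h.hν
      · rw [← hnorm k x hx]; exact thetaC_profMap _
    · exact ⟨fun x _ _ => hasFDerivAt_const (Θ.toCircle : ℂ) x, continuousOn_const,
        fun x _ _ => (Circle.norm_coe Θ.toCircle).le, fun x _ _ => by simp⟩
    · have h1 := ((h.tendsto_shift ㏑x).comp hlog)
      have h2 : Continuous circ := by unfold circ; fun_prop
      have h3 := hΘ.mul ((h2.tendsto 0).comp h1)
      have h4 : circ 0 = 1 := by simp [circ]
      rw [h4, mul_one] at h3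
      refine h3.congr fun k => ?_
      have : thetaC (fun x => 𝐔 ((0 : E m) + r k • x)) x =
        circ (θ (log (r k) + ㏑ x)) := by rw [← hnorm k x hx]; exact thetaC_profMap _
      rw [this]
      simp only [Function.comp_def, circ]
      rw [← Complex.exp_add]
      congr 1
      push_cast
      ring
    · refine hsR x ?_
      have h1 := (h.tendsto_a.comp (hshift ㏑x)).norm
      rw [norm_zero] at h1
      refine squeeze_zero_norm (fun k => ?_) h1
      rw [norm_smul, norm_circT, mul_one]
      rfl
  · refine tendstoW1p_of_punctured h.hp hpm (C := 1) (f' := fun k x => (dLog x).smulRight (b (log (r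
      k) + ㏑ x))) (g' := fun _ => 0) (hRk.mono fun k hk => ?_) ?_ (fun x hx => ?_) fun x hx => ?_
    · refine (PuncturedC1.radial (γ := fun t => y (log (r k) + t)) (γ' := fun t => b (log (r k) +
        t)) (hcont k h.smooth_b.continuousOn) (fun t ht => hsm k ht h.deriv_y) (fun t ht => ?_) (fun
        t ht => (h.b_le _ (hlt k t ht)).trans h.hν) hk).congr fun x hx => ?_
      · rw [norm_of_nonneg (h.y_pos _ (hlt k t ht)).le]
        exact (h.y_le _ (hlt k t ht)).trans h.hν
      · rw [← hnorm k x hx]; rfl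
    · exact ⟨fun x _ _ => hasFDerivAt_const (0 : ℝ) x, continuousOn_const,
        fun x _ _ => by simp [yC, equivMap], fun x _ _ => by simp⟩
    · refine (h.tendsto_y.comp (hshift ㏑x)).congr fun k => ?_
      rw [Function.comp_apply, ← hnorm k x hx]; rfl
    · exact hsR x (h.tendsto_b.comp (hshift ㏑x))
  · have hv : ∀ k (x : E m), x ≠ 0 → vC (fun x => 𝐔 ((0 : E m) + r k • x)) x =
        vC (equivMap m n fun _ => (Θ, 0)) x := fun k x hx => by
      have hx' : (0 : E m) + r k • x ≠ 0 := by simp [hx, (hr k).ne']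
      have e := vC_equivMap hmn (profMap θ y) hx'
      rw [vC_equivMap hmn _ hx]
      refine Eq.trans e ?_
      rw [zero_add, norm_smul, norm_of_nonneg (hr k).le, smul_smul, mul_inv, mul_right_comm,
        inv_mul_cancel₀ (hr k).ne', one_mul]
    have hP := punctured_vC (m := m) hmn (fun _ => (Θ, 0)) R
    refine tendstoW1p_of_punctured h.hp hpm (C := 2) (f' := fun _ x => (padL m n).comp (dDir x))
      (.of_forall fun k => hP.congr (hv k)) hP (fun x hx => ?_) fun x _ => tendsto_const_nhds
    simp only [hv _ x hx]
    exact tendsto_const_nhds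

lemma IsProfile.exists_angle_eq (Θ : Real.Angle) (T : ℝ) :
    ∃ t < T, t < 0 ∧ ((θ t : ℝ) : Real.Angle) = Θ := by
  induction Θ using Real.Angle.induction_on with
  | _ φ =>
    set T₀ := min T 0 - 1 with hT₀
    have h1 : T₀ < T := by linarith [min_le_left T 0]
    have h2 : T₀ < 0 := by linarith [min_le_right T 0]
    obtain ⟨N, hN⟩ := exists_nat_gt (φ - θ T₀)
    have h3 : φ - N * (2 * π) ≤ θ T₀ := by
      have := pi_gt_three
      have h5 : (N : ℝ) * 1 ≤ N * (2 * π) := by gcongr; linarith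
      linarith
    obtain ⟨s, hs1, hs2⟩ := ((h.tendsto_θ.eventually_le_atBot (φ - N * (2 * π))).and
      (eventually_le_atBot T₀)).exists
    have hcont : ContinuousOn θ (Icc s T₀) :=
      h.smooth_θ.continuousOn.mono fun t ht => ht.2.trans_lt h2
    obtain ⟨t, ht, hte⟩ := intermediate_value_Icc hs2 hcont ⟨hs1, h3⟩
    refine ⟨t, ht.2.trans_lt h1, ht.2.trans_lt h2, ?_⟩
    rw [hte, Real.Angle.coe_sub, sub_eq_self, Real.Angle.coe_eq_zero_iff]
    exact ⟨N, by simp⟩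

theorem IsProfile.isTangentMap_iff (hmn : m ≤ n + 1) (hpm : p < m) (W : E m → Target n) :
    IsTangentMap p 𝐔 0 W ↔ ∃ Θ : Real.Angle, W =ᵐ[volume] equivMap m n (fun _ => (Θ, 0)) := by
  constructor
  · rintro ⟨r, hr, hr0, hW⟩
    obtain ⟨z, φ, hφ, hz⟩ := CompactSpace.tendsto_subseq
      fun k => ((θ (log (r k)) : ℝ) : Real.Angle).toCircle
    obtain ⟨Θ, rfl⟩ : ∃ Θ : Real.Angle, Θ.toCircle = z :=
      ⟨(Complex.arg z : Real.Angle), AddCircle.homeomorphCircle'.right_inv z⟩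
    have hz' : Tendsto (fun k => circ (θ (log (r (φ k))))) atTop (𝓝 (Θ.toCircle : ℂ)) := by
      refine ((continuous_subtype_val.tendsto _).comp hz).congr fun k => ?_
      exact toCircle_coe _
    refine ⟨Θ, ?_⟩
    have key : ∀ N : ℕ, ∀ᵐ x : E m, x ∈ ball (0 : E m) (N + 1) →
        W x = equivMap m n (fun _ => (Θ, 0)) x := fun N => by
      have hR : (0 : ℝ) < N + 1 := by positivity
      obtain ⟨l1, l2, l3⟩ := h.tendstoW1p_rescaled (n := n) hmn hpm (fun k => hr (φ k))
        (hr0.comp hφ.tendsto_atTop) hz' hR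
      obtain ⟨w1, w2, w3⟩ := hW (N + 1) hR
      refine (ae_restrict_iff' measurableSet_ball).1 ?_
      filter_upwards [(w1.comp hφ.tendsto_atTop).unique h.hp.le l1,
        (w2.comp hφ.tendsto_atTop).unique h.hp.le l2, (w3.comp hφ.tendsto_atTop).unique h.hp.le l3]
        with x e1 e2 e3
      exact target_ext e1 e2 e3
    filter_upwards [ae_all_iff.2 key] with x hx
    obtain ⟨N, hN⟩ := exists_nat_gt ‖x‖
    exact hx N (by simp; linarith)
  · rintro ⟨Θ, hΘ⟩
    choose t ht ht0 hte using fun k : ℕ => h.exists_angle_eq Θ (-k)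
    have hexp : Tendsto (fun k => exp (t k)) atTop (𝓝 0) :=
      tendsto_exp_atBot.comp (tendsto_atBot_mono (fun k => (ht k).le)
        (tendsto_neg_atTop_atBot.comp tendsto_natCast_atTop_atTop))
    refine ⟨fun k => exp (t k), fun k => exp_pos _, hexp, fun R hR => ?_⟩
    have hz : Tendsto (fun k => circ (θ (log (exp (t k))))) atTop (𝓝 (Θ.toCircle : ℂ)) := by
      refine tendsto_const_nhds.congr fun k => ?_
      rw [log_exp, ← hte k, toCircle_coe]
    obtain ⟨l1, l2, l3⟩ := h.tendstoW1p_rescaled (n := n) hmn hpm (fun k => exp_pos (t k))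
        hexp hz hR
    have hΘ' := ae_restrict_of_ae (s := (ballO m R : Set (E m))) hΘ
    refine ⟨l1.congr ?_, l2.congr ?_, l3.congr ?_⟩ <;>
    · filter_upwards [hΘ'] with x hx
      simp only [thetaC, yC, vC, hx]

end TangentMaps

section Divergence

variable [FiniteDimensional ℝ H]

/-- The product rule for `∂_e (|x|^{1-p} ⟨Γ, φ⟩)`, integrated. -/
lemma integral_divergence {Γ : E m → H} {Γ' : E m → E m →L[ℝ] H} (h : Adm univ fun w : E m × H => Γ
    w.1) (hΓ : ∀ x ∈ 𝔹, x ≠ 0 → HasFDerivAt Γ (Γ' x) x) (hp : 1 < p) (hpm : p < m) (φ : 𝓓(ballO m 1,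
    H)) (e : E m) {T : E m → ℝ} (hT : ∀ x ∈ 𝔹, x ≠ 0 → T x = ‖x‖ ^ (-p) * ((1 - p) * inner ℝ 𝐧x e *
    inner ℝ (Γ x) (φ x) + (inner ℝ (‖x‖ • Γ' x e) (φ x) + inner ℝ (Γ x) (‖x‖ • fderiv ℝ (fun z => φ
    z) x e)))) : IntegrableOn T 𝔹 ∧ ∫ x in 𝔹, T x = 0 := by
  have hm0 : 0 < m := by rify; linarith
  have hφ : ContDiff ℝ ∞ fun z => φ z := contDiff_test φ
  have hdc : Continuous (fderiv ℝ fun z => φ z) := hφ.continuous_fderiv (by simp)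
  obtain ⟨Cφ, hCφ⟩ := φ.hasCompactSupport.exists_bound_of_continuous hφ.continuous
  have hC0 : 0 ≤ Cφ := (norm_nonneg _).trans (hCφ 0)
  obtain ⟨τ, C, hτ1, hτ2, hτ3, hτ4⟩ := exists_truncated_id H (δ := 2 * (Cφ + 1)) (by positivity)
  have hτ : Adm univ fun w : E m × H => τ w.2 :=
    Adm.of_snd hτ1 (fun s _ => hτ2 s) fun s _ => hτ3 s
  have hg := h.inner hτ
  have hφτ : ∀ x, τ (φ x) = φ x := fun x => hτ4 _ (by linarith [hCφ x])
  have hdτ : ∀ x, HasFDerivAt τ (ContinuousLinearMap.id ℝ H) (φ x) := fun x => by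
    refine (hasFDerivAt_id (φ x)).congr_of_eventuallyEq ?_
    have : ∀ᶠ z in 𝓝 (φ x), ‖z‖ < 2 * (Cφ + 1) / 2 :=
      continuous_norm.continuousAt.eventually_lt continuousAt_const (by linarith [hCφ x])
    exact this.mono fun z hz => hτ4 z hz
  have hi := hg.integrableOn_chainTerm hp hpm e (memLp_fderiv hφ)
    (hg.aestronglyMeasurable_chainTerm hm0 hφ.continuous hdc.aestronglyMeasurable e)
  have hz := hg.integral_chainTerm_smooth hp hpm (fun x _ _ => by
      have := hτ4 0 (by rw [norm_zero]; positivity)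
      simp only [this, inner_zero_right]) hφ φ.tsupport_subset e
  have hae : chainTerm p (fun w : E m × H => inner ℝ (Γ w.1) (τ w.2)) (fun z => φ z)
      (fderiv ℝ fun z => φ z) e =ᵐ[μ𝔹] T := by
    refine ae_restrict_punctured hm0 fun x hx hx0 => ?_
    have hr : 0 < ‖x‖ := norm_pos_iff.2 hx0
    have h1 : HasFDerivAt (fun w : E m × H => Γ w.1) ((Γ' x).comp (fst ℝ (E m) H)) (x, φ x) :=
      HasFDerivAt.comp (x, φ x) (hΓ x hx hx0) hasFDerivAt_fst
    have h2 : HasFDerivAt (fun w : E m × H => τ w.2)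
        ((ContinuousLinearMap.id ℝ H).comp (snd ℝ (E m) H)) (x, φ x) :=
      HasFDerivAt.comp (x, φ x) (hdτ x) hasFDerivAt_snd
    rw [chainTerm, (h1.inner ℝ h2).fderiv, hT x hx hx0]
    have e1 : ‖x‖ ^ (-1 - p) = ‖x‖ ^ (-p) * ‖x‖⁻¹ := by rw [← rpow_neg_one, ← rpow_add hr]; ring_nf
    have e2 : ‖x‖ ^ (1 - p) = ‖x‖ ^ (-p) * ‖x‖ := by
      conv_rhs => rw [← rpow_one ‖x‖, rpow_one ‖x‖, ← rpow_add_one hr.ne']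
      ring_nf
    simp only [comp_apply, ContinuousLinearMap.prod_apply,
      ContinuousLinearMap.coe_fst', ContinuousLinearMap.coe_snd', ContinuousLinearMap.coe_id', id,
      fderivInnerCLM_apply, hφτ, e1, e2, real_inner_smul_left, inner_smul_right]
    ring
  exact ⟨hi.congr hae, (integral_congr_ae hae).symm.trans hz⟩

/-- The integrated divergence of `∑ᵢ |x|^{1-p} q(log |x|) ⟨wᵢ, φ⟩ eᵢ`. -/
lemma integral_radial_divergence (hp : 1 < p) (hpm : p < m) {q q' : ℝ → ℝ} (hq : ∀ t < 0, HasDerivAt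
    q (q' t) t) {w : Fin m → E m → H} {w' : Fin m → E m → E m →L[ℝ] H} (hw : ∀ i, ∀ x ∈ 𝔹, x ≠ 0 →
    HasFDerivAt (w i) (w' i x) x) (hA : ∀ i, Adm univ fun z : E m × H => q ㏑z.1 • w i z.1) (φ :
    𝓓(ballO m 1, H)) {T : E m → ℝ} (hT : ∀ x ∈ 𝔹, x ≠ 0 → T x = ‖x‖ ^ (-p) * ((q' ㏑x + (1 - p) * q
    ㏑x) * inner ℝ (∑ i, 𝐧x i • w i x) (φ x) + q ㏑x * (inner ℝ (∑ i, ‖x‖ • w' i x (single i 1)) (φ x)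
    + ∑ i, inner ℝ (w i x) (‖x‖ • fderiv ℝ (fun z => φ z) x (single i 1))))) : IntegrableOn T 𝔹 ∧ ∫
    x in 𝔹, T x = 0 := by
  have hm0 : 0 < m := by rify; linarith
  have hΓ : ∀ i, ∀ x ∈ 𝔹, x ≠ 0 → HasFDerivAt (fun x => q ㏑x • w i x) (q ㏑x • w' i x + (q' ㏑x • dLog
      x).smulRight (w i x)) x :=
    fun i x hx hx0 => ((hq _ (log_norm_neg hx hx0)).comp_hasFDerivAt x
      (hasFDerivAt_log_norm hx0)).smul (hw i x hx hx0)
  have key := fun i => integral_divergence (hA i) (hΓ i) hp hpm φ (single i 1) fun x _ _ => rfl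
  have hs := integrable_finsetSum Finset.univ fun i _ => (key i).1
  have hz := integral_finsetSum Finset.univ fun i (_ : i ∈ Finset.univ) => (key i).1
  simp only [(key _).2, Finset.sum_const_zero] at hz
  have conclude := fun hae => And.intro (hs.congr (g := T) hae)
    ((integral_congr_ae (g := T) hae).symm.trans hz)
  refine conclude (ae_restrict_punctured hm0 fun x hx hx0 => ?_)
  · have hr : ‖x‖ ≠ 0 := norm_ne_zero_iff.2 hx0
    rw [hT x hx hx0, sum_inner, sum_inner, ← sum_add_distrib, mul_sum,
      mul_sum, ← sum_add_distrib, mul_sum]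
    refine sum_congr rfl fun i _ => ?_
    simp only [_root_.add_apply, _root_.smul_apply, smulRight_apply,
      dLog_single hx0, inner_single_right, smul_add, inner_add_left,
      real_inner_smul_left, inner_smul_right, smul_eq_mul, one_mul, conj_trivial]
    field_simp
    ring

end Divergence

section FirstVariation

lemma sum_sq_dir {x : E m} (hx : x ≠ 0) : ∑ i, 𝐧x i ^ 2 = 1 := by
  rw [← real_norm_sq_eq, norm_dir hx, one_pow]

lemma sum_single_sub_smul {o : E m} (ho : ∑ i, o i ^ 2 = 1) :
    ∑ i, o i • (single i (1 : ℝ) - o i • o) = 0 := by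
  ext j
  simp only [smul_sub, smul_smul, ← sq, sum_sub_distrib, ← Finset.sum_smul, ho, one_smul]
  simp [Pi.single_apply]

lemma integral_radial_divergence_dir (hp : 1 < p) (hpm : p < m) {q q' : ℝ → ℝ} (hq : ∀ t < 0,
    HasDerivAt q (q' t) t) (hA : Adm univ fun z : E m × ℝ => q ㏑z.1) (φ : 𝓓(ballO m 1, ℝ)) {T : E m
    → ℝ} (hT : ∀ x ∈ 𝔹, x ≠ 0 → T x = ‖x‖ ^ (-p) * ((q' ㏑x + (m - p) * q ㏑x) * φ x + q ㏑x * ∑ i, 𝐧x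
    i * (‖x‖ * fderiv ℝ (fun z => φ z) x (single i 1)))) : IntegrableOn T 𝔹 ∧ ∫ x in 𝔹, T x = 0 :=
    by
  refine integral_radial_divergence hp hpm hq (w := fun i x => 𝐧x i) (w' := fun i x => (proj (𝕜 :=
    ℝ) i).comp (dDir x)) (fun i x hx hx0 => (proj (𝕜 := ℝ) i).hasFDerivAt.comp x (hasFDerivAt_dir
    hx0)) (fun i => hA.smul (Adm.dir.clm (proj (𝕜 := ℝ) i))) φ fun x hx hx0 => ?_
  have hr : ‖x‖ ≠ 0 := norm_ne_zero_iff.2 hx0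
  have h1 := sum_sq_dir hx0
  have h2 : ∑ i, ‖x‖ • (proj (𝕜 := ℝ) i).comp (dDir x) (single i 1) = m - 1 := by
    have : ∀ i, ‖x‖ • (proj (𝕜 := ℝ) i).comp (dDir x) (single i 1) = 1 - 𝐧x i ^ 2 := fun i => by
      rw [comp_apply, dDir_single hx0, map_smul, smul_smul, mul_inv_cancel₀ hr, one_smul]
      simp
      ring
    simp only [this, sum_sub_distrib, h1]
    simp
  rw [hT x hx hx0, h2]
  simp only [smul_eq_mul, ← sq, h1]
  simp only [RCLike.inner_apply, conj_trivial]
  congr 1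
  have : ∀ u v w z : ℝ, u * v + w = v * (u - z * (m - 1)) + (z * (v * (m - 1)) + w) :=
    fun u v w z => by ring
  simp only [mul_comm (‖x‖ * fderiv ℝ (fun z => φ z) x _)]
  ring

lemma integral_radial_divergence_proj (hp : 1 < p) (hpm : p < m) {q q' : ℝ → ℝ} (hq : ∀ t < 0,
    HasDerivAt q (q' t) t) (hA : Adm univ fun z : E m × E (n + 1) => q ㏑z.1) (φ : 𝓓(ballO m 1, E (n
    + 1))) {T : E m → ℝ} (hT : ∀ x ∈ 𝔹, x ≠ 0 → T x = ‖x‖ ^ (-p) * (q ㏑x * (∑ i, inner ℝ (padL m n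
    (single i 1 - 𝐧x i • 𝐧x)) (‖x‖ • fderiv ℝ (fun z => φ z) x (single i 1)) - (m - 1) * inner ℝ
    (padL m n 𝐧x) (φ x)))) : IntegrableOn T 𝔹 ∧ ∫ x in 𝔹, T x = 0 := by
  have ho : Adm univ fun z : E m × E (n + 1) => 𝐧 z.1 := Adm.dir
  refine integral_radial_divergence hp hpm hq (w := fun i x => padL m n (single i 1 - 𝐧x i • 𝐧x))
    (w' := fun i x => (padL m n).comp (-(𝐧x i • dDir x + ((proj (𝕜 := ℝ) i).comp (dDir x)).smulRight
    𝐧x))) (fun i x hx hx0 => (padL m n).hasFDerivAt.comp x ((HasFDerivAt.smul ((proj (𝕜 := ℝ)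
    i).hasFDerivAt.comp x (hasFDerivAt_dir hx0)) (hasFDerivAt_dir hx0)).const_sub _)) (fun i =>
    hA.smul (((Adm.const _).sub ((ho.clm (proj (𝕜 := ℝ) i)).smul ho)).clm (padL m n))) φ fun x hx
    hx0 => ?_
  have hr : ‖x‖ ≠ 0 := norm_ne_zero_iff.2 hx0
  have h1 := sum_sq_dir hx0
  have h2 : ∑ i, ‖x‖ • (padL m n).comp (-(𝐧x i • dDir x + ((proj (𝕜 := ℝ) i).comp (dDir
      x)).smulRight 𝐧x)) (single i 1) = -((m - 1 : ℝ) • padL m n 𝐧x) := by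
    have : ∀ i, ‖x‖ • (padL m n).comp (-(𝐧x i • dDir x + ((proj (𝕜 := ℝ) i).comp (dDir x)).smulRight
        𝐧x)) (single i 1) = -padL m n (𝐧x i • (single i (1 : ℝ) - 𝐧x i • 𝐧x) + (1 - 𝐧x i ^ 2) • 𝐧x)
        := fun i => by
      rw [comp_apply, ← map_smul, ← map_neg]
      congr 1
      simp only [_root_.neg_apply, _root_.add_apply, _root_.smul_apply, smulRight_apply, comp_apply,
        dDir_single hx0, map_smul, smul_neg, smul_add, smul_smul, smul_eq_mul]
      congr 2
      · grind
      · congr 1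
        rw [mul_assoc, mul_inv_cancel_left₀ hr]
        congr 1
        simp
        ring
    simp only [this, Finset.sum_neg_distrib, ← map_sum, sum_add_distrib,
      sum_single_sub_smul h1, ← Finset.sum_smul, sum_sub_distrib, h1]
    simp
  have h3 : ∑ i, 𝐧x i • padL m n (single i 1 - 𝐧x i • 𝐧x) = 0 := by
    rw [← map_zero (padL m n), ← sum_single_sub_smul h1, map_sum]
    exact sum_congr rfl fun i _ => ((padL m n).map_smul _ _).symm
  rw [hT x hx hx0, h2, h3, inner_zero_left, mul_zero, zero_add, inner_neg_left,
    real_inner_smul_left, neg_add_eq_sub]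

/-- The derivative at `0` of the scaled energy density of a variation. -/
def varDensDeriv (M B₀ : ℝ) (θ y a b : ℝ → ℝ) (η ζ : E m → ℝ) (ψ : E m → E (n + 1)) (x : E m) : ℝ :=
  2 * a ㏑x * ∑ i, 𝐧x i * (‖x‖ * fderiv ℝ η x (single i 1)) + 2 * b ㏑x * ∑ i, 𝐧x i * (‖x‖ * fderiv ℝ
    ζ x (single i 1)) - M * (Vθ (θ ㏑x) (y ㏑x) * η x + Vy (θ ㏑x) (y ㏑x) * ζ x) + 2 * (B₀ - Vr (θ ㏑x)
    (y ㏑x)) * (∑ i, inner ℝ (padL m n (single i 1 - 𝐧x i • 𝐧x)) (‖x‖ • fderiv ℝ ψ x (single i 1)) -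
    M * inner ℝ (padL m n 𝐧x) (ψ x))

lemma hasDerivAt_varDens_zero (hm : (m : ℝ) = M + 1) (hmn : m ≤ n + 1) {x : E m} (hx : x ≠ 0)
    (η ζ : E m → ℝ) (ψ : E m → E (n + 1)) : HasDerivAt (varDens B₀ θ y a b η ζ ψ x)
      (varDensDeriv M B₀ θ y a b η ζ ψ x) 0 := by
  have ho := norm_dir hx
  have hM : ∑ i, (1 - 𝐧x i ^ 2) = M := by
    rw [sum_sub_distrib, sum_sq_dir hx]
    simp [hm]
  have lin : ∀ {G : Type} [NormedAddCommGroup G] [NormedSpace ℝ G] (c w : G),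
      HasDerivAt (fun s : ℝ => c + s • w) w 0 := fun c w => by
    simpa using ((hasDerivAt_id (0 : ℝ)).smul_const w).const_add c
  have hR : HasDerivAt (varRad a b η ζ x) (2 * a ㏑x * ∑ i, 𝐧x i * (‖x‖ * fderiv ℝ η x (single i 1))
      + 2 * b ㏑x * ∑ i, 𝐧x i * (‖x‖ * fderiv ℝ ζ x (single i 1))) 0 := by
    refine (HasDerivAt.fun_sum fun i _ => ((lin _ _).pow 2).add ((lin _ _).pow 2)).congr_deriv ?_
    rw [mul_sum, mul_sum, ← sum_add_distrib]
    refine sum_congr rfl fun i _ => ?_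
    ring
  have hS : HasDerivAt (varSph ψ x) (2 * (∑ i, inner ℝ (padL m n (single i 1 - 𝐧x i • 𝐧x)) (‖x‖ •
      fderiv ℝ ψ x (single i 1)) - M * inner ℝ (padL m n 𝐧x) (ψ x))) 0 := by
    have hv := lin (padL m n 𝐧x) (ψ x)
    have hv0 : ‖padL m n 𝐧x‖ = 1 := norm_padL_dir hmn hx
    have hvi := hv.norm_sq.fun_inv (by rw [zero_smul, add_zero, hv0]; norm_num)
    refine (HasDerivAt.fun_sum fun i _ => ((lin _ _).norm_sq.mul hvi).sub
      (((hv.inner ℝ (lin _ _)).pow 2).mul (hvi.pow 2))).congr_deriv ?_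
    rw [← hM, Finset.sum_mul, ← sum_sub_distrib, mul_sum]
    refine sum_congr rfl fun i _ => ?_
    simp only [zero_smul, add_zero, hv0, Pi.pow_apply]
    simp only [padL_apply, norm_pad hmn, inner_pad_pad hmn,
      inner_single_sub ho, norm_single_sub_sq ho]
    ring
  have hV := HasDerivAt.Vr (((hasDerivAt_id (0 : ℝ)).mul_const (η x)).const_add (θ ㏑x))
    (((hasDerivAt_id (0 : ℝ)).mul_const (ζ x)).const_add (y ㏑x))
  have hS0 : varSph ψ x 0 = M := by
    simp only [varSph, varTan, zero_smul, add_zero, padL_apply, norm_pad hmn, inner_pad_pad hmn,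
      inner_single_sub ho, ho, norm_single_sub_sq ho, ← hM]
    simp
  refine (hR.add ((hV.const_sub B₀).mul hS)).congr_deriv ?_
  simp only [id, zero_mul, add_zero, one_mul, hS0, varDensDeriv]
  ring

end FirstVariation

namespace IsProfile

include h in
/-- The weak form of the Euler-Lagrange equations. -/
lemma integral_firstVariation (hpm : p < m) (hm : (m : ℝ) = M + 1) (hlam : lam = m - p) (η ζ :
    𝓓(ballO m 1, ℝ)) (ψ : 𝓓(ballO m 1, E (n + 1))) {T : E m → ℝ} (hT : ∀ x ∈ 𝔹, x ≠ 0 → T x = ‖x‖ ^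
    (-p) * (𝐰 ㏑x / 2 * varDensDeriv M B₀ θ y a b η ζ ψ x)) : IntegrableOn T 𝔹 ∧ ∫ x in 𝔹, T x = 0 :=
    by
  have hp := h.hp
  have hm0 : 0 < m := by rify; linarith
  have h1 := integral_radial_divergence_dir h.hp hpm (fun t ht => (h.deriv_P t ht).mul (h.deriv_a t
    ht)) (h.adm_enWeight.mul h.adm_a) η fun x _ _ => rfl
  have h2 := integral_radial_divergence_dir h.hp hpm (fun t ht => (h.deriv_P t ht).mul (h.deriv_b t
    ht)) (h.adm_enWeight.mul h.adm_b) ζ fun x _ _ => rfl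
  have h3 := integral_radial_divergence_proj h.hp hpm (fun t ht => (h.deriv_P t ht).mul
    ((HasDerivAt.Vr (h.deriv_θ t ht) (h.deriv_y t ht)).const_sub B₀)) (h.adm_enWeight.mul
    ((Adm.const B₀).sub h.adm_V)) ψ fun x _ _ => rfl
  have hi := (h1.1.add h2.1).add h3.1
  have hz := integral_add (h1.1.add h2.1) h3.1
  have hz' := integral_add h1.1 h2.1
  have hz0 := hz.trans (show _ = (0 : ℝ) by
    rw [h3.2, add_zero]; exact hz'.trans (by rw [h1.2, h2.2, add_zero]))
  have conclude := fun hae => And.intro (hi.congr (g := T) hae)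
    ((integral_congr_ae (g := T) hae).symm.trans hz0)
  refine conclude (ae_restrict_punctured hm0 fun x hx hx0 => ?_)
  rw [hT x hx hx0]
  simp only [varDensDeriv, Pi.add_apply, Pi.mul_apply, hm, hlam]
  ring

end IsProfile

lemma exists_test_bound (φ : 𝓓(ballO m 1, F)) : ∃ C, ∀ x, ‖φ x‖ ≤ C :=
  φ.hasCompactSupport.exists_bound_of_continuous (contDiff_test φ).continuous

include h in
theorem IsProfile.isPHarmonic (hpm : p < m) (hm : (m : ℝ) = M + 1) (hlam : lam = m - p) (hmn : m ≤ n
    + 1) : IsPHarmonic p B₀ 𝐔 := by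
  refine ⟨h.sobolevMap hmn hpm, ne_top_of_le_ne_top ENNReal.ofReal_ne_top (h.energy_le hpm hm hmn),
    fun η ζ ψ => ?_⟩
  have hp := h.hp
  have hm0 : 0 < m := by rify; linarith
  obtain ⟨Cη, hCη⟩ := exists_test_bound η
  obtain ⟨Cζ, hCζ⟩ := exists_test_bound ζ
  obtain ⟨Cψ, hCψ⟩ := exists_test_bound ψ
  obtain ⟨s₀, C, hs₀, hC0, hψs, hvar, hcont⟩ := exists_varDens_bound (n := n) h hm hmn (contDiff_test η) (contDiff_test ζ) (contDiff_test ψ) hCη hCζ hCψ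
  set D : E m → ℝ → ℝ := varDens B₀ θ y a b η ζ ψ with hD
  obtain ⟨K, hK⟩ := (isCompact_Icc (a := (1 / 2 : ℝ)) (b := C)).exists_bound_of_continuousOn
    (f := fun z : ℝ => z ^ (p / 2 - 1)) (continuousOn_id.rpow_const fun z hz =>
      Or.inl (by have := hz.1; simp only [id]; linarith))
  have hmeas : ∀ s, |s| < s₀ → AEStronglyMeasurable (fun x => ‖x‖ ^ (-p) * D x s ^ (p / 2))
      μ𝔹 := fun s hs =>
    aesm_of_continuousOn_punctured hm0 ((continuousOn_norm_rpow _ _).mul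
      ((hcont s hs).rpow_const fun _ _ => Or.inr (by linarith)))
  have hball : ∀ {s : ℝ}, s ∈ ball (0 : ℝ) s₀ ↔ |s| < s₀ := by simp
  obtain ⟨F', hF'⟩ : ∃ F' : ℝ → E m → ℝ, ∀ s x, F' s x =
    ‖x‖ ^ (-p) * (deriv (D x) s * (p / 2) * D x s ^ (p / 2 - 1)) := ⟨_, fun _ _ => rfl⟩
  have hfv := h.integral_firstVariation hpm hm hlam η ζ ψ (T := F' 0) fun x hx hx0 => by
      simp only [hF', hD, (hasDerivAt_varDens_zero hm hmn hx0 η ζ ψ).deriv,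
        varDens_zero hm hmn hx0, enWeight]
      ring
  have key := hasDerivAt_integral_of_dominated_loc_of_deriv_le (μ := volume.restrict 𝔹) (F := fun s
      x => ‖x‖ ^ (-p) * D x s ^ (p / 2)) (F' := F') (x₀ := (0 : ℝ)) (bound := fun x => C * (p / 2) *
      K * ‖x‖ ^ (-p)) (ball_mem_nhds 0 hs₀) (by
        filter_upwards [ball_mem_nhds (0 : ℝ) hs₀] with s hs
        exact hmeas s (hball.1 hs))
      (by
        refine ((integrableOn_norm_rpow_neg hm0 hpm 1).const_mul (C ^ (p / 2))).mono'
          (hmeas 0 (by simpa using hs₀)) (ae_restrict_punctured hm0 fun x hx hx0 => ?_)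
        obtain ⟨h1, h2, -⟩ := hvar x hx hx0 0 (by simpa using hs₀)
        rw [norm_of_nonneg (mul_nonneg (by positivity) (rpow_nonneg (by linarith) _)), mul_comm]
        gcongr)
      hfv.1.1
      (ae_restrict_punctured hm0 fun x hx hx0 s hs => by
        obtain ⟨h1, h2, d, hd, hdC⟩ := hvar x hx hx0 s (hball.1 hs)
        have hk := hK _ ⟨h1, h2⟩
        rw [hF', hd.deriv, norm_mul, norm_mul, norm_mul, mul_comm (C * _ * _), norm_of_nonneg (by
          positivity : 0 ≤ ‖x‖ ^ (-p)), norm_of_nonneg (by linarith : 0 ≤ p / 2)]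
        gcongr
        exact hdC)
      ((integrableOn_norm_rpow_neg hm0 hpm 1).const_mul _)
      (ae_restrict_punctured hm0 fun x hx hx0 s hs => by
        obtain ⟨h1, h2, d, hd, hdC⟩ := hvar x hx hx0 s (hball.1 hs)
        rw [hF', hd.deriv]
        exact (hd.rpow_const (Or.inl (by linarith))).const_mul _)
  have hder := key.2
  rw [hfv.2] at hder
  refine hder.congr_of_eventuallyEq ?_
  filter_upwards [ball_mem_nhds (0 : ℝ) hs₀] with s hs
  have hs' := hball.1 hs
  have hψ' : ∀ x, ‖s • ψ x‖ ≤ 1 / 2 := fun x => by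
    rw [norm_smul, norm_eq_abs]
    exact (mul_le_mul_of_nonneg_right hs'.le (norm_nonneg _)).trans (hψs x)
  rw [h.energy_vary hpm hmn hψ' fun x hx hx0 => by linarith [(hvar x hx hx0 s hs').1],
    integral_eq_lintegral_of_nonneg_ae (ae_restrict_punctured hm0 fun x hx hx0 => ?_) (hmeas s hs')]
  exact mul_nonneg (by positivity) (rpow_nonneg (by linarith [(hvar x hx hx0 s hs').1]) _)

end PHarm

end

open PHarm in
theorem mainTheorem3 (p : ℝ) (m : ℕ) (hp : 1 < p) (hpm : p < (m : ℝ)) :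
    ∃ C Bbar : ℝ, ∀ (n : ℕ) (B₀ : ℝ), m ≤ n + 1 →
      (∃ K : ℝ, (∀ (θ : Real.Angle) (y : ℝ), |V θ y| + gradV θ y ≤ K) ∧ K + 1 < B₀) →
      ∃ u : ℝ → Real.Angle × ℝ,
        IsEquivariant (equivMap m n u) ∧
        IsPHarmonic p B₀ (equivMap m n u) ∧
        (4 * ((m : ℝ) - 1) < ((m : ℝ) - p) ^ 2 →
          IsUniqueMinimizerIn p B₀ (Set.range (equivMap m n)) (equivMap m n u) ∧
          (Bbar < B₀ → IsUniqueMinimizerIn p B₀ Set.univ (equivMap m n u))) ∧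
        energy p B₀ (equivMap m n u) ≤ ENNReal.ofReal (C * B₀ ^ (p / 2)) ∧
        OnlySingularAtZero (equivMap m n u) ∧
        (∀ W : E m → Target n, IsTangentMap p (equivMap m n u) 0 W ↔
          ∃ θ : Real.Angle, W =ᵐ[volume] equivMap m n (fun _ => (θ, 0))) := by
  have hm1 : 1 < m := by exact_mod_cast hp.trans hpm
  have hm2 : (2 : ℝ) ≤ m := by exact_mod_cast hm1
  have hM : 1 ≤ (m : ℝ) - 1 := by linarith
  have hm : (m : ℝ) = (m - 1) + 1 := by ring
  obtain ⟨Bbar, hcal⟩ := exists_calibrated hp hpm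
  refine ⟨(1 + 2 * ((m : ℝ) - 1)) ^ (p / 2) * ∫ x in Metric.ball (0 : E m) 1, ‖x‖ ^ (-p), Bbar,
    fun n B₀ hmn ⟨K, hK, hKB⟩ => ?_⟩
  have hB := two_le_of_bound hK hKB
  obtain ⟨ν, hν0, hν1, hν⟩ := hcal B₀ hB
  obtain ⟨θ, y, a, b, ϖ, h⟩ := exists_profile (p := p) (M := m - 1) (lam := m - p) hp hM
    (by linarith) hB hν0 hν1
  exact ⟨profMap θ y, isEquivariant_equivMap hmn _,
    h.isPHarmonic hpm hm rfl hmn, hν n θ y a b ϖ hmn h,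
    h.energy_le hpm hm hmn,
    ⟨h.smoothMapOn hmn, fun W hW => not_continuousAt_of_ae_eq (by omega) hmn _ hW⟩,
    h.isTangentMap_iff hmn hpm⟩
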